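/- **Setting.** Let $M$ be a connected, Hausdorff, paracompact smooth 4-manifold. A *Finsler spacetime* structure on $M$ is a pair of continuous functions $L,F:TM\to\mathbb R$ such that: $L$ is smooth on $TM\setminus\{0\}$; $L(x,\lambda y)=\lambda^nL(x,y)$ for all $\lambda>0$, with a real $n\ge 2$, and $F=|L|^{1/n}$; $|L(x,-y)|=|L(x,y)|$; the fibre Hessian $g^L_{ab}=\frac12\bar\partial_a\bar\partial_bL$ is non-degenerate on $TM\setminus X$ for some set $X$ of measure zero that does not contain $\{L=0\}$; and for every $x$ the set $\Omega_x$ of all $y\in T_xM$ with $|L(x,y)|=1$ such that $g^L(x,y)$ has signature $(\epsilon,-\epsilon,-\epsilon,-\epsilon)$, $\epsilon=L(x,y)/|L(x,y)|$, has a non-empty closed connected component. Assume that $M$ is oriented and that $(M,L,F)$ is time-oriented, i.e. for every $x$ a closed (in $T_xM$) connected component $S_x$ of $\Omega_x$ is chosen in such a way that near every point of $M$ there is a continuous local vector field with values in the sets $S_x$. Here $\partial_a,\bar\partial_a$ are the derivatives with respect to induced coordinates $(x^a,y^a)$ of $TM$, and $g^F_{ab}=\frac12\bar\partial_a\bar\partial_bF^2$.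 *Observer space.* Let $O=\bigcup_xS_x\subset TM$. Let $P$ be the set of oriented frames $(x,f_0,\dots,f_3)$ with $f_0\in S_x$ and $g^F(x,f_0)(f_i,f_j)=-\eta_{ij}$, $\eta=\mathrm{diag}(-1,1,1,1)$; let $\pi:P\to O$, $(x,f)\mapsto(x,f_0)$, and let $K=SO(3)$ act on $P$ from the right by rotating $f_1,f_2,f_3$. Let $\mathfrak g=\mathfrak h\oplus\mathfrak z$ be $\mathfrak{so}(4,1)$, $\mathfrak{iso}(3,1)$ or $\mathfrak{so}(3,2)$, according to the sign of a real number $\Lambda$, with $\mathfrak h=\mathfrak{so}(3,1)$ and $\mathfrak z\cong\mathbb R^4$ spanned by the translation generators $\mathcal Z_0,\dots,\mathcal Z_3$; let $\mathfrak y\subset\mathfrak h$ be the space of boosts. Let $A=\omega+e$ be the $\mathfrak g$-valued one-form on $P$ given in every chart of $M$ by $$f_i^a\,e^i=dx^a,\qquad f_j^a\,\omega^j{}_i=df_i^a+f_i^b\left[F^a{}_{bc}dx^c+C^a{}_{bc}(N^c{}_ddx^d+df_0^c)\right],$$ the coefficients being taken at $(x,f_0)$, where $N^a{}_b=\frac14\bar\partial_b[g^{F\,ac}(y^d\partial_d\bar\partial_cF^2-\partial_cF^2)]$,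 $\delta_a=\partial_a-N^b{}_a\bar\partial_b$, $F^a{}_{bc}=\frac12g^{F\,ad}(\delta_bg^F_{cd}+\delta_cg^F_{bd}-\delta_dg^F_{bc})$ and $C^a{}_{bc}=\frac12g^{F\,ad}(\bar\partial_bg^F_{cd}+\bar\partial_cg^F_{bd}-\bar\partial_dg^F_{bc})$. *Reconstruction.* For a Cartan geometry $(\pi:P\to O,A)$ modelled on $G/K$ with $\dim O=7$ (a principal $K$-bundle with a $K$-equivariant one-form $A\in\Omega^1(P,\mathfrak g)$ that is an isomorphism $T_pP\to\mathfrak g$ at each $p$ and is the Maurer–Cartan form on vertical vectors) let $\underline A(a)$, $a\in\mathfrak g$, be the vector field on $P$ with $A(\underline A(a))=a$. Let $VO\subset TO$ be the projection by $\pi_*$ of the distribution on $P$ spanned by $\underline A(\mathfrak y)$, and let $\mathbf r$ be the vector field on $O$ with $\mathbf r\circ\pi=\pi_*\underline A(\mathcal Z_0)$. If $VO$ is integrable, let $\hat M$ be the leaf space of its foliation and $\hat\pi':O\to\hat M$ the projection. If $\hat M$ is a smooth Hausdorff manifold, put $\sigma=\hat\pi'_*\circ\mathbf r:O\to T\hat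 M$, and let $\hat F(\lambda\sigma(o))=|\lambda|$ on the double cone $\mathbb R\sigma(O)$. **Statement.** Let $(M,L,F)$ be an oriented and time-oriented Finsler spacetime and $\Lambda\in\mathbb R$. Then $O$ is a 7-dimensional embedded submanifold of $TM$, $P$ is a 10-dimensional embedded submanifold of $TM\times TM\times TM\times TM$, the one-form $A$ is well defined, and $(\pi:P\to O,A)$ is a Cartan geometry modelled on $G/K$. This Cartan geometry satisfies the following conditions. 1. The vertical distribution $VO$ is integrable. 2. Its foliation is strictly simple: the leaf space $\hat M$ is a smooth Hausdorff 4-manifold and $\hat\pi'$ is a surjective submersion. 3. $\sigma:O\to T\hat M$ is an embedding. 4. Each line $\{(x,\lambda y):\lambda\in\mathbb R\}$ in $T\hat M$ meets $\sigma(O)$ at most once. 5. $\hat F$ is smooth near $\sigma(O)$ and its Finsler metric $\hat g^F=\frac12\bar\partial\bar\partial\hat F^2$ is non-degenerate of Lorentz signature $(1,-1,-1,-1)$ at all points of $\sigma(O)$. Moreover, there is a diffeomorphism $\mu:M\to\hat M$ such that, for all $o\in O$ and $\lambda\in\mathbb R$, $$\mu_*(o)=\sigma(o),\qquad \hat F(\mu_*(\lambda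 o))=F(\lambda o)=|\lambda| ,$$ so that $\hat F\circ\mu_*=F$ on the double cone $\mathbb RO$; and $\mu_*$ preserves the Finsler metric, $\hat g^F_{\mu_*o}(\mu_*v,\mu_*w)=g^F_o(v,w)$ for $o\in O\cap T_xM$ and $v,w\in T_xM$. -/

import Mathlib

open scoped Manifold ContDiff Matrix

noncomputable section

namespace FinslerCartan

abbrev Euc (n : ℕ) : Type := EuclideanSpace ℝ (Fin n)

/-- The Minkowski matrix `diag(-1, 1, 1, 1)`. -/
def eta : Matrix (Fin 4) (Fin 4) ℝ := Matrix.diagonal (fun i => if i = 0 then -1 else 1)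

/-! ### Fibre Hessians, signature, null sets of the tangent bundle -/

section TangentBundle

variable {M : Type*} [TopologicalSpace M] [ChartedSpace (Euc 4) M]

/-- Half of the Hessian of `f`, restricted to the fibre `T_xM`, at the point `v ∈ T_xM`. -/
def fiberHessian (f : TangentBundle (𝓡 4) M → ℝ) (v : TangentBundle (𝓡 4) M) :
    Euc 4 →L[ℝ] Euc 4 →L[ℝ] ℝ :=
  (1 / 2 : ℝ) • fderiv ℝ (fderiv ℝ (fun y : Euc 4 => f ⟨v.proj, y⟩)) v.snd

/-- The Finsler metric `g^F`, half of the fibre Hessian of `F ^ 2`. -/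
def finslerMetric (F : TangentBundle (𝓡 4) M → ℝ) (v : TangentBundle (𝓡 4) M) :
    Euc 4 →L[ℝ] Euc 4 →L[ℝ] ℝ :=
  fiberHessian (fun w => F w ^ 2) v

/-- The form `B` has signature `(ε, -ε, -ε, -ε)`, where `ε = ± 1`. -/
def HasLorentzSignature (B : Euc 4 →L[ℝ] Euc 4 →L[ℝ] ℝ) (ε : ℝ) : Prop :=
  ∃ b : Module.Basis (Fin 4) ℝ (Euc 4), ∀ i j, B (b i) (b j) = -ε * eta i j

/-- A subset of `TM` has measure zero if its image in every standard chart of `TM` has. -/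
def HasMeasureZero [IsManifold (𝓡 4) 1 M] (X : Set (TangentBundle (𝓡 4) M)) : Prop :=
  ∀ w : TangentBundle (𝓡 4) M, MeasureTheory.volume
    (extChartAt (𝓡 4).tangent w '' (X ∩ (extChartAt (𝓡 4).tangent w).source)) = 0

/-- The unit timelike vectors `Ω_x` of a function `L` on the tangent bundle. -/
def unitTimelike (L : TangentBundle (𝓡 4) M → ℝ) (x : M) : Set (TangentSpace (𝓡 4) x) :=
  {y | |L ⟨x, y⟩| = 1 ∧
    HasLorentzSignature (fiberHessian L ⟨x, y⟩) (L ⟨x, y⟩ / |L ⟨x, y⟩|)}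

end TangentBundle

/-! ### Finsler spacetimes -/

/-- A Finsler spacetime structure `(L, F)` on a smooth four-manifold. -/
structure FinslerSpacetime (M : Type*) [TopologicalSpace M] [ChartedSpace (Euc 4) M]
    [IsManifold (𝓡 4) ∞ M] where
  L : TangentBundle (𝓡 4) M → ℝ
  F : TangentBundle (𝓡 4) M → ℝ
  degree : ℝ
  continuous_L : Continuous L
  continuous_F : Continuous F
  smooth_L : ContMDiffOn (𝓡 4).tangent 𝓘(ℝ) ∞ L {v | v.snd ≠ 0}
  two_le_degree : 2 ≤ degree
  homogeneous : ∀ (x : M) (y : TangentSpace (𝓡 4) x) (c : ℝ), 0 < c →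
    L ⟨x, c • y⟩ = c ^ degree * L ⟨x, y⟩
  F_eq : ∀ v, F v = |L v| ^ (1 / degree)
  reversible : ∀ (x : M) (y : TangentSpace (𝓡 4) x), |L ⟨x, -y⟩| = |L ⟨x, y⟩|
  nondegenerate : ∃ X : Set (TangentBundle (𝓡 4) M), HasMeasureZero X ∧ ¬ {v | L v = 0} ⊆ X ∧
    ∀ v ∉ X, ∀ u, (∀ w, fiberHessian L v u w = 0) → u = 0
  timelike : ∀ x : M, ∃ y ∈ unitTimelike L x,
    IsClosed (connectedComponentIn (unitTimelike L x) y)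

section Observers

variable {M : Type*} [TopologicalSpace M] [ChartedSpace (Euc 4) M] [IsManifold (𝓡 4) ∞ M]

/-- A time orientation: a choice, depending continuously on `x`, of a closed connected component
`S_x` of the set `Ω_x` of unit timelike vectors at `x`. -/
structure TimeOrientation (FS : FinslerSpacetime M) where
  S : (x : M) → Set (TangentSpace (𝓡 4) x)
  isComponent : ∀ x, ∃ y ∈ unitTimelike FS.L x, S x = connectedComponentIn (unitTimelike FS.L x) y
  isClosed : ∀ x, IsClosed (S x)
  continuous : ∀ x₀ : M, ∃ U : Set M, IsOpen U ∧ x₀ ∈ U ∧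
    ∃ s : (x : M) → TangentSpace (𝓡 4) x,
      ContinuousOn (fun x => (⟨x, s x⟩ : TangentBundle (𝓡 4) M)) U ∧ ∀ x ∈ U, s x ∈ S x

variable (M) in
/-- An orientation of the manifold: orientations of the tangent spaces such that every point has
a neighbourhood with a continuous, positively oriented frame field. -/
structure ManifoldOrientation where
  orient : (x : M) → Orientation ℝ (TangentSpace (𝓡 4) x) (Fin 4)
  continuous : ∀ x₀ : M, ∃ U : Set M, IsOpen U ∧ x₀ ∈ U ∧
    ∃ s : Fin 4 → (x : M) → TangentSpace (𝓡 4) x,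
      (∀ i, ContinuousOn (fun x => (⟨x, s i x⟩ : TangentBundle (𝓡 4) M)) U) ∧
      ∀ x ∈ U, ∃ b : Module.Basis (Fin 4) ℝ (TangentSpace (𝓡 4) x),
        (∀ i, b i = s i x) ∧ b.orientation = orient x

/-- The observer space `O`, the union of the sets `S_x`, with the subspace topology of `TM`. -/
abbrev ObserverSpace {FS : FinslerSpacetime M} (T : TimeOrientation FS) : Type _ :=
  {v : TangentBundle (𝓡 4) M // v.snd ∈ T.S v.proj}

/-- The total space `P`: oriented frames with time component in `O` that are orthonormal for the
Finsler metric at their time component. -/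
structure ObserverFrame {FS : FinslerSpacetime M} (T : TimeOrientation FS)
    (ori : ManifoldOrientation M) where
  base : M
  vec : Fin 4 → TangentSpace (𝓡 4) base
  time_mem : vec 0 ∈ T.S base
  orthonormal : ∀ i j, finslerMetric FS.F ⟨base, vec 0⟩ (vec i) (vec j) = -eta i j
  oriented : ∃ b : Module.Basis (Fin 4) ℝ (TangentSpace (𝓡 4) base),
    (∀ i, b i = vec i) ∧ b.orientation = ori.orient base

variable {FS : FinslerSpacetime M} {T : TimeOrientation FS} {ori : ManifoldOrientation M}

/-- The `i`-th vector of a frame as a point of `TM`. -/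
def ObserverFrame.toTM (p : ObserverFrame T ori) (i : Fin 4) : TangentBundle (𝓡 4) M :=
  ⟨p.base, p.vec i⟩

/-- The time component of a frame, as an observer. -/
def ObserverFrame.observer (p : ObserverFrame T ori) : ObserverSpace T :=
  ⟨⟨p.base, p.vec 0⟩, p.time_mem⟩

/-- `P` carries the topology of a subspace of `TM × TM × TM × TM`. -/
instance : TopologicalSpace (ObserverFrame T ori) :=
  TopologicalSpace.induced (fun p i => p.toTM i) inferInstance

/-- The smooth structure on `P` is that of an embedded submanifold of `TM × TM × TM × TM`
(that the inclusion is a topological embedding holds by definition of the topology of `P`). -/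
def IsFrameSubmanifold [ChartedSpace (Euc 10) (ObserverFrame T ori)] : Prop :=
  (∀ i, ContMDiff (𝓡 10) (𝓡 4).tangent ∞ (fun p : ObserverFrame T ori => p.toTM i)) ∧
  ∀ (p : ObserverFrame T ori) (v : TangentSpace (𝓡 10) p),
    (∀ i, mfderiv (𝓡 10) (𝓡 4).tangent (fun q : ObserverFrame T ori => q.toTM i) p v = 0) → v = 0

end Observers

/-! ### The Cartan linear connection in induced coordinates

Functions of the induced coordinates `(x, y)` of `TM` are functions on `Euc 4 × Euc 4`. -/

section Coordinates

abbrev dX (a : Fin 4) (h : Euc 4 × Euc 4 → ℝ) (z : Euc 4 × Euc 4) : ℝ :=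
  fderiv ℝ h z (EuclideanSpace.single a 1, 0)

abbrev dY (a : Fin 4) (h : Euc 4 × Euc 4 → ℝ) (z : Euc 4 × Euc 4) : ℝ :=
  fderiv ℝ h z (0, EuclideanSpace.single a 1)

/-- Coordinate expression of `F ^ 2` in the coordinates on `TM` induced by a chart of `M`. -/
def coordSq {M : Type*} [TopologicalSpace M] [ChartedSpace (Euc 4) M]
    (F : TangentBundle (𝓡 4) M → ℝ) (φ : OpenPartialHomeomorph M (Euc 4))
    (z : Euc 4 × Euc 4) : ℝ :=
  F ⟨φ.symm z.1, mfderiv (𝓡 4) (𝓡 4) φ.symm z.1 z.2⟩ ^ 2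

variable (Q : Euc 4 × Euc 4 → ℝ)

/-- The components `g_ab` of the Finsler metric, where `Q` is the coordinate form of `F ^ 2`. -/
def metricCoeff (z : Euc 4 × Euc 4) : Matrix (Fin 4) (Fin 4) ℝ :=
  Matrix.of fun a b => (1 / 2) * dY a (dY b Q) z

/-- The Cartan non-linear connection `N^a_b`. -/
def nonlinCoeff (a b : Fin 4) (z : Euc 4 × Euc 4) : ℝ :=
  (1 / 4) * dY b (fun w => ∑ c, (metricCoeff Q w)⁻¹ a c *
    (∑ d, w.2 d * dX d (dY c Q) w - dX c Q w)) z

/-- The horizontal derivative `δ_a = ∂_a - N^b_a ∂/∂y^b`. -/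
def deltaX (a : Fin 4) (h : Euc 4 × Euc 4 → ℝ) (z : Euc 4 × Euc 4) : ℝ :=
  dX a h z - ∑ b, nonlinCoeff Q b a z * dY b h z

/-- The coefficients `F^a_bc` of the Cartan linear connection. -/
def horCoeff (a b c : Fin 4) (z : Euc 4 × Euc 4) : ℝ :=
  (1 / 2) * ∑ d, (metricCoeff Q z)⁻¹ a d *
    (deltaX Q b (fun w => metricCoeff Q w c d) z + deltaX Q c (fun w => metricCoeff Q w b d) z
      - deltaX Q d (fun w => metricCoeff Q w b c) z)

/-- The coefficients `C^a_bc` of the Cartan linear connection. -/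
def verCoeff (a b c : Fin 4) (z : Euc 4 × Euc 4) : ℝ :=
  (1 / 2) * ∑ d, (metricCoeff Q z)⁻¹ a d *
    (dY b (fun w => metricCoeff Q w c d) z + dY c (fun w => metricCoeff Q w b d) z
      - dY d (fun w => metricCoeff Q w b c) z)

end Coordinates

/-! ### The algebra `𝔤`

`𝔤` is realised by the matrices with blocks `h, z; -sgn(Λ) zᵀη, 0`, where `h ∈ so(3,1)` and
`z ∈ ℝ⁴`. It is `so(4,1)`, `iso(3,1)` or `so(3,2)` according to the sign of `Λ`. -/

section Algebra

abbrev Mat5 : Type := Matrix (Fin 4 ⊕ Unit) (Fin 4 ⊕ Unit) ℝ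

/-- The matrix with blocks `h, z; -sgn(Λ) zᵀη, 0`. -/
def obsMat (Λ : ℝ) (h : Matrix (Fin 4) (Fin 4) ℝ) (z : Matrix (Fin 4) Unit ℝ) : Mat5 :=
  Matrix.fromBlocks h z (-((SignType.sign Λ : ℝ) • (zᵀ * eta))) 0

/-- The underlying vector space of the Lie algebra `𝔤` of `SO₀(4,1)`, `ISO₀(3,1)` or `SO₀(3,2)`. -/
def obsAlgebra (Λ : ℝ) : Submodule ℝ Mat5 where
  carrier := {X | ∃ h z, hᵀ * eta + eta * h = 0 ∧ X = obsMat Λ h z}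
  zero_mem' := ⟨0, 0, by simp, by simp [obsMat]⟩
  add_mem' := by
    rintro _ _ ⟨h, z, hh, rfl⟩ ⟨h', z', hh', rfl⟩
    refine ⟨h + h', z + z', ?_, ?_⟩
    · rw [Matrix.transpose_add, add_mul, mul_add, add_add_add_comm, hh, hh', add_zero]
    · simp [obsMat, Matrix.fromBlocks_add, Matrix.add_mul, add_comm]
  smul_mem' := by
    rintro c _ ⟨h, z, hh, rfl⟩
    refine ⟨c • h, c • z, ?_, ?_⟩
    · rw [Matrix.transpose_smul, smul_mul_assoc, mul_smul_comm, ← smul_add, hh, smul_zero]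
    · simp [obsMat, Matrix.fromBlocks_smul, smul_comm c]

/-- `𝔤` is closed under the commutator of matrices, its Lie bracket. -/
theorem obsAlgebra_lie_mem (Λ : ℝ) {X Y : Mat5} (hX : X ∈ obsAlgebra Λ) (hY : Y ∈ obsAlgebra Λ) :
    X * Y - Y * X ∈ obsAlgebra Λ := by
  obtain ⟨h, z, hh, rfl⟩ := hX
  obtain ⟨h', z', hh', rfl⟩ := hY
  have ht : etaᵀ = eta := Matrix.diagonal_transpose _
  have e1 : hᵀ * eta = -(eta * h) := eq_neg_of_add_eq_zero_left hh
  have e2 : h'ᵀ * eta = -(eta * h') := eq_neg_of_add_eq_zero_left hh'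
  have e3 : zᵀ * eta * z' = z'ᵀ * eta * z := by
    have : (zᵀ * eta * z')ᵀ = zᵀ * eta * z' := by
      ext i j; rfl
    rw [← this]
    simp [Matrix.transpose_mul, ht, Matrix.mul_assoc]
  generalize hε : (SignType.sign Λ : ℝ) = ε
  refine ⟨h * h' - ε • (z * (z'ᵀ * eta)) - (h' * h - ε • (z' * (zᵀ * eta))),
    h * z' - h' * z, ?_, ?_⟩
  · simp only [Matrix.transpose_sub, Matrix.transpose_mul, Matrix.transpose_smul, ht,
      Matrix.transpose_transpose, Matrix.sub_mul, Matrix.mul_sub, Matrix.smul_mul,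
      Matrix.mul_smul, Matrix.mul_assoc, e1, e2, Matrix.mul_neg]
    simp only [← Matrix.mul_assoc, e1, e2, Matrix.neg_mul]
    abel
  · simp only [obsMat, hε, Matrix.fromBlocks_multiply, sub_eq_add_neg,
      Matrix.fromBlocks_neg, Matrix.fromBlocks_add]
    congr 1
    · simp
    · simp
    · simp only [← sub_eq_add_neg, Matrix.transpose_sub, Matrix.transpose_mul, Matrix.sub_mul,
        Matrix.mul_assoc, e1, e2, Matrix.mul_neg, Matrix.neg_mul, Matrix.smul_mul, Matrix.zero_mul,
        smul_sub, smul_neg]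
      abel
    · simp only [Matrix.neg_mul, Matrix.smul_mul, e3]
      simp

/-- The generator `𝒵₀` of time translations. -/
def timeGenerator (Λ : ℝ) : obsAlgebra Λ :=
  ⟨obsMat Λ 0 (Matrix.of fun i _ => if i = 0 then 1 else 0), 0, _, by simp, rfl⟩

/-- The subspace `𝔶` of boosts: no translation part and no rotation part. -/
def boosts (Λ : ℝ) : Set (obsAlgebra Λ) :=
  {a | (∀ i, (a : Mat5) (.inl i) (.inr ()) = 0) ∧
    ∀ α β : Fin 3, (a : Mat5) (.inl α.succ) (.inl β.succ) = 0}

/-- The group `K = SO(3)`. -/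
abbrev RotGroup : Type := Matrix.specialOrthogonalGroup (Fin 3) ℝ

/-- The inclusion of `K` into `G`, as a matrix. -/
def rotMat (k : RotGroup) : Mat5 :=
  Matrix.fromBlocks
    (Matrix.of (Fin.cons (Fin.cons 1 0) (fun α => Fin.cons 0 ((k : Matrix (Fin 3) (Fin 3) ℝ) α))))
    0 0 1

end Algebra

/-! ### Observer space Cartan geometries -/

/-- A Cartan geometry `(π : P → O, A)` modelled on `G/K`: a principal `K`-bundle with a
`𝔤`-valued one-form `A` satisfying the three axioms of a Cartan connection. As `K` is an
embedded submanifold of the matrices, a map into `K` is smooth when its matrix entries are; and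
a map out of `P × K` is smooth when it is smooth along all smooth maps from open subsets of
Euclidean spaces. -/
structure ObserverCartanGeometry (Λ : ℝ) (P O : Type*)
    [TopologicalSpace P] [ChartedSpace (Euc 10) P] [IsManifold (𝓡 10) ∞ P]
    [TopologicalSpace O] [ChartedSpace (Euc 7) O] [IsManifold (𝓡 7) ∞ O] where
  /-- the bundle projection `π` -/
  proj : P → O
  /-- the right action of `K` on `P` -/
  act : P → RotGroup → P
  /-- the Cartan connection `A` -/
  form : (p : P) → TangentSpace (𝓡 10) p →ₗ[ℝ] obsAlgebra Λ
  proj_smooth : ContMDiff (𝓡 10) (𝓡 7) ∞ proj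
  act_one : ∀ p, act p 1 = p
  act_mul : ∀ p k k', act p (k * k') = act (act p k) k'
  act_smooth : ∀ (m : ℕ) (W : Set (Euc m)) (f : Euc m → P) (κ : Euc m → RotGroup), IsOpen W →
    ContMDiffOn (𝓡 m) (𝓡 10) ∞ f W →
    (∀ α β, ContDiffOn ℝ ∞ (fun w => (κ w : Matrix (Fin 3) (Fin 3) ℝ) α β) W) →
    ContMDiffOn (𝓡 m) (𝓡 10) ∞ (fun w => act (f w) (κ w)) W
  proj_act : ∀ p k, proj (act p k) = proj p
  /-- local triviality: `(u, k) ↦ s(u) k` is a diffeomorphism `U × K → π⁻¹(U)` with inverse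
  `p ↦ (π(p), κ(p))` -/
  locally_trivial : ∀ o : O, ∃ (U : Set O) (s : O → P) (κ : P → RotGroup), IsOpen U ∧ o ∈ U ∧
    ContMDiffOn (𝓡 7) (𝓡 10) ∞ s U ∧ (∀ u ∈ U, proj (s u) = u) ∧
    (∀ α β, ContMDiffOn (𝓡 10) 𝓘(ℝ) ∞
      (fun p => (κ p : Matrix (Fin 3) (Fin 3) ℝ) α β) (proj ⁻¹' U)) ∧
    (∀ p ∈ proj ⁻¹' U, act (s (proj p)) (κ p) = p) ∧ ∀ u ∈ U, ∀ k, κ (act (s u) k) = k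
  form_smooth : ∀ i j, ContMDiff (𝓡 10).tangent 𝓘(ℝ) ∞
    (fun v : TangentBundle (𝓡 10) P => (form v.proj v.snd : Mat5) i j)
  /-- `A_p` is a linear isomorphism -/
  bijective : ∀ p, Function.Bijective (form p)
  /-- `R_k^* A = Ad(k⁻¹) ∘ A` -/
  equivariant : ∀ p k (v : TangentSpace (𝓡 10) p),
    (form (act p k) (mfderiv (𝓡 10) (𝓡 10) (fun q => act q k) p v) : Mat5) =
      rotMat k⁻¹ * (form p v : Mat5) * rotMat k
  /-- `A` is the Maurer-Cartan form on the velocities of curves `t ↦ p k(t)` in the fibres -/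
  maurerCartan : ∀ (p : P) (κ : ℝ → RotGroup),
    (∀ α β, ContDiff ℝ ∞ (fun t => (κ t : Matrix (Fin 3) (Fin 3) ℝ) α β)) → κ 0 = 1 →
    ∀ i j, (form (act p (κ 0)) (mfderiv 𝓘(ℝ) (𝓡 10) (fun t => act p (κ t)) 0 (1 : ℝ)) : Mat5) i j
      = deriv (fun t => rotMat (κ t) i j) 0

namespace ObserverCartanGeometry

variable {Λ : ℝ} {P O : Type*}
  [TopologicalSpace P] [ChartedSpace (Euc 10) P] [IsManifold (𝓡 10) ∞ P]
  [TopologicalSpace O] [ChartedSpace (Euc 7) O] [IsManifold (𝓡 7) ∞ O]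
  (C : ObserverCartanGeometry Λ P O)

theorem proj_surjective : Function.Surjective C.proj := fun o => by
  obtain ⟨U, s, κ, -, ho, -, hs, -⟩ := C.locally_trivial o
  exact ⟨s o, hs o ho⟩

/-- The fundamental vector field of `a ∈ 𝔤`: its value at `p` is the inverse image of `a`
under `A_p`. -/
def fundamental (a : obsAlgebra Λ) (p : P) : TangentBundle (𝓡 10) P :=
  ⟨p, (LinearEquiv.ofBijective (C.form p) (C.bijective p)).symm a⟩

/-- The vertical distribution `VO`: the projection to `TO` of the boost distribution `BP`. -/
def vertical : Set (TangentBundle (𝓡 7) O) :=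
  {w | ∃ (p : P) (a : obsAlgebra Λ), a ∈ boosts Λ ∧
    w = tangentMap (𝓡 10) (𝓡 7) C.proj (C.fundamental a p)}

/-- The vector field `𝐫` on `O`, the projection of `𝐭 = A̲(𝒵₀)`: its value at `o` is computed
at any point `p` of the fibre over `o`. -/
def reeb (o : O) : TangentBundle (𝓡 7) O :=
  tangentMap (𝓡 10) (𝓡 7) C.proj
    (C.fundamental (timeGenerator Λ) (Function.surjInv C.proj_surjective o))

/-- `j : W → O` parametrizes a (three-dimensional) integral manifold of `VO`: it is an injective
immersion whose tangent spaces are those of `VO`. -/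
structure IsIntegralManifold (W : Set (Euc 3)) (j : Euc 3 → O) : Prop where
  isOpen : IsOpen W
  smooth : ContMDiffOn (𝓡 3) (𝓡 7) ∞ j W
  injOn : Set.InjOn j W
  immersive : ∀ w ∈ W, Function.Injective (mfderiv (𝓡 3) (𝓡 7) j w)
  tangent : ∀ w ∈ W, ∀ ξ : TangentSpace (𝓡 7) (j w),
    (⟨j w, ξ⟩ : TangentBundle (𝓡 7) O) ∈ C.vertical ↔ ∃ v, mfderiv (𝓡 3) (𝓡 7) j w v = ξ

/-- Through every point of `O` there is an integral manifold of `VO`. -/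
def IsIntegrable : Prop :=
  ∀ o : O, ∃ W j, C.IsIntegralManifold W j ∧ o ∈ j '' W

/-- Two points lie on the same leaf if they are joined by a finite chain of connected integral
manifolds of `VO`. -/
def leafSetoid : Setoid O :=
  Relation.EqvGen.setoid fun o o' =>
    ∃ W j, C.IsIntegralManifold W j ∧ IsPreconnected W ∧ o ∈ j '' W ∧ o' ∈ j '' W

/-- The leaf space, with the quotient topology. -/
abbrev LeafSpace : Type _ := Quotient C.leafSetoid

/-- The canonical projection onto the leaf space. -/
def leafProj (o : O) : C.LeafSpace := Quotient.mk C.leafSetoid o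

/-- The foliation is strictly simple, that is, the leaf space is Hausdorff and carries
a smooth structure (necessarily unique) for which the projection is a submersion. This predicate
says that the given structure is such a one. -/
structure IsStrictlySimple [ChartedSpace (Euc 4) C.LeafSpace] [IsManifold (𝓡 4) ∞ C.LeafSpace] :
    Prop where
  hausdorff : T2Space C.LeafSpace
  submersion : Manifold.IsSubmersion (𝓡 7) (𝓡 4) ∞ C.leafProj

section Reconstruction

variable [ChartedSpace (Euc 4) C.LeafSpace]

/-- The map `σ = π'_* ∘ 𝐫` from observers to four-velocities. -/
def sigma (o : O) : TangentBundle (𝓡 4) C.LeafSpace :=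
  tangentMap (𝓡 7) (𝓡 4) C.leafProj (C.reeb o)

/-- `σ` is an embedding. -/
def SigmaIsEmbedding [IsManifold (𝓡 4) ∞ C.LeafSpace] : Prop :=
  Manifold.IsSmoothEmbedding (𝓡 7) (𝓡 4).tangent ∞ C.sigma

/-- Each line in a tangent space meets `σ(O)` at most once. -/
def LinesMeetOnce : Prop :=
  ∀ (x : C.LeafSpace) (y : TangentSpace (𝓡 4) x),
    (Set.range C.sigma ∩
      Set.range (fun c : ℝ => (⟨x, c • y⟩ : TangentBundle (𝓡 4) C.LeafSpace))).Subsingleton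

open Classical in
/-- The reconstructed Finsler function: `λ σ(o) ↦ |λ|` on the double cone `ℝσ(O)` (and the
meaningless value `0` elsewhere). -/
def recFinsler (w : TangentBundle (𝓡 4) C.LeafSpace) : ℝ :=
  if h : ∃ (c : ℝ) (o : O), w = ⟨(C.sigma o).proj, c • (C.sigma o).snd⟩ then |h.choose| else 0

/-- Around observers the reconstructed Finsler function is smooth and its Finsler
metric is non-degenerate of Lorentz signature `(1, -1, -1, -1)`. -/
def HasLorentzMetric [IsManifold (𝓡 4) ∞ C.LeafSpace] : Prop :=
  ∀ o : O, ContMDiffAt (𝓡 4).tangent 𝓘(ℝ) ∞ C.recFinsler (C.sigma o) ∧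
    HasLorentzSignature (finslerMetric C.recFinsler (C.sigma o)) 1

end Reconstruction

end ObserverCartanGeometry

/-! ### The observer space Cartan geometry of a Finsler spacetime -/

section FinslerCartanGeometry

variable {M : Type*} [TopologicalSpace M] [ChartedSpace (Euc 4) M] [IsManifold (𝓡 4) ∞ M]
  {FS : FinslerSpacetime M} {T : TimeOrientation FS} {ori : ManifoldOrientation M}

/-- Coordinates of the base point of a frame, in a chart `φ`. -/
def baseCoord (φ : OpenPartialHomeomorph M (Euc 4)) (p : ObserverFrame T ori) : Euc 4 := φ p.base

/-- Coordinates `f_i^a` of the `i`-th frame vector, in a chart `φ`. -/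
def vecCoord (φ : OpenPartialHomeomorph M (Euc 4)) (i : Fin 4) (p : ObserverFrame T ori) : Euc 4 :=
  mfderiv (𝓡 4) (𝓡 4) φ p.base (p.vec i)

/-- The Cartan geometry `C` is that of the Finsler spacetime: `π` discards the spatial vectors
of a frame, `K` rotates them, the translational part `e` of `A` is the solder form and the Lorentz
part `ω` is the covariant derivative of frames by the Cartan linear connection; in coordinates
`f_i^a e^i = dx^a` and
`f_j^a ω^j_i = df_i^a + f_i^b (F^a_bc dx^c + C^a_bc (N^c_d dx^d + df_0^c))`. -/
structure IsFinslerCartanGeometry {Λ : ℝ}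
    [ChartedSpace (Euc 7) (ObserverSpace T)] [IsManifold (𝓡 7) ∞ (ObserverSpace T)]
    [ChartedSpace (Euc 10) (ObserverFrame T ori)] [IsManifold (𝓡 10) ∞ (ObserverFrame T ori)]
    (C : ObserverCartanGeometry Λ (ObserverFrame T ori) (ObserverSpace T)) : Prop where
  proj_eq : ∀ p, C.proj p = p.observer
  act_zero : ∀ p k, (C.act p k).toTM 0 = p.toTM 0
  act_succ : ∀ p k (α : Fin 3), (C.act p k).toTM α.succ =
    ⟨p.base, ∑ β : Fin 3, (k : Matrix (Fin 3) (Fin 3) ℝ) β α • p.vec β.succ⟩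
  form_translation : ∀ φ ∈ IsManifold.maximalAtlas (𝓡 4) ∞ M, ∀ p : ObserverFrame T ori,
    p.base ∈ φ.source → ∀ v : TangentSpace (𝓡 10) p, ∀ a,
    let dx : Euc 4 := mfderiv (𝓡 10) 𝓘(ℝ, Euc 4) (baseCoord φ) p v
    ∑ i, (C.form p v : Mat5) (.inl i) (.inr ()) * vecCoord φ i p a = dx a
  form_lorentz : ∀ φ ∈ IsManifold.maximalAtlas (𝓡 4) ∞ M, ∀ p : ObserverFrame T ori,
    p.base ∈ φ.source → ∀ v : TangentSpace (𝓡 10) p, ∀ i a,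
    let Q := coordSq FS.F φ
    let z := (baseCoord φ p, vecCoord φ 0 p)
    let dx : Euc 4 := mfderiv (𝓡 10) 𝓘(ℝ, Euc 4) (baseCoord φ) p v
    let df : Fin 4 → Euc 4 := fun j => mfderiv (𝓡 10) 𝓘(ℝ, Euc 4) (vecCoord φ j) p v
    ∑ j, (C.form p v : Mat5) (.inl j) (.inl i) * vecCoord φ j p a =
      df i a + ∑ b, ∑ c, vecCoord φ i p b *
        (horCoeff Q a b c z * dx c +
          verCoeff Q a b c z * (∑ d, nonlinCoeff Q c d z * dx d + df 0 c))

end FinslerCartanGeometry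

end FinslerCartan

end

noncomputable section

open scoped Topology

set_option linter.unusedSectionVars false
set_option maxSynthPendingDepth 3

namespace FinslerCartan

/-! ### Lorentzian bilinear forms -/

/-! The spacetime can be read off from its Cartan geometry because the boosts are exactly the
directions along the fibres of `O → M`. A tangent vector of `P` on which the solder form `e`
vanishes does not move the base point, and its boost part is the velocity of `f_0` inside `S_x`.
Hence `VO` is the kernel of the differential of `O → M` (`mem_vertical_iff`). Its leaves are the
sets `S_x`, which are connected by definition (`leafSetoid_iff`), so the leaf space is `M`
(`leafHomeomorph`). Along `A̲(𝒵₀)` the solder form is the unit vector of index zero, so the base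
point moves with velocity `f_0` (`tangentMap_base_reeb`). Under the identification of the leaf space
with `M`, the map `σ` thus becomes the inclusion `O ⊂ TM`, and the remaining conditions become
statements about this inclusion and about `F`.

Three consequences of Euler's theorem on homogeneous functions carry the analysis. First, `y` is a
timelike vector of the Hessian of `|L|` at `y`. The signature condition therefore becomes the
condition `IsTimelike`, which is open (`IsTimelike.eventually`) and passes from `g^L` to `g^F`
(`isTimelike_finsler`). Second, `F` is homogeneous of degree one, so `O` is the level set `F = 1` of
an open cone and is transverse to the rays; `radialChart` straightens it. Third, `C^a_bc y^b = 0`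
(`cartanConn_vertical`), so for vertical motions the covariant derivative of `f_0` is its ordinary
derivative. This gives the injectivity of `A` and shows that every vertical direction is produced by
a boost.

Two topological points need an argument. The components `S_x` are chosen fibre by fibre, and the
cone that they span is open in `TM` only thanks to the continuous local sections; connectedness
spreads the openness from these sections (`TimeOrientation.isOpen_cone`). And `S_x` never contains
opposite vectors (`neg_notMem`): along segments in the timelike cone `|L|` attains its minimum at an
end point, so all of `S_x` is visible from one of its points inside the open cone, whereas the
segment to the opposite vector would meet the origin. This is what makes each line meet `σ(O)` only
once.

The connection is handled without indices as `cartanConn`. Its metricity puts `ω` into the Lorentz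
algebra, its transformation law makes `A` independent of the chart, and linearity in the frame gives
equivariance. Bijectivity follows from injectivity by counting dimensions. The smooth structures of
`O` and `P` consist of all charts that are smooth with respect to the ambient products of `TM`. For
`P` such charts come from local frames, obtained by Gram-Schmidt, and from Rodrigues coordinates on
`SO(3)`. -/

/-- Bilinear forms on `ℝ⁴`. -/
abbrev Bil : Type := Euc 4 →L[ℝ] Euc 4 →L[ℝ] ℝ

/-- The vector `y` is timelike for `B`: `B` is positive on `y` and negative on its complement. -/
structure IsTimelike (B : Bil) (y : Euc 4) : Prop where
  pos : 0 < B y y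
  neg : ∀ v, v ≠ 0 → B y v = 0 → B v v < 0

/-- The vectors `f 0, …, f 3` are orthonormal for `B`. -/
def IsOrthoFrame (B : Bil) (f : Fin 4 → Euc 4) : Prop := ∀ i j, B (f i) (f j) = -eta i j

theorem eta_apply (i j : Fin 4) : eta i j = if i = j then (if i = 0 then -1 else 1) else 0 := by
  simp [eta, Matrix.diagonal_apply]

theorem eta_sq (i : Fin 4) : eta i i * eta i i = 1 := by
  rw [eta_apply, if_pos rfl]; split_ifs <;> norm_num

namespace IsOrthoFrame

variable {B : Bil} {f : Fin 4 → Euc 4}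

theorem linearIndependent (h : IsOrthoFrame B f) : LinearIndependent ℝ f := by
  rw [Fintype.linearIndependent_iff]
  intro g hg i
  have := congrArg (B (f i)) hg
  simp only [map_sum, map_smul, h i, map_zero, eta_apply, smul_eq_mul] at this
  simp at this
  split_ifs at this <;> simpa using this

/-- The basis formed by an orthonormal frame. -/
def basis (h : IsOrthoFrame B f) : Module.Basis (Fin 4) ℝ (Euc 4) :=
  basisOfLinearIndependentOfCardEqFinrank h.linearIndependent (by simp)

@[simp] theorem basis_apply (h : IsOrthoFrame B f) (i : Fin 4) : h.basis i = f i := by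
  simp [basis]

/-- Since `B (f j) (f j) = -η_jj` is its own inverse, the dual basis is `v ↦ -η_jj B (f j) v`. The
forms `ω` and `e` are later defined by these coefficients, so that their defining equations are
instances of this expansion. -/
theorem sum_repr (h : IsOrthoFrame B f) (v : Euc 4) :
    ∑ j, (-eta j j * B (f j) v) • f j = v := by
  have key : ∀ c : Fin 4 → ℝ, ∀ j, B (f j) (∑ i, c i • f i) = -eta j j * c j := by
    intro c j
    simp only [map_sum, map_smul, h j, smul_eq_mul]
    rw [Finset.sum_eq_single j]
    · ring
    · intro b _ hb; simp [eta_apply, hb.symm]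
    · simp
  have hv : ∑ i, h.basis.repr v i • f i = v := by simpa using h.basis.sum_repr v
  conv_rhs => rw [← hv]
  refine Finset.sum_congr rfl fun j _ => ?_
  congr 1
  conv_lhs => rw [← hv]
  rw [key]
  linear_combination (h.basis.repr v j) * eta_sq j

theorem hasLorentzSignature (h : IsOrthoFrame B f) : HasLorentzSignature B 1 :=
  ⟨h.basis, fun i j => by simp [h i j]⟩

theorem eq_of_sum_eq (h : IsOrthoFrame B f) {c d : Fin 4 → ℝ}
    (hcd : ∑ i, c i • f i = ∑ i, d i • f i) : c = d := by
  have := Fintype.linearIndependent_iff.1 h.linearIndependent (fun i => c i - d i)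
    (by simp [sub_smul, Finset.sum_sub_distrib, hcd])
  funext i
  linarith [this i]

end IsOrthoFrame

theorem HasLorentzSignature.smul {B : Bil} {ε : ℝ} (hε : ε * ε = 1) (h : HasLorentzSignature B ε) :
    HasLorentzSignature (ε • B) 1 := by
  obtain ⟨b, hb⟩ := h
  refine ⟨b, fun i j => ?_⟩
  simp only [smul_apply, hb, smul_eq_mul]
  linear_combination (-eta i j) * hε

theorem HasLorentzSignature.isTimelike {B : Bil} (h : HasLorentzSignature B 1) {y : Euc 4}
    (hy : 0 < B y y) : IsTimelike B y := by
  obtain ⟨b, hb⟩ := h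
  have key : ∀ u v : Euc 4, B u v = b.repr u 0 * b.repr v 0 - b.repr u 1 * b.repr v 1
      - b.repr u 2 * b.repr v 2 - b.repr u 3 * b.repr v 3 := by
    intro u v
    have hu := b.sum_repr u
    have hv := b.sum_repr v
    rw [Fin.sum_univ_four] at hu hv
    conv_lhs => rw [← hu, ← hv]
    simp only [map_add, map_smul, add_apply, smul_apply, hb, smul_eq_mul]
    simp [eta_apply]
    ring
  refine ⟨hy, fun v hv0 hyv => ?_⟩
  by_contra hv
  rw [key] at hy hyv hv
  set y0 := b.repr y 0
  set y1 := b.repr y 1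
  set y2 := b.repr y 2
  set y3 := b.repr y 3
  -- Orthogonality says that `y₀v₀` is the Euclidean product of the spatial parts. By Cauchy-Schwarz
  -- `y₀²v₀² ≤ |y|²|v|² ≤ |y|²v₀²` for the spatial norms, which contradicts `|y|² < y₀²` unless `v₀
  -- = 0`.
  have hz : b.repr v 0 = 0 := by
    by_contra h0
    have h0' : 0 < b.repr v 0 ^ 2 := by positivity
    set v0 := b.repr v 0
    set v1 := b.repr v 1
    set v2 := b.repr v 2
    set v3 := b.repr v 3
    have e1 : y0 * v0 = y1 * v1 + y2 * v2 + y3 * v3 := by linarith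
    have e2 : (y1 * v1 + y2 * v2 + y3 * v3) ^ 2 ≤
        (y1 ^ 2 + y2 ^ 2 + y3 ^ 2) * (v1 ^ 2 + v2 ^ 2 + v3 ^ 2) := by
      nlinarith [sq_nonneg (y1 * v2 - y2 * v1), sq_nonneg (y1 * v3 - y3 * v1),
        sq_nonneg (y2 * v3 - y3 * v2)]
    rw [← e1] at e2
    have e3 : (y1 ^ 2 + y2 ^ 2 + y3 ^ 2) * (v1 ^ 2 + v2 ^ 2 + v3 ^ 2) ≤
        (y1 ^ 2 + y2 ^ 2 + y3 ^ 2) * v0 ^ 2 := by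
      apply mul_le_mul_of_nonneg_left _ (by positivity)
      nlinarith
    nlinarith
  rw [hz] at hv
  have h1 : b.repr v 1 = 0 := by nlinarith [sq_nonneg (b.repr v 1), sq_nonneg (b.repr v 2), sq_nonneg (b.repr v 3)]
  have h2 : b.repr v 2 = 0 := by nlinarith [sq_nonneg (b.repr v 1), sq_nonneg (b.repr v 2), sq_nonneg (b.repr v 3)]
  have h3 : b.repr v 3 = 0 := by nlinarith [sq_nonneg (b.repr v 1), sq_nonneg (b.repr v 2), sq_nonneg (b.repr v 3)]
  apply hv0
  have hs := b.sum_repr v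
  rw [Fin.sum_univ_four, hz, h1, h2, h3] at hs
  simpa using hs.symm

/-- The positive definite form obtained by reflecting `B` in the direction of `y`. -/
theorem IsTimelike.reflect_pos {B : Bil} {y : Euc 4} (hs : ∀ u v, B u v = B v u)
    (h : IsTimelike B y) {v : Euc 4} (hv : v ≠ 0) : 0 < 2 * B y v ^ 2 - B y y * B v v := by
  have hp := h.pos
  -- With the component `w` of `v` orthogonal to `y`, the form equals `B(y,v)² - B(y,y) B(w,w)`.
  -- Both terms are nonnegative, and they do not vanish together.
  set w := v - (B y v / B y y) • y with hw
  have h1 : B y w = 0 := by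
    simp [hw]; field_simp; ring
  have h2 : v = w + (B y v / B y y) • y := by simp [hw]
  have h3 : B v v = B w w + B y v ^ 2 / B y y := by
    conv_lhs => rw [h2]
    simp only [map_add, map_smul, add_apply, smul_apply,
      smul_eq_mul, hs w y, h1]
    field_simp
    ring
  have h4 : B y y * B v v = B y y * B w w + B y v ^ 2 := by rw [h3]; field_simp
  rw [h4]
  by_cases hw0 : w = 0
  · have : B y v ≠ 0 := by
      intro h0; apply hv; rw [h2, hw0, h0]; simp
    have : 0 < B y v ^ 2 := by positivity
    rw [hw0]; simp; linarith
  · have := h.neg w hw0 h1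
    nlinarith [sq_nonneg (B y v)]

theorem isTimelike_of_reflect_pos {B : Bil} {y : Euc 4} (hy : 0 < B y y)
    (h : ∀ v, v ≠ 0 → 0 < 2 * B y v ^ 2 - B y y * B v v) : IsTimelike B y := by
  refine ⟨hy, fun v hv h0 => ?_⟩
  have := h v hv
  rw [h0] at this
  nlinarith

/-- The negativity condition lives on a hyperplane that varies with `y`. Positivity of the reflected
form is a condition on all of `ℝ⁴`, homogeneous in the vector, so it need only be tested on the
compact unit sphere. Symmetry is required of `B` alone and not of the nearby forms. -/
theorem IsTimelike.eventually {B : Bil} {y : Euc 4} (hs : ∀ u v, B u v = B v u)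
    (h : IsTimelike B y) : ∀ᶠ q : Bil × Euc 4 in 𝓝 (B, y), IsTimelike q.1 q.2 := by
  set R : (Bil × Euc 4) × Euc 4 → ℝ := fun r =>
    2 * r.1.1 r.1.2 r.2 ^ 2 - r.1.1 r.1.2 r.1.2 * r.1.1 r.2 r.2 with hR
  have hRc : Continuous R := by fun_prop
  have h1 : ∀ᶠ q : Bil × Euc 4 in 𝓝 (B, y), ∀ v ∈ Metric.sphere (0 : Euc 4) 1, 0 < R (q, v) := by
    apply (isCompact_sphere (0 : Euc 4) 1).eventually_forall_of_forall_eventually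
    intro v hv
    apply hRc.continuousAt.eventually
    apply lt_mem_nhds
    refine h.reflect_pos hs ?_
    rintro rfl
    simp at hv
  have h2 : ∀ᶠ q : Bil × Euc 4 in 𝓝 (B, y), 0 < q.1 q.2 q.2 := by
    have : Continuous fun q : Bil × Euc 4 => q.1 q.2 q.2 := by fun_prop
    exact this.continuousAt.eventually (lt_mem_nhds h.pos)
  filter_upwards [h1, h2] with q hq1 hq2
  refine isTimelike_of_reflect_pos hq2 fun v hv => ?_
  have hn : 0 < ‖v‖ := norm_pos_iff.2 hv
  have := hq1 (‖v‖⁻¹ • v) (by simp [norm_smul, hn.ne'])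
  simp only [hR, map_smul, smul_apply, smul_eq_mul] at this
  have e : 2 * q.1 q.2 v ^ 2 - q.1 q.2 q.2 * q.1 v v = ‖v‖ ^ 2 *
     (2 * (‖v‖⁻¹ * q.1 q.2 v) ^ 2 - q.1 q.2 q.2 * (‖v‖⁻¹ * (‖v‖⁻¹ * q.1 v v))) := by
    field_simp
  rw [e]; positivity

theorem IsTimelike.smul {B : Bil} {y : Euc 4} (h : IsTimelike B y) {a c : ℝ} (ha : 0 < a)
    (hc : c ≠ 0) : IsTimelike (a • B) (c • y) := by
  refine ⟨?_, fun v hv h0 => ?_⟩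
  · have := h.pos
    have hc2 : 0 < c * c := mul_self_pos.2 hc
    simp only [map_smul, smul_apply, smul_eq_mul]
    have : c * (c * (a * B y y)) = a * ((c * c) * B y y) := by ring
    rw [this]; positivity
  · simp only [map_smul, smul_apply, smul_eq_mul] at h0 ⊢
    have := h.neg v hv (by simpa [ha.ne', hc] using h0)
    nlinarith

/-! ### Orthonormal frames with given time component -/

/-- `u 0, u 1, u 2` are orthonormal for `-B` and orthogonal to `y`. -/
structure IsSpatialFrame (B : Bil) (y : Euc 4) (u : Fin 3 → Euc 4) : Prop where
  time : ∀ α, B y (u α) = 0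
  space : ∀ α β, B (u α) (u β) = if α = β then -1 else 0

theorem IsSpatialFrame.isOrthoFrame {B : Bil} {y : Euc 4} {u : Fin 3 → Euc 4}
    (hs : ∀ u v, B u v = B v u) (h : IsSpatialFrame B y u) (hy : B y y = 1) :
    IsOrthoFrame B (Fin.cons y u) := by
  intro i j
  rw [eta_apply]
  refine Fin.cases ?_ (fun α => ?_) i <;> refine Fin.cases ?_ (fun β => ?_) j
  · simp [hy]
  · simp [h.time, (Fin.succ_ne_zero β).symm]
  · simp [h.time, hs _ y, Fin.succ_ne_zero]
  · simp only [Fin.cons_succ, h.space, Fin.succ_inj, Fin.succ_ne_zero, if_false]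
    split_ifs <;> simp

theorem IsOrthoFrame.isSpatialFrame {B : Bil} {f : Fin 4 → Euc 4} (h : IsOrthoFrame B f) :
    IsSpatialFrame B (f 0) (fun α => f α.succ) where
  time α := by rw [h 0 α.succ, eta_apply]; simp [(Fin.succ_ne_zero α).symm]
  space α β := by
    rw [h α.succ β.succ, eta_apply]
    simp only [Fin.succ_inj, Fin.succ_ne_zero, if_false]
    split_ifs <;> simp

theorem exists_ne_zero_of_functionals {k : ℕ} (hk : k < 4) (l : Fin k → Euc 4 →L[ℝ] ℝ) :
    ∃ v : Euc 4, v ≠ 0 ∧ ∀ i, l i v = 0 := by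
  have := LinearMap.ker_ne_bot_of_finrank_lt (K := ℝ)
    (f := LinearMap.pi fun i => (l i : Euc 4 →ₗ[ℝ] ℝ)) (by simpa using hk)
  obtain ⟨v, hv, hv0⟩ := (Submodule.ne_bot_iff _).1 this
  exact ⟨v, hv0, fun i => by simpa using congrFun (LinearMap.mem_ker.1 hv) i⟩

/-- Orthogonality to `y` and to at most two further vectors leaves a nonzero vector in `ℝ⁴`. It is
orthogonal to `y`, hence of negative square, and can be normalized. -/
theorem IsTimelike.exists_unit {B : Bil} {y : Euc 4} (h : IsTimelike B y) {k : ℕ} (hk : k < 3)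
    (l : Fin k → Euc 4) : ∃ v, B y v = 0 ∧ B v v = -1 ∧ ∀ i, B (l i) v = 0 := by
  obtain ⟨v, hv0, hv⟩ := exists_ne_zero_of_functionals (k := k + 1) (by omega)
    (Fin.cons (B y) fun i => B (l i))
  have h0 : B y v = 0 := by simpa using hv 0
  have hi : ∀ i, B (l i) v = 0 := fun i => by simpa using hv i.succ
  have hneg := h.neg v hv0 h0
  have hs : 0 < √(-B v v) := Real.sqrt_pos.2 (by linarith)
  refine ⟨(√(-B v v))⁻¹ • v, by simp [h0], ?_, fun i => by simp [hi]⟩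
  simp only [map_smul, smul_apply, smul_eq_mul]
  have := Real.mul_self_sqrt (show 0 ≤ -B v v by linarith)
  field_simp
  nlinarith

theorem IsTimelike.exists_spatialFrame {B : Bil} {y : Euc 4} (hs : ∀ u v, B u v = B v u)
    (h : IsTimelike B y) : ∃ u, IsSpatialFrame B y u := by
  obtain ⟨a, a0, a1, -⟩ := h.exists_unit (k := 0) (by norm_num) Fin.elim0
  obtain ⟨b, b0, b1, b2⟩ := h.exists_unit (k := 1) (by norm_num) ![a]
  obtain ⟨c, c0, c1, c2⟩ := h.exists_unit (k := 2) (by norm_num) ![a, b]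
  have hab : B a b = 0 := by simpa using b2 0
  have hac : B a c = 0 := by simpa using c2 0
  have hbc : B b c = 0 := by simpa using c2 1
  refine ⟨![a, b, c], ⟨fun α => ?_, fun α β => ?_⟩⟩
  · fin_cases α <;> simp [a0, b0, c0]
  · fin_cases α <;> fin_cases β <;> simp [a1, b1, c1, hab, hac, hbc, hs b a, hs c a, hs c b]

theorem IsTimelike.hasLorentzSignature {B : Bil} {y : Euc 4} (hs : ∀ u v, B u v = B v u)
    (h : IsTimelike B y) : HasLorentzSignature B 1 := by
  have hp := Real.sqrt_pos.2 h.pos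
  have h1 : B ((√(B y y))⁻¹ • y) ((√(B y y))⁻¹ • y) = 1 := by
    simp only [map_smul, smul_apply, smul_eq_mul]
    have := Real.mul_self_sqrt h.pos.le
    field_simp
    nlinarith
  obtain ⟨u, hu⟩ := h.exists_spatialFrame hs
  have : IsSpatialFrame B ((√(B y y))⁻¹ • y) u := ⟨fun α => by simp [hu.time], hu.space⟩
  exact (this.isOrthoFrame hs h1).hasLorentzSignature

/-- Normalization of a spacelike vector. -/
def spaceNormalize (B : Bil) (w : Euc 4) : Euc 4 := (√(-B w w))⁻¹ • w

/-- The Gram-Schmidt process in the complement of `y`. -/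
def gramSchmidtSpace (v : Fin 3 → Euc 4) (q : Bil × Euc 4) : Fin 3 → Euc 4 :=
  let p : Euc 4 → Euc 4 := fun x => x - (q.1 q.2 x / q.1 q.2 q.2) • q.2
  let a := spaceNormalize q.1 (p (v 0))
  -- The projections are added rather than subtracted because the normalized vectors have square
  -- `-1`.
  let b := spaceNormalize q.1 (p (v 1) + q.1 a (v 1) • a)
  ![a, b, spaceNormalize q.1 (p (v 2) + q.1 a (v 2) • a + q.1 b (v 2) • b)]

theorem contDiffAt_spaceNormalize {E : Type*} [NormedAddCommGroup E] [NormedSpace ℝ E]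
    {B : E → Bil} {w : E → Euc 4} {x : E} (hB : ContDiffAt ℝ ∞ B x) (hw : ContDiffAt ℝ ∞ w x)
    (h : B x (w x) (w x) < 0) : ContDiffAt ℝ ∞ (fun x => spaceNormalize (B x) (w x)) x := by
  have h1 : ContDiffAt ℝ ∞ (fun x => -B x (w x) (w x)) x := ((hB.clm_apply hw).clm_apply hw).neg
  have h2 : -B x (w x) (w x) ≠ 0 := by linarith
  exact ((h1.sqrt h2).inv (Real.sqrt_ne_zero'.2 (by linarith))).smul hw

theorem spaceNormalize_self {B : Bil} {w : Euc 4} (h : B w w < 0) :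
    B (spaceNormalize B w) (spaceNormalize B w) = -1 := by
  have hs : 0 < √(-B w w) := Real.sqrt_pos.2 (by linarith)
  simp only [spaceNormalize, map_smul, smul_apply, smul_eq_mul]
  have := Real.mul_self_sqrt (show 0 ≤ -B w w by linarith)
  field_simp
  nlinarith

/-- Seeding the process with an orthonormal `v` makes it return `v` at the given form and vector, so
a prescribed frame extends to a smooth family of frames. The process is smooth as long as every
vector to be normalized has negative square. Symmetry of the form matters only for the orthogonality
relations. -/
theorem gramSchmidtSpace_spec (v : Fin 3 → Euc 4) (B₀ : Bil) (y₀ : Euc 4)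
    (ht : IsTimelike B₀ y₀) (hv : IsSpatialFrame B₀ y₀ v) :
    gramSchmidtSpace v (B₀, y₀) = v ∧ ∃ U ∈ 𝓝 (B₀, y₀), IsOpen U ∧
      (∀ α, ContDiffOn ℝ ∞ (fun q => gramSchmidtSpace v q α) U) ∧
      ∀ q ∈ U, (∀ u v, q.1 u v = q.1 v u) → IsSpatialFrame q.1 q.2 (gramSchmidtSpace v q) := by
  set p : Bil × Euc 4 → Euc 4 → Euc 4 := fun q x => x - (q.1 q.2 x / q.1 q.2 q.2) • q.2 with hp
  set a : Bil × Euc 4 → Euc 4 := fun q => spaceNormalize q.1 (p q (v 0)) with ha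
  set wb : Bil × Euc 4 → Euc 4 := fun q => p q (v 1) + q.1 (a q) (v 1) • a q with hwb
  set b : Bil × Euc 4 → Euc 4 := fun q => spaceNormalize q.1 (wb q) with hb
  set wc : Bil × Euc 4 → Euc 4 := fun q =>
    p q (v 2) + q.1 (a q) (v 2) • a q + q.1 (b q) (v 2) • b q with hwc
  have hg : ∀ q, gramSchmidtSpace v q = ![a q, b q, spaceNormalize q.1 (wc q)] := fun q => rfl
  have hfst : ∀ q : Bil × Euc 4, ContDiffAt ℝ ∞ (fun q : Bil × Euc 4 => q.1) q :=
    fun q => contDiffAt_fst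
  have hsnd : ∀ q : Bil × Euc 4, ContDiffAt ℝ ∞ (fun q : Bil × Euc 4 => q.2) q :=
    fun q => contDiffAt_snd
  have dp : ∀ q : Bil × Euc 4, 0 < q.1 q.2 q.2 → ∀ x, ContDiffAt ℝ ∞ (fun q => p q x) q := by
    intro q hq x
    exact contDiffAt_const.sub (((((hfst q).clm_apply (hsnd q)).clm_apply contDiffAt_const).div
      (((hfst q).clm_apply (hsnd q)).clm_apply (hsnd q)) hq.ne').smul (hsnd q))
  have da : ∀ q : Bil × Euc 4, 0 < q.1 q.2 q.2 → q.1 (p q (v 0)) (p q (v 0)) < 0 →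
      ContDiffAt ℝ ∞ a q := fun q h1 h2 => contDiffAt_spaceNormalize (hfst q) (dp q h1 _) h2
  have dwb : ∀ q : Bil × Euc 4, 0 < q.1 q.2 q.2 → q.1 (p q (v 0)) (p q (v 0)) < 0 →
      ContDiffAt ℝ ∞ wb q := fun q h1 h2 => (dp q h1 _).add
        ((((hfst q).clm_apply (da q h1 h2)).clm_apply contDiffAt_const).smul (da q h1 h2))
  have db : ∀ q : Bil × Euc 4, 0 < q.1 q.2 q.2 → q.1 (p q (v 0)) (p q (v 0)) < 0 →
      q.1 (wb q) (wb q) < 0 → ContDiffAt ℝ ∞ b q := fun q h1 h2 h3 =>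
        contDiffAt_spaceNormalize (hfst q) (dwb q h1 h2) h3
  have dwc : ∀ q : Bil × Euc 4, 0 < q.1 q.2 q.2 → q.1 (p q (v 0)) (p q (v 0)) < 0 →
      q.1 (wb q) (wb q) < 0 → ContDiffAt ℝ ∞ wc q := fun q h1 h2 h3 => ((dp q h1 _).add
        ((((hfst q).clm_apply (da q h1 h2)).clm_apply contDiffAt_const).smul (da q h1 h2))).add
        ((((hfst q).clm_apply (db q h1 h2 h3)).clm_apply contDiffAt_const).smul (db q h1 h2 h3))
  have h00 : B₀ (v 0) (v 0) = -1 := by simp [hv.space]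
  have h11 : B₀ (v 1) (v 1) = -1 := by simp [hv.space]
  have h22 : B₀ (v 2) (v 2) = -1 := by simp [hv.space]
  have h01 : B₀ (v 0) (v 1) = 0 := by simp [hv.space]
  have h02 : B₀ (v 0) (v 2) = 0 := by simp [hv.space]
  have h12 : B₀ (v 1) (v 2) = 0 := by simp [hv.space]
  have p0 : ∀ α, p (B₀, y₀) (v α) = v α := fun α => by simp [hp, hv.time]
  have n0 : ∀ x, B₀ x x = -1 → spaceNormalize B₀ x = x := fun x hx => by
    simp [spaceNormalize, hx]
  have a0 : a (B₀, y₀) = v 0 := by simp [ha, p0, n0 _ h00]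
  have wb0 : wb (B₀, y₀) = v 1 := by simp [hwb, p0, a0, h01]
  have b0 : b (B₀, y₀) = v 1 := by simp [hb, wb0, n0 _ h11]
  have wc0 : wc (B₀, y₀) = v 2 := by simp [hwc, p0, a0, b0, h02, h12]
  refine ⟨?_, ?_⟩
  · rw [hg, a0, b0, wc0, n0 _ h22]
    funext α; fin_cases α <;> rfl
  set U : Set (Bil × Euc 4) := {q | 0 < q.1 q.2 q.2 ∧ q.1 (p q (v 0)) (p q (v 0)) < 0 ∧
    q.1 (wb q) (wb q) < 0 ∧ q.1 (wc q) (wc q) < 0} with hU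
  -- The vectors of later stages are continuous only where the earlier inequalities hold, so
  -- openness is checked at each point rather than as a preimage.
  have hopen : IsOpen U := by
    rw [isOpen_iff_mem_nhds]
    rintro q ⟨h1, h2, h3, h4⟩
    have c : ∀ w : Bil × Euc 4 → Euc 4, ContDiffAt ℝ ∞ w q → q.1 (w q) (w q) < 0 →
        ∀ᶠ q in 𝓝 q, q.1 (w q) (w q) < 0 := fun w hw hneg =>
      (((hfst q).clm_apply hw).clm_apply hw).continuousAt.eventually (gt_mem_nhds hneg)
    have c1 : ∀ᶠ q : Bil × Euc 4 in 𝓝 q, 0 < q.1 q.2 q.2 :=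
      (((hfst q).clm_apply (hsnd q)).clm_apply (hsnd q)).continuousAt.eventually (lt_mem_nhds h1)
    filter_upwards [c1, c _ (dp q h1 (v 0)) h2, c _ (dwb q h1 h2) h3, c _ (dwc q h1 h2 h3) h4]
      with r r1 r2 r3 r4 using ⟨r1, r2, r3, r4⟩
  have hmem : (B₀, y₀) ∈ U := by
    refine ⟨ht.pos, ?_, ?_, ?_⟩
    · rw [p0]; simp [h00]
    · rw [wb0]; simp [h11]
    · rw [wc0]; simp [h22]
  refine ⟨U, hopen.mem_nhds hmem, hopen, fun α q ⟨h1, h2, h3, h4⟩ => ContDiffAt.contDiffWithinAt ?_,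
    fun q ⟨h1, h2, h3, h4⟩ hs => ?_⟩
  · simp only [hg]
    fin_cases α
    · exact da q h1 h2
    · exact db q h1 h2 h3
    · exact contDiffAt_spaceNormalize (hfst q) (dwc q h1 h2 h3) h4
  · rw [hg]
    have tp : ∀ x, q.1 q.2 (p q x) = 0 := fun x => by
      simp [hp, h1.ne']
    have tn : ∀ w u, q.1 u w = 0 → q.1 u (spaceNormalize q.1 w) = 0 := fun w u h => by
      simp [spaceNormalize, h]
    have ta : q.1 q.2 (a q) = 0 := tn _ _ (tp _)
    have twb : q.1 q.2 (wb q) = 0 := by simp [hwb, tp, ta]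
    have tb : q.1 q.2 (b q) = 0 := tn _ _ twb
    have twc : q.1 q.2 (wc q) = 0 := by simp [hwc, tp, ta, tb]
    have tc := tn _ _ twc
    have aa : q.1 (a q) (a q) = -1 := spaceNormalize_self h2
    have bb : q.1 (b q) (b q) = -1 := spaceNormalize_self h3
    have cc := spaceNormalize_self h4
    have ap : ∀ w x, q.1 q.2 w = 0 → q.1 w (p q x) = q.1 w x := fun w x h => by
      simp [hp, hs w q.2, h]
    have ab : q.1 (a q) (b q) = 0 := tn _ _ (by simp [hwb, ap _ _ ta, aa])
    have ac : q.1 (a q) (spaceNormalize q.1 (wc q)) = 0 :=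
      tn _ _ (by simp [hwc, ap _ _ ta, aa, ab])
    have bc : q.1 (b q) (spaceNormalize q.1 (wc q)) = 0 :=
      tn _ _ (by simp [hwc, ap _ _ tb, bb, hs (b q) (a q), ab])
    refine ⟨fun α => ?_, fun α β => ?_⟩
    · fin_cases α
      · exact ta
      · exact tb
      · exact tc
    · fin_cases α <;> fin_cases β <;>
        simp [aa, bb, cc, ab, ac, bc, hs (b q) (a q), hs (spaceNormalize q.1 (wc q)) (a q),
          hs (spaceNormalize q.1 (wc q)) (b q)]

/-! ### Homogeneous functions -/

section Homogeneous

variable {E V : Type*} [NormedAddCommGroup E] [NormedSpace ℝ E] [NormedAddCommGroup V]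
  [NormedSpace ℝ V]

/-- Euler's identity: differentiate `c ↦ f (c • y)` at `c = 1`. -/
theorem fderiv_apply_self_of_homogeneous {f : E → V} {k : ℝ} {y : E}
    (hf : DifferentiableAt ℝ f y) (hom : ∀ c : ℝ, 0 < c → f (c • y) = c ^ k • f y) :
    fderiv ℝ f y y = k • f y := by
  have h1 : HasDerivAt (fun c : ℝ => f (c • y)) (fderiv ℝ f y y) 1 := by
    have hc : HasDerivAt (fun c : ℝ => c • y) y 1 := by
      simpa using (hasDerivAt_id (1 : ℝ)).smul_const y
    have hf' : HasFDerivAt f (fderiv ℝ f y) ((1 : ℝ) • y) := by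
      rw [one_smul]; exact hf.hasFDerivAt
    exact hf'.comp_hasDerivAt (1 : ℝ) hc
  have h2 : HasDerivAt (fun c : ℝ => c ^ k • f y) (k • f y) 1 := by
    simpa using (Real.hasDerivAt_rpow_const (x := 1) (p := k) (Or.inl one_ne_zero)).smul_const (f y)
  refine h1.unique (h2.congr_of_eventuallyEq ?_)
  filter_upwards [lt_mem_nhds (zero_lt_one' ℝ)] with c hc using hom c hc

theorem fderiv_homogeneous {f : E → V} {k : ℝ}
    (hom : ∀ c : ℝ, 0 < c → ∀ y, f (c • y) = c ^ k • f y) {c : ℝ} (hc : 0 < c) (y : E) :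
    fderiv ℝ f (c • y) = c ^ (k - 1) • fderiv ℝ f y := by
  have h1 : fderiv ℝ (fun y => f (c • y)) y = c • fderiv ℝ f (c • y) := fderiv_comp_smul c
  have h2 : fderiv ℝ (fun y => f (c • y)) y = c ^ k • fderiv ℝ f y := by
    rw [funext (hom c hc)]
    exact congrFun (fderiv_const_smul_field (f := f) (c ^ k)) y
  rw [h1] at h2
  rw [Real.rpow_sub_one hc.ne', div_eq_inv_mul, mul_smul, ← h2, smul_smul,
    inv_mul_cancel₀ hc.ne', one_smul]

end Homogeneous

/-- Half of the Hessian. -/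
def hess (f : Euc 4 → ℝ) (y : Euc 4) : Bil := (1 / 2 : ℝ) • fderiv ℝ (fderiv ℝ f) y

theorem hess_symm {f : Euc 4 → ℝ} {y : Euc 4} (hf : ContDiffAt ℝ ∞ f y) (u v : Euc 4) :
    hess f y u v = hess f y v u := by
  have := (hf.isSymmSndFDerivAt (by simp; norm_cast)).eq u v
  simp [hess, this]

theorem hess_congr {f g : Euc 4 → ℝ} {y : Euc 4} (h : f =ᶠ[𝓝 y] g) : hess f y = hess g y := by
  rw [hess, hess, (Filter.EventuallyEq.fderiv h).fderiv_eq]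

theorem hess_comp_linear (f : Euc 4 → ℝ) (T : Euc 4 ≃L[ℝ] Euc 4) (y u v : Euc 4) :
    hess (fun y => f (T y)) y u v = hess f (T y) (T u) (T v) := by
  set Ψ : (Euc 4 →L[ℝ] ℝ) ≃L[ℝ] (Euc 4 →L[ℝ] ℝ) :=
    T.symm.arrowCongr (ContinuousLinearEquiv.refl ℝ ℝ) with hΨ
  have h1 : fderiv ℝ (fun y => f (T y)) = Ψ ∘ fderiv ℝ f ∘ T := by
    funext z
    exact T.comp_right_fderiv
  rw [hess, hess, h1, Ψ.comp_fderiv, T.comp_right_fderiv]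
  rfl

/-- The function `ℓ` on `ℝ⁴` is smooth outside of the origin and homogeneous of degree `n ≥ 2`. -/
structure IsHomogeneous (ℓ : Euc 4 → ℝ) (n : ℝ) : Prop where
  two_le : 2 ≤ n
  smooth : ContDiffOn ℝ ∞ ℓ {0}ᶜ
  hom : ∀ c : ℝ, 0 < c → ∀ y, ℓ (c • y) = c ^ n • ℓ y

namespace IsHomogeneous

variable {ℓ : Euc 4 → ℝ} {n : ℝ} (h : IsHomogeneous ℓ n)
include h

theorem contDiffAt {y : Euc 4} (hy : y ≠ 0) : ContDiffAt ℝ ∞ ℓ y :=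
  h.smooth.contDiffAt (isOpen_compl_singleton.mem_nhds hy)

theorem map_zero : ℓ 0 = 0 := by
  have := h.hom 2 (by norm_num) 0
  rw [smul_zero, smul_eq_mul] at this
  have h2 : (1 : ℝ) < 2 ^ n := Real.one_lt_rpow (by norm_num) (by linarith [h.two_le])
  nlinarith

theorem ne_zero {y : Euc 4} (hy : ℓ y ≠ 0) : y ≠ 0 := by
  rintro rfl; exact hy h.map_zero

/-- Euler's identity for the derivative, which has degree `n - 1`. Consequently the complement of
`y` with respect to the Hessian is the kernel of the differential of `ℓ`, which is what links
critical points along lines to the signature. -/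
theorem hess_self {y : Euc 4} (hy : y ≠ 0) (v : Euc 4) :
    hess ℓ y y v = (n - 1) / 2 * fderiv ℝ ℓ y v := by
  have hd : DifferentiableAt ℝ (fderiv ℝ ℓ) y :=
    ((h.contDiffAt hy).fderiv_right (m := 1) (by norm_cast)).differentiableAt one_ne_zero
  have := fderiv_apply_self_of_homogeneous hd fun c hc => fderiv_homogeneous h.hom hc y
  simp only [hess, smul_apply, this, smul_eq_mul]
  ring

theorem hess_self_self {y : Euc 4} (hy : y ≠ 0) : hess ℓ y y y = n * (n - 1) / 2 * ℓ y := by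
  rw [h.hess_self hy, fderiv_apply_self_of_homogeneous
    ((h.contDiffAt hy).differentiableAt (by simp)) (fun c hc => h.hom c hc y), smul_eq_mul]
  ring

theorem hess_smul {c : ℝ} (hc : 0 < c) (y : Euc 4) : hess ℓ (c • y) = c ^ (n - 2) • hess ℓ y := by
  have := fderiv_homogeneous (f := fderiv ℝ ℓ) (k := n - 1)
    (fun c hc => fderiv_homogeneous h.hom hc) hc y
  rw [hess, hess, this, smul_comm, show n - 1 - 1 = n - 2 by ring]

end IsHomogeneous

/-- The cone on which `ℓ` does not vanish and has Hessian of signature `(ε, -ε, -ε, -ε)`. -/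
def timelikeCone (ℓ : Euc 4 → ℝ) : Set (Euc 4) :=
  {y | ℓ y ≠ 0 ∧ HasLorentzSignature (hess ℓ y) (ℓ y / |ℓ y|)}

theorem div_abs_mul_self {a : ℝ} (ha : a ≠ 0) : a / |a| * (a / |a|) = 1 := by
  have : |a| ≠ 0 := abs_ne_zero.2 ha
  field_simp
  rw [sq_abs]

theorem HasLorentzSignature.of_smul {B : Bil} {ε : ℝ} (hε : ε * ε = 1)
    (h : HasLorentzSignature (ε • B) 1) : HasLorentzSignature B ε := by
  obtain ⟨b, hb⟩ := h
  refine ⟨b, fun i j => ?_⟩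
  have := hb i j
  simp only [smul_apply, smul_eq_mul] at this
  linear_combination ε * this - (B (b i) (b j)) * hε

/-! ### Geometry of the timelike cone, and the Finsler function of a homogeneous function -/

namespace IsHomogeneous

variable {ℓ : Euc 4 → ℝ} {n : ℝ} (h : IsHomogeneous ℓ n)
include h

/-- By Euler's identity the Hessian of `ℓ`, multiplied by the sign of `ℓ y`, has the positive value
`n(n-1)/2 · |ℓ y|` on `y`. So the signature condition amounts to `y` itself being timelike, and the
latter condition is open. -/
theorem mem_timelikeCone_iff {y : Euc 4} :
    y ∈ timelikeCone ℓ ↔ ℓ y ≠ 0 ∧ IsTimelike ((ℓ y / |ℓ y|) • hess ℓ y) y := by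
  refine and_congr_right fun h0 => ⟨fun hs => ?_, fun hs => ?_⟩
  · refine (hs.smul (div_abs_mul_self h0)).isTimelike ?_
    have hn := h.two_le
    rw [smul_apply, smul_apply, h.hess_self_self (h.ne_zero h0), smul_eq_mul]
    have : ℓ y / |ℓ y| * (n * (n - 1) / 2 * ℓ y) = n * (n - 1) / 2 * |ℓ y| := by
      have : |ℓ y| ≠ 0 := abs_ne_zero.2 h0
      field_simp
      rw [sq_abs]
    rw [this]
    have : 0 < |ℓ y| := abs_pos.2 h0
    have : 0 < n - 1 := by linarith
    positivity
  · refine (hs.hasLorentzSignature fun u v => ?_).of_smul (div_abs_mul_self h0)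
    simp [hess_symm (h.contDiffAt (h.ne_zero h0)) u v]

theorem smul_mem_timelikeCone {y : Euc 4} (hy : y ∈ timelikeCone ℓ) {c : ℝ} (hc : 0 < c) :
    c • y ∈ timelikeCone ℓ := by
  rw [h.mem_timelikeCone_iff] at hy ⊢
  have hcn : 0 < c ^ n := by positivity
  have hs : ℓ (c • y) / |ℓ (c • y)| = ℓ y / |ℓ y| := by
    rw [h.hom c hc, smul_eq_mul, abs_mul, abs_of_pos hcn, mul_div_mul_left _ _ hcn.ne']
  refine ⟨by simp [h.hom c hc, hcn.ne', hy.1], ?_⟩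
  rw [hs, h.hess_smul hc, smul_comm]
  exact hy.2.smul (by positivity) hc.ne'

/-- Along a segment in the timelike cone `|ℓ|` attains its minimum at an end point. -/
theorem min_le_of_segment (hcont : Continuous ℓ) {a v : Euc 4}
    (hseg : ∀ t ∈ Set.Icc (0 : ℝ) 1, a + t • v ∈ timelikeCone ℓ) {t : ℝ} (ht : t ∈ Set.Icc (0 : ℝ) 1) :
    min |ℓ a| |ℓ (a + v)| ≤ |ℓ (a + t • v)| := by
  by_cases hv : v = 0
  · simp [hv]
  have hγ : Continuous fun t : ℝ => a + t • v := by fun_prop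
  obtain ⟨t₀, ht₀, hmin⟩ := isCompact_Icc.exists_isMinOn (Set.nonempty_Icc.2 zero_le_one)
    (hcont.comp hγ).abs.continuousOn (s := Set.Icc (0 : ℝ) 1)
  refine le_trans ?_ (hmin ht)
  rcases eq_or_lt_of_le ht₀.1 with h0 | h0
  · simp [← h0]
  rcases eq_or_lt_of_le ht₀.2 with h1 | h1
  · simp [h1]
  exfalso
  have hy := h.mem_timelikeCone_iff.1 (hseg t₀ ht₀)
  set y := a + t₀ • v with hydef
  set ε := ℓ y / |ℓ y| with hε
  have hy0 : y ≠ 0 := h.ne_zero hy.1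
  -- The sign of `ℓ` is frozen at the interior minimum, so that `f` is smooth nearby and agrees with
  -- the absolute value where it is positive.
  set f : ℝ → ℝ := fun t => ε * ℓ (a + t • v) with hf
  have hεy : ε * ℓ y = |ℓ y| := by
    have : |ℓ y| ≠ 0 := abs_ne_zero.2 hy.1
    rw [hε]; field_simp; rw [sq_abs]
  have hpos : ∀ᶠ t in 𝓝 t₀, 0 < f t := by
    have : ContinuousAt f t₀ := by fun_prop
    refine this.eventually (lt_mem_nhds ?_)
    change 0 < ε * ℓ y
    rw [hεy]; exact abs_pos.2 hy.1
  have hε1 : |ε| = 1 := by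
    rw [hε, abs_div, abs_abs, div_self (abs_ne_zero.2 hy.1)]
  have hmin' : IsLocalMin f t₀ := by
    filter_upwards [hpos, Ioo_mem_nhds h0 h1] with t ht ht'
    have h2 := hmin ⟨ht'.1.le, ht'.2.le⟩
    simp only [Set.mem_ofPred_eq, Function.comp] at h2
    have h3 : f t = |ℓ (a + t • v)| := by
      rw [← abs_of_pos ht, hf, abs_mul, hε1, one_mul]
    rw [h3]
    change ε * ℓ y ≤ _
    rw [hεy]; exact h2
  have hne : ∀ᶠ t in 𝓝 t₀, a + t • v ≠ 0 := hγ.continuousAt.eventually_ne hy0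
  have hd1 : ∀ᶠ t in 𝓝 t₀, deriv f t = ε * fderiv ℝ ℓ (a + t • v) v := by
    filter_upwards [hne] with t ht
    have e1 : HasDerivAt (fun t : ℝ => a + t • v) v t := by
      simpa using ((hasDerivAt_id t).smul_const v).const_add a
    exact ((((h.contDiffAt ht).differentiableAt (by simp)).hasFDerivAt.comp_hasDerivAt t e1).const_mul
      ε).deriv
  have hd2 : deriv (deriv f) t₀ = ε * fderiv ℝ (fderiv ℝ ℓ) y v v := by
    rw [Filter.EventuallyEq.deriv_eq hd1]
    have e1 : HasDerivAt (fun t : ℝ => a + t • v) v t₀ := by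
      simpa using ((hasDerivAt_id t₀).smul_const v).const_add a
    have e2 : DifferentiableAt ℝ (fderiv ℝ ℓ) y :=
      ((h.contDiffAt hy0).fderiv_right (m := 1) (by norm_cast)).differentiableAt one_ne_zero
    have e3 := e2.hasFDerivAt.comp_hasDerivAt t₀ e1
    have e4 := (e3.clm_apply (hasDerivAt_const t₀ v)).const_mul ε
    simpa using e4.deriv
  have h0 : deriv f t₀ = 0 := hmin'.deriv_eq_zero
  -- At a critical point `v` is annihilated by the differential, hence orthogonal to the timelike
  -- vector `y`, and the Hessian is negative on it.
  have hneg : deriv (deriv f) t₀ < 0 := by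
    have e0 : ε * fderiv ℝ ℓ y v = 0 := by rw [← h0]; exact hd1.self_of_nhds.symm
    have e1 := hy.2.neg v hv (by
      rw [smul_apply, smul_apply, h.hess_self hy0, smul_eq_mul]
      linear_combination (n - 1) / 2 * e0)
    rw [hd2]
    simp only [hess, smul_apply, smul_eq_mul] at e1
    linarith
  -- The point is then a local maximum as well as a local minimum, so `f` is locally constant and
  -- its second derivative vanishes, a contradiction.
  have hmax : IsLocalMax f t₀ := isLocalMax_of_deriv_deriv_neg hneg h0 (by fun_prop)
  have hconst : f =ᶠ[𝓝 t₀] fun _ => f t₀ := by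
    filter_upwards [hmin', hmax] with t h1 h2 using le_antisymm h2 h1
  have : deriv (deriv f) t₀ = 0 := by
    rw [hconst.deriv.deriv_eq]; simp
  linarith

/-- A closed connected set of unit timelike vectors that spans an open cone does not contain
opposite vectors. -/
theorem neg_notMem (hcont : Continuous ℓ) {F : Euc 4 → ℝ}
    (hF : ∀ y, F y = |ℓ y| ^ (1 / n)) {S : Set (Euc 4)} (hS : IsPreconnected S)
    (hclosed : IsClosed S) (hsub : S ⊆ timelikeCone ℓ) (hone : ∀ y ∈ S, |ℓ y| = 1)
    (hopen : IsOpen {y | ℓ y ≠ 0 ∧ (F y)⁻¹ • y ∈ S}) {y : Euc 4} (hy : y ∈ S) : -y ∉ S := by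
  intro hy'
  have hn : 0 < n := by linarith [h.two_le]
  set K := {y | ℓ y ≠ 0 ∧ (F y)⁻¹ • y ∈ S} with hK
  have hFc : Continuous F := by
    rw [funext hF]
    exact hcont.abs.rpow_const fun _ => Or.inr (by positivity)
  have hFpos : ∀ y, ℓ y ≠ 0 → 0 < F y := fun y h0 => by
    rw [hF]; exact Real.rpow_pos_of_pos (abs_pos.2 h0) _
  have hKsub : K ⊆ timelikeCone ℓ := fun z hz => by
    have := h.smul_mem_timelikeCone (hsub hz.2) (hFpos z hz.1)
    rwa [smul_smul, mul_inv_cancel₀ (hFpos z hz.1).ne', one_smul] at this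
  have hSK : S ⊆ K := fun z hz => by
    have h1 : F z = 1 := by rw [hF, hone z hz, Real.one_rpow]
    exact ⟨(hsub hz).1, by rwa [h1, inv_one, one_smul]⟩
  -- The points visible from `y` inside the open cone. This set is open and is relatively closed in
  -- `S`, hence contains `S`.
  set U : Set (Euc 4) := {z | ∀ t ∈ Set.Icc (0 : ℝ) 1, y + t • (z - y) ∈ K} with hU
  have hUopen : IsOpen U := by
    rw [isOpen_iff_mem_nhds]
    intro z hz
    apply isCompact_Icc.eventually_forall_of_forall_eventually
    intro t ht
    have : Continuous fun p : Euc 4 × ℝ => y + p.2 • (p.1 - y) := by fun_prop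
    exact this.continuousAt.eventually (hopen.mem_nhds (hz t ht))
  have hyU : y ∈ U := fun t _ => by simpa using hSK hy
  -- A limit of segments in the cone could only leave it where `ℓ` vanishes. This is excluded by the
  -- minimum principle: near a point of `S` one has `|ℓ| > 1/2`, so `|ℓ| ≥ 1/2` along the
  -- approximating segments and also in the limit, where the normalized points converge in the
  -- closed set `S`.
  have hclU : closure U ∩ S ⊆ U := by
    rintro z ⟨hzc, hzS⟩ t ht
    have hc : Continuous fun w : Euc 4 => y + t • (w - y) := by fun_prop
    have hev : ∀ᶠ w in 𝓝 z, 1 / 2 < |ℓ w| := by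
      refine hcont.abs.continuousAt.eventually (lt_mem_nhds ?_)
      simp only [hone z hzS]; norm_num
    have hfr : ∃ᶠ w in 𝓝 z, y + t • (w - y) ∈ K ∧ 1 / 2 ≤ |ℓ (y + t • (w - y))| := by
      refine ((mem_closure_iff_frequently.1 hzc).and_eventually hev).mono ?_
      rintro w ⟨hw, hw2⟩
      refine ⟨hw t ht, le_trans ?_ (h.min_le_of_segment hcont (fun s hs => hKsub (hw s hs)) ht)⟩
      rw [hone y hy, add_sub_cancel]
      exact le_min (by norm_num) hw2.le
    set z' := y + t • (z - y) with hz'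
    have hfr' : ∃ᶠ w in 𝓝 z', w ∈ K ∧ 1 / 2 ≤ |ℓ w| := hc.continuousAt.frequently hfr
    have hl : 1 / 2 ≤ |ℓ z'| :=
      (isClosed_le continuous_const hcont.abs).mem_of_frequently_of_tendsto
        (hfr'.mono fun _ hw => hw.2) Filter.tendsto_id
    have h0 : ℓ z' ≠ 0 := fun h0 => by rw [h0] at hl; norm_num at hl
    refine ⟨h0, ?_⟩
    have hct : ContinuousAt (fun w => (F w)⁻¹ • w) z' :=
      (hFc.continuousAt.inv₀ (hFpos z' h0).ne').smul continuousAt_id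
    exact hclosed.mem_of_frequently_of_tendsto (hfr'.mono fun _ hw => hw.1.2) hct
  -- The segment from `y` to `-y` has the origin as its midpoint, and `ℓ` vanishes there.
  have := hS.subset_of_closure_inter_subset hUopen ⟨y, hy, hyU⟩ hclU hy' (1 / 2) (by norm_num)
  have e : y + (1 / 2 : ℝ) • (-y - y) = 0 := by module
  rw [e] at this
  exact this.1 h.map_zero

theorem finsler_smul {F : Euc 4 → ℝ} (hF : ∀ y, F y = |ℓ y| ^ (1 / n)) {c : ℝ} (hc : 0 < c)
    (y : Euc 4) : F (c • y) = c * F y := by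
  have hn : n ≠ 0 := by linarith [h.two_le]
  have hcn : 0 < c ^ n := by positivity
  rw [hF, hF, h.hom c hc, smul_eq_mul, abs_mul, abs_of_pos hcn,
    Real.mul_rpow hcn.le (abs_nonneg _), ← Real.rpow_mul hc.le, mul_one_div_cancel hn, Real.rpow_one]

/-- Where `ℓ` does not vanish its sign is locally constant, so the absolute value in `F` can be
replaced by multiplication with this sign and `F` becomes a power of a positive smooth function. -/
theorem finsler_eventuallyEq {F : Euc 4 → ℝ} (hF : ∀ y, F y = |ℓ y| ^ (1 / n)) {y : Euc 4}
    (hy : ℓ y ≠ 0) : (∀ᶠ z in 𝓝 y, 0 < (ℓ y / |ℓ y|) * ℓ z) ∧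
      F =ᶠ[𝓝 y] fun z => ((ℓ y / |ℓ y|) * ℓ z) ^ (1 / n) := by
  have h1 : ∀ᶠ z in 𝓝 y, 0 < (ℓ y / |ℓ y|) * ℓ z := by
    have : ContinuousAt (fun z => (ℓ y / |ℓ y|) * ℓ z) y :=
      continuousAt_const.mul (h.contDiffAt (h.ne_zero hy)).continuousAt
    refine this.eventually (lt_mem_nhds ?_)
    have : 0 < |ℓ y| := abs_pos.2 hy
    have : ℓ y / |ℓ y| * ℓ y = |ℓ y| := by
      field_simp; rw [sq_abs]
    change 0 < ℓ y / |ℓ y| * ℓ y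
    rwa [this]
  refine ⟨h1, ?_⟩
  filter_upwards [h1] with z hz
  have h2 : abs (ℓ y / |ℓ y|) = 1 := by
    rw [abs_div, abs_abs, div_self (abs_ne_zero.2 hy)]
  rw [hF, ← abs_of_pos hz, abs_mul, h2, one_mul]

theorem contDiffAt_finsler {F : Euc 4 → ℝ} (hF : ∀ y, F y = |ℓ y| ^ (1 / n)) {y : Euc 4}
    (hy : ℓ y ≠ 0) : ContDiffAt ℝ ∞ F y := by
  obtain ⟨h1, h2⟩ := h.finsler_eventuallyEq hF hy
  exact ((contDiffAt_const.mul (h.contDiffAt (h.ne_zero hy))).rpow_const_of_ne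
    h1.self_of_nhds.ne').congr_of_eventuallyEq h2

theorem hess_finsler_self {F : Euc 4 → ℝ} (hF : ∀ y, F y = |ℓ y| ^ (1 / n)) {y : Euc 4}
    (hy : ℓ y ≠ 0) (v : Euc 4) :
    hess (fun z => F z ^ 2) y y v = 1 / 2 * fderiv ℝ (fun z => F z ^ 2) y v := by
  have hom : ∀ c : ℝ, 0 < c → ∀ y, F (c • y) ^ 2 = c ^ (2 : ℝ) • F y ^ 2 := fun c hc y => by
    rw [h.finsler_smul hF hc, smul_eq_mul, mul_pow]; norm_num
  have hd : DifferentiableAt ℝ (fderiv ℝ fun z => F z ^ 2) y :=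
    (((h.contDiffAt_finsler hF hy).pow 2).fderiv_right (m := 1)
      (by norm_cast)).differentiableAt one_ne_zero
  have := fderiv_apply_self_of_homogeneous hd fun c hc => fderiv_homogeneous hom hc y
  simp only [hess, smul_apply, this, smul_eq_mul]
  ring

theorem hess_finsler_self_self {F : Euc 4 → ℝ} (hF : ∀ y, F y = |ℓ y| ^ (1 / n)) {y : Euc 4}
    (hy : ℓ y ≠ 0) : hess (fun z => F z ^ 2) y y y = F y ^ 2 := by
  have hom : ∀ c : ℝ, 0 < c → F (c • y) ^ 2 = c ^ (2 : ℝ) • F y ^ 2 := fun c hc => by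
    rw [h.finsler_smul hF hc, smul_eq_mul, mul_pow]; norm_num
  rw [h.hess_finsler_self hF hy, fderiv_apply_self_of_homogeneous
    (((h.contDiffAt_finsler hF hy).pow 2).differentiableAt (by simp)) hom, smul_eq_mul]
  ring

/-- Locally `F² = (εℓ)^(2/n)`, so the differentials of `F²` and `ℓ` have the same kernel. On this
kernel the term with the square of `dℓ` drops out, and the Hessian of `F²` is a positive multiple of
that of `εℓ`. On `y` it is `F²` by Euler's identity. -/
theorem isTimelike_finsler {F : Euc 4 → ℝ} (hF : ∀ y, F y = |ℓ y| ^ (1 / n)) {y : Euc 4}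
    (hy : y ∈ timelikeCone ℓ) : IsTimelike (hess (fun z => F z ^ 2) y) y := by
  obtain ⟨h0, ht⟩ := h.mem_timelikeCone_iff.1 hy
  have hn : 0 < n := by linarith [h.two_le]
  obtain ⟨h1, h2⟩ := h.finsler_eventuallyEq hF h0
  set ε := ℓ y / |ℓ y| with hε
  have hy0 := h.ne_zero h0
  set m : ℝ := 2 / n with hm
  have hm0 : 0 < m := by positivity
  have hQ : (fun z => F z ^ 2) =ᶠ[𝓝 y] fun z => (ε * ℓ z) ^ m := by
    filter_upwards [h1, h2] with z hz1 hz2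
    rw [hz2, ← Real.rpow_natCast, ← Real.rpow_mul hz1.le, hm]
    congr 1; push_cast; ring
  have hne : ∀ᶠ z in 𝓝 y, z ≠ 0 := isOpen_compl_singleton.mem_nhds hy0
  have hD : fderiv ℝ (fun z => F z ^ 2) =ᶠ[𝓝 y]
      fun z => (m * (ε * ℓ z) ^ (m - 1) * ε) • fderiv ℝ ℓ z := by
    refine (Filter.EventuallyEq.fderiv hQ).trans ?_
    filter_upwards [h1, hne] with z hz1 hz2
    have := (((h.contDiffAt hz2).differentiableAt (by simp)).hasFDerivAt.const_mul ε).rpow_const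
      (p := m) (Or.inl hz1.ne')
    rw [this.fderiv, smul_smul, mul_assoc]
  set c : Euc 4 → ℝ := fun z => m * (ε * ℓ z) ^ (m - 1) * ε with hc
  have hcd : DifferentiableAt ℝ c y := by
    have : ContDiffAt ℝ ∞ c y := (contDiffAt_const.mul ((contDiffAt_const.mul
      (h.contDiffAt hy0)).rpow_const_of_ne h1.self_of_nhds.ne')).mul contDiffAt_const
    exact this.differentiableAt (by simp)
  have hd : DifferentiableAt ℝ (fderiv ℝ ℓ) y :=
    ((h.contDiffAt hy0).fderiv_right (m := 1) (by norm_cast)).differentiableAt one_ne_zero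
  have hpos : 0 < m * (ε * ℓ y) ^ (m - 1) := mul_pos hm0 (Real.rpow_pos_of_pos h1.self_of_nhds _)
  have hε0 : ε ≠ 0 := by rintro h; simpa [h] using h1.self_of_nhds
  refine ⟨?_, fun v hv hyv => ?_⟩
  · rw [h.hess_finsler_self_self hF h0, hF]
    have : 0 < |ℓ y| ^ (1 / n) := Real.rpow_pos_of_pos (abs_pos.2 h0) _
    positivity
  · rw [h.hess_finsler_self hF h0, hD.self_of_nhds, smul_apply, smul_eq_mul] at hyv
    have hv0 : fderiv ℝ ℓ y v = 0 := by
      have : c y ≠ 0 := mul_ne_zero hpos.ne' hε0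
      exact (mul_eq_zero.1 (by linarith : c y * fderiv ℝ ℓ y v = 0)).resolve_left this
    have hneg := ht.neg v hv (by simp [h.hess_self hy0, hv0])
    have : hess (fun z => F z ^ 2) y v v = m * (ε * ℓ y) ^ (m - 1) * (ε • hess ℓ y) v v := by
      rw [hess, hD.fderiv_eq, fderiv_fun_smul hcd hd]
      simp only [hess, smul_apply, add_apply, ContinuousLinearMap.smulRight_apply, hv0, smul_eq_mul, hc]
      ring
    rw [this]
    exact mul_neg_of_pos_of_neg hpos hneg

end IsHomogeneous

/-! ### Induced coordinates on the tangent bundle -/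

section InducedCoordinates

variable {M : Type*} [TopologicalSpace M] [ChartedSpace (Euc 4) M]

/-- The coordinates on `TM` induced by a chart of `M`. -/
def tcoord (φ : OpenPartialHomeomorph M (Euc 4)) (v : TangentBundle (𝓡 4) M) : Euc 4 × Euc 4 :=
  (φ v.proj, mfderiv (𝓡 4) (𝓡 4) φ v.proj v.snd)

/-- The point of `TM` with given induced coordinates. -/
def tpoint (φ : OpenPartialHomeomorph M (Euc 4)) (z : Euc 4 × Euc 4) : TangentBundle (𝓡 4) M :=
  ⟨φ.symm z.1, mfderiv (𝓡 4) (𝓡 4) φ.symm z.1 z.2⟩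

variable [IsManifold (𝓡 4) ∞ M] {φ φ' : OpenPartialHomeomorph M (Euc 4)}

theorem mdifferentiable_of_mem_maximalAtlas (hφ : φ ∈ IsManifold.maximalAtlas (𝓡 4) ∞ M) :
    φ.MDifferentiable (𝓡 4) (𝓡 4) :=
  ⟨(contMDiffOn_of_mem_maximalAtlas hφ).mdifferentiableOn (by simp),
    (contMDiffOn_symm_of_mem_maximalAtlas hφ).mdifferentiableOn (by simp)⟩

theorem chartAt_mem_maximalAtlas (x : M) :
    chartAt (Euc 4) x ∈ IsManifold.maximalAtlas (𝓡 4) ∞ M :=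
  IsManifold.chart_mem_maximalAtlas x

theorem tcoord_tpoint (hφ : φ ∈ IsManifold.maximalAtlas (𝓡 4) ∞ M) {z : Euc 4 × Euc 4}
    (hz : z.1 ∈ φ.target) : tcoord φ (tpoint φ z) = z := by
  have := (mdifferentiable_of_mem_maximalAtlas hφ).comp_symm_deriv hz
  refine Prod.ext (φ.right_inv hz) ?_
  exact congrArg (fun A => A z.2) this

theorem tpoint_tcoord (hφ : φ ∈ IsManifold.maximalAtlas (𝓡 4) ∞ M) {v : TangentBundle (𝓡 4) M}
    (hv : v.proj ∈ φ.source) : tpoint φ (tcoord φ v) = v := by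
  obtain ⟨x, y⟩ := v
  have hx : x ∈ φ.source := hv
  have h1 := (mdifferentiable_of_mem_maximalAtlas hφ).symm_comp_deriv hx
  have h2 : mfderiv (𝓡 4) (𝓡 4) φ.symm (φ x) (mfderiv (𝓡 4) (𝓡 4) φ x y) = y :=
    congrArg (fun A => A y) h1
  simp only [tpoint, tcoord]
  exact Bundle.TotalSpace.ext (φ.left_inv hx) (heq_of_eq h2)

theorem contMDiffOn_tcoord (hφ : φ ∈ IsManifold.maximalAtlas (𝓡 4) ∞ M) :
    ContMDiffOn (𝓡 4).tangent 𝓘(ℝ, Euc 4 × Euc 4) ∞ (tcoord φ)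
      {v : TangentBundle (𝓡 4) M | v.proj ∈ φ.source} := by
  have h1 := (contMDiffOn_of_mem_maximalAtlas hφ).contMDiffOn_tangentMapWithin (m := ∞)
    (by simp) φ.open_source.uniqueMDiffOn
  have h2 : ContMDiffOn (𝓡 4).tangent (𝓡 4).tangent ∞ (tangentMap (𝓡 4) (𝓡 4) φ)
      {v : TangentBundle (𝓡 4) M | v.proj ∈ φ.source} := by
    refine h1.congr fun v hv => ?_
    exact (tangentMapWithin_eq_tangentMap (φ.open_source.uniqueMDiffOn _ hv)
      ((mdifferentiable_of_mem_maximalAtlas hφ).mdifferentiableAt hv)).symm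
  have h3 : ContMDiffOn (𝓡 4).tangent (𝓡 4) ∞ (fun v : TangentBundle (𝓡 4) M => φ v.proj)
      {v : TangentBundle (𝓡 4) M | v.proj ∈ φ.source} :=
    (contMDiffOn_of_mem_maximalAtlas hφ).comp
      (Bundle.contMDiff_proj (TangentSpace (𝓡 4))).contMDiffOn fun v hv => hv
  exact h3.prodMk_space ((contMDiff_snd_tangentBundle_modelSpace (Euc 4) (𝓡 4)).comp_contMDiffOn h2)

theorem contMDiffOn_tpoint (hφ : φ ∈ IsManifold.maximalAtlas (𝓡 4) ∞ M) :
    ContMDiffOn 𝓘(ℝ, Euc 4 × Euc 4) (𝓡 4).tangent ∞ (tpoint φ) {z | z.1 ∈ φ.target} := by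
  have h1 := (contMDiffOn_symm_of_mem_maximalAtlas hφ).contMDiffOn_tangentMapWithin (m := ∞)
    (by simp) φ.open_target.uniqueMDiffOn
  have h2 : ContMDiffOn (𝓡 4).tangent (𝓡 4).tangent ∞ (tangentMap (𝓡 4) (𝓡 4) φ.symm)
      {v : TangentBundle (𝓡 4) (Euc 4) | v.proj ∈ φ.target} := by
    refine h1.congr fun v hv => ?_
    exact (tangentMapWithin_eq_tangentMap (φ.open_target.uniqueMDiffOn _ hv)
      ((mdifferentiable_of_mem_maximalAtlas hφ).mdifferentiableAt_symm hv)).symm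
  have h3 : ContMDiff 𝓘(ℝ, Euc 4 × Euc 4) (𝓘(ℝ, Euc 4).prod 𝓘(ℝ, Euc 4)) ∞
      (fun z : Euc 4 × Euc 4 => ((z.1, z.2) : ModelProd (Euc 4) (Euc 4))) :=
    contDiff_fst.contMDiff.prodMk contDiff_snd.contMDiff
  rw [chartedSpaceSelf_prod] at h3
  have h4 := (contMDiff_tangentBundleModelSpaceHomeomorph_symm (I := 𝓡 4) (n := ∞)).comp h3
  exact h2.comp h4.contMDiffOn fun z hz => hz

theorem tcoord_change (hφ : φ ∈ IsManifold.maximalAtlas (𝓡 4) ∞ M)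
    (hφ' : φ' ∈ IsManifold.maximalAtlas (𝓡 4) ∞ M) {v : TangentBundle (𝓡 4) M}
    (hv : v.proj ∈ φ.source) (hv' : v.proj ∈ φ'.source) :
    tcoord φ' v = (φ' (φ.symm (tcoord φ v).1),
      fderiv ℝ (fun x => φ' (φ.symm x)) (tcoord φ v).1 (tcoord φ v).2) := by
  have h1 : (tcoord φ v).1 ∈ φ.target := φ.map_source hv
  have h2 : φ.symm (tcoord φ v).1 = v.proj := φ.left_inv hv
  conv_lhs => rw [← tpoint_tcoord hφ hv]
  have hd' : MDifferentiableAt (𝓡 4) (𝓡 4) φ' (φ.symm (tcoord φ v).1) := by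
    rw [h2]; exact (mdifferentiable_of_mem_maximalAtlas hφ').mdifferentiableAt hv'
  have hd : MDifferentiableAt (𝓡 4) (𝓡 4) φ.symm (tcoord φ v).1 :=
    (mdifferentiable_of_mem_maximalAtlas hφ).mdifferentiableAt_symm h1
  have h3 := mfderiv_comp (tcoord φ v).1 hd' hd
  refine Prod.ext rfl ?_
  rw [← mfderiv_eq_fderiv]
  exact (congrArg (fun A => A (tcoord φ v).2) h3).symm

theorem isOpen_proj_source (φ : OpenPartialHomeomorph M (Euc 4)) :
    IsOpen {v : TangentBundle (𝓡 4) M | v.proj ∈ φ.source} :=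
  φ.open_source.preimage (FiberBundle.continuous_proj (Euc 4) (TangentSpace (𝓡 4)))

theorem isOpen_fst_target (φ : OpenPartialHomeomorph M (Euc 4)) :
    IsOpen {z : Euc 4 × Euc 4 | z.1 ∈ φ.target} := φ.open_target.preimage continuous_fst

theorem tpoint_proj_mem {z : Euc 4 × Euc 4} (hz : z.1 ∈ φ.target) :
    (tpoint φ z).proj ∈ φ.source := φ.map_target hz

theorem tcoord_fst_mem {v : TangentBundle (𝓡 4) M} (hv : v.proj ∈ φ.source) :
    (tcoord φ v).1 ∈ φ.target := φ.map_source hv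

/-- The derivative of the inverse of a chart, as an isomorphism. -/
def chartEquiv (hφ : φ ∈ IsManifold.maximalAtlas (𝓡 4) ∞ M) {x : Euc 4} (hx : x ∈ φ.target) :
    Euc 4 ≃L[ℝ] Euc 4 :=
  (mdifferentiable_of_mem_maximalAtlas hφ).symm.mfderiv hx

theorem chartEquiv_apply (hφ : φ ∈ IsManifold.maximalAtlas (𝓡 4) ∞ M) {x : Euc 4}
    (hx : x ∈ φ.target) (y : Euc 4) :
    (⟨φ.symm x, chartEquiv hφ hx y⟩ : TangentBundle (𝓡 4) M) = tpoint φ (x, y) := rfl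

/-- A change of induced coordinates is linear on each fibre, so Hessians along the fibre are pulled
back by the linear map without correction terms. -/
theorem fiberHessian_tpoint (f : TangentBundle (𝓡 4) M → ℝ)
    (hφ : φ ∈ IsManifold.maximalAtlas (𝓡 4) ∞ M) {z : Euc 4 × Euc 4} (hz : z.1 ∈ φ.target)
    (u v : Euc 4) :
    fiberHessian f (tpoint φ z) (chartEquiv hφ hz u) (chartEquiv hφ hz v) =
      hess (fun y => f (tpoint φ (z.1, y))) z.2 u v :=
  (hess_comp_linear (fun y => f ⟨φ.symm z.1, y⟩) (chartEquiv hφ hz) z.2 u v).symm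

theorem contMDiff_fiber_inclusion (x : M) :
    ContMDiff 𝓘(ℝ, Euc 4) (𝓡 4).tangent ∞
      (fun y : Euc 4 => (⟨x, y⟩ : TangentBundle (𝓡 4) M)) := by
  have hφ := chartAt_mem_maximalAtlas (M := M) x
  set φ := chartAt (Euc 4) x
  have hx : x ∈ φ.source := mem_chart_source _ x
  have hx' : φ x ∈ φ.target := φ.map_source hx
  have h1 : (fun y : Euc 4 => (⟨x, y⟩ : TangentBundle (𝓡 4) M)) =
      fun y => tpoint φ (φ x, (chartEquiv hφ hx').symm y) := by
    funext y
    rw [← chartEquiv_apply hφ hx', ContinuousLinearEquiv.apply_symm_apply]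
    exact Bundle.TotalSpace.ext (φ.left_inv hx).symm HEq.rfl
  rw [h1]
  have h2 : ContDiff ℝ ∞ fun y => (φ x, (chartEquiv hφ hx').symm y) :=
    contDiff_const.prodMk (chartEquiv hφ hx').symm.contDiff
  rw [← contMDiffOn_univ]
  exact (contMDiffOn_tpoint hφ).comp h2.contMDiff.contMDiffOn fun y _ => hx'

end InducedCoordinates

theorem mem_timelikeCone_comp (ℓ : Euc 4 → ℝ) (T : Euc 4 ≃L[ℝ] Euc 4) (y : Euc 4) :
    y ∈ timelikeCone (fun y => ℓ (T y)) ↔ T y ∈ timelikeCone ℓ := by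
  refine and_congr_right fun _ => ⟨?_, ?_⟩
  · rintro ⟨b, hb⟩
    refine ⟨b.map T.toLinearEquiv, fun i j => ?_⟩
    rw [← hb, hess_comp_linear]; simp
  · rintro ⟨b, hb⟩
    refine ⟨b.map T.symm.toLinearEquiv, fun i j => ?_⟩
    rw [← hb, hess_comp_linear]; simp

theorem hess_eq_fderiv {Q : Euc 4 × Euc 4 → ℝ} {z : Euc 4 × Euc 4} (hQ : ContDiffAt ℝ ∞ Q z)
    (u v : Euc 4) : hess (fun y => Q (z.1, y)) z.2 u v =
      1 / 2 * fderiv ℝ (fderiv ℝ Q) z (0, u) (0, v) := by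
  have hQ' : ∀ᶠ w in 𝓝 z, DifferentiableAt ℝ Q w :=
    ((hQ.of_le (by norm_cast : (1 : ℕ∞ω) ≤ ∞)).eventually (by simp)).mono
      fun w hw => hw.differentiableAt one_ne_zero
  have hc : ContinuousAt (fun y : Euc 4 => (z.1, y)) z.2 := by fun_prop
  have hi : ∀ y : Euc 4, HasFDerivAt (fun y : Euc 4 => (z.1, y))
      (ContinuousLinearMap.inr ℝ (Euc 4) (Euc 4)) y := fun y => hasFDerivAt_prodMk_right z.1 y
  have h1 : fderiv ℝ (fun y => Q (z.1, y)) =ᶠ[𝓝 z.2]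
      fun y => (fderiv ℝ Q (z.1, y)).comp (ContinuousLinearMap.inr ℝ (Euc 4) (Euc 4)) := by
    filter_upwards [hc.eventually hQ'] with y hy
    exact (hy.hasFDerivAt.comp y (hi y)).fderiv
  have hd : DifferentiableAt ℝ (fderiv ℝ Q) (z.1, z.2) :=
    (hQ.fderiv_right (m := 1) (by norm_cast)).differentiableAt one_ne_zero
  have h2 := (hd.hasFDerivAt.comp z.2 (hi z.2)).clm_comp
    (hasFDerivAt_const (ContinuousLinearMap.inr ℝ (Euc 4) (Euc 4)) z.2)
  rw [hess, h1.fderiv_eq, smul_apply, smul_apply, smul_eq_mul]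
  congr 1
  refine (congrArg (fun A : Bil => A u v) h2.fderiv).trans ?_
  simp

/-- Half of the Hessian of `Q` in the second variable. -/
def vHess (Q : Euc 4 × Euc 4 → ℝ) (z : Euc 4 × Euc 4) : Bil :=
  (1 / 2 : ℝ) • ((ContinuousLinearMap.compL ℝ (Euc 4) (Euc 4 × Euc 4) ℝ).flip
    (ContinuousLinearMap.inr ℝ (Euc 4) (Euc 4))).comp
      ((fderiv ℝ (fderiv ℝ Q) z).comp (ContinuousLinearMap.inr ℝ (Euc 4) (Euc 4)))

theorem vHess_apply (Q : Euc 4 × Euc 4 → ℝ) (z : Euc 4 × Euc 4) (u v : Euc 4) :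
    vHess Q z u v = 1 / 2 * fderiv ℝ (fderiv ℝ Q) z (0, u) (0, v) := by
  simp [vHess]

theorem hess_eq_vHess {Q : Euc 4 × Euc 4 → ℝ} {z : Euc 4 × Euc 4} (hQ : ContDiffAt ℝ ∞ Q z) :
    hess (fun y => Q (z.1, y)) z.2 = vHess Q z := by
  ext u v
  rw [hess_eq_fderiv hQ, vHess_apply]

theorem vHess_symm {Q : Euc 4 × Euc 4 → ℝ} {z : Euc 4 × Euc 4} (hQ : ContDiffAt ℝ ∞ Q z)
    (u v : Euc 4) : vHess Q z u v = vHess Q z v u := by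
  rw [vHess_apply, vHess_apply, (hQ.isSymmSndFDerivAt (by simp; norm_cast)).eq]

theorem contDiffAt_vHess {Q : Euc 4 × Euc 4 → ℝ} {z : Euc 4 × Euc 4} (hQ : ContDiffAt ℝ ∞ Q z) :
    ContDiffAt ℝ ∞ (vHess Q) z := by
  have h1 : ContDiffAt ℝ ∞ (fderiv ℝ Q) z := hQ.fderiv_right (by simp)
  have h2 : ContDiffAt ℝ ∞ (fderiv ℝ (fderiv ℝ Q)) z := h1.fderiv_right (by simp)
  exact (contDiffAt_const.clm_comp (h2.clm_comp contDiffAt_const)).const_smul (1 / 2 : ℝ)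

/-! ### The cones of timelike vectors -/

section Cones

variable {M : Type*} [TopologicalSpace M] [ChartedSpace (Euc 4) M] [IsManifold (𝓡 4) ∞ M]

theorem IsHomogeneous.comp {ℓ : Euc 4 → ℝ} {n : ℝ} (h : IsHomogeneous ℓ n)
    (T : Euc 4 ≃L[ℝ] Euc 4) : IsHomogeneous (fun y => ℓ (T y)) n where
  two_le := h.two_le
  smooth := h.smooth.comp T.contDiff.contDiffOn fun y hy => by simpa using hy
  hom c hc y := by rw [map_smul, h.hom c hc]

namespace FinslerSpacetime

variable (FS : FinslerSpacetime M)

theorem isHomogeneous (x : M) : IsHomogeneous (fun y : Euc 4 => FS.L ⟨x, y⟩) FS.degree where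
  two_le := FS.two_le_degree
  smooth := by
    rw [← contMDiffOn_iff_contDiffOn]
    exact FS.smooth_L.comp (contMDiff_fiber_inclusion x).contMDiffOn fun y hy => hy
  hom c hc y := FS.homogeneous x y c hc

/-- The set of timelike vectors. -/
def cone : Set (TangentBundle (𝓡 4) M) :=
  {v | v.snd ∈ timelikeCone (fun y : Euc 4 => FS.L ⟨v.proj, y⟩)}

variable {φ : OpenPartialHomeomorph M (Euc 4)}

theorem tpoint_mem_cone_iff (hφ : φ ∈ IsManifold.maximalAtlas (𝓡 4) ∞ M) {z : Euc 4 × Euc 4}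
    (hz : z.1 ∈ φ.target) :
    tpoint φ z ∈ FS.cone ↔ z.2 ∈ timelikeCone (fun y => FS.L (tpoint φ (z.1, y))) :=
  (mem_timelikeCone_comp (fun y : Euc 4 => FS.L ⟨φ.symm z.1, y⟩) (chartEquiv hφ hz) z.2).symm

theorem snd_ne_zero {v : TangentBundle (𝓡 4) M} (hv : FS.L v ≠ 0) : v.snd ≠ 0 :=
  (FS.isHomogeneous v.proj).ne_zero hv

theorem isOpen_snd_ne_zero : IsOpen {v : TangentBundle (𝓡 4) M | v.snd ≠ 0} := by
  rw [isOpen_iff_mem_nhds]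
  intro v hv
  have hφ := chartAt_mem_maximalAtlas (M := M) v.proj
  set φ := chartAt (Euc 4) v.proj
  have hx : v.proj ∈ φ.source := mem_chart_source _ _
  have hc := (contMDiffOn_tcoord hφ).continuousOn.continuousAt
    ((isOpen_proj_source φ).mem_nhds hx)
  have h1 : (tcoord φ v).2 ≠ 0 := by
    intro h0
    apply hv
    have := (mdifferentiable_of_mem_maximalAtlas hφ).mfderiv_injective hx
    exact this (h0.trans (_root_.map_zero _).symm)
  have h2 : ∀ᶠ w in 𝓝 v, (tcoord φ w).2 ≠ 0 :=
    (continuous_snd.continuousAt.comp hc).eventually_ne h1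
  filter_upwards [h2] with w hw h0
  apply hw
  change mfderiv (𝓡 4) (𝓡 4) φ w.proj w.snd = 0
  rw [h0]; exact _root_.map_zero _

theorem contMDiffAt_L {v : TangentBundle (𝓡 4) M} (hv : v.snd ≠ 0) :
    ContMDiffAt (𝓡 4).tangent 𝓘(ℝ) ∞ FS.L v :=
  FS.smooth_L.contMDiffAt (isOpen_snd_ne_zero.mem_nhds hv)

theorem contDiffAt_coordL (hφ : φ ∈ IsManifold.maximalAtlas (𝓡 4) ∞ M) {z : Euc 4 × Euc 4}
    (hz : z.1 ∈ φ.target) (hL : FS.L (tpoint φ z) ≠ 0) :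
    ContDiffAt ℝ ∞ (fun z => FS.L (tpoint φ z)) z := by
  rw [← contMDiffAt_iff_contDiffAt]
  exact (FS.contMDiffAt_L (FS.snd_ne_zero hL)).comp z
    ((contMDiffOn_tpoint hφ).contMDiffAt ((isOpen_fst_target φ).mem_nhds hz))

/-- In induced coordinates membership means that `z.2` is timelike for `±vHess`. This form and `z.2`
depend continuously on `z`, and being timelike is an open condition on the pair. -/
theorem isOpen_cone : IsOpen FS.cone := by
  rw [isOpen_iff_mem_nhds]
  intro v hv
  have hφ := chartAt_mem_maximalAtlas (M := M) v.proj
  set φ := chartAt (Euc 4) v.proj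
  have hx : v.proj ∈ φ.source := mem_chart_source _ _
  have hc := (contMDiffOn_tcoord hφ).continuousOn.continuousAt
    ((isOpen_proj_source φ).mem_nhds hx)
  suffices h : ∀ᶠ z in 𝓝 (tcoord φ v), tpoint φ z ∈ FS.cone by
    filter_upwards [hc.eventually h, (isOpen_proj_source φ).mem_nhds hx] with w hw hw'
    rwa [tpoint_tcoord hφ hw'] at hw
  set z₀ := tcoord φ v with hz₀
  have hz₀t : z₀.1 ∈ φ.target := tcoord_fst_mem hx
  have hv' : tpoint φ z₀ ∈ FS.cone := by rwa [hz₀, tpoint_tcoord hφ hx]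
  set f : Euc 4 × Euc 4 → ℝ := fun z => FS.L (tpoint φ z) with hf
  have hom : ∀ z : Euc 4 × Euc 4, z.1 ∈ φ.target →
      IsHomogeneous (fun y => f (z.1, y)) FS.degree := fun z hz =>
    (FS.isHomogeneous (φ.symm z.1)).comp (chartEquiv hφ hz)
  have hiff : ∀ z : Euc 4 × Euc 4, z.1 ∈ φ.target → f z ≠ 0 →
      (tpoint φ z ∈ FS.cone ↔ IsTimelike ((f z / |f z|) • vHess f z) z.2) := fun z hz h0 => by
    rw [FS.tpoint_mem_cone_iff hφ hz, (hom z hz).mem_timelikeCone_iff,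
      hess_eq_vHess (FS.contDiffAt_coordL hφ hz h0)]
    exact and_iff_right h0
  have h0 : f z₀ ≠ 0 := hv'.1
  have hd := FS.contDiffAt_coordL hφ hz₀t h0
  have ht := (hiff z₀ hz₀t h0).1 hv'
  have hcont : ContinuousAt (fun z => ((f z / |f z|) • vHess f z, z.2)) z₀ :=
    ((hd.continuousAt.div hd.continuousAt.abs (abs_ne_zero.2 h0)).smul
      (contDiffAt_vHess hd).continuousAt).prodMk continuousAt_snd
  have hev := ht.eventually fun u w => by
    rw [smul_apply, smul_apply, smul_apply, smul_apply, vHess_symm hd u w]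
  filter_upwards [hcont.eventually hev, hd.continuousAt.eventually_ne h0,
    (isOpen_fst_target φ).mem_nhds hz₀t] with z h1 h2 h3
  exact (hiff z h3 h2).2 h1

theorem mem_unitTimelike_iff {x : M} {y : TangentSpace (𝓡 4) x} :
    y ∈ unitTimelike FS.L x ↔
      |FS.L ⟨x, y⟩| = 1 ∧ (⟨x, y⟩ : TangentBundle (𝓡 4) M) ∈ FS.cone := by
  refine and_congr_right fun h => ?_
  exact ⟨fun h2 => ⟨fun h0 => by simp [h0] at h, h2⟩, fun h2 => h2.2⟩

theorem F_pos {v : TangentBundle (𝓡 4) M} (hv : FS.L v ≠ 0) : 0 < FS.F v := by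
  rw [FS.F_eq]; exact Real.rpow_pos_of_pos (abs_pos.2 hv) _

theorem F_smul_pos (x : M) (y : TangentSpace (𝓡 4) x) {c : ℝ} (hc : 0 < c) :
    FS.F ⟨x, c • y⟩ = c * FS.F ⟨x, y⟩ :=
  (FS.isHomogeneous x).finsler_smul (F := fun y => FS.F ⟨x, y⟩) (fun y => FS.F_eq ⟨x, y⟩) hc y

theorem F_smul (x : M) (y : TangentSpace (𝓡 4) x) (c : ℝ) :
    FS.F ⟨x, c • y⟩ = |c| * FS.F ⟨x, y⟩ := by
  have hn : FS.degree ≠ 0 := by linarith [FS.two_le_degree]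
  rcases lt_trichotomy c 0 with hc | rfl | hc
  · have h1 : FS.F ⟨x, -((-c) • y)⟩ = FS.F ⟨x, (-c) • y⟩ := by
      rw [FS.F_eq, FS.F_eq, FS.reversible]
    rw [neg_smul, neg_neg] at h1
    rw [h1, abs_of_neg hc, ← neg_smul, FS.F_smul_pos x y (by linarith)]
  · have : FS.L ⟨x, (0 : ℝ) • y⟩ = 0 := by
      rw [zero_smul]; exact (FS.isHomogeneous x).map_zero
    rw [FS.F_eq, this, abs_zero, zero_mul, Real.zero_rpow (one_div_ne_zero hn)]
  · rw [abs_of_pos hc, FS.F_smul_pos x y hc]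

theorem F_eq_one_iff {v : TangentBundle (𝓡 4) M} : FS.F v = 1 ↔ |FS.L v| = 1 := by
  have hn : FS.degree ≠ 0 := by linarith [FS.two_le_degree]
  rw [FS.F_eq]
  refine ⟨fun h => ?_, fun h => by rw [h, Real.one_rpow]⟩
  have := congrArg (fun t : ℝ => t ^ FS.degree) h
  simpa [← Real.rpow_mul (abs_nonneg _), hn] using this

theorem smul_mem_cone {x : M} {y : TangentSpace (𝓡 4) x} {c : ℝ} (hc : 0 < c)
    (h : (⟨x, y⟩ : TangentBundle (𝓡 4) M) ∈ FS.cone) :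
    (⟨x, c • y⟩ : TangentBundle (𝓡 4) M) ∈ FS.cone :=
  (FS.isHomogeneous x).smul_mem_timelikeCone h hc

theorem contMDiffAt_F {v : TangentBundle (𝓡 4) M} (hv : FS.L v ≠ 0) :
    ContMDiffAt (𝓡 4).tangent 𝓘(ℝ) ∞ FS.F v := by
  have h1 := FS.contMDiffAt_L (FS.snd_ne_zero hv)
  have h2 : ContDiffAt ℝ ∞ (fun t : ℝ => |t| ^ (1 / FS.degree)) (FS.L v) :=
    (contDiffAt_abs hv).rpow_const_of_ne (abs_ne_zero.2 hv)
  rw [funext FS.F_eq]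
  exact h2.contMDiffAt.comp v h1

theorem isTimelike_finslerMetric {v : TangentBundle (𝓡 4) M} (hv : v ∈ FS.cone) :
    IsTimelike (finslerMetric FS.F v) v.snd :=
  (FS.isHomogeneous v.proj).isTimelike_finsler (F := fun y => FS.F ⟨v.proj, y⟩)
    (fun y => FS.F_eq ⟨v.proj, y⟩) hv

theorem finslerMetric_self_self {v : TangentBundle (𝓡 4) M} (hv : v ∈ FS.cone) :
    finslerMetric FS.F v v.snd v.snd = FS.F v ^ 2 :=
  (FS.isHomogeneous v.proj).hess_finsler_self_self (F := fun y => FS.F ⟨v.proj, y⟩)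
    (fun y => FS.F_eq ⟨v.proj, y⟩) hv.1

end FinslerSpacetime

namespace TimeOrientation

variable {FS : FinslerSpacetime M} (T : TimeOrientation FS)

/-- The open cone spanned by the observers. -/
def cone : Set (TangentBundle (𝓡 4) M) :=
  {v | FS.L v ≠ 0 ∧ (FS.F v)⁻¹ • v.snd ∈ T.S v.proj}

theorem S_subset (x : M) : T.S x ⊆ unitTimelike FS.L x := by
  obtain ⟨y, -, h⟩ := T.isComponent x
  rw [h]; exact connectedComponentIn_subset _ _

theorem isPreconnected_S (x : M) : IsPreconnected (T.S x) := by
  obtain ⟨y, -, h⟩ := T.isComponent x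
  rw [h]; exact isPreconnected_connectedComponentIn

theorem S_nonempty (x : M) : (T.S x).Nonempty := by
  obtain ⟨y, hy, h⟩ := T.isComponent x
  exact ⟨y, h ▸ mem_connectedComponentIn hy⟩

theorem S_eq {x : M} {y : TangentSpace (𝓡 4) x} (hy : y ∈ T.S x) :
    T.S x = connectedComponentIn (unitTimelike FS.L x) y := by
  obtain ⟨y', -, h⟩ := T.isComponent x
  rw [h] at hy ⊢
  exact connectedComponentIn_eq hy

/-- This presents `O` as a level set of `F` in the cone spanned by the observers. Once the cone is
known to be open, `O` is a hypersurface. -/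
theorem mem_S_iff {v : TangentBundle (𝓡 4) M} :
    v.snd ∈ T.S v.proj ↔ v ∈ T.cone ∧ FS.F v = 1 := by
  constructor
  · intro h
    have h1 := FS.mem_unitTimelike_iff.1 (T.S_subset _ h)
    have h2 : FS.F v = 1 := FS.F_eq_one_iff.2 h1.1
    exact ⟨⟨h1.2.1, by rwa [h2, inv_one, one_smul]⟩, h2⟩
  · rintro ⟨⟨-, h⟩, h2⟩
    rwa [h2, inv_one, one_smul] at h

theorem smul_mem_cone_iff {x : M} {y : TangentSpace (𝓡 4) x} {c : ℝ} (hc : 0 < c) :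
    (⟨x, c • y⟩ : TangentBundle (𝓡 4) M) ∈ T.cone ↔
      (⟨x, y⟩ : TangentBundle (𝓡 4) M) ∈ T.cone := by
  have h1 : FS.L ⟨x, c • y⟩ = c ^ FS.degree * FS.L ⟨x, y⟩ := FS.homogeneous x y c hc
  have hcn : c ^ FS.degree ≠ 0 := (Real.rpow_pos_of_pos hc _).ne'
  have h2 : (FS.F ⟨x, c • y⟩)⁻¹ • c • y = (FS.F ⟨x, y⟩)⁻¹ • y := by
    rw [FS.F_smul_pos x y hc, smul_smul, mul_inv_rev, mul_assoc, inv_mul_cancel₀ hc.ne', mul_one]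
  refine and_congr ?_ ?_
  · rw [h1]; simp [hcn]
  · change (FS.F ⟨x, c • y⟩)⁻¹ • c • y ∈ T.S x ↔ (FS.F ⟨x, y⟩)⁻¹ • y ∈ T.S x
    rw [h2]

theorem cone_subset : T.cone ⊆ FS.cone := by
  rintro ⟨x, y⟩ hv
  have hF := FS.F_pos hv.1
  have h1 := (FS.mem_unitTimelike_iff.1 (T.S_subset _ hv.2)).2
  have h2 := FS.smul_mem_cone hF h1
  have h3 : FS.F ⟨x, y⟩ • (FS.F ⟨x, y⟩)⁻¹ • y = y := by
    rw [smul_smul, mul_inv_cancel₀ hF.ne', one_smul]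
  change (⟨x, FS.F ⟨x, y⟩ • (FS.F ⟨x, y⟩)⁻¹ • y⟩ : TangentBundle (𝓡 4) M) ∈ FS.cone at h2
  rwa [h3] at h2

theorem continuous_fiberF (x : M) : Continuous fun y : Euc 4 => FS.F ⟨x, y⟩ :=
  FS.continuous_F.comp (contMDiff_fiber_inclusion x).continuous

/-- A connected set of timelike vectors in a fibre that meets the cone lies in the cone. -/
theorem mem_cone_of_isPreconnected {x : M} {B : Set (Euc 4)} (hB : IsPreconnected B)
    (hsub : ∀ y ∈ B, (⟨x, y⟩ : TangentBundle (𝓡 4) M) ∈ FS.cone) {y₀ y : Euc 4} (hy₀ : y₀ ∈ B)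
    (h₀ : (⟨x, y₀⟩ : TangentBundle (𝓡 4) M) ∈ T.cone) (hy : y ∈ B) :
    (⟨x, y⟩ : TangentBundle (𝓡 4) M) ∈ T.cone := by
  -- Radial projection onto the unit level maps `B` onto a connected set of unit timelike vectors;
  -- it meets `S_x`, so it lies in this component.
  set r : Euc 4 → Euc 4 := fun y => (FS.F ⟨x, y⟩)⁻¹ • y with hr
  have hF : ∀ y ∈ B, 0 < FS.F ⟨x, y⟩ := fun y hy => FS.F_pos (hsub y hy).1
  have hrc : ContinuousOn r B := fun y hy =>
    (((continuous_fiberF x).continuousAt.inv₀ (hF y hy).ne').smul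
      continuousAt_id).continuousWithinAt
  have himg : r '' B ⊆ unitTimelike FS.L x := by
    rintro _ ⟨y, hy, rfl⟩
    refine FS.mem_unitTimelike_iff.2 ⟨?_, FS.smul_mem_cone (inv_pos.2 (hF y hy)) (hsub y hy)⟩
    rw [← FS.F_eq_one_iff]
    exact (FS.F_smul_pos x y (inv_pos.2 (hF y hy))).trans (inv_mul_cancel₀ (hF y hy).ne')
  have h1 : r y₀ ∈ T.S x := h₀.2
  have h2 := (hB.image r hrc).subset_connectedComponentIn ⟨y₀, hy₀, rfl⟩ himg
  refine ⟨(hsub y hy).1, ?_⟩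
  change r y ∈ T.S x
  rw [T.S_eq h1]
  exact h2 ⟨y, hy, rfl⟩

/-- A ball in induced coordinates is a product of balls, because the product carries the maximum
metric. Its fibre slices are empty or linear preimages of balls, hence connected. -/
theorem exists_box {v : TangentBundle (𝓡 4) M} (hv : v ∈ FS.cone) :
    ∃ V ∈ 𝓝 v, V ⊆ FS.cone ∧ ∀ x : M,
      IsPreconnected {y : Euc 4 | (⟨x, y⟩ : TangentBundle (𝓡 4) M) ∈ V} := by
  have hφ := chartAt_mem_maximalAtlas (M := M) v.proj
  set φ := chartAt (Euc 4) v.proj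
  have hx : v.proj ∈ φ.source := mem_chart_source _ _
  have h1 : FS.cone ∈ 𝓝 (tpoint φ (tcoord φ v)) := by
    rw [tpoint_tcoord hφ hx]; exact FS.isOpen_cone.mem_nhds hv
  have h2 : {z | z.1 ∈ φ.target ∧ tpoint φ z ∈ FS.cone} ∈ 𝓝 (tcoord φ v) :=
    Filter.inter_mem ((isOpen_fst_target φ).mem_nhds (tcoord_fst_mem hx))
      (((contMDiffOn_tpoint hφ).continuousOn.continuousAt
        ((isOpen_fst_target φ).mem_nhds (tcoord_fst_mem hx))) h1)
  obtain ⟨r, hr, hball⟩ := Metric.mem_nhds_iff.1 h2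
  have hc := (contMDiffOn_tcoord hφ).continuousOn.continuousAt
    ((isOpen_proj_source φ).mem_nhds hx)
  refine ⟨{w | w.proj ∈ φ.source ∧ tcoord φ w ∈ Metric.ball (tcoord φ v) r},
    Filter.inter_mem ((isOpen_proj_source φ).mem_nhds hx) (hc (Metric.ball_mem_nhds _ hr)), ?_, ?_⟩
  · rintro w ⟨hw1, hw2⟩
    have := (hball hw2).2
    rwa [tpoint_tcoord hφ hw1] at this
  · intro x
    let D : Euc 4 →L[ℝ] Euc 4 := mfderiv (𝓡 4) (𝓡 4) φ x
    by_cases hx' : x ∈ φ.source ∧ φ x ∈ Metric.ball (tcoord φ v).1 r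
    · have : {y : Euc 4 | (⟨x, y⟩ : TangentBundle (𝓡 4) M) ∈
          {w : TangentBundle (𝓡 4) M | w.proj ∈ φ.source ∧ tcoord φ w ∈ Metric.ball (tcoord φ v) r}}
          = D ⁻¹' Metric.ball (tcoord φ v).2 r := by
        ext y
        have hpr : Metric.ball (tcoord φ v) r =
          Metric.ball (tcoord φ v).1 r ×ˢ Metric.ball (tcoord φ v).2 r := by
          rw [ball_prod_same]
        rw [hpr]
        exact ⟨fun h => h.2.2, fun h => ⟨hx'.1, hx'.2, h⟩⟩
      rw [this]
      exact ((convex_ball _ _).is_linear_preimage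
        D.toLinearMap.isLinear).isPreconnected
    · convert isPreconnected_empty
      ext y
      simp only [Set.mem_empty_iff_false, iff_false]
      rintro ⟨h1, h2⟩
      rw [show tcoord φ v = ((tcoord φ v).1, (tcoord φ v).2) from rfl, ← ball_prod_same] at h2
      exact hx' ⟨h1, h2.1⟩

/-- If each nearby fibre contains one vector of the cone inside the box, then connectedness of the
slice puts the whole slice into the cone. The question of openness is thus reduced to finding one
vector in each fibre. -/
theorem cone_mem_nhds {v : TangentBundle (𝓡 4) M} {V : Set (TangentBundle (𝓡 4) M)} (hV : V ∈ 𝓝 v)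
    (hsub : V ⊆ FS.cone)
    (hpre : ∀ x : M, IsPreconnected {y : Euc 4 | (⟨x, y⟩ : TangentBundle (𝓡 4) M) ∈ V})
    (hex : ∀ᶠ x in 𝓝 v.proj, ∃ y : Euc 4, (⟨x, y⟩ : TangentBundle (𝓡 4) M) ∈ V ∩ T.cone) :
    T.cone ∈ 𝓝 v := by
  have hc : ContinuousAt (fun w : TangentBundle (𝓡 4) M => w.proj) v :=
    (FiberBundle.continuous_proj (Euc 4) (TangentSpace (𝓡 4))).continuousAt
  filter_upwards [hV, hc.eventually hex] with w hw ⟨y, hy1, hy2⟩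
  exact T.mem_cone_of_isPreconnected (hpre w.proj) (fun y hy => hsub hy) hy1 hy2 hw

/-- Within one fibre of the cone, which is connected as the image of `(0,∞) × S_x`, the set of
interior points of the total cone is open, nonempty and relatively closed. -/
theorem isOpen_cone : IsOpen T.cone := by
  rw [isOpen_iff_mem_nhds]
  rintro ⟨x₀, y₀⟩ hv
  set s : Set (Euc 4) := {y | (⟨x₀, y⟩ : TangentBundle (𝓡 4) M) ∈ T.cone} with hs
  have hspre : IsPreconnected s := by
    have : s = (fun p : ℝ × Euc 4 => p.1 • p.2) '' (Set.Ioi (0 : ℝ) ×ˢ (T.S x₀ : Set (Euc 4))) := by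
      ext y
      constructor
      · intro hy
        have hF := FS.F_pos hy.1
        refine ⟨(FS.F ⟨x₀, y⟩, (FS.F ⟨x₀, y⟩)⁻¹ • y), ⟨hF, hy.2⟩, ?_⟩
        simp [smul_smul, mul_inv_cancel₀ hF.ne']
      · rintro ⟨⟨c, y'⟩, ⟨hc, hy'⟩, rfl⟩
        exact (T.smul_mem_cone_iff hc).2 ((T.mem_S_iff (v := ⟨x₀, y'⟩)).1 hy').1
    rw [this]
    exact (isPreconnected_Ioi.prod (T.isPreconnected_S x₀)).image _
      (continuous_fst.smul continuous_snd).continuousOn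
  have hi : Continuous fun y : Euc 4 => (⟨x₀, y⟩ : TangentBundle (𝓡 4) M) :=
    (contMDiff_fiber_inclusion x₀).continuous
  set u : Set (Euc 4) := {y | (⟨x₀, y⟩ : TangentBundle (𝓡 4) M) ∈ interior T.cone} with hu
  have huo : IsOpen u := isOpen_interior.preimage hi
  have key : s ⊆ u := by
    refine hspre.subset_of_closure_inter_subset huo ?_ ?_
    -- Nonempty: the local section of the time orientation supplies a vector of the cone in every
    -- nearby fibre.
    · obtain ⟨U, hU, hxU, σ, hσ, hσS⟩ := T.continuous x₀
      have hσc : ∀ x ∈ U, (⟨x, σ x⟩ : TangentBundle (𝓡 4) M) ∈ T.cone := fun x hx =>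
        ((T.mem_S_iff (v := ⟨x, σ x⟩)).1 (hσS x hx)).1
      refine ⟨σ x₀, hσc x₀ hxU, mem_interior_iff_mem_nhds.2 ?_⟩
      obtain ⟨V, hV, hVs, hVp⟩ := exists_box (T.cone_subset (hσc x₀ hxU))
      refine T.cone_mem_nhds hV hVs hVp ?_
      filter_upwards [(hσ.continuousAt (hU.mem_nhds hxU)) hV, hU.mem_nhds hxU] with x hx hx'
      exact ⟨σ x, hx, hσc x hx'⟩
    · rintro y ⟨hyc, hys⟩
      obtain ⟨V, hV, hVs, hVp⟩ := exists_box (T.cone_subset hys)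
      refine mem_interior_iff_mem_nhds.2 (T.cone_mem_nhds hV hVs hVp ?_)
      obtain ⟨y', hy'V, hy'u⟩ := mem_closure_iff_nhds.1 hyc _
        (hi.continuousAt (interior_mem_nhds.2 hV))
      have h1 : V ∩ T.cone ∈ 𝓝 (⟨x₀, y'⟩ : TangentBundle (𝓡 4) M) :=
        Filter.inter_mem (mem_interior_iff_mem_nhds.1 hy'V) (mem_interior_iff_mem_nhds.1 hy'u)
      -- Relatively closed: the box around the limit point contains an interior point of the cone,
      -- and since the projection is open, this point has neighbours in the cone over all nearby
      -- base points.
      have h2 := (FiberBundle.isOpenMap_proj (Euc 4) (TangentSpace (𝓡 4) (M := M))).image_mem_nhds h1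
      filter_upwards [h2] with x ⟨w, hw, hwx⟩
      subst hwx
      exact ⟨w.snd, hw⟩
  exact mem_interior_iff_mem_nhds.1 (key hv)

theorem neg_notMem_S {x : M} {y : TangentSpace (𝓡 4) x} (hy : y ∈ T.S x) : -y ∉ T.S x := by
  have hi : Continuous fun y : Euc 4 => (⟨x, y⟩ : TangentBundle (𝓡 4) M) :=
    (contMDiff_fiber_inclusion x).continuous
  refine (FS.isHomogeneous x).neg_notMem (F := fun y => FS.F ⟨x, y⟩) (FS.continuous_L.comp hi)
    (fun y => FS.F_eq ⟨x, y⟩) (T.isPreconnected_S x) (T.isClosed x) ?_ ?_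
    (T.isOpen_cone.preimage hi) hy
  · intro y hy
    exact (FS.mem_unitTimelike_iff.1 (T.S_subset x hy)).2
  · intro y hy
    exact (FS.mem_unitTimelike_iff.1 (T.S_subset x hy)).1

end TimeOrientation

end Cones

/-! ### The Cartan linear connection without indices -/

/-- The form `B` is non-degenerate. -/
def IsNondegenerate (B : Bil) : Prop := ∀ u, (∀ v, B u v = 0) → u = 0

theorem IsTimelike.isNondegenerate {B : Bil} {y : Euc 4} (hs : ∀ u v, B u v = B v u)
    (h : IsTimelike B y) : IsNondegenerate B := by
  intro u hu
  by_contra h0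
  have := h.reflect_pos hs h0
  rw [hs y u, hu y, hu u] at this
  simp at this

/-- The isomorphism of `ℝ⁴` with its dual given by a non-degenerate form. -/
def IsNondegenerate.equiv {B : Bil} (h : IsNondegenerate B) :
    Euc 4 ≃L[ℝ] (Euc 4 →L[ℝ] ℝ) :=
  (LinearEquiv.ofInjectiveOfFinrankEq (B : Euc 4 →ₗ[ℝ] (Euc 4 →L[ℝ] ℝ))
    ((injective_iff_map_eq_zero _).2 fun u hu => h u fun v => by
      have : B u = 0 := hu
      rw [this]; rfl)
    (by
      rw [(LinearMap.toContinuousLinearMap (𝕜 := ℝ) (E := Euc 4) (F' := ℝ)).symm.finrank_eq]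
      simp)).toContinuousLinearEquiv

theorem IsNondegenerate.coe_equiv {B : Bil} (h : IsNondegenerate B) :
    (h.equiv : Euc 4 →L[ℝ] (Euc 4 →L[ℝ] ℝ)) = B := rfl

/-- The vector corresponding to a linear form. -/
def raise (B : Bil) (t : Euc 4 →L[ℝ] ℝ) : Euc 4 := ContinuousLinearMap.inverse B t

theorem IsNondegenerate.apply_raise {B : Bil} (h : IsNondegenerate B) (t : Euc 4 →L[ℝ] ℝ)
    (v : Euc 4) : B (raise B t) v = t v := by
  have : raise B t = h.equiv.symm t := by
    rw [raise]
    conv_lhs => rw [← h.coe_equiv]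
    rw [ContinuousLinearMap.inverse_equiv]; rfl
  rw [this]
  have h2 : h.equiv (h.equiv.symm t) = t := h.equiv.apply_symm_apply t
  exact congrArg (fun A : Euc 4 →L[ℝ] ℝ => A v) h2

theorem IsNondegenerate.ext {B : Bil} (h : IsNondegenerate B) {u w : Euc 4}
    (huw : ∀ v, B u v = B w v) : u = w := by
  rw [← sub_eq_zero]
  exact h _ fun v => by simp [huw v]

/-- Inversion of continuous linear maps is smooth at invertible ones; degenerate forms only receive
a default value, which does not matter near `x`. -/
theorem contDiffAt_raise {X : Type*} [NormedAddCommGroup X] [NormedSpace ℝ X] {B : X → Bil}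
    {t : X → Euc 4 →L[ℝ] ℝ} {x : X} (h : IsNondegenerate (B x)) (hB : ContDiffAt ℝ ∞ B x)
    (ht : ContDiffAt ℝ ∞ t x) : ContDiffAt ℝ ∞ (fun x => raise (B x) (t x)) x := by
  have h1 : ContDiffAt ℝ ∞ (ContinuousLinearMap.inverse (R := ℝ) (M := Euc 4) (M₂ := Euc 4 →L[ℝ] ℝ))
      (B x) := by
    have := contDiffAt_map_inverse (𝕜 := ℝ) (n := ∞) h.equiv
    rwa [h.coe_equiv] at this
  exact (h1.comp x hB).clm_apply ht

/-- Basis vectors of `ℝ⁴`. -/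
abbrev ee (a : Fin 4) : Euc 4 := EuclideanSpace.single a 1

theorem sum_ee (u : Euc 4) : ∑ a, u a • ee a = u := by
  ext b
  simp [ee, Pi.single_apply]

/-- The dictionary between raising an index by the inverse matrix and solving `B u = t`. Together
with the other formulas for coefficients it makes it possible to leave index notation. -/
theorem IsNondegenerate.sum_inv_mul {B : Bil} (h : IsNondegenerate B)
    {g : Matrix (Fin 4) (Fin 4) ℝ} (hs : ∀ u v, B u v = B v u) (hg : ∀ a b, g a b = B (ee a) (ee b))
    (t : Euc 4 →L[ℝ] ℝ) (a : Fin 4) : ∑ d, g⁻¹ a d * t (ee d) = raise B t a := by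
  have hmul : ∀ u : Euc 4, ∀ b, (g *ᵥ u.ofLp) b = B u (ee b) := fun u b => by
    conv_rhs => rw [← sum_ee u]
    simp only [Matrix.mulVec, dotProduct, map_sum, map_smul, sum_apply, smul_apply, smul_eq_mul, hg]
    exact Finset.sum_congr rfl fun c _ => by rw [hs (ee b) (ee c), mul_comm]
  have hdet : IsUnit g.det := by
    rw [isUnit_iff_ne_zero]
    intro h0
    obtain ⟨v, hv0, hv⟩ := Matrix.exists_mulVec_eq_zero_iff.2 h0
    apply hv0
    have : (WithLp.toLp 2 v : Euc 4) = 0 := by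
      apply h
      intro w
      rw [← sum_ee w]
      simp only [map_sum, map_smul]
      refine Finset.sum_eq_zero fun b _ => ?_
      rw [← hmul, hv]; simp
    simpa using congrArg WithLp.ofLp this
  have h1 : g *ᵥ (raise B t).ofLp = fun d => t (ee d) := by
    funext d
    rw [hmul, h.apply_raise]
  have h2 : g⁻¹ *ᵥ (fun d => t (ee d)) = (raise B t).ofLp := by
    rw [← h1, Matrix.mulVec_mulVec, Matrix.nonsing_inv_mul _ hdet, Matrix.one_mulVec]
  exact congrFun h2 a

/-- The linear form occurring in the Koszul formula. -/
def koszul (K : Euc 4 →L[ℝ] Bil) (f u : Euc 4) : Euc 4 →L[ℝ] ℝ :=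
  (1 / 2 : ℝ) • (K f u + K u f - (K.flip f).flip u)

theorem koszul_apply (K : Euc 4 →L[ℝ] Bil) (f u v : Euc 4) :
    koszul K f u v = 1 / 2 * (K f u v + K u f v - K v f u) := by
  simp [koszul]

/-- A function `Q` that is smooth with non-degenerate Hessian in the second variable. -/
structure IsMetricDomain (Q : Euc 4 × Euc 4 → ℝ) (D : Set (Euc 4 × Euc 4)) : Prop where
  isOpen : IsOpen D
  smooth : ∀ z ∈ D, ContDiffAt ℝ ∞ Q z
  nondegenerate : ∀ z ∈ D, IsNondegenerate (vHess Q z)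

/-- The linear form of the geodesic equation. -/
def sprayForm (Q : Euc 4 × Euc 4 → ℝ) (w : Euc 4 × Euc 4) : Euc 4 →L[ℝ] ℝ :=
  (fderiv ℝ (fderiv ℝ Q) w (w.2, 0)).comp (ContinuousLinearMap.inr ℝ (Euc 4) (Euc 4)) -
    (fderiv ℝ Q w).comp (ContinuousLinearMap.inl ℝ (Euc 4) (Euc 4))

theorem sprayForm_apply (Q : Euc 4 × Euc 4 → ℝ) (w : Euc 4 × Euc 4) (v : Euc 4) :
    sprayForm Q w v = fderiv ℝ (fderiv ℝ Q) w (w.2, 0) (0, v) - fderiv ℝ Q w (v, 0) := rfl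

/-- Four times the spray coefficients. -/
def spray (Q : Euc 4 × Euc 4 → ℝ) (w : Euc 4 × Euc 4) : Euc 4 := raise (vHess Q w) (sprayForm Q w)

/-- The non-linear connection. -/
def nonlin (Q : Euc 4 × Euc 4 → ℝ) (z : Euc 4 × Euc 4) : Euc 4 →L[ℝ] Euc 4 :=
  (1 / 4 : ℝ) • (fderiv ℝ (spray Q) z).comp (ContinuousLinearMap.inr ℝ (Euc 4) (Euc 4))

/-- The horizontal lift. -/
def horLift (Q : Euc 4 × Euc 4 → ℝ) (z : Euc 4 × Euc 4) : Euc 4 →L[ℝ] Euc 4 × Euc 4 :=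
  (ContinuousLinearMap.id ℝ (Euc 4)).prod (-nonlin Q z)

/-- Horizontal derivatives of the metric. -/
def horK (Q : Euc 4 × Euc 4 → ℝ) (z : Euc 4 × Euc 4) : Euc 4 →L[ℝ] Bil :=
  (fderiv ℝ (vHess Q) z).comp (horLift Q z)

/-- Vertical derivatives of the metric. -/
def verK (Q : Euc 4 × Euc 4 → ℝ) (z : Euc 4 × Euc 4) : Euc 4 →L[ℝ] Bil :=
  (fderiv ℝ (vHess Q) z).comp (ContinuousLinearMap.inr ℝ (Euc 4) (Euc 4))

/-- The Cartan linear connection: the correction to the derivative of the components of a vector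
field `f` in the direction `ξ`. -/
def cartanConn (Q : Euc 4 × Euc 4 → ℝ) (z ξ : Euc 4 × Euc 4) (f : Euc 4) : Euc 4 :=
  raise (vHess Q z) (koszul (horK Q z) f ξ.1 + koszul (verK Q z) f (nonlin Q z ξ.1 + ξ.2))

namespace IsMetricDomain

variable {Q : Euc 4 × Euc 4 → ℝ} {D : Set (Euc 4 × Euc 4)} (h : IsMetricDomain Q D)
  {z : Euc 4 × Euc 4}
include h

theorem contDiffAt_fderiv (hz : z ∈ D) : ContDiffAt ℝ ∞ (fderiv ℝ Q) z :=
  (h.smooth z hz).fderiv_right (by simp)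

theorem contDiffAt_fderiv₂ (hz : z ∈ D) : ContDiffAt ℝ ∞ (fderiv ℝ (fderiv ℝ Q)) z :=
  (h.contDiffAt_fderiv hz).fderiv_right (by simp)

theorem contDiffAt_vHess (hz : z ∈ D) : ContDiffAt ℝ ∞ (vHess Q) z :=
  FinslerCartan.contDiffAt_vHess (h.smooth z hz)

theorem contDiffAt_sprayForm (hz : z ∈ D) : ContDiffAt ℝ ∞ (sprayForm Q) z :=
  (((h.contDiffAt_fderiv₂ hz).clm_apply (contDiffAt_snd.prodMk contDiffAt_const)).clm_comp
    contDiffAt_const).sub ((h.contDiffAt_fderiv hz).clm_comp contDiffAt_const)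

theorem contDiffAt_spray (hz : z ∈ D) : ContDiffAt ℝ ∞ (spray Q) z :=
  contDiffAt_raise (h.nondegenerate z hz) (h.contDiffAt_vHess hz) (h.contDiffAt_sprayForm hz)

theorem contDiffAt_nonlin (hz : z ∈ D) : ContDiffAt ℝ ∞ (nonlin Q) z :=
  (((h.contDiffAt_spray hz).fderiv_right (m := ∞) (by simp)).clm_comp
    contDiffAt_const).const_smul (1 / 4 : ℝ)

theorem contDiffAt_horK (hz : z ∈ D) : ContDiffAt ℝ ∞ (horK Q) z := by
  have h1 : ContDiffAt ℝ ∞ (horLift Q) z := by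
    have : horLift Q = fun z => (ContinuousLinearMap.inl ℝ (Euc 4) (Euc 4)) -
        (ContinuousLinearMap.inr ℝ (Euc 4) (Euc 4)).comp (nonlin Q z) := by
      funext z; ext u <;> simp [horLift]
    rw [this]
    exact contDiffAt_const.sub (contDiffAt_const.clm_comp (h.contDiffAt_nonlin hz))
  exact ((h.contDiffAt_vHess hz).fderiv_right (m := ∞) (by simp)).clm_comp h1

theorem contDiffAt_verK (hz : z ∈ D) : ContDiffAt ℝ ∞ (verK Q) z :=
  ((h.contDiffAt_vHess hz).fderiv_right (m := ∞) (by simp)).clm_comp contDiffAt_const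

theorem metricCoeff_eq (hz : z ∈ D) (a b : Fin 4) :
    metricCoeff Q z a b = vHess Q z (ee a) (ee b) := by
  have hd : DifferentiableAt ℝ (fderiv ℝ Q) z :=
    (h.contDiffAt_fderiv hz).differentiableAt (by simp)
  rw [vHess_apply, metricCoeff, Matrix.of_apply]
  congr 1
  change fderiv ℝ (fun w => fderiv ℝ Q w (0, ee b)) z (0, ee a) = _
  rw [fderiv_clm_apply hd (differentiableAt_const _)]
  simp

theorem symm (hz : z ∈ D) (u v : Euc 4) : vHess Q z u v = vHess Q z v u :=
  vHess_symm (h.smooth z hz) u v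

theorem sum_inv_mul (hz : z ∈ D) (t : Euc 4 →L[ℝ] ℝ) (a : Fin 4) :
    ∑ d, (metricCoeff Q z)⁻¹ a d * t (ee d) = raise (vHess Q z) t a :=
  (h.nondegenerate z hz).sum_inv_mul (h.symm hz) (h.metricCoeff_eq hz) t a

theorem spray_apply (hz : z ∈ D) (a : Fin 4) :
    ∑ c, (metricCoeff Q z)⁻¹ a c * (∑ d, z.2 d * dX d (dY c Q) z - dX c Q z) = spray Q z a := by
  rw [spray, ← h.sum_inv_mul hz]
  refine Finset.sum_congr rfl fun c _ => ?_
  congr 1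
  have hd : DifferentiableAt ℝ (fderiv ℝ Q) z :=
    (h.contDiffAt_fderiv hz).differentiableAt (by simp)
  rw [sprayForm_apply]
  congr 1
  have h1 : ∀ d, dX d (dY c Q) z = fderiv ℝ (fderiv ℝ Q) z (ee d, 0) (0, ee c) := fun d => by
    change fderiv ℝ (fun w => fderiv ℝ Q w (0, ee c)) z (ee d, 0) = _
    rw [fderiv_clm_apply hd (differentiableAt_const _)]
    simp
  have h2 : (z.2, (0 : Euc 4)) = ∑ d, z.2 d • (ee d, (0 : Euc 4)) := by
    refine Prod.ext ?_ ?_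
    · simp only [Prod.fst_sum, Prod.smul_fst]; exact (sum_ee z.2).symm
    · simp [Prod.snd_sum]
  simp_rw [h1]
  rw [h2, map_sum, sum_apply]
  exact Finset.sum_congr rfl fun d _ => by rw [map_smul]; rfl

theorem nonlinCoeff_eq (hz : z ∈ D) (a b : Fin 4) :
    nonlinCoeff Q a b z = nonlin Q z (ee b) a := by
  -- The two expressions agree only on `D`. It is open, so they agree near `z`, which suffices for
  -- comparing derivatives.
  have h1 : (fun w => ∑ c, (metricCoeff Q w)⁻¹ a c * (∑ d, w.2 d * dX d (dY c Q) w - dX c Q w))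
      =ᶠ[𝓝 z] fun w => (EuclideanSpace.proj a : Euc 4 →L[ℝ] ℝ) (spray Q w) := by
    filter_upwards [h.isOpen.mem_nhds hz] with w hw
    exact h.spray_apply hw a
  have hd : DifferentiableAt ℝ (spray Q) z := (h.contDiffAt_spray hz).differentiableAt (by simp)
  have h2 := (EuclideanSpace.proj a : Euc 4 →L[ℝ] ℝ).hasFDerivAt.comp z hd.hasFDerivAt
  rw [nonlinCoeff, dY, h1.fderiv_eq]
  refine (congrArg (fun A : Euc 4 × Euc 4 →L[ℝ] ℝ => 1 / 4 * A (0, ee b)) h2.fderiv).trans ?_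
  simp [nonlin]

theorem sum_nonlinCoeff (hz : z ∈ D) (c : Fin 4) (u : Euc 4) :
    ∑ d, nonlinCoeff Q c d z * u d = nonlin Q z u c := by
  simp_rw [h.nonlinCoeff_eq hz]
  conv_rhs => rw [← sum_ee u]
  simp [mul_comm]

theorem fderiv_metricCoeff (hz : z ∈ D) (ζ : Euc 4 × Euc 4) (c d : Fin 4) :
    fderiv ℝ (fun w => metricCoeff Q w c d) z ζ = fderiv ℝ (vHess Q) z ζ (ee c) (ee d) := by
  have h1 : (fun w => metricCoeff Q w c d) =ᶠ[𝓝 z] fun w => vHess Q w (ee c) (ee d) := by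
    filter_upwards [h.isOpen.mem_nhds hz] with w hw using h.metricCoeff_eq hw c d
  have hd : DifferentiableAt ℝ (vHess Q) z := (h.contDiffAt_vHess hz).differentiableAt (by simp)
  rw [h1.fderiv_eq, fderiv_clm_apply (hd.clm_apply (differentiableAt_const _))
    (differentiableAt_const _), fderiv_clm_apply hd (differentiableAt_const _)]
  simp

theorem deltaX_metricCoeff (hz : z ∈ D) (b c d : Fin 4) :
    deltaX Q b (fun w => metricCoeff Q w c d) z = horK Q z (ee b) (ee c) (ee d) := by
  rw [deltaX, dX, h.fderiv_metricCoeff hz]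
  simp only [dY, h.fderiv_metricCoeff hz, h.nonlinCoeff_eq hz]
  have h1 : horLift Q z (ee b) = (ee b, 0) - ∑ a, nonlin Q z (ee b) a • ((0 : Euc 4), ee a) := by
    refine Prod.ext ?_ ?_
    · simp [horLift, Prod.fst_sum]
    · simp only [horLift, ContinuousLinearMap.prod_apply, Prod.snd_sub, Prod.snd_sum, Prod.smul_snd]
      rw [sum_ee]; simp
  rw [horK, ContinuousLinearMap.comp_apply, h1, map_sub, map_sum, sub_apply, sub_apply, sum_apply,
    sum_apply]
  congr 1
  exact Finset.sum_congr rfl fun d _ => by rw [map_smul]; rfl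

theorem sum_horCoeff (hz : z ∈ D) (a : Fin 4) (b c : Fin 4) :
    horCoeff Q a b c z = raise (vHess Q z) (koszul (horK Q z) (ee b) (ee c)) a := by
  rw [← h.sum_inv_mul hz, horCoeff, Finset.mul_sum]
  refine Finset.sum_congr rfl fun d _ => ?_
  rw [h.deltaX_metricCoeff hz, h.deltaX_metricCoeff hz, h.deltaX_metricCoeff hz, koszul_apply]
  ring

theorem sum_verCoeff (hz : z ∈ D) (a : Fin 4) (b c : Fin 4) :
    verCoeff Q a b c z = raise (vHess Q z) (koszul (verK Q z) (ee b) (ee c)) a := by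
  rw [← h.sum_inv_mul hz, verCoeff, Finset.mul_sum]
  refine Finset.sum_congr rfl fun d _ => ?_
  rw [dY, dY, dY, h.fderiv_metricCoeff hz, h.fderiv_metricCoeff hz, h.fderiv_metricCoeff hz,
    koszul_apply]
  simp only [verK, ContinuousLinearMap.comp_apply, ContinuousLinearMap.inr_apply]
  ring

omit h in
theorem sum_koszul (B : Bil) (K : Euc 4 →L[ℝ] Bil) (f u : Euc 4) (a : Fin 4) :
    ∑ b, ∑ c, f b * (raise B (koszul K (ee b) (ee c)) a * u c) = raise B (koszul K f u) a := by
  have h1 : koszul K f u = ∑ b, ∑ c, (f b * u c) • koszul K (ee b) (ee c) := by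
    ext v
    simp only [sum_apply, smul_apply, smul_eq_mul, koszul_apply]
    conv_lhs => rw [← sum_ee f, ← sum_ee u]
    simp only [map_sum, map_smul, sum_apply, smul_apply, smul_eq_mul]
    simp only [Fin.sum_univ_four]
    ring
  rw [h1]
  simp only [raise, map_sum, map_smul, WithLp.ofLp_sum, Finset.sum_apply, PiLp.smul_apply,
    smul_eq_mul]
  exact Finset.sum_congr rfl fun b _ => Finset.sum_congr rfl fun c _ => by ring

/-- By bilinearity of `koszul` and linearity of `raise`, the index expression in the definition of
`ω` is the index-free connection. From here on the coefficients are needed only to compare with that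
definition. -/
theorem cartanConn_apply (hz : z ∈ D) (ξ : Euc 4 × Euc 4) (f : Euc 4) (a : Fin 4) :
    ∑ b, ∑ c, f b * (horCoeff Q a b c z * ξ.1 c +
      verCoeff Q a b c z * (∑ d, nonlinCoeff Q c d z * ξ.1 d + ξ.2 c)) = cartanConn Q z ξ f a := by
  simp_rw [h.sum_nonlinCoeff hz, h.sum_horCoeff hz, h.sum_verCoeff hz, mul_add (f _),
    Finset.sum_add_distrib]
  rw [sum_koszul]
  have h1 := sum_koszul (vHess Q z) (verK Q z) f (nonlin Q z ξ.1 + ξ.2) a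
  simp only [PiLp.add_apply] at h1
  rw [h1, cartanConn]
  simp only [raise, map_add, PiLp.add_apply]

theorem contDiffAt_cartanConn (hz : z ∈ D) (ξ : Euc 4 × Euc 4) (f : Euc 4) :
    ContDiffAt ℝ ∞ (fun q : (Euc 4 × Euc 4) × (Euc 4 × Euc 4) × Euc 4 =>
      cartanConn Q q.1 q.2.1 q.2.2) (z, ξ, f) := by
  have hfst : ContDiffAt ℝ ∞ (fun q : (Euc 4 × Euc 4) × (Euc 4 × Euc 4) × Euc 4 => q.1) (z, ξ, f) :=
    contDiffAt_fst
  have hB := (h.contDiffAt_vHess hz).comp (z, ξ, f) hfst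
  have hH := (h.contDiffAt_horK hz).comp (z, ξ, f) hfst
  have hV := (h.contDiffAt_verK hz).comp (z, ξ, f) hfst
  have hN := (h.contDiffAt_nonlin hz).comp (z, ξ, f) hfst
  have hξ1 : ContDiffAt ℝ ∞ (fun q : (Euc 4 × Euc 4) × (Euc 4 × Euc 4) × Euc 4 => q.2.1.1)
    (z, ξ, f) := by fun_prop
  have hξ2 : ContDiffAt ℝ ∞ (fun q : (Euc 4 × Euc 4) × (Euc 4 × Euc 4) × Euc 4 => q.2.1.2)
    (z, ξ, f) := by fun_prop
  have hf : ContDiffAt ℝ ∞ (fun q : (Euc 4 × Euc 4) × (Euc 4 × Euc 4) × Euc 4 => q.2.2)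
    (z, ξ, f) := by fun_prop
  have hk : ∀ (K : (Euc 4 × Euc 4) × (Euc 4 × Euc 4) × Euc 4 → Euc 4 →L[ℝ] Bil)
      (u : (Euc 4 × Euc 4) × (Euc 4 × Euc 4) × Euc 4 → Euc 4), ContDiffAt ℝ ∞ K (z, ξ, f) →
      ContDiffAt ℝ ∞ u (z, ξ, f) → ContDiffAt ℝ ∞ (fun q => koszul (K q) q.2.2 (u q)) (z, ξ, f) := by
    intro K u hK hu
    have hflip : ∀ {V W : Type} [NormedAddCommGroup V] [NormedSpace ℝ V] [NormedAddCommGroup W]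
        [NormedSpace ℝ W] (A : (Euc 4 × Euc 4) × (Euc 4 × Euc 4) × Euc 4 → Euc 4 →L[ℝ] V →L[ℝ] W),
        ContDiffAt ℝ ∞ A (z, ξ, f) → ContDiffAt ℝ ∞ (fun q => (A q).flip) (z, ξ, f) := by
      intro V W _ _ _ _ A hA
      exact (ContinuousLinearMap.flipₗᵢ ℝ (Euc 4) V W).contDiff.contDiffAt.comp _ hA
    exact ((((hK.clm_apply hf).clm_apply hu).add ((hK.clm_apply hu).clm_apply hf)).sub
      ((hflip _ ((hflip _ hK).clm_apply hf)).clm_apply hu)).const_smul (1 / 2 : ℝ)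
  exact contDiffAt_raise (h.nondegenerate z hz) hB
    ((hk _ _ hH hξ1).add (hk _ _ hV ((hN.clm_apply hξ1).add hξ2)))

end IsMetricDomain

theorem cartanConn_add (Q : Euc 4 × Euc 4 → ℝ) (z ξ ξ' : Euc 4 × Euc 4) (f : Euc 4) :
    cartanConn Q z (ξ + ξ') f = cartanConn Q z ξ f + cartanConn Q z ξ' f := by
  have h1 : ∀ (K : Euc 4 →L[ℝ] Bil) (u u' : Euc 4), koszul K f (u + u') =
      koszul K f u + koszul K f u' := fun K u u' => by
    ext v; simp only [koszul_apply, map_add, add_apply]; ring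
  simp only [cartanConn, raise, Prod.fst_add, Prod.snd_add, map_add, h1]
  abel

theorem cartanConn_smul (Q : Euc 4 × Euc 4 → ℝ) (z ξ : Euc 4 × Euc 4) (c : ℝ) (f : Euc 4) :
    cartanConn Q z (c • ξ) f = c • cartanConn Q z ξ f := by
  have h1 : ∀ (K : Euc 4 →L[ℝ] Bil) (u : Euc 4), koszul K f (c • u) = c • koszul K f u :=
    fun K u => by
      ext v; simp only [koszul_apply, map_smul, smul_apply, smul_eq_mul]; ring
  have h2 : nonlin Q z (c • ξ.1) + c • ξ.2 = c • (nonlin Q z ξ.1 + ξ.2) := by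
    rw [map_smul, smul_add]
  simp only [cartanConn, raise, Prod.smul_fst, Prod.smul_snd]
  rw [h2, h1, h1]
  simp only [map_add, map_smul, smul_add]

theorem cartanConn_sum (Q : Euc 4 × Euc 4 → ℝ) (z ξ : Euc 4 × Euc 4) {ι : Type*} (s : Finset ι)
    (c : ι → ℝ) (f : ι → Euc 4) :
    cartanConn Q z ξ (∑ i ∈ s, c i • f i) = ∑ i ∈ s, c i • cartanConn Q z ξ (f i) := by
  have h1 : ∀ (K : Euc 4 →L[ℝ] Bil) (u : Euc 4), koszul K (∑ i ∈ s, c i • f i) u =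
      ∑ i ∈ s, c i • koszul K (f i) u := fun K u => by
    ext v
    simp only [koszul_apply, map_sum, map_smul, sum_apply, smul_apply, smul_eq_mul]
    rw [← Finset.sum_add_distrib, ← Finset.sum_sub_distrib, Finset.mul_sum]
    exact Finset.sum_congr rfl fun i _ => by ring
  simp only [cartanConn, raise, h1, map_add, map_sum, map_smul, smul_add, Finset.sum_add_distrib]

namespace IsMetricDomain

variable {Q : Euc 4 × Euc 4 → ℝ} {D : Set (Euc 4 × Euc 4)} (h : IsMetricDomain Q D)
  {z : Euc 4 × Euc 4}
include h

theorem hasFDerivAt_vHess (hz : z ∈ D) : HasFDerivAt (vHess Q) (fderiv ℝ (vHess Q) z) z :=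
  ((h.contDiffAt_vHess hz).differentiableAt (by simp)).hasFDerivAt

theorem hasFDerivAt_vHess_apply (hz : z ∈ D) (u v : Euc 4) :
    HasFDerivAt (fun w => vHess Q w u v)
      (((fderiv ℝ (vHess Q) z).flip u).flip v) z := by
  refine (((h.hasFDerivAt_vHess hz).clm_apply (hasFDerivAt_const u z)).clm_apply
    (hasFDerivAt_const v z)).congr_fderiv ?_
  ext <;> simp

theorem fderiv_vHess_symm (hz : z ∈ D) (ζ : Euc 4 × Euc 4) (u v : Euc 4) :
    fderiv ℝ (vHess Q) z ζ u v = fderiv ℝ (vHess Q) z ζ v u := by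
  have h1 : (fun w => vHess Q w u v) =ᶠ[𝓝 z] fun w => vHess Q w v u := by
    filter_upwards [h.isOpen.mem_nhds hz] with w hw using h.symm hw u v
  have h2 := (h.hasFDerivAt_vHess_apply hz u v).unique
    ((h.hasFDerivAt_vHess_apply hz v u).congr_of_eventuallyEq h1)
  exact congrArg (fun A : Euc 4 × Euc 4 →L[ℝ] ℝ => A ζ) h2

/-- The Cartan connection is metrical. -/
theorem metric_compatible (hz : z ∈ D) (ξ : Euc 4 × Euc 4) (f g : Euc 4) :
    vHess Q z (cartanConn Q z ξ f) g + vHess Q z f (cartanConn Q z ξ g) =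
      fderiv ℝ (vHess Q) z ξ f g := by
  rw [h.symm hz f, cartanConn, cartanConn, (h.nondegenerate z hz).apply_raise,
    (h.nondegenerate z hz).apply_raise]
  simp only [add_apply, koszul_apply, horK, verK, ContinuousLinearMap.comp_apply]
  set A := fderiv ℝ (vHess Q) z
  have s : ∀ ζ u v, A ζ u v = A ζ v u := h.fderiv_vHess_symm hz
  -- Every vector is the horizontal lift of its base component plus a vertical vector. The two
  -- halves of the Koszul formula are the metric derivatives along these two parts, and the terms
  -- antisymmetric in `f` and `g` cancel.
  have e : A ξ f g = A (horLift Q z ξ.1) f g +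
      A (ContinuousLinearMap.inr ℝ (Euc 4) (Euc 4) (nonlin Q z ξ.1 + ξ.2)) f g := by
    rw [← add_apply, ← add_apply, ← map_add]
    congr 3
    refine Prod.ext ?_ ?_ <;> simp [horLift]
  rw [e]
  rw [s _ g f, s _ g f, s _ g ξ.1, s _ g (nonlin Q z ξ.1 + ξ.2), s (horLift Q z f) ξ.1 g,
    s (ContinuousLinearMap.inr ℝ (Euc 4) (Euc 4) f) (nonlin Q z ξ.1 + ξ.2) g, s _ f ξ.1,
    s _ f (nonlin Q z ξ.1 + ξ.2)]
  ring

/-- Vertical derivatives of the metric are third vertical derivatives of `Q`, hence totally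
symmetric. -/
theorem fderiv_vHess_vertical_swap (hz : z ∈ D) (a b v : Euc 4) :
    fderiv ℝ (vHess Q) z (0, a) b v = fderiv ℝ (vHess Q) z (0, b) a v := by
  set k : Euc 4 × Euc 4 → ℝ := fun w => fderiv ℝ Q w (0, v) with hk
  have hkd : ∀ w ∈ D, ContDiffAt ℝ ∞ k w := fun w hw =>
    (h.contDiffAt_fderiv hw).clm_apply contDiffAt_const
  have hk2 : DifferentiableAt ℝ (fderiv ℝ k) z :=
    ((hkd z hz).fderiv_right (m := ∞) (by simp)).differentiableAt (by simp)
  have key : ∀ a b : Euc 4, fderiv ℝ (vHess Q) z (0, a) b v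
      = 1 / 2 * fderiv ℝ (fderiv ℝ k) z (0, a) (0, b) := by
    intro a b
    have h1 : (fun w => vHess Q w b v) =ᶠ[𝓝 z] fun w => 1 / 2 * fderiv ℝ k w (0, b) := by
      filter_upwards [h.isOpen.mem_nhds hz] with w hw
      rw [vHess_apply, hk, fderiv_clm_apply ((h.contDiffAt_fderiv hw).differentiableAt (by simp))
        (differentiableAt_const _)]
      simp
    have h2 := (h.hasFDerivAt_vHess_apply hz b v).unique
      (((hk2.hasFDerivAt.clm_apply (hasFDerivAt_const ((0 : Euc 4), b) z)).const_mul
        (1 / 2)).congr_of_eventuallyEq h1)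
    refine (congrArg (fun A : Euc 4 × Euc 4 →L[ℝ] ℝ => A (0, a)) h2).trans ?_
    simp
  rw [key, key, ((hkd z hz).isSymmSndFDerivAt (by simp; norm_cast)).eq]

/-- For a function that is homogeneous of degree two, the vertical connection annihilates the
tautological vector. -/
theorem cartanConn_vertical (euler : ∀ w ∈ D, ∀ v, vHess Q w w.2 v = 1 / 2 * fderiv ℝ Q w (0, v))
    (hz : z ∈ D) (η : Euc 4) : cartanConn Q z (0, η) z.2 = 0 := by
  -- Differentiating `g(y,v) = ½ ∂_v Q` vertically along `a` gives `(∂_a g)(y,v) + g(a,v)` on the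
  -- left and `g(a,v)` on the right.
  have h0 : ∀ a v, fderiv ℝ (vHess Q) z (0, a) z.2 v = 0 := by
    intro a v
    have h1 : (fun w => vHess Q w w.2 v) =ᶠ[𝓝 z] fun w => 1 / 2 * fderiv ℝ Q w (0, v) := by
      filter_upwards [h.isOpen.mem_nhds hz] with w hw using euler w hw v
    have h2 := (((h.hasFDerivAt_vHess hz).clm_apply hasFDerivAt_snd).clm_apply
      (hasFDerivAt_const v z)).unique
      (((((h.contDiffAt_fderiv hz).differentiableAt (by simp)).hasFDerivAt.clm_apply
        (hasFDerivAt_const ((0 : Euc 4), v) z)).const_mul (1 / 2)).congr_of_eventuallyEq h1)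
    have h3 := congrArg (fun A : Euc 4 × Euc 4 →L[ℝ] ℝ => A (0, a)) h2
    simp [vHess_apply] at h3
    linarith
  apply (h.nondegenerate z hz).ext
  intro v
  rw [cartanConn, (h.nondegenerate z hz).apply_raise]
  simp only [add_apply, koszul_apply, map_zero, zero_apply, verK, ContinuousLinearMap.comp_apply,
    ContinuousLinearMap.inr_apply, zero_add]
  -- The first Koszul term differentiates along `y`. Total symmetry moves `y` into the metric, where
  -- it is annihilated like in the other two terms.
  rw [h.fderiv_vHess_vertical_swap hz z.2 η, h0, h0]
  simp

end IsMetricDomain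

/-! ### Behaviour under changes of charts -/

/-- The map of induced coordinates given by a change of coordinates. -/
def tanMap (ψ : Euc 4 → Euc 4) (z : Euc 4 × Euc 4) : Euc 4 × Euc 4 := (ψ z.1, fderiv ℝ ψ z.1 z.2)

/-- The derivative of the change of induced coordinates. -/
def dT (ψ : Euc 4 → Euc 4) (w : Euc 4 × Euc 4) : Euc 4 × Euc 4 →L[ℝ] Euc 4 × Euc 4 :=
  ((fderiv ℝ ψ w.1).comp (ContinuousLinearMap.fst ℝ (Euc 4) (Euc 4))).prod
    (((fderiv ℝ (fderiv ℝ ψ) w.1).flip w.2).comp (ContinuousLinearMap.fst ℝ (Euc 4) (Euc 4)) +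
      (fderiv ℝ ψ w.1).comp (ContinuousLinearMap.snd ℝ (Euc 4) (Euc 4)))

theorem dT_apply (ψ : Euc 4 → Euc 4) (w ζ : Euc 4 × Euc 4) : dT ψ w ζ =
    (fderiv ℝ ψ w.1 ζ.1, fderiv ℝ (fderiv ℝ ψ) w.1 ζ.1 w.2 + fderiv ℝ ψ w.1 ζ.2) := rfl

theorem hasFDerivAt_tanMap {ψ : Euc 4 → Euc 4} {w : Euc 4 × Euc 4} (hψ : ContDiffAt ℝ ∞ ψ w.1) :
    HasFDerivAt (tanMap ψ) (dT ψ w) w := by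
  have h1 : HasFDerivAt (fun w : Euc 4 × Euc 4 => ψ w.1)
      ((fderiv ℝ ψ w.1).comp (ContinuousLinearMap.fst ℝ (Euc 4) (Euc 4))) w :=
    (hψ.differentiableAt (by simp)).hasFDerivAt.comp w hasFDerivAt_fst
  have h2 : HasFDerivAt (fun w : Euc 4 × Euc 4 => fderiv ℝ ψ w.1)
      ((fderiv ℝ (fderiv ℝ ψ) w.1).comp (ContinuousLinearMap.fst ℝ (Euc 4) (Euc 4))) w :=
    ((hψ.fderiv_right (m := ∞) (by simp)).differentiableAt (by simp)).hasFDerivAt.comp w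
      hasFDerivAt_fst
  refine (h1.prodMk (h2.clm_apply hasFDerivAt_snd)).congr_fderiv ?_
  ext ζ <;> simp [dT_apply]

/-- On `W`, the function `Q` is the pull back of `Q'` under a change of coordinates. -/
structure IsChartChange (Q Q' : Euc 4 × Euc 4 → ℝ) (D D' W : Set (Euc 4 × Euc 4))
    (ψ : Euc 4 → Euc 4) : Prop where
  left : IsMetricDomain Q D
  right : IsMetricDomain Q' D'
  isOpen : IsOpen W
  subset : W ⊆ D
  maps : ∀ w ∈ W, tanMap ψ w ∈ D'
  eq : ∀ w ∈ W, Q w = Q' (tanMap ψ w)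
  smooth : ∀ w ∈ W, ContDiffAt ℝ ∞ ψ w.1
  surjective : ∀ w ∈ W, Function.Surjective (fderiv ℝ ψ w.1)

namespace IsChartChange

variable {Q Q' : Euc 4 × Euc 4 → ℝ} {D D' W : Set (Euc 4 × Euc 4)} {ψ : Euc 4 → Euc 4}
  (h : IsChartChange Q Q' D D' W ψ) {w : Euc 4 × Euc 4}
include h

theorem contDiffAt_fderiv (hw : w ∈ W) : ContDiffAt ℝ ∞ (fderiv ℝ ψ) w.1 :=
  (h.smooth w hw).fderiv_right (by simp)

theorem hasFDerivAt_jac (hw : w ∈ W) : HasFDerivAt (fun w : Euc 4 × Euc 4 => fderiv ℝ ψ w.1)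
    ((fderiv ℝ (fderiv ℝ ψ) w.1).comp (ContinuousLinearMap.fst ℝ (Euc 4) (Euc 4))) w :=
  ((h.contDiffAt_fderiv hw).differentiableAt (by simp)).hasFDerivAt.comp w hasFDerivAt_fst

theorem hess_swap (hw : w ∈ W) (u v : Euc 4) :
    fderiv ℝ (fderiv ℝ ψ) w.1 u v = fderiv ℝ (fderiv ℝ ψ) w.1 v u :=
  ((h.smooth w hw).isSymmSndFDerivAt (by simp; norm_cast)).eq u v

theorem hasFDerivAt_tanMap (hw : w ∈ W) : HasFDerivAt (tanMap ψ) (dT ψ w) w :=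
  FinslerCartan.hasFDerivAt_tanMap (h.smooth w hw)

theorem fderiv_eq (hw : w ∈ W) (ζ : Euc 4 × Euc 4) :
    fderiv ℝ Q w ζ = fderiv ℝ Q' (tanMap ψ w) (dT ψ w ζ) := by
  have h1 : Q =ᶠ[𝓝 w] fun w => Q' (tanMap ψ w) := by
    filter_upwards [h.isOpen.mem_nhds hw] with w' hw' using h.eq w' hw'
  have h2 := ((h.right.smooth _ (h.maps w hw)).differentiableAt (by simp)).hasFDerivAt.comp w
    (h.hasFDerivAt_tanMap hw)
  rw [h1.fderiv_eq]
  exact congrArg (fun A : Euc 4 × Euc 4 →L[ℝ] ℝ => A ζ) h2.fderiv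

/-- With a vertical second argument the chain rule involves `ψ` only up to its second derivative.
Vertical second arguments suffice both for the metric and for the spray. -/
theorem fderiv₂_eq (hw : w ∈ W) (ζ : Euc 4 × Euc 4) (v : Euc 4) :
    fderiv ℝ (fderiv ℝ Q) w ζ (0, v) =
      fderiv ℝ (fderiv ℝ Q') (tanMap ψ w) (dT ψ w ζ) (0, fderiv ℝ ψ w.1 v) +
        fderiv ℝ Q' (tanMap ψ w) (0, fderiv ℝ (fderiv ℝ ψ) w.1 ζ.1 v) := by
  have h1 : (fun w => fderiv ℝ Q w (0, v)) =ᶠ[𝓝 w] fun w => fderiv ℝ Q' (tanMap ψ w)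
      (ContinuousLinearMap.inr ℝ (Euc 4) (Euc 4) (fderiv ℝ ψ w.1 v)) := by
    filter_upwards [h.isOpen.mem_nhds hw] with w' hw'
    rw [h.fderiv_eq hw', dT_apply]; simp
  have e1 := ((h.left.contDiffAt_fderiv (h.subset hw)).differentiableAt
    (by simp)).hasFDerivAt.clm_apply (hasFDerivAt_const ((0 : Euc 4), v) w)
  have e2 := (((h.right.contDiffAt_fderiv (h.maps w hw)).differentiableAt
    (by simp)).hasFDerivAt.comp w (h.hasFDerivAt_tanMap hw)).clm_apply
    ((ContinuousLinearMap.inr ℝ (Euc 4) (Euc 4)).hasFDerivAt.comp w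
      ((h.hasFDerivAt_jac hw).clm_apply (hasFDerivAt_const v w)))
  have e3 := congrArg (fun A : Euc 4 × Euc 4 →L[ℝ] ℝ => A ζ)
    (e1.unique (e2.congr_of_eventuallyEq h1))
  simp at e3
  rw [e3]; ring

theorem vHess_eq (hw : w ∈ W) (u v : Euc 4) :
    vHess Q w u v = vHess Q' (tanMap ψ w) (fderiv ℝ ψ w.1 u) (fderiv ℝ ψ w.1 v) := by
  rw [vHess_apply, vHess_apply, h.fderiv₂_eq hw, dT_apply]
  simp only [map_zero, zero_apply, zero_add]
  rw [← Prod.zero_eq_mk, map_zero, add_zero]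

/-- Both sides are tested against `ψ' v`. The first-order terms containing `D²ψ (y, v)` cancel by
symmetry of `D²ψ`. What remains comes from the vertical component `D²ψ (y, y)` of the transformed
vector `(y, 0)`; it has the factor two because the metric is half of the Hessian. -/
theorem spray_eq (hw : w ∈ W) : fderiv ℝ ψ w.1 (spray Q w) =
    spray Q' (tanMap ψ w) + (2 : ℝ) • fderiv ℝ (fderiv ℝ ψ) w.1 w.2 w.2 := by
  apply (h.right.nondegenerate _ (h.maps w hw)).ext
  intro v'
  obtain ⟨v, rfl⟩ := h.surjective w hw v'
  rw [← h.vHess_eq hw, spray, spray, (h.left.nondegenerate _ (h.subset hw)).apply_raise, map_add,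
    add_apply, (h.right.nondegenerate _ (h.maps w hw)).apply_raise, sprayForm_apply,
    sprayForm_apply, h.fderiv₂_eq hw, h.fderiv_eq hw, dT_apply, dT_apply, map_smul, smul_apply,
    vHess_apply, h.hess_swap hw v w.2]
  have e1 : ∀ a b : Euc 4, (a, b) = (a, (0 : Euc 4)) + ((0 : Euc 4), b) := by simp
  simp only [map_zero, add_zero]
  rw [e1 (fderiv ℝ ψ w.1 w.2), e1 (fderiv ℝ ψ w.1 v) (fderiv ℝ (fderiv ℝ ψ) w.1 w.2 v), map_add,
    map_add, add_apply]
  simp only [tanMap, smul_eq_mul]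
  ring

/-- The vertical derivative of the law for `spray`. Derivatives of `D²ψ` do not appear, since the
direction `(0, u)` leaves the base point fixed. Differentiating `2 D²ψ (y, y)` yields a factor four,
compensated by the quarter in `nonlin`. -/
theorem nonlin_eq (hw : w ∈ W) (u : Euc 4) : fderiv ℝ ψ w.1 (nonlin Q w u) =
    nonlin Q' (tanMap ψ w) (fderiv ℝ ψ w.1 u) + fderiv ℝ (fderiv ℝ ψ) w.1 w.2 u := by
  have h1 : (fun w => fderiv ℝ ψ w.1 (spray Q w)) =ᶠ[𝓝 w] fun w =>
      spray Q' (tanMap ψ w) + (2 : ℝ) • fderiv ℝ (fderiv ℝ ψ) w.1 w.2 w.2 := by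
    filter_upwards [h.isOpen.mem_nhds hw] with w' hw' using h.spray_eq hw'
  have e1 := (h.hasFDerivAt_jac hw).clm_apply
    ((h.left.contDiffAt_spray (h.subset hw)).differentiableAt (by simp)).hasFDerivAt
  have e2 := ((h.right.contDiffAt_spray (h.maps w hw)).differentiableAt
    (by simp)).hasFDerivAt.comp w (h.hasFDerivAt_tanMap hw)
  have e3 : HasFDerivAt (fun w : Euc 4 × Euc 4 => fderiv ℝ (fderiv ℝ ψ) w.1)
      ((fderiv ℝ (fderiv ℝ (fderiv ℝ ψ)) w.1).comp (ContinuousLinearMap.fst ℝ (Euc 4) (Euc 4))) w :=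
    (((h.contDiffAt_fderiv hw).fderiv_right (m := ∞) (by simp)).differentiableAt
      (by simp)).hasFDerivAt.comp w hasFDerivAt_fst
  have e4 := e2.add (((e3.clm_apply hasFDerivAt_snd).clm_apply hasFDerivAt_snd).const_smul (2 : ℝ))
  have e5 := congrArg (fun A : Euc 4 × Euc 4 →L[ℝ] Euc 4 => A (0, u))
    (e1.unique (e4.congr_of_eventuallyEq h1))
  simp [dT_apply] at e5
  simp only [nonlin, smul_apply, ContinuousLinearMap.comp_apply, ContinuousLinearMap.inr_apply,
    map_smul]
  rw [e5, h.hess_swap hw u w.2]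
  module

theorem fderiv_vHess_eq (hw : w ∈ W) (ζ : Euc 4 × Euc 4) (u v : Euc 4) :
    fderiv ℝ (vHess Q) w ζ u v =
      fderiv ℝ (vHess Q') (tanMap ψ w) (dT ψ w ζ) (fderiv ℝ ψ w.1 u) (fderiv ℝ ψ w.1 v) +
      vHess Q' (tanMap ψ w) (fderiv ℝ (fderiv ℝ ψ) w.1 ζ.1 u) (fderiv ℝ ψ w.1 v) +
      vHess Q' (tanMap ψ w) (fderiv ℝ ψ w.1 u) (fderiv ℝ (fderiv ℝ ψ) w.1 ζ.1 v) := by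
  have h1 : (fun w => vHess Q w u v) =ᶠ[𝓝 w] fun w =>
      vHess Q' (tanMap ψ w) (fderiv ℝ ψ w.1 u) (fderiv ℝ ψ w.1 v) := by
    filter_upwards [h.isOpen.mem_nhds hw] with w' hw' using h.vHess_eq hw' u v
  have e1 := h.left.hasFDerivAt_vHess_apply (h.subset hw) u v
  have e2 := (((h.right.hasFDerivAt_vHess (h.maps w hw)).comp w (h.hasFDerivAt_tanMap hw)).clm_apply
    ((h.hasFDerivAt_jac hw).clm_apply (hasFDerivAt_const u w))).clm_apply
    ((h.hasFDerivAt_jac hw).clm_apply (hasFDerivAt_const v w))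
  have e3 := congrArg (fun A : Euc 4 × Euc 4 →L[ℝ] ℝ => A ζ)
    (e1.unique (e2.congr_of_eventuallyEq h1))
  simp at e3
  rw [e3]; ring

/-- The transformation law of the Cartan connection. -/
theorem cartanConn_eq (hw : w ∈ W) (ξ : Euc 4 × Euc 4) (f : Euc 4) :
    cartanConn Q' (tanMap ψ w) (dT ψ w ξ) (fderiv ℝ ψ w.1 f) +
      fderiv ℝ (fderiv ℝ ψ) w.1 ξ.1 f = fderiv ℝ ψ w.1 (cartanConn Q w ξ f) := by
  -- The change of coordinates preserves the splitting into horizontal and vertical vectors; this is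
  -- the law for `nonlin` in another form.
  have hor : ∀ u, dT ψ w (horLift Q w u) = horLift Q' (tanMap ψ w) (fderiv ℝ ψ w.1 u) := by
    intro u
    rw [dT_apply]
    refine Prod.ext rfl ?_
    have := h.nonlin_eq hw u
    simp only [horLift, ContinuousLinearMap.prod_apply, neg_apply, map_neg, this,
      ContinuousLinearMap.id_apply, h.hess_swap hw u w.2]
    abel
  have ver : ∀ u : Euc 4, dT ψ w (0, u) = (0, fderiv ℝ ψ w.1 u) := fun u => by
    rw [dT_apply]; simp
  -- As for the Levi-Civita connection, the second derivatives of `ψ` contributed by the three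
  -- metric derivatives combine into a single inhomogeneous term. The vertical part has none.
  have hkos : ∀ u v, koszul (horK Q w) f u v = koszul (horK Q' (tanMap ψ w)) (fderiv ℝ ψ w.1 f)
      (fderiv ℝ ψ w.1 u) (fderiv ℝ ψ w.1 v) +
      vHess Q' (tanMap ψ w) (fderiv ℝ (fderiv ℝ ψ) w.1 u f) (fderiv ℝ ψ w.1 v) := by
    intro u v
    have hl : ∀ u, (horLift Q w u).1 = u := fun u => rfl
    have s := h.right.symm (h.maps w hw)
    rw [koszul_apply, koszul_apply]
    simp only [horK, ContinuousLinearMap.comp_apply, h.fderiv_vHess_eq hw, hor, hl]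
    rw [h.hess_swap hw f u, h.hess_swap hw f v, h.hess_swap hw u v,
      s (fderiv ℝ ψ w.1 u) (fderiv ℝ (fderiv ℝ ψ) w.1 v f),
      s (fderiv ℝ ψ w.1 f) (fderiv ℝ (fderiv ℝ ψ) w.1 v u)]
    ring
  have vkos : ∀ u v, koszul (verK Q w) f u v = koszul (verK Q' (tanMap ψ w)) (fderiv ℝ ψ w.1 f)
      (fderiv ℝ ψ w.1 u) (fderiv ℝ ψ w.1 v) := by
    intro u v
    rw [koszul_apply, koszul_apply]
    simp only [verK, ContinuousLinearMap.comp_apply, ContinuousLinearMap.inr_apply,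
      h.fderiv_vHess_eq hw, ver]
    simp
  apply (h.right.nondegenerate _ (h.maps w hw)).ext
  intro v'
  obtain ⟨v, rfl⟩ := h.surjective w hw v'
  rw [← h.vHess_eq hw, map_add, add_apply, cartanConn, cartanConn,
    (h.left.nondegenerate _ (h.subset hw)).apply_raise,
    (h.right.nondegenerate _ (h.maps w hw)).apply_raise, add_apply, add_apply, hkos, vkos]
  have hθ : fderiv ℝ ψ w.1 (nonlin Q w ξ.1 + ξ.2) =
      nonlin Q' (tanMap ψ w) (dT ψ w ξ).1 + (dT ψ w ξ).2 := by
    rw [map_add, h.nonlin_eq hw, dT_apply, h.hess_swap hw ξ.1 w.2]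
    exact add_assoc _ _ _
  rw [hθ, dT_apply]
  ring

end IsChartChange

/-! ### The Finsler metric of a time-oriented spacetime in induced coordinates -/

section Coordinates

variable {M : Type*} [TopologicalSpace M] [ChartedSpace (Euc 4) M] [IsManifold (𝓡 4) ∞ M]
  {FS : FinslerSpacetime M} {φ φ' : OpenPartialHomeomorph M (Euc 4)}

namespace TimeOrientation

variable (T : TimeOrientation FS)

/-- The induced coordinates of the vectors in the cone. -/
def coordDomain (φ : OpenPartialHomeomorph M (Euc 4)) : Set (Euc 4 × Euc 4) :=
  {z | z.1 ∈ φ.target ∧ tpoint φ z ∈ T.cone}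

variable {T}

theorem tcoord_mem_coordDomain (hφ : φ ∈ IsManifold.maximalAtlas (𝓡 4) ∞ M)
    {v : TangentBundle (𝓡 4) M} (hv : v.proj ∈ φ.source) (hc : v ∈ T.cone) :
    tcoord φ v ∈ T.coordDomain φ :=
  ⟨tcoord_fst_mem hv, by rwa [tpoint_tcoord hφ hv]⟩

theorem isOpen_coordDomain (hφ : φ ∈ IsManifold.maximalAtlas (𝓡 4) ∞ M) :
    IsOpen (T.coordDomain φ) :=
  (contMDiffOn_tpoint hφ).continuousOn.isOpen_inter_preimage (isOpen_fst_target φ) T.isOpen_cone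

theorem contDiffAt_coordF (hφ : φ ∈ IsManifold.maximalAtlas (𝓡 4) ∞ M) {z : Euc 4 × Euc 4}
    (hz : z ∈ T.coordDomain φ) : ContDiffAt ℝ ∞ (fun z => FS.F (tpoint φ z)) z := by
  rw [← contMDiffAt_iff_contDiffAt]
  exact (FS.contMDiffAt_F hz.2.1).comp z
    ((contMDiffOn_tpoint hφ).contMDiffAt ((isOpen_fst_target φ).mem_nhds hz.1))

theorem contDiffAt_coordSq (hφ : φ ∈ IsManifold.maximalAtlas (𝓡 4) ∞ M) {z : Euc 4 × Euc 4}
    (hz : z ∈ T.coordDomain φ) : ContDiffAt ℝ ∞ (coordSq FS.F φ) z :=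
  (contDiffAt_coordF hφ hz).pow 2

theorem vHess_eq_finslerMetric (hφ : φ ∈ IsManifold.maximalAtlas (𝓡 4) ∞ M) {z : Euc 4 × Euc 4}
    (hz : z ∈ T.coordDomain φ) (u v : Euc 4) :
    vHess (coordSq FS.F φ) z u v =
      finslerMetric FS.F (tpoint φ z) (chartEquiv hφ hz.1 u) (chartEquiv hφ hz.1 v) := by
  rw [← hess_eq_vHess (contDiffAt_coordSq hφ hz)]
  exact (fiberHessian_tpoint (fun w => FS.F w ^ 2) hφ hz.1 u v).symm

theorem vHess_tcoord (hφ : φ ∈ IsManifold.maximalAtlas (𝓡 4) ∞ M) {v : TangentBundle (𝓡 4) M}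
    (hv : v.proj ∈ φ.source) (hc : v ∈ T.cone) (u w : TangentSpace (𝓡 4) v.proj) :
    vHess (coordSq FS.F φ) (tcoord φ v) (mfderiv (𝓡 4) (𝓡 4) φ v.proj u)
      (mfderiv (𝓡 4) (𝓡 4) φ v.proj w) = finslerMetric FS.F v u w := by
  have hz := tcoord_mem_coordDomain hφ hv hc
  have h1 := vHess_eq_finslerMetric hφ hz (mfderiv (𝓡 4) (𝓡 4) φ v.proj u)
    (mfderiv (𝓡 4) (𝓡 4) φ v.proj w)
  have h2 : ∀ u : TangentSpace (𝓡 4) v.proj,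
      chartEquiv hφ hz.1 (mfderiv (𝓡 4) (𝓡 4) φ v.proj u) = u := fun u =>
    congrArg (fun A => A u) ((mdifferentiable_of_mem_maximalAtlas hφ).symm_comp_deriv hv)
  have h3 : ∀ (t : TangentBundle (𝓡 4) M) (a b a' b' : Euc 4), t = v → a = a' → b = b' →
      finslerMetric FS.F t a b = finslerMetric FS.F v a' b' := by
    rintro _ _ _ _ _ rfl rfl rfl; rfl
  exact h1.trans (h3 _ _ _ _ _ (tpoint_tcoord hφ hv) (h2 u) (h2 w))

theorem isTimelike_vHess (hφ : φ ∈ IsManifold.maximalAtlas (𝓡 4) ∞ M) {z : Euc 4 × Euc 4}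
    (hz : z ∈ T.coordDomain φ) : IsTimelike (vHess (coordSq FS.F φ) z) z.2 := by
  have h := FS.isTimelike_finslerMetric (T.cone_subset hz.2)
  have e := vHess_eq_finslerMetric hφ hz
  refine ⟨by rw [e]; exact h.pos, fun v hv h0 => ?_⟩
  rw [e] at h0 ⊢
  exact h.neg _ (fun h1 => hv ((chartEquiv hφ hz.1).map_eq_zero_iff.1 h1)) h0

theorem isMetricDomain (hφ : φ ∈ IsManifold.maximalAtlas (𝓡 4) ∞ M) :
    IsMetricDomain (coordSq FS.F φ) (T.coordDomain φ) where
  isOpen := isOpen_coordDomain hφ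
  smooth _ hz := contDiffAt_coordSq hφ hz
  nondegenerate _ hz := (isTimelike_vHess hφ hz).isNondegenerate (vHess_symm (contDiffAt_coordSq hφ hz))

theorem vHess_self (hφ : φ ∈ IsManifold.maximalAtlas (𝓡 4) ∞ M) {z : Euc 4 × Euc 4}
    (hz : z ∈ T.coordDomain φ) (v : Euc 4) :
    vHess (coordSq FS.F φ) z z.2 v = 1 / 2 * fderiv ℝ (coordSq FS.F φ) z (0, v) := by
  have h1 := ((FS.isHomogeneous (φ.symm z.1)).comp (chartEquiv hφ hz.1)).hess_finsler_self
    (F := fun y => FS.F (tpoint φ (z.1, y))) (fun y => FS.F_eq (tpoint φ (z.1, y)))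
    (y := z.2) hz.2.1 v
  have hs := contDiffAt_coordSq hφ hz
  rw [← hess_eq_vHess hs]
  refine h1.trans ?_
  have h2 : HasFDerivAt (fun y => coordSq FS.F φ (z.1, y)) _ z.2 :=
    HasFDerivAt.comp z.2 (f := fun y : Euc 4 => (z.1, y)) (g := coordSq FS.F φ)
      (hs.differentiableAt (by simp)).hasFDerivAt (hasFDerivAt_prodMk_right z.1 z.2)
  congr 1
  exact congrArg (fun A : Euc 4 →L[ℝ] ℝ => A v) h2.fderiv

theorem vHess_self_self (hφ : φ ∈ IsManifold.maximalAtlas (𝓡 4) ∞ M) {z : Euc 4 × Euc 4}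
    (hz : z ∈ T.coordDomain φ) : vHess (coordSq FS.F φ) z z.2 z.2 = FS.F (tpoint φ z) ^ 2 := by
  rw [vHess_eq_finslerMetric hφ hz]
  exact FS.finslerMetric_self_self (T.cone_subset hz.2)

theorem tcoord_eq_tanMap (hφ : φ ∈ IsManifold.maximalAtlas (𝓡 4) ∞ M)
    (hφ' : φ' ∈ IsManifold.maximalAtlas (𝓡 4) ∞ M) {v : TangentBundle (𝓡 4) M}
    (hv : v.proj ∈ φ.source) (hv' : v.proj ∈ φ'.source) :
    tcoord φ' v = tanMap (fun x => φ' (φ.symm x)) (tcoord φ v) := tcoord_change hφ hφ' hv hv'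

theorem isChartChange (hφ : φ ∈ IsManifold.maximalAtlas (𝓡 4) ∞ M)
    (hφ' : φ' ∈ IsManifold.maximalAtlas (𝓡 4) ∞ M) :
    IsChartChange (coordSq FS.F φ) (coordSq FS.F φ') (T.coordDomain φ) (T.coordDomain φ')
      (T.coordDomain φ ∩ {z | z.1 ∈ (φ.symm.trans φ').source}) (fun x => φ' (φ.symm x)) := by
  have hs : ∀ x ∈ (φ.symm.trans φ').source, ContDiffAt ℝ ∞ (fun x => φ' (φ.symm x)) x := by
    intro x hx
    rw [← contMDiffAt_iff_contDiffAt]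
    rw [OpenPartialHomeomorph.trans_source] at hx
    exact ((contMDiffOn_of_mem_maximalAtlas hφ').contMDiffAt (φ'.open_source.mem_nhds hx.2)).comp x
      ((contMDiffOn_symm_of_mem_maximalAtlas hφ).contMDiffAt (φ.open_target.mem_nhds hx.1))
  have ht : ∀ w ∈ T.coordDomain φ ∩ {z | z.1 ∈ (φ.symm.trans φ').source},
      tanMap (fun x => φ' (φ.symm x)) w = tcoord φ' (tpoint φ w) ∧
        (tpoint φ w).proj ∈ φ'.source := by
    intro w hw
    have h2 : w.1 ∈ (φ.symm.trans φ').source := hw.2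
    rw [OpenPartialHomeomorph.trans_source] at h2
    have h3 : (tpoint φ w).proj ∈ φ'.source := h2.2
    refine ⟨?_, h3⟩
    rw [tcoord_eq_tanMap hφ hφ' (tpoint_proj_mem hw.1.1) h3, tcoord_tpoint hφ hw.1.1]
  refine ⟨isMetricDomain hφ, isMetricDomain hφ', ?_, Set.inter_subset_left, ?_, ?_,
    fun w hw => hs _ hw.2, ?_⟩
  · exact (isOpen_coordDomain hφ).inter ((φ.symm.trans φ').open_source.preimage continuous_fst)
  · intro w hw
    rw [(ht w hw).1]
    exact tcoord_mem_coordDomain hφ' (ht w hw).2 hw.1.2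
  · intro w hw
    rw [(ht w hw).1]
    change FS.F (tpoint φ w) ^ 2 = FS.F (tpoint φ' (tcoord φ' (tpoint φ w))) ^ 2
    rw [tpoint_tcoord hφ' (ht w hw).2]
  · intro w hw v
    have h3 := (ht w hw).2
    -- A preimage under the Jacobian is found without inverting it: take the tangent vector with
    -- components `v` in the second chart and read off its components in the first.
    set t := tpoint φ' (φ' (φ.symm w.1), v) with ht
    have h4 : t.proj = φ.symm w.1 := φ'.left_inv h3
    have h5 : (tcoord φ t).1 = w.1 := (congrArg φ h4).trans (φ.right_inv hw.1.1)
    have h6 := tcoord_change hφ hφ' (v := t) (by rw [h4]; exact φ.map_target hw.1.1)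
      (by rw [h4]; exact h3)
    refine ⟨(tcoord φ t).2, ?_⟩
    rw [tcoord_tpoint hφ' (φ'.map_source h3), h5] at h6
    exact (congrArg Prod.snd h6).symm

end TimeOrientation

end Coordinates

/-! ### Submanifolds of products of the tangent bundle -/

section SliceCharts

variable {M : Type*} [TopologicalSpace M] [ChartedSpace (Euc 4) M] [IsManifold (𝓡 4) ∞ M]
  {S : Type*} [TopologicalSpace S] {ι : Type*} [Fintype ι] {n : ℕ}

/-- A chart of `S` that is smooth as a map from and to the product of copies of `TM` into which
`S` is mapped by `inc`. -/
structure IsSliceChart (inc : ι → S → TangentBundle (𝓡 4) M) (e : OpenPartialHomeomorph S (Euc n)) :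
    Prop where
  exists_coord : ∃ φ ∈ IsManifold.maximalAtlas (𝓡 4) ∞ M, ∃ R : (ι → Euc 4 × Euc 4) → Euc n,
    ∀ s ∈ e.source, (∀ i, (inc i s).proj ∈ φ.source) ∧
      ContDiffAt ℝ ∞ R (fun i => tcoord φ (inc i s)) ∧ e s = R (fun i => tcoord φ (inc i s))
  smooth_symm : ∀ i, ContMDiffOn (𝓡 n) (𝓡 4).tangent ∞ (fun u => inc i (e.symm u)) e.target

variable {inc : ι → S → TangentBundle (𝓡 4) M}

theorem contMDiffAt_tcoord {φ : OpenPartialHomeomorph M (Euc 4)}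
    (hφ : φ ∈ IsManifold.maximalAtlas (𝓡 4) ∞ M) {v : TangentBundle (𝓡 4) M}
    (hv : v.proj ∈ φ.source) :
    ContMDiffAt (𝓡 4).tangent 𝓘(ℝ, Euc 4 × Euc 4) ∞ (tcoord φ) v :=
  (contMDiffOn_tcoord hφ).contMDiffAt ((isOpen_proj_source φ).mem_nhds hv)

theorem contMDiffAt_tpoint {φ : OpenPartialHomeomorph M (Euc 4)}
    (hφ : φ ∈ IsManifold.maximalAtlas (𝓡 4) ∞ M) {z : Euc 4 × Euc 4} (hz : z.1 ∈ φ.target) :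
    ContMDiffAt 𝓘(ℝ, Euc 4 × Euc 4) (𝓡 4).tangent ∞ (tpoint φ) z :=
  (contMDiffOn_tpoint hφ).contMDiffAt ((isOpen_fst_target φ).mem_nhds hz)

section Maps

variable {E H N : Type*} [NormedAddCommGroup E] [NormedSpace ℝ E] [TopologicalSpace H]
  {J : ModelWithCorners ℝ E H} [TopologicalSpace N] [ChartedSpace H N] {g : N → S} {W : Set N}
  {x : N}

/-- A slice chart factors through the ambient coordinates by the smooth map `R`, so smoothness of a
map into `S` can be tested on its components in `TM`. -/
theorem IsSliceChart.contMDiffWithinAt_comp {e : OpenPartialHomeomorph S (Euc n)}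
    (he : IsSliceChart inc e)
    (hg : ∀ i, ContMDiffWithinAt J (𝓡 4).tangent ∞ (fun y => inc i (g y)) W x)
    (hc : ContinuousWithinAt g W x) (hx : g x ∈ e.source) :
    ContMDiffWithinAt J (𝓡 n) ∞ (fun y => e (g y)) W x := by
  obtain ⟨φ, hφ, R, hR⟩ := he.exists_coord
  have h1 : ContMDiffWithinAt J 𝓘(ℝ, ι → Euc 4 × Euc 4) ∞
      (fun y i => tcoord φ (inc i (g y))) W x := by
    rw [contMDiffWithinAt_pi_space]
    exact fun i => (contMDiffAt_tcoord hφ ((hR _ hx).1 i)).comp_contMDiffWithinAt x (hg i)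
  have h2 := (hR _ hx).2.1.contMDiffAt.comp_contMDiffWithinAt x h1
  refine h2.congr_of_eventuallyEq ?_ (hR _ hx).2.2
  filter_upwards [hc (e.open_source.mem_nhds hx)] with y hy using (hR _ hy).2.2

end Maps

/-- The charts of `S` are all slice charts. -/
structure IsSliceAtlas [ChartedSpace (Euc n) S] (inc : ι → S → TangentBundle (𝓡 4) M) : Prop where
  inducing : Topology.IsInducing (fun s i => inc i s)
  mem_atlas_iff : ∀ e : OpenPartialHomeomorph S (Euc n),
    e ∈ atlas (Euc n) S ↔ IsSliceChart inc e

/-- The charted space structure whose charts are all slice charts. -/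
@[reducible]
def sliceChartedSpace (inc : ι → S → TangentBundle (𝓡 4) M)
    (h : ∀ s, ∃ e : OpenPartialHomeomorph S (Euc n), IsSliceChart inc e ∧ s ∈ e.source) :
    ChartedSpace (Euc n) S where
  atlas := {e | IsSliceChart inc e}
  chartAt s := (h s).choose
  mem_chart_source s := (h s).choose_spec.2
  chart_mem_atlas s := (h s).choose_spec.1

theorem isSliceAtlas_sliceChartedSpace (hi : Topology.IsInducing (fun s i => inc i s))
    (h : ∀ s, ∃ e : OpenPartialHomeomorph S (Euc n), IsSliceChart inc e ∧ s ∈ e.source) :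
    letI := sliceChartedSpace inc h
    IsSliceAtlas (n := n) inc :=
  letI := sliceChartedSpace inc h
  ⟨hi, fun _ => Iff.rfl⟩

namespace IsSliceAtlas

variable [ChartedSpace (Euc n) S] (h : IsSliceAtlas (n := n) inc)
include h

theorem continuous_inc (i : ι) : Continuous (inc i) :=
  (continuous_apply i).comp h.inducing.continuous

/-- Transition maps are `R'` after the ambient coordinates of an inverse chart. Any two slice charts
are therefore compatible, and no particular family has to be selected. -/
theorem isManifold : IsManifold (𝓡 n) ∞ S := by
  refine isManifold_of_contDiffOn _ _ _ fun e e' he he' => ?_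
  rw [h.mem_atlas_iff] at he he'
  have h1 : ContDiffOn ℝ ∞ (fun u => e' (e.symm u)) (e.symm.trans e').source := by
    rw [← contMDiffOn_iff_contDiffOn]
    intro u hu
    have hu' := hu
    rw [OpenPartialHomeomorph.trans_source] at hu'
    refine he'.contMDiffWithinAt_comp (g := e.symm) (fun i => ?_)
      (e.symm.continuousAt hu'.1).continuousWithinAt hu'.2
    exact ((he.smooth_symm i).contMDiffAt (e.open_target.mem_nhds hu'.1)).contMDiffWithinAt
  simpa [Function.comp_def] using h1

variable [IsManifold (𝓡 n) ∞ S]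

theorem mem_maximalAtlas {e : OpenPartialHomeomorph S (Euc n)} (he : IsSliceChart inc e) :
    e ∈ IsManifold.maximalAtlas (𝓡 n) ∞ S :=
  IsManifold.subset_maximalAtlas ((h.mem_atlas_iff e).2 he)

theorem isSliceChart_chartAt (s : S) : IsSliceChart inc (chartAt (Euc n) s) :=
  (h.mem_atlas_iff _).1 (chart_mem_atlas _ s)

theorem contMDiff_inc (i : ι) : ContMDiff (𝓡 n) (𝓡 4).tangent ∞ (inc i) := by
  intro s
  have he := h.isSliceChart_chartAt s
  set e := chartAt (Euc n) s
  have hs : s ∈ e.source := mem_chart_source _ s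
  have h1 : ContMDiffAt (𝓡 n) (𝓡 n) ∞ e s :=
    (contMDiffOn_of_mem_maximalAtlas (h.mem_maximalAtlas he)).contMDiffAt
      (e.open_source.mem_nhds hs)
  have h2 := ((he.smooth_symm i).contMDiffAt (e.open_target.mem_nhds (e.map_source hs))).comp s h1
  refine h2.congr_of_eventuallyEq ?_
  filter_upwards [e.open_source.mem_nhds hs] with t ht
  simp [e.left_inv ht]

section Maps

variable {E H N : Type*} [NormedAddCommGroup E] [NormedSpace ℝ E] [TopologicalSpace H]
  {J : ModelWithCorners ℝ E H} [TopologicalSpace N] [ChartedSpace H N] {g : N → S} {W : Set N}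
  {x : N}

/-- A map into `S` is smooth if its components in `TM` are. -/
theorem contMDiffWithinAt
    (hg : ∀ i, ContMDiffWithinAt J (𝓡 4).tangent ∞ (fun y => inc i (g y)) W x) :
    ContMDiffWithinAt J (𝓡 n) ∞ g W x := by
  have hc : ContinuousWithinAt g W x := by
    rw [h.inducing.continuousWithinAt_iff, continuousWithinAt_pi]
    exact fun i => (hg i).continuousWithinAt
  rw [contMDiffWithinAt_iff_target]
  refine ⟨hc, ?_⟩
  have := (h.isSliceChart_chartAt (g x)).contMDiffWithinAt_comp hg hc (mem_chart_source _ _)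
  simpa [Function.comp_def] using this

end Maps

/-- The injective differential of a slice chart factors through the differential of the ambient
coordinates of the inclusion. The latter is therefore injective as well, so slice charts make the
inclusion immersive. -/
theorem eq_zero_of_mfderiv_inc {s : S} {v : TangentSpace (𝓡 n) s}
    (hv : ∀ i, mfderiv (𝓡 n) (𝓡 4).tangent (inc i) s v = 0) : v = 0 := by
  have he := h.isSliceChart_chartAt s
  have hm := h.mem_maximalAtlas he
  set e := chartAt (Euc n) s
  have hs : s ∈ e.source := mem_chart_source _ s
  obtain ⟨φ, hφ, R, hR⟩ := he.exists_coord
  obtain ⟨hb, hR1, -⟩ := hR s hs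
  have hd : ∀ i, HasMFDerivAt (𝓡 n) 𝓘(ℝ, Euc 4 × Euc 4) (fun t => tcoord φ (inc i t)) s
      ((mfderiv (𝓡 4).tangent 𝓘(ℝ, Euc 4 × Euc 4) (tcoord φ) (inc i s)).comp
        (mfderiv (𝓡 n) (𝓡 4).tangent (inc i) s)) := fun i =>
    HasMFDerivAt.comp s ((contMDiffAt_tcoord hφ (hb i)).mdifferentiableAt (by simp)).hasMFDerivAt
      ((h.contMDiff_inc i).mdifferentiableAt (by simp)).hasMFDerivAt
  have h1 : ContMDiffAt (𝓡 n) 𝓘(ℝ, ι → Euc 4 × Euc 4) ∞ (fun t i => tcoord φ (inc i t)) s := by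
    rw [contMDiffAt_pi_space]
    exact fun i => (contMDiffAt_tcoord hφ (hb i)).comp s (h.contMDiff_inc i s)
  have h2 := (h1.mdifferentiableAt (by simp)).hasMFDerivAt
  set A : TangentSpace (𝓡 n) s →L[ℝ] (ι → Euc 4 × Euc 4) :=
    mfderiv (𝓡 n) 𝓘(ℝ, ι → Euc 4 × Euc 4) (fun t i => tcoord φ (inc i t)) s
  have h3 : A v = 0 := by
    funext i
    have h4 : HasMFDerivAt (𝓡 n) 𝓘(ℝ, Euc 4 × Euc 4) (fun t => tcoord φ (inc i t)) s
        ((ContinuousLinearMap.proj (R := ℝ) (φ := fun _ : ι => Euc 4 × Euc 4) i).comp A) :=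
      HasMFDerivAt.comp s
        (g := (ContinuousLinearMap.proj (R := ℝ) (φ := fun _ : ι => Euc 4 × Euc 4) i))
        (ContinuousLinearMap.hasMFDerivAt _) h2
    have h5 := congrArg (fun B => B v) (hasMFDerivAt_unique h4 (hd i))
    refine h5.trans ?_
    refine (congrArg _ (hv i)).trans (map_zero
      (mfderiv (𝓡 4).tangent 𝓘(ℝ, Euc 4 × Euc 4) (tcoord φ) (inc i s)))
  have h6 : HasMFDerivAt (𝓡 n) (𝓡 n) e s ((fderiv ℝ R (fun i => tcoord φ (inc i s))).comp A) := by
    have := HasMFDerivAt.comp s (f := fun t i => tcoord φ (inc i t))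
      (hR1.differentiableAt (by simp)).hasFDerivAt.hasMFDerivAt h2
    refine this.congr_of_eventuallyEq ?_
    filter_upwards [e.open_source.mem_nhds hs] with t ht using (hR t ht).2.2
  have hmd : e.MDifferentiable (𝓡 n) (𝓡 n) :=
    ⟨(contMDiffOn_of_mem_maximalAtlas hm).mdifferentiableOn (by simp),
      (contMDiffOn_symm_of_mem_maximalAtlas hm).mdifferentiableOn (by simp)⟩
  have h7 : mfderiv (𝓡 n) (𝓡 n) e s v = 0 := by
    rw [h6.mfderiv]
    exact (congrArg _ h3).trans (map_zero (fderiv ℝ R (fun i => tcoord φ (inc i s))))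
  exact (hmd.mfderiv_injective hs) (h7.trans (map_zero _).symm)

theorem eq_zero_of_mfderiv_tcoord {φ : OpenPartialHomeomorph M (Euc 4)}
    (hφ : φ ∈ IsManifold.maximalAtlas (𝓡 4) ∞ M) {s : S} (hs : ∀ i, (inc i s).proj ∈ φ.source)
    {v : TangentSpace (𝓡 n) s}
    (hv : ∀ i, mfderiv (𝓡 n) 𝓘(ℝ, Euc 4 × Euc 4) (fun t => tcoord φ (inc i t)) s v = 0) :
    v = 0 := by
  refine h.eq_zero_of_mfderiv_inc fun i => ?_
  have h1 : ContMDiffAt (𝓡 n) 𝓘(ℝ, Euc 4 × Euc 4) ∞ (fun t => tcoord φ (inc i t)) s :=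
    (contMDiffAt_tcoord hφ (hs i)).comp s (h.contMDiff_inc i s)
  have h2 := HasMFDerivAt.comp s (f := fun t => tcoord φ (inc i t))
    ((contMDiffAt_tpoint hφ (tcoord_fst_mem (hs i))).mdifferentiableAt (by simp)).hasMFDerivAt
    (h1.mdifferentiableAt (by simp)).hasMFDerivAt
  have h3 : inc i =ᶠ[𝓝 s] tpoint φ ∘ fun t => tcoord φ (inc i t) := by
    filter_upwards [((isOpen_proj_source φ).preimage (h.continuous_inc i)).mem_nhds (hs i)] with t ht
    exact (tpoint_tcoord hφ ht).symm
  rw [(h2.congr_of_eventuallyEq h3).mfderiv]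
  exact (congrArg _ (hv i)).trans (map_zero
    (mfderiv 𝓘(ℝ, Euc 4 × Euc 4) (𝓡 4).tangent (tpoint φ) (tcoord φ (inc i s))))

end IsSliceAtlas

/-- Smoothness of a map into the tangent bundle can be checked in induced coordinates. -/
theorem contMDiffWithinAt_of_tcoord {E H N : Type*} [NormedAddCommGroup E] [NormedSpace ℝ E]
    [TopologicalSpace H] {J : ModelWithCorners ℝ E H} [TopologicalSpace N] [ChartedSpace H N]
    {g : N → TangentBundle (𝓡 4) M} {W : Set N} {x : N} {φ : OpenPartialHomeomorph M (Euc 4)}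
    (hφ : φ ∈ IsManifold.maximalAtlas (𝓡 4) ∞ M) (hb : ∀ᶠ y in 𝓝[W] x, (g y).proj ∈ φ.source)
    (hx : (g x).proj ∈ φ.source)
    (hg : ContMDiffWithinAt J 𝓘(ℝ, Euc 4 × Euc 4) ∞ (fun y => tcoord φ (g y)) W x) :
    ContMDiffWithinAt J (𝓡 4).tangent ∞ g W x := by
  have h1 := (contMDiffAt_tpoint hφ (tcoord_fst_mem hx)).comp_contMDiffWithinAt x hg
  refine h1.congr_of_eventuallyEq ?_ (tpoint_tcoord hφ hx).symm
  filter_upwards [hb] with y hy using (tpoint_tcoord hφ hy).symm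

/-- The slice chart defined by a smooth function of the induced coordinates, with a given inverse. -/
def mkSliceChart (hi : Topology.IsInducing (fun s i => inc i s)) {φ : OpenPartialHomeomorph M (Euc 4)}
    (hφ : φ ∈ IsManifold.maximalAtlas (𝓡 4) ∞ M) (R : (ι → Euc 4 × Euc 4) → Euc n)
    (inv : Euc n → S) (U : Set S) (V : Set (Euc n)) (hU : IsOpen U) (hV : IsOpen V)
    (hb : ∀ s ∈ U, ∀ i, (inc i s).proj ∈ φ.source)
    (hR : ∀ s ∈ U, ContDiffAt ℝ ∞ R (fun i => tcoord φ (inc i s)))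
    (hinv : ∀ i, ContMDiffOn (𝓡 n) (𝓡 4).tangent ∞ (fun u => inc i (inv u)) V)
    (maps : ∀ s ∈ U, R (fun i => tcoord φ (inc i s)) ∈ V) (maps' : ∀ u ∈ V, inv u ∈ U)
    (left : ∀ s ∈ U, inv (R (fun i => tcoord φ (inc i s))) = s)
    (right : ∀ u ∈ V, R (fun i => tcoord φ (inc i (inv u))) = u) :
    OpenPartialHomeomorph S (Euc n) where
  toFun s := R (fun i => tcoord φ (inc i s))
  invFun := inv
  source := U
  target := V
  map_source' := maps
  map_target' := maps'
  left_inv' := left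
  right_inv' := right
  open_source := hU
  open_target := hV
  continuousOn_toFun s hs := by
    have h1 : ContinuousAt (fun s i => tcoord φ (inc i s)) s := by
      rw [continuousAt_pi]
      exact fun i => (contMDiffAt_tcoord hφ (hb s hs i)).continuousAt.comp
        ((continuous_apply i).comp hi.continuous).continuousAt
    exact (ContinuousAt.comp (f := fun s i => tcoord φ (inc i s)) (hR s hs).continuousAt
      h1).continuousWithinAt
  continuousOn_invFun := by
    rw [hi.continuousOn_iff, continuousOn_pi]
    exact fun i => (hinv i).continuousOn

theorem isSliceChart_mkSliceChart (hi : Topology.IsInducing (fun s i => inc i s))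
    {φ : OpenPartialHomeomorph M (Euc 4)}
    (hφ : φ ∈ IsManifold.maximalAtlas (𝓡 4) ∞ M) (R : (ι → Euc 4 × Euc 4) → Euc n)
    (inv : Euc n → S) (U : Set S) (V : Set (Euc n)) (hU : IsOpen U) (hV : IsOpen V)
    (hb : ∀ s ∈ U, ∀ i, (inc i s).proj ∈ φ.source)
    (hR : ∀ s ∈ U, ContDiffAt ℝ ∞ R (fun i => tcoord φ (inc i s)))
    (hinv : ∀ i, ContMDiffOn (𝓡 n) (𝓡 4).tangent ∞ (fun u => inc i (inv u)) V)
    (maps : ∀ s ∈ U, R (fun i => tcoord φ (inc i s)) ∈ V) (maps' : ∀ u ∈ V, inv u ∈ U)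
    (left : ∀ s ∈ U, inv (R (fun i => tcoord φ (inc i s))) = s)
    (right : ∀ u ∈ V, R (fun i => tcoord φ (inc i (inv u))) = u) :
    IsSliceChart inc (mkSliceChart hi hφ R inv U V hU hV hb hR hinv maps maps' left right) where
  exists_coord := ⟨φ, hφ, R, fun s hs => ⟨hb s hs, hR s hs, rfl⟩⟩
  smooth_symm := hinv

end SliceCharts

/-! ### Projective coordinates -/

/-- Splits off the line of `y`, so that directions close to that of `y` are described by an affine
chart of projective space. -/
theorem exists_adapted {y : Euc 4} (hy : y ≠ 0) : ∃ A : Euc 4 ≃L[ℝ] Euc 3 × ℝ, A y = (0, 1) := by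
  let A₀ : Euc 4 ≃L[ℝ] Euc 3 × ℝ := ContinuousLinearEquiv.ofFinrankEq (by simp)
  obtain ⟨B, hB⟩ := SeparatingDual.exists_continuousLinearEquiv_apply_eq (R := ℝ)
    (x := A₀ y) (y := ((0, 1) : Euc 3 × ℝ)) (by simpa using hy) (by simp)
  exact ⟨A₀.trans B, by simpa using hB⟩

/-- Projective coordinates of a vector. -/
def wproj (A : Euc 4 ≃L[ℝ] Euc 3 × ℝ) (y : Euc 4) : Euc 3 := (A y).2⁻¹ • (A y).1

/-- A vector with given projective coordinates. -/
def wlift (A : Euc 4 ≃L[ℝ] Euc 3 × ℝ) (w : Euc 3) : Euc 4 := A.symm (w, 1)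

section Projective

variable (A : Euc 4 ≃L[ℝ] Euc 3 × ℝ)

theorem wlift_wproj {y : Euc 4} (h : (A y).2 ≠ 0) : wlift A (wproj A y) = (A y).2⁻¹ • y := by
  apply A.injective
  rw [wlift, A.apply_symm_apply, map_smul]
  exact Prod.ext rfl (by simp [h])

theorem apply_wlift (w : Euc 3) : A (wlift A w) = (w, 1) := A.apply_symm_apply _

theorem snd_smul_wlift (c : ℝ) (w : Euc 3) : (A (c • wlift A w)).2 = c := by
  rw [map_smul, apply_wlift]; simp

theorem wproj_smul_wlift {c : ℝ} (hc : c ≠ 0) (w : Euc 3) : wproj A (c • wlift A w) = w := by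
  rw [wproj, snd_smul_wlift, map_smul, apply_wlift]
  simp [smul_smul, hc]

theorem contDiff_wlift : ContDiff ℝ ∞ (wlift A) :=
  A.symm.contDiff.comp (contDiff_id.prodMk contDiff_const)

theorem contDiffAt_wproj {y : Euc 4} (h : (A y).2 ≠ 0) : ContDiffAt ℝ ∞ (wproj A) y := by
  have h1 : ContDiffAt ℝ ∞ A y := A.contDiff.contDiffAt
  exact (h1.snd.inv h).smul h1.fst

end Projective

/-! ### Radial charts of the tangent bundle -/

section Radial

variable {M : Type*} [TopologicalSpace M] [ChartedSpace (Euc 4) M] [IsManifold (𝓡 4) ∞ M]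
  {φ : OpenPartialHomeomorph M (Euc 4)}

theorem tpoint_smul (φ : OpenPartialHomeomorph M (Euc 4)) (x y : Euc 4) (c : ℝ) :
    tpoint φ (x, c • y) = ⟨(tpoint φ (x, y)).proj, c • (tpoint φ (x, y)).snd⟩ := by
  exact Bundle.TotalSpace.ext rfl (heq_of_eq (map_smul (mfderiv (𝓡 4) (𝓡 4) φ.symm x) c y))

variable {FS : FinslerSpacetime M}

theorem FinslerSpacetime.F_tpoint_smul (φ : OpenPartialHomeomorph M (Euc 4)) (x y : Euc 4) (c : ℝ) :
    FS.F (tpoint φ (x, c • y)) = |c| * FS.F (tpoint φ (x, y)) := by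
  rw [tpoint_smul, FS.F_smul]

namespace TimeOrientation

variable {T : TimeOrientation FS}

theorem tpoint_smul_mem_cone_iff (φ : OpenPartialHomeomorph M (Euc 4)) (x y : Euc 4) {c : ℝ}
    (hc : 0 < c) : tpoint φ (x, c • y) ∈ T.cone ↔ tpoint φ (x, y) ∈ T.cone := by
  rw [tpoint_smul]; exact T.smul_mem_cone_iff hc

theorem F_ne_zero {v : TangentBundle (𝓡 4) M} (hv : v ∈ T.cone) : FS.F v ≠ 0 := (FS.F_pos hv.1).ne'

/-- A chart of `TM` in which the observer space is a coordinate hyperplane. -/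
def radialChart (T : TimeOrientation FS) (φ : OpenPartialHomeomorph M (Euc 4))
    (hφ : φ ∈ IsManifold.maximalAtlas (𝓡 4) ∞ M) (A : Euc 4 ≃L[ℝ] Euc 3 × ℝ) :
    OpenPartialHomeomorph (TangentBundle (𝓡 4) M) (Euc 4 × Euc 4) where
  -- The fibre coordinates are the direction of the vector and `F - 1`, so the observer space is the
  -- zero set of the last one.
  toFun v := ((tcoord φ v).1, A.symm (wproj A (tcoord φ v).2, FS.F v - 1))
  -- On the ray with the given direction there is exactly one vector at which `F` has the prescribed
  -- value, because `F` is homogeneous of degree one and positive on the cone.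
  invFun q := tpoint φ (q.1, (((A q.2).2 + 1) / FS.F (tpoint φ (q.1, wlift A (A q.2).1))) •
    wlift A (A q.2).1)
  source := {v | v.proj ∈ φ.source ∧ (v ∈ T.cone ∧ 0 < (A (tcoord φ v).2).2)}
  target := {q | q.1 ∈ φ.target ∧ (-1 < (A q.2).2 ∧ tpoint φ (q.1, wlift A (A q.2).1) ∈ T.cone)}
  map_source' := by
    rintro v ⟨h1, h2, h3⟩
    refine ⟨tcoord_fst_mem h1, ?_, ?_⟩
    · simpa using FS.F_pos h2.1
    · simp only [A.apply_symm_apply]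
      rw [wlift_wproj A h3.ne', tpoint_smul_mem_cone_iff _ _ _ (inv_pos.2 h3)]
      rwa [Prod.mk.eta, tpoint_tcoord hφ h1]
  map_target' := by
    rintro q ⟨h1, h2, h3⟩
    have hc : 0 < ((A q.2).2 + 1) / FS.F (tpoint φ (q.1, wlift A (A q.2).1)) :=
      div_pos (by linarith) (FS.F_pos h3.1)
    refine ⟨tpoint_proj_mem h1, ?_, ?_⟩
    · rwa [tpoint_smul_mem_cone_iff _ _ _ hc]
    · rw [tcoord_tpoint hφ (by exact h1), snd_smul_wlift]; exact hc
  left_inv' := by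
    rintro v ⟨h1, h2, h3⟩
    have hF := FS.F_pos h2.1
    simp only [A.apply_symm_apply, sub_add_cancel]
    rw [wlift_wproj A h3.ne', FS.F_tpoint_smul, smul_smul, abs_of_pos (inv_pos.2 h3), Prod.mk.eta,
      tpoint_tcoord hφ h1]
    have : FS.F v / ((A (tcoord φ v).2).2⁻¹ * FS.F v) * (A (tcoord φ v).2).2⁻¹ = 1 := by
      field_simp
    rw [this, one_smul, Prod.mk.eta, tpoint_tcoord hφ h1]
  right_inv' := by
    rintro q ⟨h1, h2, h3⟩
    have hF := FS.F_pos h3.1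
    have hc : 0 < ((A q.2).2 + 1) / FS.F (tpoint φ (q.1, wlift A (A q.2).1)) :=
      div_pos (by linarith) hF
    rw [tcoord_tpoint hφ (by exact h1), FS.F_tpoint_smul, abs_of_pos hc,
      wproj_smul_wlift A hc.ne', div_mul_cancel₀ _ hF.ne', add_sub_cancel_right, Prod.mk.eta,
      A.symm_apply_apply]
  open_source := by
    have h1 : IsOpen {z : Euc 4 × Euc 4 | 0 < (A z.2).2} :=
      isOpen_lt continuous_const (by fun_prop)
    have h2 := (contMDiffOn_tcoord hφ).continuousOn.isOpen_inter_preimage (isOpen_proj_source φ) h1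
    convert h2.inter T.isOpen_cone using 1
    ext v
    simp only [Set.mem_inter_iff, Set.mem_ofPred_eq, Set.mem_preimage]
    tauto
  open_target := by
    have h1 : Continuous fun q : Euc 4 × Euc 4 => (q.1, wlift A (A q.2).1) := by
      unfold wlift; fun_prop
    have h2 : ContinuousOn (fun q : Euc 4 × Euc 4 => tpoint φ (q.1, wlift A (A q.2).1))
        {q | q.1 ∈ φ.target} :=
      (contMDiffOn_tpoint hφ).continuousOn.comp h1.continuousOn fun q hq => hq
    have h3 : IsOpen {q : Euc 4 × Euc 4 | -1 < (A q.2).2} :=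
      isOpen_lt continuous_const (by fun_prop)
    convert (h2.isOpen_inter_preimage (isOpen_fst_target φ) T.isOpen_cone).inter h3 using 1
    ext v
    simp only [Set.mem_inter_iff, Set.mem_ofPred_eq, Set.mem_preimage]
    tauto
  continuousOn_toFun := by
    rintro v ⟨h1, h2, h3⟩
    have c1 := (contMDiffAt_tcoord hφ h1).continuousAt
    have c2 : ContinuousAt (fun v => wproj A (tcoord φ v).2) v :=
      ContinuousAt.comp (f := fun v => (tcoord φ v).2) (contDiffAt_wproj A h3.ne').continuousAt c1.snd
    exact (c1.fst.prodMk (A.symm.continuous.continuousAt.comp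
      (c2.prodMk (FS.continuous_F.continuousAt.sub_const 1)))).continuousWithinAt
  continuousOn_invFun := by
    rintro q ⟨h1, h2, h3⟩
    have e1 : Continuous fun q : Euc 4 × Euc 4 => (q.1, wlift A (A q.2).1) := by
      unfold wlift; fun_prop
    have e2 : ContinuousAt (fun q : Euc 4 × Euc 4 => FS.F (tpoint φ (q.1, wlift A (A q.2).1))) q :=
      FS.continuous_F.continuousAt.comp (ContinuousAt.comp (f := fun q : Euc 4 × Euc 4 =>
        (q.1, wlift A (A q.2).1)) (contMDiffAt_tpoint hφ (by exact h1)).continuousAt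
          e1.continuousAt)
    have e3 : ContinuousAt (fun q : Euc 4 × Euc 4 =>
        ((A q.2).2 + 1) / FS.F (tpoint φ (q.1, wlift A (A q.2).1))) q :=
      ContinuousAt.div (by fun_prop) e2 (F_ne_zero h3)
    exact (ContinuousAt.comp (f := fun q : Euc 4 × Euc 4 => (q.1, _))
      (contMDiffAt_tpoint hφ (by exact h1)).continuousAt
      (continuousAt_fst.prodMk (e3.smul e1.continuousAt.snd))).continuousWithinAt

theorem contMDiffOn_radialChart (hφ : φ ∈ IsManifold.maximalAtlas (𝓡 4) ∞ M)
    (A : Euc 4 ≃L[ℝ] Euc 3 × ℝ) : ContMDiffOn (𝓡 4).tangent 𝓘(ℝ, Euc 4 × Euc 4) ∞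
      (T.radialChart φ hφ A) (T.radialChart φ hφ A).source := by
  rintro v ⟨h1, h2, h3⟩
  have c1 := contMDiffAt_tcoord hφ h1
  have c2 : ContMDiffAt (𝓡 4).tangent 𝓘(ℝ, Euc 4) ∞ (fun v => (tcoord φ v).2) v :=
    contDiff_snd.contDiffAt.contMDiffAt.comp v c1
  have c3 : ContMDiffAt (𝓡 4).tangent 𝓘(ℝ, Euc 3) ∞ (fun v => wproj A (tcoord φ v).2) v :=
    ContMDiffAt.comp v (g := wproj A) (f := fun v => (tcoord φ v).2)
      (contDiffAt_wproj A h3.ne').contMDiffAt c2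
  have c4 : ContMDiffAt (𝓡 4).tangent 𝓘(ℝ, ℝ) ∞ (fun v => FS.F v - 1) v :=
    (FS.contMDiffAt_F h2.1).sub contMDiffAt_const
  have c5 := A.symm.contDiff.contMDiff.contMDiffAt.comp v (c3.prodMk_space c4)
  exact ((contDiff_fst.contDiffAt.contMDiffAt.comp v c1).prodMk_space c5).contMDiffWithinAt

theorem contMDiffOn_radialChart_symm (hφ : φ ∈ IsManifold.maximalAtlas (𝓡 4) ∞ M)
    (A : Euc 4 ≃L[ℝ] Euc 3 × ℝ) : ContMDiffOn 𝓘(ℝ, Euc 4 × Euc 4) (𝓡 4).tangent ∞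
      (T.radialChart φ hφ A).symm (T.radialChart φ hφ A).target := by
  rintro q ⟨h1, h2, h3⟩
  have e1 : ContDiff ℝ ∞ fun q : Euc 4 × Euc 4 => (q.1, wlift A (A q.2).1) :=
    contDiff_fst.prodMk ((contDiff_wlift A).comp
      (contDiff_fst.comp (A.contDiff.comp contDiff_snd)))
  have e2 : ContDiffAt ℝ ∞ (fun q : Euc 4 × Euc 4 => FS.F (tpoint φ (q.1, wlift A (A q.2).1))) q :=
    ContDiffAt.comp q (f := fun q : Euc 4 × Euc 4 => (q.1, wlift A (A q.2).1))
      (contDiffAt_coordF hφ ⟨h1, h3⟩) e1.contDiffAt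
  have e4 : ContDiffAt ℝ ∞ (fun q : Euc 4 × Euc 4 => (A q.2).2 + 1) q :=
    ((contDiff_snd.comp (A.contDiff.comp contDiff_snd)).add contDiff_const).contDiffAt
  have e3 : ContDiffAt ℝ ∞ (fun q : Euc 4 × Euc 4 =>
      ((A q.2).2 + 1) / FS.F (tpoint φ (q.1, wlift A (A q.2).1))) q :=
    e4.div e2 (F_ne_zero h3)
  have e5 := contDiffAt_fst.prodMk (e3.smul e1.contDiffAt.snd)
  exact ((contMDiffAt_tpoint hφ (by exact h1)).comp q
    e5.contMDiffAt).contMDiffWithinAt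

theorem radialChart_mem_maximalAtlas (hφ : φ ∈ IsManifold.maximalAtlas (𝓡 4) ∞ M)
    (A : Euc 4 ≃L[ℝ] Euc 3 × ℝ) :
    (T.radialChart φ hφ A : OpenPartialHomeomorph (TangentBundle (𝓡 4) M)
      (ModelProd (Euc 4) (Euc 4))) ∈
      IsManifold.maximalAtlas (𝓡 4).tangent ∞ (TangentBundle (𝓡 4) M) := by
  refine OpenPartialHomeomorph.mem_maximalAtlas_of_contMDiffOn _ ?_ ?_
  · have := contMDiffOn_radialChart (T := T) hφ A
    rw [modelWithCornersSelf_prod] at this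
    exact this
  · have := contMDiffOn_radialChart_symm (T := T) hφ A
    rw [modelWithCornersSelf_prod] at this
    exact this

end TimeOrientation

end Radial

/-! ### The observer space as a manifold -/

section ObserverManifold

variable {M : Type*} [TopologicalSpace M] [ChartedSpace (Euc 4) M] [IsManifold (𝓡 4) ∞ M]
  {φ : OpenPartialHomeomorph M (Euc 4)} {FS : FinslerSpacetime M}

/-- The model space of the observer space. -/
def euc7 : (Euc 4 × Euc 3) ≃L[ℝ] Euc 7 := ContinuousLinearEquiv.ofFinrankEq (by simp)

/-- The inclusion of the observer space into `TM`. -/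
def obsInc (T : TimeOrientation FS) (_ : Unit) (o : ObserverSpace T) : TangentBundle (𝓡 4) M := o.val

theorem isInducing_obsInc (T : TimeOrientation FS) :
    Topology.IsInducing (fun o i => obsInc T i o) := by
  have h : (fun (o : ObserverSpace T) (i : Unit) => obsInc T i o) =
      (Homeomorph.funUnique Unit (TangentBundle (𝓡 4) M)).symm ∘ Subtype.val := by
    funext o i; rfl
  rw [h]
  exact (Homeomorph.isInducing _).comp Topology.IsInducing.subtypeVal

namespace TimeOrientation

variable {T : TimeOrientation FS}

theorem F_eq_one (o : ObserverSpace T) : FS.F o.val = 1 := (T.mem_S_iff.1 o.2).2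

theorem observer_mem_cone (o : ObserverSpace T) : o.val ∈ T.cone := (T.mem_S_iff.1 o.2).1

theorem radialChart_apply (hφ : φ ∈ IsManifold.maximalAtlas (𝓡 4) ∞ M) (A : Euc 4 ≃L[ℝ] Euc 3 × ℝ)
    (o : ObserverSpace T) : T.radialChart φ hφ A o.val =
      ((tcoord φ o.val).1, A.symm (wproj A (tcoord φ o.val).2, 0)) := by
  change (_, A.symm (_, FS.F o.val - 1)) = _
  rw [F_eq_one, sub_self]

theorem radialChart_symm_mem (hφ : φ ∈ IsManifold.maximalAtlas (𝓡 4) ∞ M)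
    (A : Euc 4 ≃L[ℝ] Euc 3 × ℝ) {x : Euc 4} {w : Euc 3}
    (h : (x, A.symm (w, 0)) ∈ (T.radialChart φ hφ A).target) :
    ((T.radialChart φ hφ A).symm (x, A.symm (w, 0))).snd ∈
      T.S ((T.radialChart φ hφ A).symm (x, A.symm (w, 0))).proj := by
  have h1 := (T.radialChart φ hφ A).map_target h
  have h2 := (T.radialChart φ hφ A).right_inv h
  refine (T.mem_S_iff).2 ⟨h1.2.1, ?_⟩
  have h3 : A.symm (wproj A _, FS.F ((T.radialChart φ hφ A).symm (x, A.symm (w, 0))) - 1) =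
      A.symm (w, 0) := congrArg Prod.snd h2
  have := congrArg Prod.snd (A.symm.injective h3)
  exact sub_eq_zero.1 this

open Classical in
/-- The observer with given coordinates. -/
def obsPoint (T : TimeOrientation FS) (φ : OpenPartialHomeomorph M (Euc 4))
    (hφ : φ ∈ IsManifold.maximalAtlas (𝓡 4) ∞ M) (A : Euc 4 ≃L[ℝ] Euc 3 × ℝ)
    (o₀ : ObserverSpace T) (q : Euc 4 × Euc 3) : ObserverSpace T :=
  -- The default observer only makes the function total; it is used solely on the coordinate domain.
  if h : (q.1, A.symm (q.2, 0)) ∈ (T.radialChart φ hφ A).target then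
    ⟨_, radialChart_symm_mem hφ A h⟩ else o₀

theorem obsPoint_val (hφ : φ ∈ IsManifold.maximalAtlas (𝓡 4) ∞ M) (A : Euc 4 ≃L[ℝ] Euc 3 × ℝ)
    (o₀ : ObserverSpace T) {q : Euc 4 × Euc 3}
    (h : (q.1, A.symm (q.2, 0)) ∈ (T.radialChart φ hφ A).target) :
    (T.obsPoint φ hφ A o₀ q).val = (T.radialChart φ hφ A).symm (q.1, A.symm (q.2, 0)) := by
  rw [obsPoint, dif_pos h]

/-- The coordinates of an observer. -/
def obsCoord (φ : OpenPartialHomeomorph M (Euc 4)) (A : Euc 4 ≃L[ℝ] Euc 3 × ℝ)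
    (o : ObserverSpace T) : Euc 4 × Euc 3 := ((tcoord φ o.val).1, wproj A (tcoord φ o.val).2)

theorem obsCoord_eq (hφ : φ ∈ IsManifold.maximalAtlas (𝓡 4) ∞ M) (A : Euc 4 ≃L[ℝ] Euc 3 × ℝ)
    (o : ObserverSpace T) :
    ((obsCoord φ A o).1, A.symm ((obsCoord φ A o).2, 0)) = T.radialChart φ hφ A o.val :=
  (radialChart_apply hφ A o).symm

theorem obsPoint_obsCoord (hφ : φ ∈ IsManifold.maximalAtlas (𝓡 4) ∞ M) (A : Euc 4 ≃L[ℝ] Euc 3 × ℝ)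
    (o₀ o : ObserverSpace T) (ho : o.val ∈ (T.radialChart φ hφ A).source) :
    T.obsPoint φ hφ A o₀ (obsCoord φ A o) = o := by
  have h := obsCoord_eq hφ A o
  apply Subtype.ext
  rw [obsPoint_val hφ A o₀ (by rw [h]; exact (T.radialChart φ hφ A).map_source ho), h,
    (T.radialChart φ hφ A).left_inv ho]

theorem obsPoint_mem (hφ : φ ∈ IsManifold.maximalAtlas (𝓡 4) ∞ M) (A : Euc 4 ≃L[ℝ] Euc 3 × ℝ)
    (o₀ : ObserverSpace T) {q : Euc 4 × Euc 3}
    (h : (q.1, A.symm (q.2, 0)) ∈ (T.radialChart φ hφ A).target) :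
    (T.obsPoint φ hφ A o₀ q).val ∈ (T.radialChart φ hφ A).source := by
  rw [obsPoint_val hφ A o₀ h]; exact (T.radialChart φ hφ A).map_target h

theorem obsCoord_obsPoint (hφ : φ ∈ IsManifold.maximalAtlas (𝓡 4) ∞ M) (A : Euc 4 ≃L[ℝ] Euc 3 × ℝ)
    (o₀ : ObserverSpace T) {q : Euc 4 × Euc 3}
    (h : (q.1, A.symm (q.2, 0)) ∈ (T.radialChart φ hφ A).target) :
    obsCoord φ A (T.obsPoint φ hφ A o₀ q) = q := by
  have h1 := obsCoord_eq hφ A (T.obsPoint φ hφ A o₀ q)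
  rw [obsPoint_val hφ A o₀ h, (T.radialChart φ hφ A).right_inv h] at h1
  have h2 := congrArg Prod.fst h1
  have h3 := congrArg Prod.fst (A.symm.injective (congrArg Prod.snd h1))
  exact Prod.ext h2 h3

theorem isOpen_obsTarget (hφ : φ ∈ IsManifold.maximalAtlas (𝓡 4) ∞ M)
    (A : Euc 4 ≃L[ℝ] Euc 3 × ℝ) :
    IsOpen {q : Euc 4 × Euc 3 | (q.1, A.symm (q.2, 0)) ∈ (T.radialChart φ hφ A).target} :=
  (T.radialChart φ hφ A).open_target.preimage (by fun_prop)

theorem contMDiffOn_obsPoint (hφ : φ ∈ IsManifold.maximalAtlas (𝓡 4) ∞ M)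
    (A : Euc 4 ≃L[ℝ] Euc 3 × ℝ) (o₀ : ObserverSpace T) :
    ContMDiffOn 𝓘(ℝ, Euc 4 × Euc 3) (𝓡 4).tangent ∞ (fun q => (T.obsPoint φ hφ A o₀ q).val)
      {q | (q.1, A.symm (q.2, 0)) ∈ (T.radialChart φ hφ A).target} := by
  have h1 : ContDiff ℝ ∞ fun q : Euc 4 × Euc 3 => (q.1, A.symm (q.2, (0 : ℝ))) :=
    contDiff_fst.prodMk (A.symm.contDiff.comp (contDiff_snd.prodMk contDiff_const))
  refine ((contMDiffOn_radialChart_symm (T := T) hφ A).comp h1.contMDiff.contMDiffOn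
    fun q hq => hq).congr fun q hq => obsPoint_val hφ A o₀ hq

theorem contDiffAt_obsCoord (A : Euc 4 ≃L[ℝ] Euc 3 × ℝ) {z : Euc 4 × Euc 4} (hz : (A z.2).2 ≠ 0) :
    ContDiffAt ℝ ∞ (fun z : Euc 4 × Euc 4 => (z.1, wproj A z.2)) z :=
  contDiffAt_fst.prodMk (ContDiffAt.comp z (f := Prod.snd) (contDiffAt_wproj A hz) contDiffAt_snd)

/-- The chart of the observer space given by a chart of `M` and projective coordinates. -/
def obsChart (T : TimeOrientation FS) (φ : OpenPartialHomeomorph M (Euc 4))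
    (hφ : φ ∈ IsManifold.maximalAtlas (𝓡 4) ∞ M) (A : Euc 4 ≃L[ℝ] Euc 3 × ℝ)
    (o₀ : ObserverSpace T) : OpenPartialHomeomorph (ObserverSpace T) (Euc 7) :=
  mkSliceChart (isInducing_obsInc T) hφ (fun ζ => euc7 ((ζ ()).1, wproj A (ζ ()).2))
    (fun u => T.obsPoint φ hφ A o₀ (euc7.symm u))
    {o | o.val ∈ (T.radialChart φ hφ A).source}
    (euc7.symm ⁻¹' {q | (q.1, A.symm (q.2, 0)) ∈ (T.radialChart φ hφ A).target})
    ((T.radialChart φ hφ A).open_source.preimage continuous_subtype_val)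
    ((isOpen_obsTarget hφ A).preimage euc7.symm.continuous)
    (fun _ ho _ => ho.1)
    (fun o ho => euc7.contDiff.contDiffAt.comp _ (ContDiffAt.comp
      (f := fun ζ : Unit → Euc 4 × Euc 4 => ζ ()) _ (contDiffAt_obsCoord A ho.2.2.ne')
      (contDiff_apply ℝ (Euc 4 × Euc 4) ()).contDiffAt))
    (fun _ => (contMDiffOn_obsPoint hφ A o₀).comp euc7.symm.contDiff.contMDiff.contMDiffOn
      fun _ hu => hu)
    (fun o ho => by
      change (obsCoord φ A o |> fun p => euc7.symm (euc7 p)) ∈ {q : Euc 4 × Euc 3 | _}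
      simp only [ContinuousLinearEquiv.symm_apply_apply, Set.mem_ofPred_eq, obsCoord_eq hφ A o]
      exact (T.radialChart φ hφ A).map_source ho)
    (fun u hu => obsPoint_mem hφ A o₀ hu)
    (fun o ho => by
      change T.obsPoint φ hφ A o₀ (euc7.symm (euc7 (obsCoord φ A o))) = o
      rw [ContinuousLinearEquiv.symm_apply_apply, obsPoint_obsCoord hφ A o₀ o ho])
    (fun u hu => by
      change euc7 (obsCoord φ A (T.obsPoint φ hφ A o₀ (euc7.symm u))) = u
      rw [obsCoord_obsPoint hφ A o₀ hu, ContinuousLinearEquiv.apply_symm_apply])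

theorem isSliceChart_obsChart (hφ : φ ∈ IsManifold.maximalAtlas (𝓡 4) ∞ M)
    (A : Euc 4 ≃L[ℝ] Euc 3 × ℝ) (o₀ : ObserverSpace T) :
    IsSliceChart (obsInc T) (T.obsChart φ hφ A o₀) := isSliceChart_mkSliceChart ..

theorem tcoord_snd_ne_zero (hφ : φ ∈ IsManifold.maximalAtlas (𝓡 4) ∞ M) {v : TangentBundle (𝓡 4) M}
    (hv : v.proj ∈ φ.source) (h0 : v.snd ≠ 0) : (tcoord φ v).2 ≠ 0 := fun h =>
  h0 ((mdifferentiable_of_mem_maximalAtlas hφ).mfderiv_injective hv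
    (Eq.trans h (map_zero (mfderiv (𝓡 4) (𝓡 4) φ v.proj)).symm))

theorem exists_mem_radialChart (hφ : φ ∈ IsManifold.maximalAtlas (𝓡 4) ∞ M) (o : ObserverSpace T)
    (ho : o.val.proj ∈ φ.source) : ∃ A : Euc 4 ≃L[ℝ] Euc 3 × ℝ,
      o.val ∈ (T.radialChart φ hφ A).source := by
  obtain ⟨A, hA⟩ := exists_adapted (tcoord_snd_ne_zero hφ ho
    (FS.snd_ne_zero (observer_mem_cone o).1))
  exact ⟨A, ho, observer_mem_cone o, by rw [hA]; exact one_pos⟩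

theorem exists_isSliceChart (o : ObserverSpace T) : ∃ e : OpenPartialHomeomorph (ObserverSpace T)
    (Euc 7), IsSliceChart (obsInc T) e ∧ o ∈ e.source := by
  have hφ := chartAt_mem_maximalAtlas (M := M) o.val.proj
  obtain ⟨A, hA⟩ := exists_mem_radialChart hφ o (mem_chart_source _ _)
  exact ⟨_, isSliceChart_obsChart hφ A o, hA⟩

/-- With respect to `obsChart` and `radialChart` the inclusion is the linear map `u ↦ (u, 0)`, the
complement being the line of the coordinate `F - 1`. -/
theorem isImmersion_val [ChartedSpace (Euc 7) (ObserverSpace T)]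
    [IsManifold (𝓡 7) ∞ (ObserverSpace T)] (h : IsSliceAtlas (n := 7) (obsInc T)) :
    Manifold.IsImmersionOfComplement ℝ (𝓡 7) (𝓡 4).tangent ∞
      (Subtype.val : ObserverSpace T → TangentBundle (𝓡 4) M) := by
  intro o
  have hφ := chartAt_mem_maximalAtlas (M := M) o.val.proj
  obtain ⟨A, hA⟩ := exists_mem_radialChart hφ o (mem_chart_source _ _)
  let L : (Euc 7 × ℝ) ≃L[ℝ] Euc 4 × Euc 4 :=
    ((euc7.symm.prodCongr (ContinuousLinearEquiv.refl ℝ ℝ)).trans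
      (ContinuousLinearEquiv.prodAssoc ℝ (Euc 4) (Euc 3) ℝ)).trans
      ((ContinuousLinearEquiv.refl ℝ (Euc 4)).prodCongr A.symm)
  refine Manifold.IsImmersionAtOfComplement.mk_of_charts L (T.obsChart _ hφ A o)
    (T.radialChart _ hφ A) hA hA (h.mem_maximalAtlas (isSliceChart_obsChart hφ A o))
    (radialChart_mem_maximalAtlas hφ A) (fun o' ho' => ho') ?_
  intro u hu
  have hu' : u ∈ (T.obsChart _ hφ A o).target := by simpa using hu
  change T.radialChart _ hφ A (T.obsPoint _ hφ A o (euc7.symm u)).val =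
    ((euc7.symm u).1, A.symm ((euc7.symm u).2, 0))
  rw [obsPoint_val hφ A o hu', (T.radialChart _ hφ A).right_inv hu']

end TimeOrientation

end ObserverManifold

/-! ### A chart of the rotation group -/

/-- The rotation with Rodrigues vector `q`. -/
def rodrigues (q : Euc 3) : Matrix (Fin 3) (Fin 3) ℝ :=
  (1 + q 0 ^ 2 + q 1 ^ 2 + q 2 ^ 2)⁻¹ •
    !![1 + q 0 ^ 2 - q 1 ^ 2 - q 2 ^ 2, 2 * (q 0 * q 1 - q 2), 2 * (q 0 * q 2 + q 1);
      2 * (q 0 * q 1 + q 2), 1 - q 0 ^ 2 + q 1 ^ 2 - q 2 ^ 2, 2 * (q 1 * q 2 - q 0);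
      2 * (q 0 * q 2 - q 1), 2 * (q 1 * q 2 + q 0), 1 - q 0 ^ 2 - q 1 ^ 2 + q 2 ^ 2]

/-- The Rodrigues vector of a rotation. -/
def rodriguesVec (k : Matrix (Fin 3) (Fin 3) ℝ) : Euc 3 :=
  (1 + k 0 0 + k 1 1 + k 2 2)⁻¹ • !₂[k 2 1 - k 1 2, k 0 2 - k 2 0, k 1 0 - k 0 1]

theorem rodrigues_mem (q : Euc 3) : rodrigues q ∈ Matrix.specialOrthogonalGroup (Fin 3) ℝ := by
  have h : (1 + q 0 ^ 2 + q 1 ^ 2 + q 2 ^ 2) ≠ 0 := by positivity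
  rw [Matrix.mem_specialOrthogonalGroup_iff, Matrix.mem_orthogonalGroup_iff]
  constructor
  · ext i j
    fin_cases i <;> fin_cases j <;>
      simp [rodrigues, Matrix.mul_apply, Fin.sum_univ_three] <;> field_simp <;> ring
  · simp [rodrigues, Matrix.det_fin_three]
    field_simp
    ring

theorem trace_rodrigues (q : Euc 3) :
    1 + rodrigues q 0 0 + rodrigues q 1 1 + rodrigues q 2 2 =
      4 * (1 + q 0 ^ 2 + q 1 ^ 2 + q 2 ^ 2)⁻¹ := by
  have h : (1 + q 0 ^ 2 + q 1 ^ 2 + q 2 ^ 2) ≠ 0 := by positivity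
  simp [rodrigues]
  field_simp
  ring

theorem trace_rodrigues_pos (q : Euc 3) :
    0 < 1 + rodrigues q 0 0 + rodrigues q 1 1 + rodrigues q 2 2 := by
  rw [trace_rodrigues]; positivity

theorem rodriguesVec_rodrigues (q : Euc 3) : rodriguesVec (rodrigues q) = q := by
  have h : (1 + q 0 ^ 2 + q 1 ^ 2 + q 2 ^ 2) ≠ 0 := by positivity
  rw [rodriguesVec, trace_rodrigues]
  ext i
  fin_cases i <;> simp [rodrigues] <;> field_simp <;> ring

/-- The Rodrigues vector of a rotation by the angle `θ` is `tan(θ/2)` times the unit axis.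
Positivity of `1 + tr k` excludes the half-turns, for which it is infinite. -/
theorem rodrigues_rodriguesVec {k : Matrix (Fin 3) (Fin 3) ℝ}
    (hk : k ∈ Matrix.specialOrthogonalGroup (Fin 3) ℝ) (ht : 0 < 1 + k 0 0 + k 1 1 + k 2 2) :
    rodrigues (rodriguesVec k) = k := by
  obtain ⟨ho, hd⟩ := Matrix.mem_specialOrthogonalGroup_iff.1 hk
  have h1 : k * kᵀ = 1 := (Matrix.mem_orthogonalGroup_iff _ _).1 ho
  have h2 : kᵀ * k = 1 := (Matrix.mem_orthogonalGroup_iff' _ _).1 ho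
  -- For a rotation every entry equals its cofactor. These quadratic relations encode `det k = 1`
  -- and supplement those of orthogonality.
  have h3 : k.adjugate = kᵀ := by
    rw [← one_mul k.adjugate, ← h2, mul_assoc, Matrix.mul_adjugate, hd, one_smul, mul_one]
  have r : ∀ i j, k i 0 * k j 0 + k i 1 * k j 1 + k i 2 * k j 2 = if i = j then 1 else 0 := by
    intro i j
    have := congrFun (congrFun h1 i) j
    rw [Matrix.mul_apply, Fin.sum_univ_three, Matrix.one_apply] at this
    exact this
  have c : ∀ i j, k 0 i * k 0 j + k 1 i * k 1 j + k 2 i * k 2 j = if i = j then 1 else 0 := by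
    intro i j
    have := congrFun (congrFun h2 i) j
    rw [Matrix.mul_apply, Fin.sum_univ_three, Matrix.one_apply] at this
    exact this
  rw [Matrix.adjugate_fin_three] at h3
  have a : ∀ i j, _ = kᵀ i j := fun i j => congrFun (congrFun h3 i) j
  have a00 := a 0 0
  have a01 := a 0 1
  have a02 := a 0 2
  have a10 := a 1 0
  have a11 := a 1 1
  have a12 := a 1 2
  have a20 := a 2 0
  have a21 := a 2 1
  have a22 := a 2 2
  simp [Matrix.transpose_apply] at a00 a01 a02 a10 a11 a12 a20 a21 a22
  have r00 := r 0 0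
  have r11 := r 1 1
  have r22 := r 2 2
  have r01 := r 0 1
  have r02 := r 0 2
  have r12 := r 1 2
  have c00 := c 0 0
  have c11 := c 1 1
  have c22 := c 2 2
  have c01 := c 0 1
  have c02 := c 0 2
  have c12 := c 1 2
  simp at r00 r11 r22 r01 r02 r12 c00 c11 c22 c01 c02 c12
  -- The quadruple `(t, x, y, z)` is a multiple of the unit quaternion of `k`. The identities below
  -- express the entries of `k` by the products of its components.
  set t := 1 + k 0 0 + k 1 1 + k 2 2 with ht'
  set x := k 2 1 - k 1 2 with hx
  set y := k 0 2 - k 2 0 with hy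
  set z := k 1 0 - k 0 1 with hz
  have hxy : x * y = t * (k 0 1 + k 1 0) := by
    rw [hx, hy, ht']; linear_combination a01 + a10 - r01 - c01
  have hxz : x * z = t * (k 0 2 + k 2 0) := by
    rw [hx, hz, ht']; linear_combination a02 + a20 - r02 - c02
  have hyz : y * z = t * (k 1 2 + k 2 1) := by
    rw [hz, hy, ht']; linear_combination a12 + a21 - r12 - c12
  have hn : t ^ 2 + x ^ 2 + y ^ 2 + z ^ 2 = 4 * t := by
    rw [hx, hy, hz, ht']; linear_combination 2 * a00 + 2 * a11 + 2 * a22 + r00 + r11 + r22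
  have hp : t ^ 2 + x ^ 2 - y ^ 2 - z ^ 2 = 4 * t * k 0 0 := by
    rw [hx, hy, hz, ht']; linear_combination 2 * a00 - 2 * a11 - 2 * a22 - r00 + r11 + r22 - 2 * c00
  have hq : t ^ 2 - x ^ 2 + y ^ 2 - z ^ 2 = 4 * t * k 1 1 := by
    rw [hx, hy, hz, ht']; linear_combination -2 * a00 + 2 * a11 - 2 * a22 + r00 - r11 + r22 - 2 * c11
  have hr : t ^ 2 - x ^ 2 - y ^ 2 + z ^ 2 = 4 * t * k 2 2 := by
    rw [hx, hy, hz, ht']; linear_combination -2 * a00 - 2 * a11 + 2 * a22 + r00 + r11 - r22 - 2 * c22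
  have hN : 1 + (t⁻¹ * x) ^ 2 + (t⁻¹ * y) ^ 2 + (t⁻¹ * z) ^ 2 = 4 * t⁻¹ := by
    field_simp; linarith
  have e0 : rodriguesVec k 0 = t⁻¹ * x := by simp [rodriguesVec, ht', hx]
  have e1 : rodriguesVec k 1 = t⁻¹ * y := by simp [rodriguesVec, ht', hy]
  have e2 : rodriguesVec k 2 = t⁻¹ * z := by simp [rodriguesVec, ht', hz]
  rw [rodrigues, e0, e1, e2, hN]
  ext i j
  fin_cases i <;> fin_cases j <;> simp <;> field_simp <;> linarith

theorem contDiff_rodrigues (α β : Fin 3) : ContDiff ℝ ∞ (fun q => rodrigues q α β) := by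
  have hc : ∀ i, ContDiff ℝ ∞ fun q : Euc 3 => q i := fun i => contDiff_euclidean.1 contDiff_id i
  have h : ContDiff ℝ ∞ fun q : Euc 3 => (1 + q 0 ^ 2 + q 1 ^ 2 + q 2 ^ 2)⁻¹ :=
    ((((contDiff_const.add ((hc 0).pow 2)).add ((hc 1).pow 2)).add ((hc 2).pow 2))).inv
      fun q => by positivity
  have h0 := hc 0
  have h1 := hc 1
  have h2 := hc 2
  fin_cases α <;> fin_cases β <;> simp only [rodrigues, Matrix.smul_apply, smul_eq_mul] <;>
    refine h.mul ?_ <;> simp <;> fun_prop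

theorem contDiffAt_rodriguesVec {E : Type*} [NormedAddCommGroup E] [NormedSpace ℝ E]
    {k : E → Matrix (Fin 3) (Fin 3) ℝ} {x : E} (hk : ∀ α β, ContDiffAt ℝ ∞ (fun x => k x α β) x)
    (ht : 0 < 1 + k x 0 0 + k x 1 1 + k x 2 2) : ContDiffAt ℝ ∞ (fun x => rodriguesVec (k x)) x := by
  have h1 : ContDiffAt ℝ ∞ (fun x => 1 + k x 0 0 + k x 1 1 + k x 2 2) x :=
    ((contDiffAt_const.add (hk 0 0)).add (hk 1 1)).add (hk 2 2)
  refine (h1.inv ht.ne').smul (contDiffAt_euclidean.2 fun i => ?_)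
  fin_cases i
  · exact (hk 2 1).sub (hk 1 2)
  · exact (hk 0 2).sub (hk 2 0)
  · exact (hk 1 0).sub (hk 0 1)

/-! ### Rotations of frames -/

/-- A rotation of the spatial vectors, as a Lorentz transformation. -/
def rot4 (k : Matrix (Fin 3) (Fin 3) ℝ) : Matrix (Fin 4) (Fin 4) ℝ :=
  Matrix.of (Fin.cons (Fin.cons 1 0) (fun α => Fin.cons 0 (k α)))

theorem rotMat_eq (k : RotGroup) : rotMat k = Matrix.fromBlocks (rot4 k.val) 0 0 1 := rfl

@[simp] theorem rot4_zero_zero (k : Matrix (Fin 3) (Fin 3) ℝ) : rot4 k 0 0 = 1 := rfl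
@[simp] theorem rot4_zero_succ (k : Matrix (Fin 3) (Fin 3) ℝ) (α : Fin 3) : rot4 k 0 α.succ = 0 := rfl
@[simp] theorem rot4_succ_zero (k : Matrix (Fin 3) (Fin 3) ℝ) (α : Fin 3) : rot4 k α.succ 0 = 0 := rfl
@[simp] theorem rot4_succ_succ (k : Matrix (Fin 3) (Fin 3) ℝ) (α β : Fin 3) :
    rot4 k α.succ β.succ = k α β := rfl

theorem rot4_one : rot4 1 = 1 := by
  ext i j
  refine Fin.cases ?_ (fun α => ?_) i <;> refine Fin.cases ?_ (fun β => ?_) j <;>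
    simp [Matrix.one_apply, Fin.succ_ne_zero, (Fin.succ_ne_zero _).symm]

theorem rot4_mul (k k' : Matrix (Fin 3) (Fin 3) ℝ) : rot4 (k * k') = rot4 k * rot4 k' := by
  ext i j
  refine Fin.cases ?_ (fun α => ?_) i <;> refine Fin.cases ?_ (fun β => ?_) j <;>
    simp [Matrix.mul_apply, Fin.sum_univ_succ (n := 3)]

theorem rot4_transpose (k : Matrix (Fin 3) (Fin 3) ℝ) : rot4 kᵀ = (rot4 k)ᵀ := by
  ext i j
  refine Fin.cases ?_ (fun α => ?_) i <;> refine Fin.cases ?_ (fun β => ?_) j <;> simp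

theorem rot4_mul_eta (k : Matrix (Fin 3) (Fin 3) ℝ) : rot4 k * eta = eta * rot4 k := by
  ext i j
  rw [eta, Matrix.mul_diagonal, Matrix.diagonal_mul]
  refine Fin.cases ?_ (fun α => ?_) i <;> refine Fin.cases ?_ (fun β => ?_) j <;>
    simp [Fin.succ_ne_zero]

theorem det_rot4 (k : Matrix (Fin 3) (Fin 3) ℝ) : (rot4 k).det = k.det := by
  rw [Matrix.det_succ_row_zero, Fin.sum_univ_succ]
  simp
  congr 1

theorem transpose_mul_self (k : RotGroup) :
    (k : Matrix (Fin 3) (Fin 3) ℝ)ᵀ * (k : Matrix (Fin 3) (Fin 3) ℝ) = 1 :=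
  (Matrix.mem_orthogonalGroup_iff' _ _).1 (Matrix.mem_specialOrthogonalGroup_iff.1 k.2).1

theorem det_rotGroup (k : RotGroup) : (k : Matrix (Fin 3) (Fin 3) ℝ).det = 1 :=
  (Matrix.mem_specialOrthogonalGroup_iff.1 k.2).2

/-- The frame with rotated spatial vectors. -/
def rotFrame (f : Fin 4 → Euc 4) (k : Matrix (Fin 3) (Fin 3) ℝ) (i : Fin 4) : Euc 4 :=
  ∑ j, rot4 k j i • f j

@[simp] theorem rotFrame_zero (f : Fin 4 → Euc 4) (k : Matrix (Fin 3) (Fin 3) ℝ) :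
    rotFrame f k 0 = f 0 := by
  simp [rotFrame, Fin.sum_univ_succ (n := 3)]

theorem rotFrame_succ (f : Fin 4 → Euc 4) (k : Matrix (Fin 3) (Fin 3) ℝ) (α : Fin 3) :
    rotFrame f k α.succ = ∑ β, k β α • f β.succ := by
  rw [rotFrame, Fin.sum_univ_succ]; simp

theorem rotFrame_one (f : Fin 4 → Euc 4) : rotFrame f 1 = f := by
  funext i
  simp [rotFrame, rot4_one, Matrix.one_apply]

theorem rotFrame_mul (f : Fin 4 → Euc 4) (k k' : Matrix (Fin 3) (Fin 3) ℝ) :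
    rotFrame f (k * k') = rotFrame (rotFrame f k) k' := by
  funext i
  simp only [rotFrame, rot4_mul, Matrix.mul_apply, Finset.smul_sum, Finset.sum_smul, smul_smul]
  rw [Finset.sum_comm]
  exact Finset.sum_congr rfl fun j _ => Finset.sum_congr rfl fun l _ => by rw [mul_comm]

theorem map_rotFrame (D : Euc 4 →L[ℝ] Euc 4) (f : Fin 4 → Euc 4) (k : Matrix (Fin 3) (Fin 3) ℝ)
    (i : Fin 4) : D (rotFrame f k i) = rotFrame (fun i => D (f i)) k i := by
  simp [rotFrame]

theorem IsOrthoFrame.rotFrame {B : Bil} {f : Fin 4 → Euc 4} (h : IsOrthoFrame B f)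
    {k : Matrix (Fin 3) (Fin 3) ℝ} (hk : kᵀ * k = 1) : IsOrthoFrame B (rotFrame f k) := by
  have h1 : (rot4 k)ᵀ * eta * rot4 k = eta := by
    rw [← rot4_transpose, rot4_mul_eta, mul_assoc, ← rot4_mul, hk, rot4_one, mul_one]
  intro i j
  rw [← h1, Matrix.mul_apply]
  simp only [FinslerCartan.rotFrame, map_sum, map_smul, sum_apply, smul_apply, h _ _, smul_eq_mul,
    Matrix.mul_apply, Matrix.transpose_apply]
  rw [← Finset.sum_neg_distrib]
  refine Finset.sum_congr rfl fun l _ => ?_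
  simp only [mul_neg, Finset.sum_neg_distrib]
  rw [mul_comm]

/-- The matrix that rotates the frame `g` into the frame `f`. -/
def relRot (B : Bil) (g f : Fin 4 → Euc 4) : Matrix (Fin 3) (Fin 3) ℝ :=
  Matrix.of fun α β => -B (g α.succ) (f β.succ)

theorem IsOrthoFrame.rotFrame_relRot {B : Bil} {f g : Fin 4 → Euc 4} (hg : IsOrthoFrame B g)
    (hf : IsOrthoFrame B f) (h0 : f 0 = g 0) : FinslerCartan.rotFrame g (relRot B g f) = f := by
  funext i
  refine Fin.cases ?_ (fun β => ?_) i
  · rw [rotFrame_zero, h0]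
  · rw [rotFrame_succ]
    conv_rhs => rw [← hg.sum_repr (f β.succ), Fin.sum_univ_succ, ← h0, hf 0 β.succ]
    simp [eta_apply, relRot, Fin.succ_ne_zero, (Fin.succ_ne_zero _).symm]

theorem IsOrthoFrame.relRot_transpose_mul {B : Bil} {f g : Fin 4 → Euc 4} (hg : IsOrthoFrame B g)
    (hf : IsOrthoFrame B f) (h0 : f 0 = g 0) : (relRot B g f)ᵀ * relRot B g f = 1 := by
  ext α β
  have h1 := hf α.succ β.succ
  rw [← hg.rotFrame_relRot hf h0, rotFrame_succ, rotFrame_succ] at h1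
  simp only [map_sum, map_smul, sum_apply, smul_apply, hg _ _, smul_eq_mul, eta_apply,
    Fin.succ_inj, Fin.succ_ne_zero, if_false] at h1
  simp only [mul_neg, mul_ite, mul_one, mul_zero, Finset.sum_neg_distrib, Finset.mem_univ, if_true, Finset.sum_ite_eq'] at h1
  rw [Matrix.mul_apply, Matrix.one_apply]
  simp only [Matrix.transpose_apply]
  rw [← neg_inj, ← h1]
  exact congrArg _ (Finset.sum_congr rfl fun γ _ => mul_comm _ _)

theorem IsOrthoFrame.relRot_rotFrame {B : Bil} {g : Fin 4 → Euc 4} (hg : IsOrthoFrame B g)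
    (k : Matrix (Fin 3) (Fin 3) ℝ) : relRot B g (FinslerCartan.rotFrame g k) = k := by
  ext α β
  rw [relRot, Matrix.of_apply, rotFrame_succ]
  simp [hg _ _, eta_apply, Fin.succ_ne_zero]

/-! ### Orientations -/

/-- The frame `f` is positively oriented. -/
def IsPositiveFrame (o : Orientation ℝ (Euc 4) (Fin 4)) (f : Fin 4 → Euc 4) : Prop :=
  ∃ b : Module.Basis (Fin 4) ℝ (Euc 4), (∀ i, b i = f i) ∧ b.orientation = o

/-- An auxiliary basis `e` turns the comparison of two orientations into a sign of determinants.
With `e` coming from coordinates this sign depends continuously on the frames. -/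
theorem orientation_eq_iff (e b r : Module.Basis (Fin 4) ℝ (Euc 4)) :
    b.orientation = r.orientation ↔ 0 < e.det b * e.det r := by
  have key : ∀ b : Module.Basis (Fin 4) ℝ (Euc 4), (0 < e.det b ∧ b.orientation = e.orientation) ∨
      (e.det b < 0 ∧ b.orientation = -e.orientation) := by
    intro b
    rcases lt_or_gt_of_ne (e.isUnit_det b).ne_zero with h | h
    · refine Or.inr ⟨h, ?_⟩
      rcases e.orientation_eq_or_eq_neg b.orientation with h1 | h1
      · have := (e.orientation_eq_iff_det_pos b).1 h1.symm
        linarith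
      · exact h1
    · exact Or.inl ⟨h, ((e.orientation_eq_iff_det_pos b).2 h).symm⟩
  have hne : e.orientation ≠ -e.orientation := Module.Ray.ne_neg_self _
  rcases key b with ⟨hb, hb'⟩ | ⟨hb, hb'⟩ <;> rcases key r with ⟨hr, hr'⟩ | ⟨hr, hr'⟩ <;>
    rw [hb', hr']
  · simp [mul_pos hb hr]
  · simp [hne, (mul_neg_of_pos_of_neg hb hr).le]
  · simp [hne.symm, (mul_neg_of_neg_of_pos hb hr).le]
  · simp [mul_pos_of_neg_of_neg hb hr]

/-- The determinant of the components of a frame. -/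
def frameDet (f : Fin 4 → Euc 4) : ℝ := (EuclideanSpace.basisFun (Fin 4) ℝ).toBasis.det f

theorem continuous_frameDet : Continuous frameDet := by
  unfold frameDet
  simp_rw [Module.Basis.det_apply]
  refine Continuous.matrix_det ?_
  refine continuous_matrix fun i j => ?_
  simp only [Module.Basis.toMatrix_apply, OrthonormalBasis.coe_toBasis_repr_apply,
    EuclideanSpace.basisFun_repr]
  fun_prop

/-- The reference frame `r` is positive, so positivity of `f` means that both determinants have the
same sign in any linear coordinates `D`. As a strict inequality between continuous functions it
persists near a point. -/
theorem isPositiveFrame_iff_frameDet {o : Orientation ℝ (Euc 4) (Fin 4)} {f r : Fin 4 → Euc 4}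
    (hr : IsPositiveFrame o r) (hf : LinearIndependent ℝ f) (D : Euc 4 ≃L[ℝ] Euc 4) :
    IsPositiveFrame o f ↔ 0 < frameDet (fun i => D (f i)) * frameDet (fun i => D (r i)) := by
  obtain ⟨r', hr1, hr2⟩ := hr
  obtain rfl : (r' : Fin 4 → Euc 4) = r := funext hr1
  let b := basisOfLinearIndependentOfCardEqFinrank hf (by simp)
  have hb : (b : Fin 4 → Euc 4) = f := by simp [b]
  have hdet : ∀ g : Fin 4 → Euc 4, ((EuclideanSpace.basisFun (Fin 4) ℝ).toBasis.map
      D.symm.toLinearEquiv).det g = frameDet fun i => D (g i) := by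
    intro g
    rw [Module.Basis.det_map]; rfl
  have h1 := orientation_eq_iff ((EuclideanSpace.basisFun (Fin 4) ℝ).toBasis.map
      D.symm.toLinearEquiv) b r'
  rw [hdet, hdet, hb] at h1
  rw [← h1, ← hr2]
  constructor
  · rintro ⟨b', hb1, hb2⟩
    rw [← hb2]
    congr 1
    exact Module.Basis.eq_of_apply_eq fun i => by rw [hb1, hb]
  · exact fun h => ⟨b, fun i => by rw [hb], h⟩

/-- The determinant of the rotated frame relative to the original one is `det (rot4 k) = det k`. -/
theorem isPositiveFrame_rotFrame_iff {o : Orientation ℝ (Euc 4) (Fin 4)} {f : Fin 4 → Euc 4}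
    (hf : IsPositiveFrame o f) {k : Matrix (Fin 3) (Fin 3) ℝ}
    (hk : LinearIndependent ℝ (rotFrame f k)) :
    IsPositiveFrame o (rotFrame f k) ↔ 0 < k.det := by
  obtain ⟨f', hf1, hf2⟩ := hf
  obtain rfl : (f' : Fin 4 → Euc 4) = f := funext hf1
  let b := basisOfLinearIndependentOfCardEqFinrank hk (by simp)
  have hb : (b : Fin 4 → Euc 4) = rotFrame f' k := by simp [b]
  have h1 : f'.det b = k.det := by
    rw [Module.Basis.det_apply, ← det_rot4]
    congr 1
    ext i j
    rw [Module.Basis.toMatrix_apply, hb, rotFrame]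
    simp [Finsupp.single_apply]
  rw [← h1, ← f'.orientation_eq_iff_det_pos, hf2]
  constructor
  · rintro ⟨b', hb1, hb2⟩
    rw [← hb2]
    congr 1
    exact Module.Basis.eq_of_apply_eq fun i => by rw [hb1, hb]
  · exact fun h => ⟨b, fun i => by rw [hb], h.symm⟩

/-- Orthonormality of both frames makes the relative matrix orthogonal, so its determinant is `±1`;
equal orientations exclude `-1`. -/
theorem IsOrthoFrame.relRot_mem {B : Bil} {o : Orientation ℝ (Euc 4) (Fin 4)} {f g : Fin 4 → Euc 4}
    (hg : IsOrthoFrame B g) (hf : IsOrthoFrame B f) (h0 : f 0 = g 0) (hg' : IsPositiveFrame o g)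
    (hf' : IsPositiveFrame o f) : relRot B g f ∈ Matrix.specialOrthogonalGroup (Fin 3) ℝ := by
  have h1 := hg.relRot_transpose_mul hf h0
  have h2 := hg.rotFrame_relRot hf h0
  rw [Matrix.mem_specialOrthogonalGroup_iff]
  refine ⟨(Matrix.mem_orthogonalGroup_iff' _ _).2 h1, ?_⟩
  have h3 := congrArg Matrix.det h1
  rw [Matrix.det_mul, Matrix.det_transpose, Matrix.det_one] at h3
  rw [← h2] at hf'
  have h4 := (isPositiveFrame_rotFrame_iff hg' (by rw [h2]; exact hf.linearIndependent)).1 hf'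
  nlinarith

/-! ### The frame bundle -/

section Frames

variable {M : Type*} [TopologicalSpace M] [ChartedSpace (Euc 4) M] [IsManifold (𝓡 4) ∞ M]
  {φ : OpenPartialHomeomorph M (Euc 4)} {FS : FinslerSpacetime M} {T : TimeOrientation FS}
  {ori : ManifoldOrientation M}

namespace ObserverFrame

theorem ext_toTM {p q : ObserverFrame T ori} (h : ∀ i, p.toTM i = q.toTM i) : p = q := by
  obtain ⟨x, v, h1, h2, h3⟩ := p
  obtain ⟨x', v', h1', h2', h3'⟩ := q
  obtain rfl : x = x' := congrArg (fun t : TangentBundle (𝓡 4) M => t.proj) (h 0)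
  obtain rfl : v = v' := funext fun i => by
    have := h i
    simpa [toTM] using this
  rfl

theorem isOrthoFrame (p : ObserverFrame T ori) :
    IsOrthoFrame (finslerMetric FS.F (p.toTM 0)) p.vec := p.orthonormal

theorem isPositiveFrame (p : ObserverFrame T ori) :
    IsPositiveFrame (ori.orient p.base) p.vec := p.oriented

theorem toTM_mem_cone (p : ObserverFrame T ori) : p.toTM 0 ∈ T.cone :=
  TimeOrientation.observer_mem_cone p.observer

theorem mk_congr {x : M} {y y' : Euc 4} (h : y = y') :
    (⟨x, y⟩ : TangentBundle (𝓡 4) M) = ⟨x, y'⟩ := by rw [h]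

/-- The action of a rotation on a frame. -/
def act (p : ObserverFrame T ori) (k : RotGroup) : ObserverFrame T ori where
  base := p.base
  vec := rotFrame p.vec k.val
  time_mem := Set.mem_of_eq_of_mem (rotFrame_zero p.vec k.val) p.time_mem
  orthonormal i j := (congrArg (fun t => finslerMetric FS.F t (rotFrame p.vec k.val i)
    (rotFrame p.vec k.val j)) (mk_congr (rotFrame_zero p.vec k.val))).trans
      (p.isOrthoFrame.rotFrame (transpose_mul_self k) i j)
  oriented := (isPositiveFrame_rotFrame_iff p.isPositiveFrame
    (p.isOrthoFrame.rotFrame (transpose_mul_self k)).linearIndependent).2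
      (by rw [det_rotGroup]; exact one_pos)

theorem toTM_act_zero (p : ObserverFrame T ori) (k : RotGroup) :
    (p.act k).toTM 0 = p.toTM 0 :=
  mk_congr (rotFrame_zero p.vec k.val)

theorem observer_act (p : ObserverFrame T ori) (k : RotGroup) :
    (p.act k).observer = p.observer := Subtype.ext (p.toTM_act_zero k)

theorem act_one (p : ObserverFrame T ori) : p.act 1 = p :=
  ext_toTM fun i => mk_congr (congrFun (rotFrame_one p.vec) i)

theorem act_mul (p : ObserverFrame T ori) (k k' : RotGroup) : p.act (k * k') = (p.act k).act k' :=
  ext_toTM fun i => 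
    mk_congr (congrFun (rotFrame_mul p.vec k.val k'.val) i)

theorem isOrthoFrame_coord (hφ : φ ∈ IsManifold.maximalAtlas (𝓡 4) ∞ M) (p : ObserverFrame T ori)
    (hp : p.base ∈ φ.source) : IsOrthoFrame (vHess (coordSq FS.F φ) (tcoord φ (p.toTM 0)))
      (fun i => (tcoord φ (p.toTM i)).2) := fun i j =>
  (TimeOrientation.vHess_tcoord hφ (v := p.toTM 0) hp p.toTM_mem_cone (p.vec i) (p.vec j)).trans
    (p.orthonormal i j)

theorem tcoord_act (p : ObserverFrame T ori) (k : RotGroup) (i : Fin 4) :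
    tcoord φ ((p.act k).toTM i) = (φ p.base, rotFrame (fun i => (tcoord φ (p.toTM i)).2) k.val i) :=
  Prod.ext rfl (map_rotFrame (mfderiv (𝓡 4) (𝓡 4) φ p.base) p.vec k.val i)

/-- Orthonormal completion of an observer is linear algebra in one tangent space. Only the
orientation may come out wrong, and a spatial reflection corrects it. -/
theorem exists_observer_eq (o : ObserverSpace T) : ∃ p : ObserverFrame T ori, p.observer = o := by
  have ho := TimeOrientation.observer_mem_cone o
  have ht := FS.isTimelike_finslerMetric (T.cone_subset ho)
  have h1 : finslerMetric FS.F o.val o.val.snd o.val.snd = 1 := by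
    rw [FS.finslerMetric_self_self (T.cone_subset ho), TimeOrientation.F_eq_one, one_pow]
  have hs : ∀ u v, finslerMetric FS.F o.val u v = finslerMetric FS.F o.val v u := by
    have hφ := chartAt_mem_maximalAtlas (M := M) o.val.proj
    have hx : o.val.proj ∈ (chartAt (Euc 4) o.val.proj).source := mem_chart_source _ _
    intro u v
    have h2 := TimeOrientation.vHess_tcoord hφ hx ho u v
    have h3 := TimeOrientation.vHess_tcoord hφ hx ho v u
    exact h2.symm.trans ((vHess_symm (TimeOrientation.contDiffAt_coordSq hφ
      (TimeOrientation.tcoord_mem_coordDomain hφ hx ho)) _ _).trans h3)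
  obtain ⟨u, hu⟩ := ht.exists_spatialFrame hs
  have hf := hu.isOrthoFrame hs h1
  set f : Fin 4 → Euc 4 := Fin.cons o.val.snd u with hfdef
  suffices h : ∃ f' : Fin 4 → Euc 4, f' 0 = o.val.snd ∧ IsOrthoFrame (finslerMetric FS.F o.val) f' ∧
      IsPositiveFrame (ori.orient o.val.proj) f' by
    obtain ⟨f', hf0, hf1, hf2⟩ := h
    refine ⟨⟨o.val.proj, f', hf0 ▸ o.2, fun i j => ?_, hf2⟩, ?_⟩
    · rw [hf0]; exact hf1 i j
    · exact Subtype.ext (Bundle.TotalSpace.ext rfl (heq_of_eq hf0))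
  let o' : Orientation ℝ (Euc 4) (Fin 4) := ori.orient o.val.proj
  by_cases hp : IsPositiveFrame o' f
  · exact ⟨f, rfl, hf, hp⟩
  -- In the three spatial dimensions `-1` is orthogonal of determinant `-1`. The inverted frame and
  -- the required orientation both differ from the orientation of `f`, and there are only two
  -- orientations.
  · have hk : (-1 : Matrix (Fin 3) (Fin 3) ℝ)ᵀ * (-1 : Matrix (Fin 3) (Fin 3) ℝ) = 1 := by simp
    have hr := hf.rotFrame hk
    refine ⟨rotFrame f (-1), rotFrame_zero _ _, hr, ?_⟩
    have h2 : IsPositiveFrame hf.basis.orientation f := ⟨hf.basis, fun i => by simp, rfl⟩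
    have h3 := isPositiveFrame_rotFrame_iff h2 hr.linearIndependent
    have h4 : (-1 : Matrix (Fin 3) (Fin 3) ℝ).det = -1 := by
      rw [Matrix.det_neg]; norm_num
    have h5 : ∀ x y : Orientation ℝ (Euc 4) (Fin 4), x ≠ y → x = -y := fun x y hxy =>
      (x.ne_iff_eq_neg y (by simp)).1 hxy
    have h6 : o' ≠ hf.basis.orientation := fun h => hp (h ▸ h2)
    have h7 : hr.basis.orientation ≠ hf.basis.orientation := fun h => by
      have := h3.1 ⟨hr.basis, fun i => by simp, h⟩
      rw [h4] at this; linarith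
    exact ⟨hr.basis, fun i => by simp, (h5 _ _ h7).trans (h5 _ _ h6).symm⟩

end ObserverFrame

variable (T ori) in
/-- The inclusion of the frame bundle into the fourth power of `TM`. -/
def frameInc (i : Fin 4) (p : ObserverFrame T ori) : TangentBundle (𝓡 4) M := p.toTM i

theorem isInducing_frameInc : Topology.IsInducing (fun p i => frameInc T ori i p) := ⟨rfl⟩

theorem continuous_toTM (i : Fin 4) : Continuous (fun p : ObserverFrame T ori => p.toTM i) :=
  (continuous_apply i).comp isInducing_frameInc.continuous

/-- A local section of the frame bundle, in induced coordinates. -/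
structure LocalFrame (T : TimeOrientation FS) (ori : ManifoldOrientation M)
    (φ : OpenPartialHomeomorph M (Euc 4)) (V : Set (Euc 4 × Euc 4))
    (g : Euc 4 × Euc 4 → Fin 4 → Euc 4) : Prop where
  chart : φ ∈ IsManifold.maximalAtlas (𝓡 4) ∞ M
  isOpen : IsOpen V
  subset : V ⊆ T.coordDomain φ
  smooth : ∀ i, ∀ z ∈ V, ContDiffAt ℝ ∞ (fun z => g z i) z
  zero : ∀ z, g z 0 = z.2
  -- The vector of index zero is `z.2`, which is normalized only on the level `F = 1`. Off this
  -- level the family serves just to make derivatives available.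
  ortho : ∀ z ∈ V, FS.F (tpoint φ z) = 1 → IsOrthoFrame (vHess (coordSq FS.F φ) z) (g z)
  positive : ∀ z ∈ V, FS.F (tpoint φ z) = 1 → IsPositiveFrame (ori.orient (φ.symm z.1))
    (fun i => mfderiv (𝓡 4) (𝓡 4) φ.symm z.1 (g z i))

/-- Gram-Schmidt in induced coordinates, seeded with the frame `p`, gives a smooth orthonormal
family through `p`. The domain is then shrunk until all frames have the orientation that `p` has. -/
theorem exists_localFrame (hφ : φ ∈ IsManifold.maximalAtlas (𝓡 4) ∞ M) (p : ObserverFrame T ori)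
    (hp : p.base ∈ φ.source) : ∃ V g, LocalFrame T ori φ V g ∧ tcoord φ (p.toTM 0) ∈ V ∧
      ∀ i, g (tcoord φ (p.toTM 0)) i = (tcoord φ (p.toTM i)).2 := by
  set Q := coordSq FS.F φ with hQ
  set z₀ := tcoord φ (p.toTM 0) with hz₀
  have hz₀D : z₀ ∈ T.coordDomain φ :=
    TimeOrientation.tcoord_mem_coordDomain hφ hp p.toTM_mem_cone
  have hmd := TimeOrientation.isMetricDomain (T := T) hφ
  have hof := p.isOrthoFrame_coord hφ hp
  obtain ⟨hgs, U, hU, hUo, hUs, hUf⟩ := gramSchmidtSpace_spec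
    (fun α => (tcoord φ (p.toTM α.succ)).2) (vHess Q z₀) z₀.2
    (TimeOrientation.isTimelike_vHess hφ hz₀D) hof.isSpatialFrame
  set G : Euc 4 × Euc 4 → Fin 3 → Euc 4 := fun z =>
    gramSchmidtSpace (fun α => (tcoord φ (p.toTM α.succ)).2) (vHess Q z, z.2) with hG
  set g : Euc 4 × Euc 4 → Fin 4 → Euc 4 := fun z => Fin.cons z.2 (G z) with hg
  have hgz₀ : ∀ i, g z₀ i = (tcoord φ (p.toTM i)).2 := by
    intro i
    refine Fin.cases rfl (fun α => ?_) i
    exact congrFun hgs α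
  have hq : ∀ z ∈ T.coordDomain φ, ContDiffAt ℝ ∞ (fun z => (vHess Q z, z.2)) z := fun z hz =>
    (hmd.contDiffAt_vHess hz).prodMk contDiffAt_snd
  set V₀ : Set (Euc 4 × Euc 4) := T.coordDomain φ ∩ (fun z => (vHess Q z, z.2)) ⁻¹' U with hV₀
  have hV₀o : IsOpen V₀ := ContinuousOn.isOpen_inter_preimage
    (fun z hz => (hq z hz).continuousAt.continuousWithinAt) hmd.isOpen hUo
  have hsm : ∀ i, ∀ z ∈ V₀, ContDiffAt ℝ ∞ (fun z => g z i) z := by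
    intro i z hz
    refine Fin.cases contDiffAt_snd (fun α => ?_) i
    exact ContDiffAt.comp z (f := fun z => (vHess Q z, z.2))
      ((hUs α).contDiffAt (hUo.mem_nhds hz.2)) (hq z hz.1)
  obtain ⟨N, hNo, hN, s, hsc, hsp⟩ := ori.continuous p.base
  set V₁ : Set (Euc 4 × Euc 4) := V₀ ∩ {z | z.1 ∈ φ.target ∩ φ.symm ⁻¹' N} with hV₁
  have hV₁o : IsOpen V₁ := hV₀o.inter
    ((φ.symm.isOpen_inter_preimage hNo).preimage continuous_fst)
  -- The coordinates of the continuous oriented frame field of `M`, against which the orientation of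
  -- the family is measured.
  set r : Euc 4 × Euc 4 → Fin 4 → Euc 4 := fun z i =>
    (tcoord φ ⟨φ.symm z.1, s i (φ.symm z.1)⟩).2 with hr
  have hrc : ContinuousOn r V₁ := by
    rw [continuousOn_pi]
    intro i
    have h1 : ContinuousOn (fun z : Euc 4 × Euc 4 => φ.symm z.1) V₁ :=
      φ.symm.continuousOn.comp continuousOn_fst fun z hz => hz.2.1
    have h2 := (hsc i).comp h1 fun z hz => hz.2.2
    exact ((contMDiffOn_tcoord hφ).continuousOn.comp h2 fun z hz => φ.map_target hz.2.1).snd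
  have hgc : ContinuousOn g V₁ := by
    rw [continuousOn_pi]
    exact fun i z hz => (hsm i z hz.1).continuousAt.continuousWithinAt
  have hpc : ContinuousOn (fun z => frameDet (g z) * frameDet (r z)) V₁ :=
    (continuous_frameDet.comp_continuousOn hgc).mul (continuous_frameDet.comp_continuousOn hrc)
  have hpos : ∀ x (hx : x ∈ φ.source) (hxN : x ∈ N) (f : Fin 4 → Euc 4)
      (hf : LinearIndependent ℝ f), IsPositiveFrame (ori.orient x) f ↔
        0 < frameDet (fun i => mfderiv (𝓡 4) (𝓡 4) φ x (f i)) *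
          frameDet (fun i => mfderiv (𝓡 4) (𝓡 4) φ x (s i x)) := by
    intro x hx hxN f hf
    exact isPositiveFrame_iff_frameDet (hsp x hxN) hf
      ((mdifferentiable_of_mem_maximalAtlas hφ).mfderiv hx)
  have hx₀ : φ.symm z₀.1 = p.base := φ.left_inv hp
  have hV₁z : z₀ ∈ V₁ := ⟨⟨hz₀D, show (vHess Q z₀, z₀.2) ∈ U from mem_of_mem_nhds hU⟩, φ.map_source hp, by
    rw [Set.mem_preimage, hx₀]; exact hN⟩
  have horth : ∀ z ∈ V₀, FS.F (tpoint φ z) = 1 → IsOrthoFrame (vHess Q z) (g z) := by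
    intro z hz hF
    refine (hUf _ hz.2 (hmd.symm hz.1)).isOrthoFrame (hmd.symm hz.1) ?_
    rw [TimeOrientation.vHess_self_self hφ hz.1, hF, one_pow]
  -- On the final domain the two determinants have the same sign. This is an open condition, and it
  -- holds at `z₀` because `p` is positively oriented.
  refine ⟨V₁ ∩ (fun z => frameDet (g z) * frameDet (r z)) ⁻¹' Set.Ioi 0, g, ⟨hφ,
    hpc.isOpen_inter_preimage hV₁o isOpen_Ioi, fun z hz => hz.1.1.1, fun i z hz => hsm i z hz.1.1,
    fun z => rfl, fun z hz => horth z hz.1.1, fun z hz hF => ?_⟩, ⟨hV₁z, ?_⟩, hgz₀⟩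
  · have hzt : z.1 ∈ φ.target := hz.1.2.1
    have hd : ∀ i, mfderiv (𝓡 4) (𝓡 4) φ (φ.symm z.1) (mfderiv (𝓡 4) (𝓡 4) φ.symm z.1 (g z i)) =
        g z i := fun i => congrArg (fun A => A (g z i))
      ((mdifferentiable_of_mem_maximalAtlas hφ).comp_symm_deriv hzt)
    have hli : LinearIndependent ℝ (fun i => (chartEquiv hφ hzt (g z i))) :=
      (horth z hz.1.1 hF).linearIndependent.map' (chartEquiv hφ hzt).toLinearEquiv.toLinearMap
        (LinearMap.ker_eq_bot.2 (chartEquiv hφ hzt).injective)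
    refine (hpos _ (φ.map_target hzt) hz.1.2.2 _ hli).2 ?_
    have h1 : 0 < frameDet (g z) * frameDet (r z) := hz.2
    have h2 : (fun i => mfderiv (𝓡 4) (𝓡 4) φ (φ.symm z.1) (chartEquiv hφ hzt (g z i))) = g z :=
      funext hd
    rw [← h2] at h1
    exact h1
  · have h1 := (hpos p.base hp hN p.vec p.isOrthoFrame.linearIndependent).1 p.isPositiveFrame
    have h2 : (fun i => mfderiv (𝓡 4) (𝓡 4) φ p.base (p.vec i)) = g z₀ := funext fun i => (hgz₀ i).symm
    have h3 : (fun i => mfderiv (𝓡 4) (𝓡 4) φ p.base (s i p.base)) = r z₀ := by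
      simp only [hr]
      rw [hx₀]; rfl
    rw [Set.mem_preimage, Set.mem_Ioi, ← h2, ← h3]
    exact h1

end Frames

/-! ### Local sections of the frame bundle and its charts -/

section Sections

variable {M : Type*} [TopologicalSpace M] [ChartedSpace (Euc 4) M] [IsManifold (𝓡 4) ∞ M]
  {φ : OpenPartialHomeomorph M (Euc 4)} {FS : FinslerSpacetime M} {T : TimeOrientation FS}
  {ori : ManifoldOrientation M}

/-- Points of `TM` with induced coordinates in `V`. -/
def overSet (φ : OpenPartialHomeomorph M (Euc 4)) (V : Set (Euc 4 × Euc 4)) :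
    Set (TangentBundle (𝓡 4) M) := {v | v.proj ∈ φ.source ∧ tcoord φ v ∈ V}

/-- The matrix that rotates the frame `g` into the frame with coordinates `ζ`. -/
def rotCoord (Q : Euc 4 × Euc 4 → ℝ) (g : Euc 4 × Euc 4 → Fin 4 → Euc 4) (ζ : Fin 4 → Euc 4 × Euc 4) :
    Matrix (Fin 3) (Fin 3) ℝ := relRot (vHess Q (ζ 0)) (g (ζ 0)) (fun i => (ζ i).2)

namespace LocalFrame

variable {V : Set (Euc 4 × Euc 4)} {g : Euc 4 × Euc 4 → Fin 4 → Euc 4} (h : LocalFrame T ori φ V g)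
include h

theorem isOpen_overSet : IsOpen (overSet (M := M) φ V) :=
  (contMDiffOn_tcoord h.chart).continuousOn.isOpen_inter_preimage (isOpen_proj_source φ) h.isOpen

theorem F_tpoint_tcoord (o : ObserverSpace T) (ho : o.val ∈ overSet φ V) :
    FS.F (tpoint φ (tcoord φ o.val)) = 1 := by
  rw [tpoint_tcoord h.chart ho.1, TimeOrientation.F_eq_one]

/-- The frame over an observer given by a local section. -/
def frameOver (o : ObserverSpace T) (ho : o.val ∈ overSet φ V) : ObserverFrame T ori where
  base := φ.symm (tcoord φ o.val).1
  vec i := mfderiv (𝓡 4) (𝓡 4) φ.symm (tcoord φ o.val).1 (g (tcoord φ o.val) i)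
  time_mem := by
    have h1 : tpoint φ ((tcoord φ o.val).1, g (tcoord φ o.val) 0) = o.val := by
      rw [h.zero, Prod.mk.eta, tpoint_tcoord h.chart ho.1]
    have h2 : ∀ v : TangentBundle (𝓡 4) M, v = o.val → v.snd ∈ T.S v.proj := by
      rintro _ rfl; exact o.2
    exact h2 _ h1
  orthonormal i j := by
    have h1 := h.ortho _ ho.2 (h.F_tpoint_tcoord o ho) i j
    rw [TimeOrientation.vHess_eq_finslerMetric h.chart (h.subset ho.2)] at h1
    have h2 : tpoint φ ((tcoord φ o.val).1, g (tcoord φ o.val) 0) = tpoint φ (tcoord φ o.val) := by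
      rw [h.zero]
    exact (congrArg (fun t => finslerMetric FS.F t _ _) h2).trans h1
  oriented := h.positive _ ho.2 (h.F_tpoint_tcoord o ho)

theorem toTM_frameOver (o : ObserverSpace T) (ho : o.val ∈ overSet φ V) (i : Fin 4) :
    (h.frameOver o ho).toTM i = tpoint φ ((tcoord φ o.val).1, g (tcoord φ o.val) i) := rfl

open Classical in
/-- The local section, with a default value outside its domain. -/
def sect (p₀ : ObserverFrame T ori) (o : ObserverSpace T) : ObserverFrame T ori :=
  if ho : o.val ∈ overSet φ V then h.frameOver o ho else p₀

theorem toTM_act_sect (p₀ : ObserverFrame T ori) {o : ObserverSpace T} (ho : o.val ∈ overSet φ V)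
    (k : RotGroup) (i : Fin 4) : ((h.sect p₀ o).act k).toTM i =
      tpoint φ ((tcoord φ o.val).1, rotFrame (g (tcoord φ o.val)) k.val i) := by
  rw [sect, dif_pos ho]
  exact ObserverFrame.mk_congr (map_rotFrame (mfderiv (𝓡 4) (𝓡 4) φ.symm (tcoord φ o.val).1)
    (g (tcoord φ o.val)) k.val i).symm

theorem observer_act_sect (p₀ : ObserverFrame T ori) {o : ObserverSpace T}
    (ho : o.val ∈ overSet φ V) (k : RotGroup) : ((h.sect p₀ o).act k).observer = o := by
  apply Subtype.ext
  refine (h.toTM_act_sect p₀ ho k 0).trans ?_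
  rw [rotFrame_zero, h.zero, Prod.mk.eta, tpoint_tcoord h.chart ho.1]

theorem observer_sect (p₀ : ObserverFrame T ori) {o : ObserverSpace T}
    (ho : o.val ∈ overSet φ V) : (h.sect p₀ o).observer = o := by
  have := h.observer_act_sect p₀ ho 1
  rwa [ObserverFrame.act_one] at this

theorem tcoord_act_sect (p₀ : ObserverFrame T ori) {o : ObserverSpace T} (ho : o.val ∈ overSet φ V)
    (k : RotGroup) (i : Fin 4) : tcoord φ (((h.sect p₀ o).act k).toTM i) =
      ((tcoord φ o.val).1, rotFrame (g (tcoord φ o.val)) k.val i) := by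
  rw [h.toTM_act_sect p₀ ho]
  exact tcoord_tpoint h.chart (z := (_, _)) (tcoord_fst_mem ho.1)

theorem tcoord_act_sect_zero (p₀ : ObserverFrame T ori) {o : ObserverSpace T}
    (ho : o.val ∈ overSet φ V) (k : RotGroup) :
    tcoord φ (((h.sect p₀ o).act k).toTM 0) = tcoord φ o.val := by
  rw [h.tcoord_act_sect p₀ ho, rotFrame_zero, h.zero]

theorem rotCoord_act_sect (p₀ : ObserverFrame T ori) {o : ObserverSpace T}
    (ho : o.val ∈ overSet φ V) (k : RotGroup) :
    rotCoord (coordSq FS.F φ) g (fun i => tcoord φ (((h.sect p₀ o).act k).toTM i)) = k.val := by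
  rw [rotCoord, h.tcoord_act_sect_zero p₀ ho]
  simp only [h.tcoord_act_sect p₀ ho]
  exact (h.ortho _ ho.2 (h.F_tpoint_tcoord o ho)).relRot_rotFrame k.val

theorem rotCoord_mem (p : ObserverFrame T ori) (hp : p.toTM 0 ∈ overSet φ V) :
    rotCoord (coordSq FS.F φ) g (fun i => tcoord φ (p.toTM i)) ∈
      Matrix.specialOrthogonalGroup (Fin 3) ℝ := by
  have hF := h.F_tpoint_tcoord p.observer hp
  have hx : p.base ∈ φ.source := hp.1
  let D : Euc 4 ≃L[ℝ] Euc 4 := chartEquiv h.chart (tcoord_fst_mem (φ := φ) (v := p.toTM 0) hp.1)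
  have hb : φ.symm (tcoord φ (p.toTM 0)).1 = p.base := φ.left_inv hx
  have h1 := h.positive _ hp.2 hF
  rw [hb] at h1
  have h2 := p.isPositiveFrame
  have h3 : (fun i => D ((tcoord φ (p.toTM i)).2)) = p.vec := funext fun i =>
    congrArg (fun A => A (p.vec i))
      ((mdifferentiable_of_mem_maximalAtlas h.chart).symm_comp_deriv hx)
  have h1' : IsPositiveFrame (ori.orient p.base) (fun i => D (g (tcoord φ (p.toTM 0)) i)) := h1
  have h2' : IsPositiveFrame (ori.orient p.base) (fun i => D ((tcoord φ (p.toTM i)).2)) := by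
    rw [h3]; exact h2
  -- The orientation lives on the tangent space while the frames are compared in coordinates, so it
  -- is transported along the differential of the chart.
  have key : ∀ (o : Orientation ℝ (Euc 4) (Fin 4)) (f : Fin 4 → Euc 4),
      IsPositiveFrame o (fun i => D (f i)) →
      IsPositiveFrame (Orientation.map (Fin 4) D.symm.toLinearEquiv o) f := by
    rintro o f ⟨b, hb1, rfl⟩
    refine ⟨b.map D.symm.toLinearEquiv, fun i => by simp [hb1], ?_⟩
    rw [Module.Basis.orientation_map]
  exact (h.ortho _ hp.2 hF).relRot_mem (p.isOrthoFrame_coord h.chart hx) (h.zero _).symm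
    (key _ _ h1') (key _ _ h2')

open Classical in
/-- The rotation that relates a frame to the local section. -/
def kap (p : ObserverFrame T ori) : RotGroup :=
  if hp : p.toTM 0 ∈ overSet φ V then ⟨_, h.rotCoord_mem p hp⟩ else 1

theorem kap_val {p : ObserverFrame T ori} (hp : p.toTM 0 ∈ overSet φ V) :
    (h.kap p).val = rotCoord (coordSq FS.F φ) g (fun i => tcoord φ (p.toTM i)) := by
  rw [kap, dif_pos hp]

/-- The rotation `k` is described by its matrix only, since it occurs in two guises: as `kap p`, and
as the rotation recovered from a Rodrigues vector. -/
theorem act_sect_eq (p₀ p : ObserverFrame T ori) (hp : p.toTM 0 ∈ overSet φ V) (k : RotGroup)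
    (hk : k.val = rotCoord (coordSq FS.F φ) g (fun i => tcoord φ (p.toTM i))) :
    (h.sect p₀ p.observer).act k = p := by
  apply ObserverFrame.ext_toTM
  intro i
  have hF := h.F_tpoint_tcoord p.observer hp
  rw [h.toTM_act_sect p₀ (o := p.observer) hp, hk]
  have h1 := congrFun ((h.ortho _ hp.2 hF).rotFrame_relRot
    (p.isOrthoFrame_coord h.chart hp.1) (h.zero _).symm) i
  have h2 : tpoint φ (tcoord φ (p.toTM i)) = p.toTM i :=
    tpoint_tcoord h.chart (v := p.toTM i) hp.1
  refine Eq.trans ?_ h2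
  exact congrArg (fun y => tpoint φ ((tcoord φ (p.toTM 0)).1, y)) h1

theorem act_sect_kap (p₀ p : ObserverFrame T ori) (hp : p.toTM 0 ∈ overSet φ V) :
    (h.sect p₀ p.observer).act (h.kap p) = p := h.act_sect_eq p₀ p hp _ (h.kap_val hp)

theorem kap_act_sect (p₀ : ObserverFrame T ori) {o : ObserverSpace T} (ho : o.val ∈ overSet φ V)
    (k : RotGroup) : h.kap ((h.sect p₀ o).act k) = k := by
  apply Subtype.ext
  rw [h.kap_val, h.rotCoord_act_sect p₀ ho]
  have := h.observer_act_sect p₀ ho k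
  rw [← this] at ho
  exact ho

theorem contDiffAt_rotCoord {ζ : Fin 4 → Euc 4 × Euc 4} (hζ : ζ 0 ∈ V) (α β : Fin 3) :
    ContDiffAt ℝ ∞ (fun ζ => rotCoord (coordSq FS.F φ) g ζ α β) ζ := by
  have h0 : ContDiffAt ℝ ∞ (fun ζ : Fin 4 → Euc 4 × Euc 4 => ζ 0) ζ :=
    (contDiff_apply ℝ (Euc 4 × Euc 4) 0).contDiffAt
  have h1 : ContDiffAt ℝ ∞ (fun ζ : Fin 4 → Euc 4 × Euc 4 => vHess (coordSq FS.F φ) (ζ 0)) ζ :=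
    ContDiffAt.comp ζ (f := fun ζ : Fin 4 → Euc 4 × Euc 4 => ζ 0)
      ((TimeOrientation.isMetricDomain h.chart).contDiffAt_vHess (h.subset hζ)) h0
  have h2 : ContDiffAt ℝ ∞ (fun ζ : Fin 4 → Euc 4 × Euc 4 => g (ζ 0) α.succ) ζ :=
    ContDiffAt.comp ζ (f := fun ζ : Fin 4 → Euc 4 × Euc 4 => ζ 0) (h.smooth α.succ _ hζ) h0
  have h3 : ContDiffAt ℝ ∞ (fun ζ : Fin 4 → Euc 4 × Euc 4 => (ζ β.succ).2) ζ :=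
    (contDiff_snd.comp (contDiff_apply ℝ (Euc 4 × Euc 4) β.succ)).contDiffAt
  exact ((h1.clm_apply h2).clm_apply h3).neg

theorem contDiffAt_rotFrame {E : Type*} [NormedAddCommGroup E] [NormedSpace ℝ E]
    {z : E → Euc 4 × Euc 4} {k : E → Matrix (Fin 3) (Fin 3) ℝ} {x : E} (hz : ContDiffAt ℝ ∞ z x)
    (hk : ∀ α β, ContDiffAt ℝ ∞ (fun x => k x α β) x) (hx : z x ∈ V) (i : Fin 4) :
    ContDiffAt ℝ ∞ (fun x => rotFrame (g (z x)) (k x) i) x := by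
  have hg : ∀ j, ContDiffAt ℝ ∞ (fun x => g (z x) j) x := fun j =>
    ContDiffAt.comp x (g := fun z => g z j) (h.smooth j _ hx) hz
  have hc : ∀ i j, ContDiffAt ℝ ∞ (fun x => rot4 (k x) j i) x := by
    intro i j
    refine Fin.cases ?_ (fun α => ?_) i <;> refine Fin.cases ?_ (fun β => ?_) j
    · exact contDiffAt_const
    · exact contDiffAt_const
    · exact contDiffAt_const
    · exact hk _ _
  exact ContDiffAt.sum fun j _ => (hc i j).smul (hg j)

end LocalFrame

/-- The model space of the frame bundle. -/
def euc10 : ((Euc 4 × Euc 3) × Euc 3) ≃L[ℝ] Euc 10 := ContinuousLinearEquiv.ofFinrankEq (by simp)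

/-- The coordinates of a frame as a function of the induced coordinates of its vectors. -/
def frameCoord (Q : Euc 4 × Euc 4 → ℝ) (g : Euc 4 × Euc 4 → Fin 4 → Euc 4)
    (A : Euc 4 ≃L[ℝ] Euc 3 × ℝ) (ζ : Fin 4 → Euc 4 × Euc 4) : (Euc 4 × Euc 3) × Euc 3 :=
  (((ζ 0).1, wproj A (ζ 0).2), rodriguesVec (rotCoord Q g ζ))

/-- A local section identifies frames with pairs of an observer and the rotation that carries the
section to the frame. Projective coordinates of the observer and the Rodrigues vector of the
rotation give `4 + 3 + 3 = 10` coordinates. -/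
theorem exists_frameChart (p₀ : ObserverFrame T ori) : ∃ e : OpenPartialHomeomorph
    (ObserverFrame T ori) (Euc 10), IsSliceChart (frameInc T ori) e ∧ p₀ ∈ e.source := by
  have hφ := chartAt_mem_maximalAtlas (M := M) p₀.base
  set φ := chartAt (Euc 4) p₀.base
  have hp₀ : p₀.base ∈ φ.source := mem_chart_source _ _
  obtain ⟨A, hA⟩ := TimeOrientation.exists_mem_radialChart hφ p₀.observer hp₀
  obtain ⟨V, g, h, hz₀, hg₀⟩ := exists_localFrame hφ p₀ hp₀
  set Θ := T.radialChart φ hφ A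
  set κ : ObserverFrame T ori → Matrix (Fin 3) (Fin 3) ℝ := fun p =>
    rotCoord (coordSq FS.F φ) g (fun i => tcoord φ (p.toTM i)) with hκ
  set inv : (Euc 4 × Euc 3) × Euc 3 → ObserverFrame T ori := fun q =>
    (h.sect p₀ (T.obsPoint φ hφ A p₀.observer q.1)).act ⟨rodrigues q.2, rodrigues_mem q.2⟩ with hinv
  set U₀ : Set (ObserverFrame T ori) := {p | p.toTM 0 ∈ Θ.source ∩ overSet φ V} with hU₀
  have hU₀o : IsOpen U₀ := (Θ.open_source.inter h.isOpen_overSet).preimage (continuous_toTM 0)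
  have hκc : ∀ α β, ContinuousOn (fun p => κ p α β) U₀ := by
    intro α β p hp
    have h1 : ContinuousAt (fun (p : ObserverFrame T ori) i => tcoord φ (p.toTM i)) p := by
      rw [continuousAt_pi]
      exact fun i => ContinuousAt.comp (f := fun p : ObserverFrame T ori => p.toTM i)
        (contMDiffAt_tcoord hφ (v := p.toTM i) hp.2.1).continuousAt (continuous_toTM i).continuousAt
    exact (ContinuousAt.comp (f := fun (p : ObserverFrame T ori) i => tcoord φ (p.toTM i))
      (h.contDiffAt_rotCoord (ζ := fun i => tcoord φ (p.toTM i)) hp.2.2 α β).continuousAt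
      h1).continuousWithinAt
  -- Rodrigues coordinates require `1 + tr κ > 0`, where `κ` is the rotation relative to the
  -- section.
  set U : Set (ObserverFrame T ori) :=
    U₀ ∩ (fun p => 1 + κ p 0 0 + κ p 1 1 + κ p 2 2) ⁻¹' Set.Ioi 0 with hU
  have hUo : IsOpen U := ContinuousOn.isOpen_inter_preimage
    (((continuousOn_const.add (hκc 0 0)).add (hκc 1 1)).add (hκc 2 2)) hU₀o isOpen_Ioi
  set W : Set (Euc 4 × Euc 3) := {q | (q.1, A.symm (q.2, 0)) ∈ Θ.target} ∩
    (fun q => (T.obsPoint φ hφ A p₀.observer q).val) ⁻¹' overSet φ V with hW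
  have hWo : IsOpen W := ContinuousOn.isOpen_inter_preimage
    (TimeOrientation.contMDiffOn_obsPoint hφ A p₀.observer).continuousOn
    (TimeOrientation.isOpen_obsTarget hφ A) h.isOpen_overSet
  set V' : Set (Euc 10) := euc10.symm ⁻¹' {q | q.1 ∈ W} with hV'
  have hV'o : IsOpen V' := (hWo.preimage continuous_fst).preimage euc10.symm.continuous
  have hb : ∀ p ∈ U, ∀ i, (frameInc T ori i p).proj ∈ φ.source := fun p hp i => hp.1.2.1
  have hR : ∀ p ∈ U, ContDiffAt ℝ ∞ (fun ζ => euc10 (frameCoord (coordSq FS.F φ) g A ζ))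
      (fun i => tcoord φ (frameInc T ori i p)) := by
    intro p hp
    refine euc10.contDiff.contDiffAt.comp _ (ContDiffAt.prodMk ?_ ?_)
    · exact ContDiffAt.comp (f := fun ζ : Fin 4 → Euc 4 × Euc 4 => ζ 0) _
        (TimeOrientation.contDiffAt_obsCoord A hp.1.1.2.2.ne')
        (contDiff_apply ℝ (Euc 4 × Euc 4) 0).contDiffAt
    · exact contDiffAt_rodriguesVec (k := rotCoord (coordSq FS.F φ) g)
        (h.contDiffAt_rotCoord hp.1.2.2) hp.2
  have hmem : ∀ u ∈ V', (T.obsPoint φ hφ A p₀.observer (euc10.symm u).1).val ∈ overSet φ V :=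
    fun u hu => hu.2
  have hinvs : ∀ i, ContMDiffOn (𝓡 10) (𝓡 4).tangent ∞
      (fun u => frameInc T ori i (inv (euc10.symm u))) V' := by
    intro i
    set z : Euc 10 → Euc 4 × Euc 4 := fun u =>
      tcoord φ (T.obsPoint φ hφ A p₀.observer (euc10.symm u).1).val with hz
    have hzs : ∀ u ∈ V', ContDiffAt ℝ ∞ z u := by
      intro u hu
      rw [← contMDiffAt_iff_contDiffAt]
      have h1 : ContMDiffAt (𝓡 10) 𝓘(ℝ, Euc 4 × Euc 3) ∞ (fun u => (euc10.symm u).1) u :=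
        (contDiff_fst.comp euc10.symm.contDiff).contMDiff.contMDiffAt
      have h2 : ContMDiffAt 𝓘(ℝ, Euc 4 × Euc 3) (𝓡 4).tangent ∞
          (fun q => (T.obsPoint φ hφ A p₀.observer q).val) (euc10.symm u).1 :=
        (TimeOrientation.contMDiffOn_obsPoint hφ A p₀.observer).contMDiffAt
          ((TimeOrientation.isOpen_obsTarget hφ A).mem_nhds hu.1)
      have h3 := ContMDiffAt.comp u (f := fun u => (euc10.symm u).1) h2 h1
      exact ContMDiffAt.comp u (g := tcoord φ) (contMDiffAt_tcoord hφ (hmem u hu).1) h3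
    have h4 : ∀ u ∈ V', ContDiffAt ℝ ∞ (fun u => ((z u).1,
        rotFrame (g (z u)) (rodrigues (euc10.symm u).2) i)) u := fun u hu =>
      (hzs u hu).fst.prodMk (h.contDiffAt_rotFrame (hzs u hu)
        (fun α β => ((contDiff_rodrigues α β).comp
          (contDiff_snd.comp euc10.symm.contDiff)).contDiffAt) (hmem u hu).2 i)
    have h5 : ContMDiffOn (𝓡 10) (𝓡 4).tangent ∞ (fun u => tpoint φ ((z u).1,
        rotFrame (g (z u)) (rodrigues (euc10.symm u).2) i)) V' := fun u hu =>
      (ContMDiffAt.comp u (g := tpoint φ) (contMDiffAt_tpoint hφ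
        (z := ((z u).1, rotFrame (g (z u)) (rodrigues (euc10.symm u).2) i))
        (by exact tcoord_fst_mem (hmem u hu).1)) (h4 u hu).contMDiffAt).contMDiffWithinAt
    refine h5.congr fun u hu => ?_
    exact h.toTM_act_sect p₀ (hmem u hu) _ i
  have hrod : ∀ u ∈ V', κ (inv (euc10.symm u)) = rodrigues (euc10.symm u).2 := fun u hu =>
    h.rotCoord_act_sect p₀ (hmem u hu) _
  have hobs : ∀ u ∈ V', (inv (euc10.symm u)).observer =
      T.obsPoint φ hφ A p₀.observer (euc10.symm u).1 := fun u hu =>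
    h.observer_act_sect p₀ (hmem u hu) _
  have hcoord : ∀ p : ObserverFrame T ori, euc10.symm (euc10 (frameCoord (coordSq FS.F φ) g A
      (fun i => tcoord φ (frameInc T ori i p)))) =
      (TimeOrientation.obsCoord φ A p.observer, rodriguesVec (κ p)) := fun p => by
    rw [ContinuousLinearEquiv.symm_apply_apply]; rfl
  have maps : ∀ p ∈ U, euc10 (frameCoord (coordSq FS.F φ) g A
      (fun i => tcoord φ (frameInc T ori i p))) ∈ V' := by
    intro p hp
    rw [hV', Set.mem_preimage, hcoord]
    refine ⟨?_, ?_⟩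
    · change (_, A.symm (_, 0)) ∈ Θ.target
      rw [TimeOrientation.obsCoord_eq hφ A p.observer]
      exact Θ.map_source hp.1.1
    · rw [Set.mem_preimage, TimeOrientation.obsPoint_obsCoord hφ A p₀.observer p.observer hp.1.1]
      exact hp.1.2
  have maps' : ∀ u ∈ V', inv (euc10.symm u) ∈ U := by
    intro u hu
    have h1 : (inv (euc10.symm u)).toTM 0 =
        (T.obsPoint φ hφ A p₀.observer (euc10.symm u).1).val := congrArg Subtype.val (hobs u hu)
    refine ⟨⟨?_, ?_⟩, ?_⟩
    · rw [h1]; exact TimeOrientation.obsPoint_mem hφ A _ hu.1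
    · rw [h1]; exact hmem u hu
    · rw [Set.mem_preimage, hrod u hu]; exact trace_rodrigues_pos _
  have left : ∀ p ∈ U, inv (euc10.symm (euc10 (frameCoord (coordSq FS.F φ) g A
      (fun i => tcoord φ (frameInc T ori i p))))) = p := by
    intro p hp
    rw [hcoord, hinv]
    simp only
    rw [TimeOrientation.obsPoint_obsCoord hφ A p₀.observer p.observer hp.1.1]
    exact h.act_sect_eq p₀ p hp.1.2 _ (rodrigues_rodriguesVec (h.rotCoord_mem p hp.1.2) hp.2)
  have right : ∀ u ∈ V', euc10 (frameCoord (coordSq FS.F φ) g A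
      (fun i => tcoord φ (frameInc T ori i (inv (euc10.symm u))))) = u := by
    intro u hu
    apply euc10.symm.injective
    rw [hcoord, hobs u hu, hrod u hu, rodriguesVec_rodrigues,
      TimeOrientation.obsCoord_obsPoint hφ A _ hu.1]
  refine ⟨mkSliceChart isInducing_frameInc hφ _ (fun u => inv (euc10.symm u)) U V' hUo hV'o hb hR
    hinvs maps maps' left right, isSliceChart_mkSliceChart .., ⟨hA, hp₀, hz₀⟩, ?_⟩
  -- The section passes through `p₀`, so the relative rotation there is the identity, for which `1 +
  -- tr` equals four.
  have h1 : κ p₀ = 1 := by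
    have hF := h.F_tpoint_tcoord p₀.observer ⟨hp₀, hz₀⟩
    have h2 : (fun i => (tcoord φ (p₀.toTM i)).2) =
        rotFrame (g (tcoord φ (p₀.toTM 0))) 1 := by
      rw [rotFrame_one]; exact funext fun i => (hg₀ i).symm
    rw [hκ]
    simp only [rotCoord]
    rw [h2]
    exact (h.ortho _ hz₀ hF).relRot_rotFrame 1
  rw [Set.mem_preimage, h1]
  norm_num

end Sections

/-! ### The frame bundle as a principal bundle -/

section Rotations

variable {E H N : Type*} [NormedAddCommGroup E] [NormedSpace ℝ E] [TopologicalSpace H]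
  {J : ModelWithCorners ℝ E H} [TopologicalSpace N] [ChartedSpace H N] {W : Set N} {x : N}

theorem contMDiffWithinAt_rot4 {k : N → Matrix (Fin 3) (Fin 3) ℝ}
    (hk : ∀ α β, ContMDiffWithinAt J 𝓘(ℝ) ∞ (fun y => k y α β) W x) (i j : Fin 4) :
    ContMDiffWithinAt J 𝓘(ℝ) ∞ (fun y => rot4 (k y) i j) W x := by
  refine Fin.cases ?_ (fun α => ?_) i <;> refine Fin.cases ?_ (fun β => ?_) j
  · exact contMDiffWithinAt_const
  · exact contMDiffWithinAt_const
  · exact contMDiffWithinAt_const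
  · exact hk _ _

theorem contMDiffWithinAt_rotFrame {k : N → Matrix (Fin 3) (Fin 3) ℝ} {f : N → Fin 4 → Euc 4}
    (hf : ∀ i, ContMDiffWithinAt J 𝓘(ℝ, Euc 4) ∞ (fun y => f y i) W x)
    (hk : ∀ α β, ContMDiffWithinAt J 𝓘(ℝ) ∞ (fun y => k y α β) W x) (i : Fin 4) :
    ContMDiffWithinAt J 𝓘(ℝ, Euc 4) ∞ (fun y => rotFrame (f y) (k y) i) W x := by
  have h : ∀ j ∈ Finset.univ, ContMDiffWithinAt J 𝓘(ℝ, Euc 4) ∞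
      (fun y => rot4 (k y) j i • f y j) W x :=
    fun j _ => (contMDiffWithinAt_rot4 hk j i).smul (hf j)
  exact contMDiffWithinAt_finsetSum h

end Rotations

section PrincipalBundle

variable {M : Type*} [TopologicalSpace M] [ChartedSpace (Euc 4) M] [IsManifold (𝓡 4) ∞ M]
  {φ : OpenPartialHomeomorph M (Euc 4)} {FS : FinslerSpacetime M} {T : TimeOrientation FS}
  {ori : ManifoldOrientation M} [ChartedSpace (Euc 10) (ObserverFrame T ori)]
  [IsManifold (𝓡 10) ∞ (ObserverFrame T ori)]

theorem isFrameSubmanifold (hP : IsSliceAtlas (n := 10) (frameInc T ori)) :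
    IsFrameSubmanifold (T := T) (ori := ori) :=
  ⟨hP.contMDiff_inc, fun _ _ hv => hP.eq_zero_of_mfderiv_inc hv⟩

section Maps

variable {E H N : Type*} [NormedAddCommGroup E] [NormedSpace ℝ E] [TopologicalSpace H]
  {J : ModelWithCorners ℝ E H} [TopologicalSpace N] [ChartedSpace H N] {W : Set N} {x : N}

theorem contMDiffWithinAt_act (hP : IsSliceAtlas (n := 10) (frameInc T ori))
    {f : N → ObserverFrame T ori} {κ : N → RotGroup} (hf : ContMDiffWithinAt J (𝓡 10) ∞ f W x)
    (hκ : ∀ α β, ContMDiffWithinAt J 𝓘(ℝ) ∞ (fun y => (κ y).val α β) W x) :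
    ContMDiffWithinAt J (𝓡 10) ∞ (fun y => (f y).act (κ y)) W x := by
  refine hP.contMDiffWithinAt fun i => ?_
  have hφ := chartAt_mem_maximalAtlas (M := M) (f x).base
  set φ := chartAt (Euc 4) (f x).base
  have hx : (f x).base ∈ φ.source := mem_chart_source _ _
  have hj : ∀ j, ContMDiffWithinAt J 𝓘(ℝ, Euc 4 × Euc 4) ∞
      (fun y => tcoord φ ((f y).toTM j)) W x := fun j =>
    ContMDiffAt.comp_contMDiffWithinAt x (g := tcoord φ) (f := fun y => (f y).toTM j)
      (contMDiffAt_tcoord hφ hx)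
      ((hP.contMDiff_inc j).contMDiffAt.comp_contMDiffWithinAt x hf)
  refine contMDiffWithinAt_of_tcoord hφ ?_ hx ?_
  · exact hf.continuousWithinAt (((isOpen_proj_source φ).preimage (continuous_toTM 0)).mem_nhds hx)
  · have h1 : ContMDiffWithinAt J 𝓘(ℝ, Euc 4 × Euc 4) ∞ (fun y => ((tcoord φ ((f y).toTM 0)).1,
        rotFrame (fun i => (tcoord φ ((f y).toTM i)).2) (κ y).val i)) W x :=
      ((contDiff_fst.contMDiff (E := Euc 4 × Euc 4)).contMDiffAt.comp_contMDiffWithinAt x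
        (hj 0)).prodMk_space (contMDiffWithinAt_rotFrame
          (fun i => (contDiff_snd.contMDiff (E := Euc 4 × Euc 4)).contMDiffAt.comp_contMDiffWithinAt
            x (hj i)) hκ i)
    exact h1.congr (fun y _ => (f y).tcoord_act (κ y) i) ((f x).tcoord_act (κ x) i)

end Maps

theorem act_smooth (hP : IsSliceAtlas (n := 10) (frameInc T ori)) (m : ℕ) (W : Set (Euc m))
    (f : Euc m → ObserverFrame T ori) (κ : Euc m → RotGroup)
    (hf : ContMDiffOn (𝓡 m) (𝓡 10) ∞ f W)
    (hκ : ∀ α β, ContDiffOn ℝ ∞ (fun w => (κ w : Matrix (Fin 3) (Fin 3) ℝ) α β) W) :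
    ContMDiffOn (𝓡 m) (𝓡 10) ∞ (fun w => (f w).act (κ w)) W := fun x hx =>
  contMDiffWithinAt_act hP (hf x hx) fun α β => (hκ α β x hx).contMDiffWithinAt

variable [ChartedSpace (Euc 7) (ObserverSpace T)] [IsManifold (𝓡 7) ∞ (ObserverSpace T)]

theorem contMDiff_observer (hO : IsSliceAtlas (n := 7) (obsInc T))
    (hP : IsSliceAtlas (n := 10) (frameInc T ori)) :
    ContMDiff (𝓡 10) (𝓡 7) ∞ (ObserverFrame.observer : ObserverFrame T ori → ObserverSpace T) := by
  rw [← contMDiffOn_univ]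
  exact fun p _ => hO.contMDiffWithinAt fun _ => (hP.contMDiff_inc 0).contMDiffAt.contMDiffWithinAt

/-- A local frame field yields the section, and the matrix of scalar products between the section
and a frame yields the fibre coordinate in `SO(3)`. This trivializes all of `K`, without the trace
condition needed for a chart. -/
theorem locally_trivial (hO : IsSliceAtlas (n := 7) (obsInc T))
    (hP : IsSliceAtlas (n := 10) (frameInc T ori)) (o : ObserverSpace T) :
    ∃ (U : Set (ObserverSpace T)) (s : ObserverSpace T → ObserverFrame T ori)
      (κ : ObserverFrame T ori → RotGroup), IsOpen U ∧ o ∈ U ∧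
      ContMDiffOn (𝓡 7) (𝓡 10) ∞ s U ∧ (∀ u ∈ U, (s u).observer = u) ∧
      (∀ α β, ContMDiffOn (𝓡 10) 𝓘(ℝ) ∞ (fun p => (κ p : Matrix (Fin 3) (Fin 3) ℝ) α β)
        (ObserverFrame.observer ⁻¹' U)) ∧
      (∀ p ∈ ObserverFrame.observer ⁻¹' U, (s p.observer).act (κ p) = p) ∧
      ∀ u ∈ U, ∀ k, κ ((s u).act k) = k := by
  obtain ⟨p₀, rfl⟩ := ObserverFrame.exists_observer_eq (ori := ori) o
  have hφ := chartAt_mem_maximalAtlas (M := M) p₀.base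
  set φ := chartAt (Euc 4) p₀.base
  have hp₀ : p₀.base ∈ φ.source := mem_chart_source _ _
  obtain ⟨V, g, h, hz₀, -⟩ := exists_localFrame hφ p₀ hp₀
  refine ⟨{o | o.val ∈ overSet φ V}, h.sect p₀, h.kap,
    h.isOpen_overSet.preimage continuous_subtype_val, ⟨hp₀, hz₀⟩, fun o ho => ?_,
    fun u hu => h.observer_sect p₀ hu, fun α β p hp => ?_, fun p hp => h.act_sect_kap p₀ p hp,
    fun u hu k => h.kap_act_sect p₀ hu k⟩
  · have hs : ∀ u : ObserverSpace T, u.val ∈ overSet φ V → ∀ i, (h.sect p₀ u).toTM i =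
        tpoint φ ((tcoord φ u.val).1, g (tcoord φ u.val) i) := fun u hu i => by
      rw [LocalFrame.sect, dif_pos hu]; exact h.toTM_frameOver u hu i
    have hz : ContMDiffAt (𝓡 7) 𝓘(ℝ, Euc 4 × Euc 4) ∞ (fun u : ObserverSpace T => tcoord φ u.val) o :=
      (contMDiffAt_tcoord hφ ho.1).comp o (hO.contMDiff_inc ()).contMDiffAt
    refine hP.contMDiffWithinAt fun i => ?_
    have h1 : ContDiffAt ℝ ∞ (fun z : Euc 4 × Euc 4 => (z.1, g z i)) (tcoord φ o.val) :=
      contDiffAt_fst.prodMk (h.smooth i _ ho.2)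
    have h2 := ContMDiffAt.comp o (f := fun u : ObserverSpace T => tcoord φ u.val)
      (g := fun z : Euc 4 × Euc 4 => (z.1, g z i)) h1.contMDiffAt hz
    have h3 := ContMDiffAt.comp o (g := tpoint φ)
      (f := (fun z : Euc 4 × Euc 4 => (z.1, g z i)) ∘ fun u : ObserverSpace T => tcoord φ u.val)
      (contMDiffAt_tpoint hφ (z := ((tcoord φ o.val).1, g (tcoord φ o.val) i))
        (by exact tcoord_fst_mem ho.1)) h2
    exact h3.contMDiffWithinAt.congr (fun u hu => hs u hu i) (hs o ho i)
  · have hz : ContMDiffAt (𝓡 10) 𝓘(ℝ, Fin 4 → Euc 4 × Euc 4) ∞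
        (fun (p : ObserverFrame T ori) i => tcoord φ (p.toTM i)) p := by
      rw [contMDiffAt_pi_space]
      exact fun i => ContMDiffAt.comp p (g := tcoord φ) (f := fun p : ObserverFrame T ori => p.toTM i)
        (contMDiffAt_tcoord hφ (hp.1 : p.base ∈ φ.source)) (hP.contMDiff_inc i).contMDiffAt
    have h1 := ContMDiffAt.comp p (f := fun (p : ObserverFrame T ori) i => tcoord φ (p.toTM i))
      (g := fun ζ => rotCoord (coordSq FS.F φ) g ζ α β)
      (h.contDiffAt_rotCoord (ζ := fun i => tcoord φ (p.toTM i)) hp.2 α β).contMDiffAt hz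
    refine h1.contMDiffWithinAt.congr (fun q hq => ?_) ?_
    · exact congrFun (congrFun (h.kap_val hq) α) β
    · exact congrFun (congrFun (h.kap_val hp) α) β

end PrincipalBundle

/-! ### The Cartan connection in induced coordinates

The coordinates of the vectors of a frame, and of a tangent vector to the frame bundle, are
families `ζ`, `ξ` of elements of `Euc 4 × Euc 4`. -/

section CoordinateForm

variable (Q : Euc 4 × Euc 4 → ℝ) (ζ ξ : Fin 4 → Euc 4 × Euc 4)

/-- The covariant derivatives of the vectors of a frame. -/
def covDer (i : Fin 4) : Euc 4 := (ξ i).2 + cartanConn Q (ζ 0) (ξ 0) (ζ i).2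

/-- The Lorentz part of the Cartan connection. -/
def lorentzPart : Matrix (Fin 4) (Fin 4) ℝ :=
  Matrix.of fun j i => -eta j j * vHess Q (ζ 0) (ζ j).2 (covDer Q ζ ξ i)

/-- The solder form. -/
def solderPart : Matrix (Fin 4) Unit ℝ :=
  Matrix.of fun i _ => -eta i i * vHess Q (ζ 0) (ζ i).2 (ξ 0).1

variable {Q ζ ξ} {D : Set (Euc 4 × Euc 4)}

theorem sum_lorentzPart (h : IsOrthoFrame (vHess Q (ζ 0)) fun i => (ζ i).2) (i : Fin 4) :
    ∑ j, lorentzPart Q ζ ξ j i • (ζ j).2 = covDer Q ζ ξ i := h.sum_repr _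

theorem sum_solderPart (h : IsOrthoFrame (vHess Q (ζ 0)) fun i => (ζ i).2) :
    ∑ j, solderPart Q ζ ξ j () • (ζ j).2 = (ξ 0).1 := h.sum_repr _

theorem lorentzPart_eq (h : IsOrthoFrame (vHess Q (ζ 0)) fun i => (ζ i).2)
    {A : Matrix (Fin 4) (Fin 4) ℝ} (hA : ∀ i, ∑ j, A j i • (ζ j).2 = covDer Q ζ ξ i) :
    lorentzPart Q ζ ξ = A := by
  ext j i
  exact congrFun (h.eq_of_sum_eq (c := fun j => lorentzPart Q ζ ξ j i) (d := fun j => A j i)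
    ((sum_lorentzPart h i).trans (hA i).symm)) j

theorem solderPart_eq (h : IsOrthoFrame (vHess Q (ζ 0)) fun i => (ζ i).2)
    {e : Matrix (Fin 4) Unit ℝ} (he : ∑ j, e j () • (ζ j).2 = (ξ 0).1) :
    solderPart Q ζ ξ = e := by
  ext j i
  exact congrFun (h.eq_of_sum_eq (c := fun j => solderPart Q ζ ξ j ()) (d := fun j => e j ())
    ((sum_solderPart h).trans he.symm)) j

theorem transpose_mul_eta_add_eq_zero_iff (A : Matrix (Fin 4) (Fin 4) ℝ) :
    Aᵀ * eta + eta * A = 0 ↔ ∀ i j, eta j j * A j i + eta i i * A i j = 0 := by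
  have key : ∀ i j, (Aᵀ * eta + eta * A) i j = eta j j * A j i + eta i i * A i j := by
    intro i j
    rw [Matrix.add_apply, eta, Matrix.mul_diagonal, Matrix.diagonal_mul, Matrix.transpose_apply,
      Matrix.diagonal_apply_eq, Matrix.diagonal_apply_eq]
    ring
  constructor
  · intro h i j; rw [← key, h]; rfl
  · intro h; ext i j; rw [key, h]; rfl

/-- The hypothesis `hd` is the derivative of the orthonormality relations. Metricity of the
connection turns it into antisymmetry of the covariant derivatives, which is membership in the
Lorentz algebra. -/
theorem lorentzPart_mem (hQ : IsMetricDomain Q D) (hz : ζ 0 ∈ D)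
    (hd : ∀ i j, fderiv ℝ (vHess Q) (ζ 0) (ξ 0) (ζ i).2 (ζ j).2 + vHess Q (ζ 0) (ξ i).2 (ζ j).2 +
      vHess Q (ζ 0) (ζ i).2 (ξ j).2 = 0) :
    (lorentzPart Q ζ ξ)ᵀ * eta + eta * lorentzPart Q ζ ξ = 0 := by
  rw [transpose_mul_eta_add_eq_zero_iff]
  intro i j
  have h1 := hd i j
  rw [← hQ.metric_compatible hz] at h1
  simp only [lorentzPart, covDer, Matrix.of_apply, map_add, hQ.symm hz (ζ j).2] at h1 ⊢
  linear_combination -(vHess Q (ζ 0) (ξ i).2 (ζ j).2 +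
    vHess Q (ζ 0) (cartanConn Q (ζ 0) (ξ 0) (ζ i).2) (ζ j).2) * eta_sq j -
    (vHess Q (ζ 0) (ζ i).2 (ξ j).2 +
    vHess Q (ζ 0) (ζ i).2 (cartanConn Q (ζ 0) (ξ 0) (ζ j).2)) * eta_sq i - h1

theorem covDer_add (ξ ξ' : Fin 4 → Euc 4 × Euc 4) (i : Fin 4) :
    covDer Q ζ (ξ + ξ') i = covDer Q ζ ξ i + covDer Q ζ ξ' i := by
  simp only [covDer, Pi.add_apply, Prod.snd_add, cartanConn_add]; abel

theorem covDer_smul (c : ℝ) (ξ : Fin 4 → Euc 4 × Euc 4) (i : Fin 4) :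
    covDer Q ζ (c • ξ) i = c • covDer Q ζ ξ i := by
  simp only [covDer, Pi.smul_apply, Prod.smul_snd, cartanConn_smul, smul_add]

theorem lorentzPart_add (ξ ξ' : Fin 4 → Euc 4 × Euc 4) :
    lorentzPart Q ζ (ξ + ξ') = lorentzPart Q ζ ξ + lorentzPart Q ζ ξ' := by
  ext j i
  simp only [lorentzPart, covDer_add, map_add, Matrix.of_apply, Matrix.add_apply]; ring

theorem lorentzPart_smul (c : ℝ) (ξ : Fin 4 → Euc 4 × Euc 4) :
    lorentzPart Q ζ (c • ξ) = c • lorentzPart Q ζ ξ := by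
  ext j i
  simp only [lorentzPart, covDer_smul, map_smul, Matrix.of_apply, Matrix.smul_apply, smul_eq_mul]
  ring

theorem solderPart_add (ξ ξ' : Fin 4 → Euc 4 × Euc 4) :
    solderPart Q ζ (ξ + ξ') = solderPart Q ζ ξ + solderPart Q ζ ξ' := by
  ext j i
  simp only [solderPart, Pi.add_apply, Prod.fst_add, map_add, Matrix.of_apply, Matrix.add_apply]
  ring

theorem solderPart_smul (c : ℝ) (ξ : Fin 4 → Euc 4 × Euc 4) :
    solderPart Q ζ (c • ξ) = c • solderPart Q ζ ξ := by
  ext j i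
  simp only [solderPart, Pi.smul_apply, Prod.smul_fst, map_smul, Matrix.of_apply,
    Matrix.smul_apply, smul_eq_mul]
  ring

theorem obsMat_add (Λ : ℝ) (h h' : Matrix (Fin 4) (Fin 4) ℝ) (z z' : Matrix (Fin 4) Unit ℝ) :
    obsMat Λ (h + h') (z + z') = obsMat Λ h z + obsMat Λ h' z' := by
  simp [obsMat, Matrix.fromBlocks_add, Matrix.add_mul, add_comm]

theorem obsMat_smul (Λ c : ℝ) (h : Matrix (Fin 4) (Fin 4) ℝ) (z : Matrix (Fin 4) Unit ℝ) :
    obsMat Λ (c • h) (c • z) = c • obsMat Λ h z := by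
  simp [obsMat, Matrix.fromBlocks_smul, smul_comm c]

theorem obsMat_inj {Λ : ℝ} {h h' : Matrix (Fin 4) (Fin 4) ℝ} {z z' : Matrix (Fin 4) Unit ℝ}
    (e : obsMat Λ h z = obsMat Λ h' z') : h = h' ∧ z = z' := by
  rw [obsMat, obsMat, Matrix.fromBlocks_inj] at e
  exact ⟨e.1, e.2.1⟩

/-- The covariant derivatives determine the vertical part of the tangent vector. -/
theorem eq_zero_of_covDer_eq_zero (hQ : IsMetricDomain Q D)
    (euler : ∀ w ∈ D, ∀ v, vHess Q w w.2 v = 1 / 2 * fderiv ℝ Q w (0, v)) (hz : ζ 0 ∈ D)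
    (hx : ∀ i, (ξ i).1 = 0) (hξ : ∀ i, covDer Q ζ ξ i = 0) : ξ = 0 := by
  have h0 : ξ 0 = (0, (ξ 0).2) := Prod.ext (hx 0) rfl
  -- The vector of index zero comes first: its own connection term vanishes for vertical motions, so
  -- its velocity is zero. After that the connection terms of all frame vectors vanish.
  have h1 : (ξ 0).2 = 0 := by
    have := hξ 0
    rw [covDer, h0, hQ.cartanConn_vertical euler hz, add_zero] at this
    exact this
  have h2 : ξ 0 = 0 := Prod.ext (hx 0) h1
  have h3 : ∀ f, cartanConn Q (ζ 0) 0 f = 0 := fun f => by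
    have := cartanConn_smul Q (ζ 0) 0 0 f
    simpa using this
  funext i
  have := hξ i
  rw [covDer, h2, h3, add_zero] at this
  exact Prod.ext (hx i) this

theorem covDer_zero_of_vertical (hQ : IsMetricDomain Q D)
    (euler : ∀ w ∈ D, ∀ v, vHess Q w w.2 v = 1 / 2 * fderiv ℝ Q w (0, v)) (hz : ζ 0 ∈ D)
    (hx : (ξ 0).1 = 0) : covDer Q ζ ξ 0 = (ξ 0).2 := by
  have h0 : ξ 0 = (0, (ξ 0).2) := Prod.ext hx rfl
  rw [covDer, h0, hQ.cartanConn_vertical euler hz, add_zero]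

/-- Behaviour of the Cartan connection under changes of charts. -/
theorem lorentzPart_change {Q' : Euc 4 × Euc 4 → ℝ} {D' W : Set (Euc 4 × Euc 4)}
    {ψ : Euc 4 → Euc 4} (h : IsChartChange Q Q' D D' W ψ) (hw : ζ 0 ∈ W)
    (hx : ∀ i, (ζ i).1 = (ζ 0).1) (hdx : ∀ i, (ξ i).1 = (ξ 0).1) :
    lorentzPart Q' (fun i => tanMap ψ (ζ i)) (fun i => dT ψ (ζ i) (ξ i)) =
      lorentzPart Q ζ ξ := by
  have h1 : ∀ i, covDer Q' (fun i => tanMap ψ (ζ i)) (fun i => dT ψ (ζ i) (ξ i)) i =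
      fderiv ℝ ψ (ζ 0).1 (covDer Q ζ ξ i) := by
    intro i
    have h2 := h.cartanConn_eq hw (ξ 0) (ζ i).2
    simp only [covDer, map_add]
    rw [← h2, dT_apply ψ (ζ i)]
    simp only [tanMap, hx i, hdx i]
    abel
  ext j i
  simp only [lorentzPart, Matrix.of_apply, h1]
  rw [h.vHess_eq hw]
  simp only [tanMap, hx j]

theorem solderPart_change {Q' : Euc 4 × Euc 4 → ℝ} {D' W : Set (Euc 4 × Euc 4)}
    {ψ : Euc 4 → Euc 4} (h : IsChartChange Q Q' D D' W ψ) (hw : ζ 0 ∈ W)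
    (hx : ∀ i, (ζ i).1 = (ζ 0).1) :
    solderPart Q' (fun i => tanMap ψ (ζ i)) (fun i => dT ψ (ζ i) (ξ i)) =
      solderPart Q ζ ξ := by
  ext j i
  simp only [solderPart, Matrix.of_apply]
  rw [h.vHess_eq hw]
  simp only [tanMap, hx j, dT_apply]

/-- A rotation of the coordinates of a frame. -/
def rotZeta (ζ : Fin 4 → Euc 4 × Euc 4) (k : Matrix (Fin 3) (Fin 3) ℝ) : Fin 4 → Euc 4 × Euc 4 :=
  fun i => ((ζ 0).1, rotFrame (fun j => (ζ j).2) k i)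

theorem rotZeta_zero (ζ : Fin 4 → Euc 4 × Euc 4) (k : Matrix (Fin 3) (Fin 3) ℝ) :
    rotZeta ζ k 0 = ζ 0 := 
  Prod.ext rfl (rotFrame_zero (fun j => (ζ j).2) k)

theorem covDer_rotZeta (k : Matrix (Fin 3) (Fin 3) ℝ) (i : Fin 4) :
    covDer Q (rotZeta ζ k) (rotZeta ξ k) i = ∑ m, rot4 k m i • covDer Q ζ ξ m := by
  rw [covDer, rotZeta_zero, rotZeta_zero]
  simp only [rotZeta, rotFrame, cartanConn_sum, covDer, smul_add, Finset.sum_add_distrib]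

/-- The lower row of a matrix in `𝔤` contains `zᵀη`. It transforms in accordance with the upper
right block because rotations commute with `η`. -/
theorem obsMat_rot (Λ : ℝ) (R A : Matrix (Fin 4) (Fin 4) ℝ) (e : Matrix (Fin 4) Unit ℝ)
    (hR : R * eta = eta * R) : Matrix.fromBlocks Rᵀ 0 0 1 * obsMat Λ A e * Matrix.fromBlocks R 0 0 1 =
      obsMat Λ (Rᵀ * A * R) (Rᵀ * e) := by
  simp only [obsMat, Matrix.fromBlocks_multiply, Matrix.zero_mul, Matrix.mul_zero, add_zero,
    zero_add, Matrix.mul_one, Matrix.one_mul, Matrix.transpose_mul, Matrix.transpose_transpose,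
    Matrix.neg_mul, Matrix.smul_mul, Matrix.mul_assoc, hR]

theorem sum_mul_rot4 {k : Matrix (Fin 3) (Fin 3) ℝ} (hk : k * kᵀ = 1) (f : Fin 4 → Euc 4)
    (c : Fin 4 → ℝ) : ∑ j, (∑ l, (rot4 k)ᵀ j l * c l) • rotFrame f k j = ∑ l, c l • f l := by
  have h1 : rot4 k * (rot4 k)ᵀ = 1 := by rw [← rot4_transpose, ← rot4_mul, hk, rot4_one]
  have h2 : ∀ m, ∑ j, rot4 k m j * ∑ l, (rot4 k)ᵀ j l * c l = c m := by
    intro m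
    have := congrFun (Matrix.mulVec_mulVec c (rot4 k) (rot4 k)ᵀ) m
    rw [h1, Matrix.one_mulVec] at this
    exact this
  simp only [rotFrame, Finset.smul_sum, smul_smul]
  rw [Finset.sum_comm]
  refine Finset.sum_congr rfl fun m _ => ?_
  rw [← Finset.sum_smul]
  congr 1
  conv_rhs => rw [← h2 m]
  exact Finset.sum_congr rfl fun j _ => mul_comm _ _

/-- The covariant derivative and the base velocity are linear in the frame, and `ω` and `e` are
their components. Components with respect to the rotated frame are obtained by multiplying with the
inverse rotation on the left, and `ω` also with the rotation on the right, as one of its indices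
labels frame vectors. -/
theorem obsMat_rotZeta (Λ : ℝ) (h : IsOrthoFrame (vHess Q (ζ 0)) fun i => (ζ i).2) (k : RotGroup) :
    obsMat Λ (lorentzPart Q (rotZeta ζ k.val) (rotZeta ξ k.val))
      (solderPart Q (rotZeta ζ k.val) (rotZeta ξ k.val)) =
      rotMat k⁻¹ * obsMat Λ (lorentzPart Q ζ ξ) (solderPart Q ζ ξ) * rotMat k := by
  have hk := transpose_mul_self k
  have hk' : k.val * k.valᵀ = 1 := mul_eq_one_comm.1 hk
  have hinv : rotMat k⁻¹ = Matrix.fromBlocks (rot4 k.val)ᵀ 0 0 1 := by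
    rw [rotMat_eq, ← rot4_transpose]; rfl
  have h' : IsOrthoFrame (vHess Q (rotZeta ζ k.val 0)) fun i => (rotZeta ζ k.val i).2 := by
    rw [rotZeta_zero]; exact h.rotFrame hk
  rw [hinv, rotMat_eq, obsMat_rot _ _ _ _ (rot4_mul_eta _)]
  congr 1
  · refine lorentzPart_eq h' fun i => ?_
    rw [covDer_rotZeta, Matrix.mul_assoc]
    refine (sum_mul_rot4 hk' (fun j => (ζ j).2) fun l => (lorentzPart Q ζ ξ * rot4 k.val) l i).trans ?_
    simp only [Matrix.mul_apply, ← sum_lorentzPart h, Finset.sum_smul, Finset.smul_sum, smul_smul]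
    rw [Finset.sum_comm]
    exact Finset.sum_congr rfl fun j _ => Finset.sum_congr rfl fun l _ => by rw [mul_comm]
  · refine solderPart_eq h' ?_
    rw [rotZeta_zero, ← sum_solderPart h]
    exact sum_mul_rot4 hk' (fun j => (ζ j).2) fun l => solderPart Q ζ ξ l ()

theorem contDiffAt_lorentzPart (hQ : IsMetricDomain Q D) (hz : ζ 0 ∈ D) (j i : Fin 4) :
    ContDiffAt ℝ ∞ (fun q : (Fin 4 → Euc 4 × Euc 4) × (Fin 4 → Euc 4 × Euc 4) =>
      lorentzPart Q q.1 q.2 j i) (ζ, ξ) := by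
  have hp : ∀ m, ContDiffAt ℝ ∞
      (fun q : (Fin 4 → Euc 4 × Euc 4) × (Fin 4 → Euc 4 × Euc 4) => q.1 m) (ζ, ξ) := fun m =>
    ((contDiff_apply ℝ (Euc 4 × Euc 4) m).comp contDiff_fst).contDiffAt
  have hq : ∀ m, ContDiffAt ℝ ∞
      (fun q : (Fin 4 → Euc 4 × Euc 4) × (Fin 4 → Euc 4 × Euc 4) => q.2 m) (ζ, ξ) := fun m =>
    ((contDiff_apply ℝ (Euc 4 × Euc 4) m).comp contDiff_snd).contDiffAt
  have hB : ContDiffAt ℝ ∞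
      (fun q : (Fin 4 → Euc 4 × Euc 4) × (Fin 4 → Euc 4 × Euc 4) => vHess Q (q.1 0)) (ζ, ξ) :=
    ContDiffAt.comp (ζ, ξ)
      (f := fun q : (Fin 4 → Euc 4 × Euc 4) × (Fin 4 → Euc 4 × Euc 4) => q.1 0)
      (hQ.contDiffAt_vHess hz) (hp 0)
  have hC : ContDiffAt ℝ ∞ (fun q : (Fin 4 → Euc 4 × Euc 4) × (Fin 4 → Euc 4 × Euc 4) =>
      cartanConn Q (q.1 0) (q.2 0) (q.1 i).2) (ζ, ξ) :=
    ContDiffAt.comp (ζ, ξ) (f := fun q : (Fin 4 → Euc 4 × Euc 4) × (Fin 4 → Euc 4 × Euc 4) =>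
        (q.1 0, q.2 0, (q.1 i).2))
      (hQ.contDiffAt_cartanConn hz (ξ 0) (ζ i).2) ((hp 0).prodMk ((hq 0).prodMk (hp i).snd))
  exact contDiffAt_const.mul ((hB.clm_apply (hp j).snd).clm_apply ((hq i).snd.add hC))

theorem contDiffAt_solderPart (hQ : IsMetricDomain Q D) (hz : ζ 0 ∈ D) (i : Fin 4) :
    ContDiffAt ℝ ∞ (fun q : (Fin 4 → Euc 4 × Euc 4) × (Fin 4 → Euc 4 × Euc 4) =>
      solderPart Q q.1 q.2 i ()) (ζ, ξ) := by
  have hp : ∀ m, ContDiffAt ℝ ∞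
      (fun q : (Fin 4 → Euc 4 × Euc 4) × (Fin 4 → Euc 4 × Euc 4) => q.1 m) (ζ, ξ) := fun m =>
    ((contDiff_apply ℝ (Euc 4 × Euc 4) m).comp contDiff_fst).contDiffAt
  have hq : ContDiffAt ℝ ∞
      (fun q : (Fin 4 → Euc 4 × Euc 4) × (Fin 4 → Euc 4 × Euc 4) => q.2 0) (ζ, ξ) :=
    ((contDiff_apply ℝ (Euc 4 × Euc 4) 0).comp contDiff_snd).contDiffAt
  have hB : ContDiffAt ℝ ∞
      (fun q : (Fin 4 → Euc 4 × Euc 4) × (Fin 4 → Euc 4 × Euc 4) => vHess Q (q.1 0)) (ζ, ξ) :=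
    ContDiffAt.comp (ζ, ξ)
      (f := fun q : (Fin 4 → Euc 4 × Euc 4) × (Fin 4 → Euc 4 × Euc 4) => q.1 0)
      (hQ.contDiffAt_vHess hz) (hp 0)
  exact contDiffAt_const.mul ((hB.clm_apply (hp i).snd).clm_apply hq.fst)

theorem contDiffAt_obsMat (Λ : ℝ) (hQ : IsMetricDomain Q D) (hz : ζ 0 ∈ D)
    (i j : Fin 4 ⊕ Unit) :
    ContDiffAt ℝ ∞ (fun q : (Fin 4 → Euc 4 × Euc 4) × (Fin 4 → Euc 4 × Euc 4) =>
      obsMat Λ (lorentzPart Q q.1 q.2) (solderPart Q q.1 q.2) i j) (ζ, ξ) := by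
  rcases i with i | ⟨⟩ <;> rcases j with j | ⟨⟩
  · exact contDiffAt_lorentzPart hQ hz i j
  · exact contDiffAt_solderPart hQ hz i
  · have h1 : ∀ (A : Matrix (Fin 4) (Fin 4) ℝ) (e : Matrix (Fin 4) Unit ℝ),
        obsMat Λ A e (.inr ()) (.inl j) = -((SignType.sign Λ : ℝ) * ∑ l, e l () * eta l j) := by
      intro A e
      simp [obsMat, Matrix.mul_apply]
    simp only [h1]
    exact (contDiffAt_const.mul
      (ContDiffAt.sum fun l _ => (contDiffAt_solderPart hQ hz l).mul contDiffAt_const)).neg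
  · exact contDiffAt_const

end CoordinateForm

/-! ### The Cartan connection on the frame bundle -/

section CartanForm

variable {M : Type*} [TopologicalSpace M] [ChartedSpace (Euc 4) M] [IsManifold (𝓡 4) ∞ M]
  {φ φ' : OpenPartialHomeomorph M (Euc 4)} {FS : FinslerSpacetime M} {T : TimeOrientation FS}
  {ori : ManifoldOrientation M}

/-- The coordinates of the vectors of a frame. -/
def frameCoords (φ : OpenPartialHomeomorph M (Euc 4)) (p : ObserverFrame T ori) :
    Fin 4 → Euc 4 × Euc 4 := fun i => tcoord φ (p.toTM i)

theorem frameCoords_act (p : ObserverFrame T ori) (k : RotGroup) :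
    frameCoords φ (p.act k) = rotZeta (frameCoords φ p) k.val :=
  funext fun i => p.tcoord_act k i

theorem isOpen_base_mem (φ : OpenPartialHomeomorph M (Euc 4)) :
    IsOpen {p : ObserverFrame T ori | p.base ∈ φ.source} :=
  (isOpen_proj_source φ).preimage (continuous_toTM 0)

theorem frameCoords_mem (hφ : φ ∈ IsManifold.maximalAtlas (𝓡 4) ∞ M) {p : ObserverFrame T ori}
    (hp : p.base ∈ φ.source) : frameCoords φ p 0 ∈ T.coordDomain φ :=
  TimeOrientation.tcoord_mem_coordDomain hφ (v := p.toTM 0) hp p.toTM_mem_cone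

theorem isOrthoFrame_frameCoords (hφ : φ ∈ IsManifold.maximalAtlas (𝓡 4) ∞ M)
    {p : ObserverFrame T ori} (hp : p.base ∈ φ.source) :
    IsOrthoFrame (vHess (coordSq FS.F φ) (frameCoords φ p 0)) (fun i => (frameCoords φ p i).2) :=
  p.isOrthoFrame_coord hφ hp

variable [ChartedSpace (Euc 10) (ObserverFrame T ori)] [IsManifold (𝓡 10) ∞ (ObserverFrame T ori)]

/-- The coordinates of a tangent vector to the frame bundle. -/
def frameVel (φ : OpenPartialHomeomorph M (Euc 4)) (p : ObserverFrame T ori) :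
    TangentSpace (𝓡 10) p →L[ℝ] (Fin 4 → Euc 4 × Euc 4) :=
  mfderiv (𝓡 10) 𝓘(ℝ, Fin 4 → Euc 4 × Euc 4) (frameCoords φ) p

/-- The value of the Cartan connection, computed in a chart. -/
def formMat (Λ : ℝ) (φ : OpenPartialHomeomorph M (Euc 4)) (p : ObserverFrame T ori)
    (v : TangentSpace (𝓡 10) p) : Mat5 :=
  obsMat Λ (lorentzPart (coordSq FS.F φ) (frameCoords φ p) (frameVel φ p v))
    (solderPart (coordSq FS.F φ) (frameCoords φ p) (frameVel φ p v))

variable (hP : IsSliceAtlas (n := 10) (frameInc T ori))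
  (hφ : φ ∈ IsManifold.maximalAtlas (𝓡 4) ∞ M) {p : ObserverFrame T ori}
include hP hφ

theorem contMDiffAt_frameCoords (hp : p.base ∈ φ.source) :
    ContMDiffAt (𝓡 10) 𝓘(ℝ, Fin 4 → Euc 4 × Euc 4) ∞ (frameCoords φ) p := by
  rw [contMDiffAt_pi_space]
  exact fun i => ContMDiffAt.comp p (g := tcoord φ) (f := fun p : ObserverFrame T ori => p.toTM i)
    (contMDiffAt_tcoord hφ hp) (hP.contMDiff_inc i).contMDiffAt

theorem hasMFDerivAt_frameCoords (hp : p.base ∈ φ.source) :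
    HasMFDerivAt (𝓡 10) 𝓘(ℝ, Fin 4 → Euc 4 × Euc 4) (frameCoords φ) p (frameVel φ p) :=
  ((contMDiffAt_frameCoords hP hφ hp).mdifferentiableAt (by simp)).hasMFDerivAt

theorem hasMFDerivAt_comp_frameCoords (hp : p.base ∈ φ.source) {E : Type*} [NormedAddCommGroup E]
    [NormedSpace ℝ E] {Φ : (Fin 4 → Euc 4 × Euc 4) → E} {Φ' : (Fin 4 → Euc 4 × Euc 4) →L[ℝ] E}
    (h : HasFDerivAt Φ Φ' (frameCoords φ p)) :
    HasMFDerivAt (𝓡 10) 𝓘(ℝ, E) (fun q => Φ (frameCoords φ q)) p (Φ'.comp (frameVel φ p)) :=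
  HasMFDerivAt.comp p h.hasMFDerivAt (hasMFDerivAt_frameCoords hP hφ hp)

theorem mfderiv_tcoord_toTM (hp : p.base ∈ φ.source) (i : Fin 4) (v : TangentSpace (𝓡 10) p) :
    mfderiv (𝓡 10) 𝓘(ℝ, Euc 4 × Euc 4) (fun q : ObserverFrame T ori => tcoord φ (q.toTM i)) p v =
      frameVel φ p v i :=
  congrArg (fun A => A v) (hasMFDerivAt_comp_frameCoords hP hφ hp
    (ContinuousLinearMap.proj (R := ℝ) (φ := fun _ : Fin 4 => Euc 4 × Euc 4) i).hasFDerivAt).mfderiv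

theorem mfderiv_baseCoord (hp : p.base ∈ φ.source) (i : Fin 4) (v : TangentSpace (𝓡 10) p) :
    mfderiv (𝓡 10) 𝓘(ℝ, Euc 4) (baseCoord (T := T) (ori := ori) φ) p v = (frameVel φ p v i).1 :=
  congrArg (fun A => A v) (hasMFDerivAt_comp_frameCoords hP hφ hp
    ((ContinuousLinearMap.fst ℝ (Euc 4) (Euc 4)).comp
      (ContinuousLinearMap.proj (R := ℝ) (φ := fun _ : Fin 4 => Euc 4 × Euc 4) i)).hasFDerivAt).mfderiv

theorem mfderiv_vecCoord (hp : p.base ∈ φ.source) (i : Fin 4) (v : TangentSpace (𝓡 10) p) :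
    mfderiv (𝓡 10) 𝓘(ℝ, Euc 4) (vecCoord (T := T) (ori := ori) φ i) p v = (frameVel φ p v i).2 :=
  congrArg (fun A => A v) (hasMFDerivAt_comp_frameCoords hP hφ hp
    ((ContinuousLinearMap.snd ℝ (Euc 4) (Euc 4)).comp
      (ContinuousLinearMap.proj (R := ℝ) (φ := fun _ : Fin 4 => Euc 4 × Euc 4) i)).hasFDerivAt).mfderiv

theorem frameVel_fst (hp : p.base ∈ φ.source) (i : Fin 4) (v : TangentSpace (𝓡 10) p) :
    (frameVel φ p v i).1 = (frameVel φ p v 0).1 :=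
  (mfderiv_baseCoord hP hφ hp i v).symm.trans (mfderiv_baseCoord hP hφ hp 0 v)

theorem eq_zero_of_frameVel (hp : p.base ∈ φ.source) {v : TangentSpace (𝓡 10) p}
    (hv : frameVel φ p v = 0) : v = 0 :=
  hP.eq_zero_of_mfderiv_tcoord hφ (fun _ => hp) fun i =>
    (mfderiv_tcoord_toTM hP hφ hp i v).trans (congrFun hv i)

/-- On `P` the scalar products of the frame vectors are the constants `-η_ij`, and this is the
product rule for their vanishing derivative. -/
theorem orthonormal_deriv (hp : p.base ∈ φ.source) (v : TangentSpace (𝓡 10) p) (i j : Fin 4) :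
    fderiv ℝ (vHess (coordSq FS.F φ)) (frameCoords φ p 0) (frameVel φ p v 0) (frameCoords φ p i).2
      (frameCoords φ p j).2 +
    vHess (coordSq FS.F φ) (frameCoords φ p 0) (frameVel φ p v i).2 (frameCoords φ p j).2 +
    vHess (coordSq FS.F φ) (frameCoords φ p 0) (frameCoords φ p i).2 (frameVel φ p v j).2 = 0 := by
  have hz := frameCoords_mem (T := T) hφ hp
  have hB := (TimeOrientation.isMetricDomain (T := T) hφ).hasFDerivAt_vHess hz
  have hpr : ∀ m, HasFDerivAt (fun ζ : Fin 4 → Euc 4 × Euc 4 => ζ m)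
      (ContinuousLinearMap.proj (R := ℝ) (φ := fun _ : Fin 4 => Euc 4 × Euc 4) m)
      (frameCoords φ p) := fun m => hasFDerivAt_apply m _
  have h1 := HasFDerivAt.comp (frameCoords φ p) (f := fun ζ : Fin 4 → Euc 4 × Euc 4 => ζ 0) hB (hpr 0)
  have h2 := (h1.clm_apply (hpr i).snd).clm_apply (hpr j).snd
  have h3 := hasMFDerivAt_comp_frameCoords hP hφ hp h2
  have h4 : HasMFDerivAt (𝓡 10) 𝓘(ℝ) (fun _ : ObserverFrame T ori => -eta i j) p
      (0 : TangentSpace (𝓡 10) p →L[ℝ] ℝ) := hasMFDerivAt_const _ _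
  have h5 := h4.congr_of_eventuallyEq (f₁ := fun q : ObserverFrame T ori =>
      vHess (coordSq FS.F φ) (frameCoords φ q 0) (frameCoords φ q i).2 (frameCoords φ q j).2) (by
    filter_upwards [(isOpen_base_mem φ).mem_nhds hp] with q hq
    exact isOrthoFrame_frameCoords hφ hq i j)
  have h6 := congrArg (fun A : TangentSpace (𝓡 10) p →L[ℝ] ℝ => A v) (hasMFDerivAt_unique h3 h5)
  refine Eq.trans ?_ h6
  simp
  ring

theorem formMat_mem (Λ : ℝ) (hp : p.base ∈ φ.source) (v : TangentSpace (𝓡 10) p) :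
    formMat Λ φ p v ∈ obsAlgebra Λ :=
  ⟨_, _, lorentzPart_mem (TimeOrientation.isMetricDomain (T := T) hφ) (frameCoords_mem hφ hp)
    (orthonormal_deriv hP hφ hp v), rfl⟩

/-- The term with `D²ψ` in the derivative of the frame components cancels the inhomogeneous term of
the connection. Therefore the chart formula defines a form on `P`. -/
theorem formMat_change (hφ' : φ' ∈ IsManifold.maximalAtlas (𝓡 4) ∞ M) (Λ : ℝ)
    (hp : p.base ∈ φ.source) (hp' : p.base ∈ φ'.source) (v : TangentSpace (𝓡 10) p) :
    formMat Λ φ' p v = formMat Λ φ p v := by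
  set ψ : Euc 4 → Euc 4 := fun x => φ' (φ.symm x) with hψ
  have hc := TimeOrientation.isChartChange (T := T) hφ hφ'
  have hw : frameCoords φ p 0 ∈ T.coordDomain φ ∩ {z | z.1 ∈ (φ.symm.trans φ').source} := by
    refine ⟨frameCoords_mem hφ hp, φ.map_source hp, ?_⟩
    change φ.symm (φ p.base) ∈ φ'.source
    rwa [φ.left_inv hp]
  have hs : ContDiffAt ℝ ∞ ψ (φ p.base) := hc.smooth _ hw
  have hE : ∀ q : ObserverFrame T ori, q.base ∈ φ.source → q.base ∈ φ'.source →
      frameCoords φ' q = fun i => tanMap ψ (frameCoords φ q i) := fun q hq hq' =>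
    funext fun i => TimeOrientation.tcoord_eq_tanMap hφ hφ' (v := q.toTM i) hq hq'
  have hd : HasFDerivAt (fun (ζ : Fin 4 → Euc 4 × Euc 4) i => tanMap ψ (ζ i))
      (ContinuousLinearMap.pi fun i => (dT ψ (frameCoords φ p i)).comp
        (ContinuousLinearMap.proj (R := ℝ) (φ := fun _ : Fin 4 => Euc 4 × Euc 4) i))
      (frameCoords φ p) := by
    rw [hasFDerivAt_pi]
    intro i
    exact HasFDerivAt.comp (frameCoords φ p) (f := fun ζ : Fin 4 → Euc 4 × Euc 4 => ζ i)
      (hasFDerivAt_tanMap (w := frameCoords φ p i) hs)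
      (ContinuousLinearMap.hasFDerivAt
        (ContinuousLinearMap.proj (R := ℝ) (φ := fun _ : Fin 4 => Euc 4 × Euc 4) i))
  have h1 := hasMFDerivAt_comp_frameCoords hP hφ hp hd
  have h2 : frameVel φ' p v = fun i => dT ψ (frameCoords φ p i) (frameVel φ p v i) := by
    refine congrArg (fun A : TangentSpace (𝓡 10) p →L[ℝ] (Fin 4 → Euc 4 × Euc 4) => A v)
      (h1.congr_of_eventuallyEq (f₁ := frameCoords φ') ?_).mfderiv
    filter_upwards [(isOpen_base_mem φ).mem_nhds hp, (isOpen_base_mem φ').mem_nhds hp'] with q hq hq'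
    exact hE q hq hq'
  rw [formMat, formMat, hE p hp hp', h2]
  congr 1
  · exact lorentzPart_change hc hw (fun _ => rfl) (fun i => frameVel_fst hP hφ hp i v)
  · exact solderPart_change hc hw (fun _ => rfl)

omit hφ in
variable (p) in
/-- The Cartan connection of a Finsler spacetime. -/
def cartanForm (Λ : ℝ) (p : ObserverFrame T ori) : TangentSpace (𝓡 10) p →ₗ[ℝ] obsAlgebra Λ where
  toFun v := ⟨formMat Λ (chartAt (Euc 4) p.base) p v,
    formMat_mem hP (chartAt_mem_maximalAtlas p.base) Λ (mem_chart_source _ _) v⟩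
  map_add' v w := Subtype.ext <| by
    change formMat _ _ _ _ = formMat _ _ _ _ + formMat _ _ _ _
    rw [formMat, map_add, lorentzPart_add, solderPart_add, obsMat_add]; rfl
  map_smul' c v := Subtype.ext <| by
    change formMat _ _ _ _ = c • formMat _ _ _ _
    rw [formMat, map_smul, lorentzPart_smul, solderPart_smul, obsMat_smul]; rfl

/-- The chart in the definition varies with the base point. Independence of the chart allows one
chart to be kept near a point, which smoothness and all computations below require. -/
theorem coe_cartanForm (Λ : ℝ) (hp : p.base ∈ φ.source) (v : TangentSpace (𝓡 10) p) :
    (cartanForm hP Λ p v : Mat5) = formMat Λ φ p v :=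
  formMat_change hP hφ (chartAt_mem_maximalAtlas p.base) Λ hp (mem_chart_source _ _) v

theorem contMDiffAt_frameVel (v : TangentBundle (𝓡 10) (ObserverFrame T ori))
    (hv : v.proj.base ∈ φ.source) :
    ContMDiffAt (𝓡 10).tangent
      𝓘(ℝ, (Fin 4 → Euc 4 × Euc 4) × (Fin 4 → Euc 4 × Euc 4)) ∞
      (fun w : TangentBundle (𝓡 10) (ObserverFrame T ori) =>
        (frameCoords φ w.proj, frameVel φ w.proj w.snd)) v := by
  set U : Set (ObserverFrame T ori) := {p | p.base ∈ φ.source}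
  have hU : IsOpen U := isOpen_base_mem φ
  have h0 : ContMDiffOn (𝓡 10) 𝓘(ℝ, Fin 4 → Euc 4 × Euc 4) ∞ (frameCoords φ) U := fun p hp =>
    (contMDiffAt_frameCoords hP hφ hp).contMDiffWithinAt
  have hU' : IsOpen {w : TangentBundle (𝓡 10) (ObserverFrame T ori) | w.proj ∈ U} :=
    hU.preimage (FiberBundle.continuous_proj (Euc 10) (TangentSpace (𝓡 10)))
  have h1 := h0.contMDiffOn_tangentMapWithin (m := ∞) (by simp) hU.uniqueMDiffOn
  have h2 : ContMDiffOn (𝓡 10).tangent (𝓘(ℝ, Fin 4 → Euc 4 × Euc 4)).tangent ∞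
      (tangentMap (𝓡 10) 𝓘(ℝ, Fin 4 → Euc 4 × Euc 4) (frameCoords φ))
      {w : TangentBundle (𝓡 10) (ObserverFrame T ori) | w.proj ∈ U} := by
    refine h1.congr fun w hw => ?_
    exact (tangentMapWithin_eq_tangentMap (hU.uniqueMDiffOn _ hw)
      ((contMDiffAt_frameCoords hP hφ hw).mdifferentiableAt (by simp))).symm
  have h3 : ContMDiffOn (𝓡 10).tangent 𝓘(ℝ, Fin 4 → Euc 4 × Euc 4) ∞
      (fun w : TangentBundle (𝓡 10) (ObserverFrame T ori) => frameCoords φ w.proj)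
      {w : TangentBundle (𝓡 10) (ObserverFrame T ori) | w.proj ∈ U} :=
    h0.comp (Bundle.contMDiff_proj (TangentSpace (𝓡 10))).contMDiffOn fun w hw => hw
  have h4 := h3.prodMk_space ((contMDiff_snd_tangentBundle_modelSpace (Fin 4 → Euc 4 × Euc 4)
    𝓘(ℝ, Fin 4 → Euc 4 × Euc 4)).comp_contMDiffOn h2)
  exact h4.contMDiffAt (hU'.mem_nhds hv)

omit hφ in
theorem cartanForm_smooth (Λ : ℝ) (i j : Fin 4 ⊕ Unit) : ContMDiff (𝓡 10).tangent 𝓘(ℝ) ∞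
    (fun v : TangentBundle (𝓡 10) (ObserverFrame T ori) =>
      (cartanForm hP Λ v.proj v.snd : Mat5) i j) := by
  intro v
  have hφ := chartAt_mem_maximalAtlas (M := M) v.proj.base
  set φ := chartAt (Euc 4) v.proj.base
  have hv : v.proj.base ∈ φ.source := mem_chart_source _ _
  have h1 := ContMDiffAt.comp v
    (f := fun w : TangentBundle (𝓡 10) (ObserverFrame T ori) =>
        (frameCoords φ w.proj, frameVel φ w.proj w.snd))
    (contDiffAt_obsMat Λ (TimeOrientation.isMetricDomain (T := T) hφ) (frameCoords_mem hφ hv) i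
      j).contMDiffAt (contMDiffAt_frameVel hP hφ v hv)
  refine h1.congr_of_eventuallyEq ?_
  filter_upwards [((isOpen_base_mem φ).preimage
    (FiberBundle.continuous_proj (Euc 10) (TangentSpace (𝓡 10)))).mem_nhds hv] with w hw
  exact congrFun (congrFun (coe_cartanForm hP hφ Λ hw w.snd) i) j

/-- Vanishing of `e` means that the base point does not move, and vanishing of `ω` that all
covariant derivatives are zero. For vertical motions these determine the velocity. -/
theorem eq_zero_of_formMat (Λ : ℝ) (hp : p.base ∈ φ.source) {v : TangentSpace (𝓡 10) p}
    (hv : formMat Λ φ p v = 0) : v = 0 := by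
  have h0 : obsMat Λ 0 0 = 0 := by simp [obsMat]
  obtain ⟨h1, h2⟩ := obsMat_inj (hv.trans h0.symm)
  have ho := isOrthoFrame_frameCoords (T := T) hφ hp
  refine eq_zero_of_frameVel hP hφ hp (eq_zero_of_covDer_eq_zero
    (TimeOrientation.isMetricDomain (T := T) hφ) (fun w hw => TimeOrientation.vHess_self hφ hw)
    (frameCoords_mem hφ hp) (fun i => ?_) (fun i => ?_))
  · rw [frameVel_fst hP hφ hp, ← sum_solderPart ho, h2]; simp
  · rw [← sum_lorentzPart ho, h1]; simp

end CartanForm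

/-- Antisymmetry leaves four translation, three boost and three rotation entries. The upper bound is
enough: the injective Cartan form on a space of dimension ten forces equality. -/
theorem finrank_obsAlgebra_le (Λ : ℝ) : Module.finrank ℝ (obsAlgebra Λ) ≤ 10 := by
  let l : obsAlgebra Λ →ₗ[ℝ] (Fin 4 → ℝ) × (Fin 3 → ℝ) × (Fin 3 → ℝ) :=
    { toFun := fun X => (fun i => (X : Mat5) (.inl i) (.inr ()),
        fun α => (X : Mat5) (.inl 0) (.inl α.succ),
        ![(X : Mat5) (.inl 1) (.inl 2), (X : Mat5) (.inl 1) (.inl 3), (X : Mat5) (.inl 2) (.inl 3)])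
      map_add' := fun X Y => by
        refine Prod.ext rfl (Prod.ext rfl ?_)
        funext i; fin_cases i <;> rfl
      map_smul' := fun c X => by
        refine Prod.ext rfl (Prod.ext rfl ?_)
        funext i; fin_cases i <;> rfl }
  have hl : Function.Injective l := by
    refine (injective_iff_map_eq_zero l).2 ?_
    rintro ⟨_, A, z, hA, rfl⟩ h0
    rw [transpose_mul_eta_add_eq_zero_iff] at hA
    have h1 : ∀ i, z i () = 0 := fun i => congrFun (congrArg (fun q => q.1) h0) i
    have h2 : ∀ α : Fin 3, A 0 α.succ = 0 := fun α => congrFun (congrArg (fun q => q.2.1) h0) α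
    have h3 : A 1 2 = 0 := congrFun (congrArg (fun q => q.2.2) h0) 0
    have h4 : A 1 3 = 0 := congrFun (congrArg (fun q => q.2.2) h0) 1
    have h5 : A 2 3 = 0 := congrFun (congrArg (fun q => q.2.2) h0) 2
    have a1 : A 0 1 = 0 := h2 0
    have a2 : A 0 2 = 0 := h2 1
    have a3 : A 0 3 = 0 := h2 2
    have hz : z = 0 := by ext i u; exact h1 i
    have hA0 : A = 0 := by
      ext i j
      have e := hA i j
      have e' := hA j i
      fin_cases i <;> fin_cases j <;> simp [eta_apply] at e e' ⊢ <;> linarith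
    apply Subtype.ext
    simp [hA0, hz, obsMat]
  simpa using LinearMap.finrank_le_finrank_of_injective hl

/-! ### The Cartan geometry of a Finsler spacetime -/

/-- A rotation of the coordinates of a frame, as a linear map. -/
def rotZetaL (k : Matrix (Fin 3) (Fin 3) ℝ) :
    (Fin 4 → Euc 4 × Euc 4) →L[ℝ] (Fin 4 → Euc 4 × Euc 4) :=
  LinearMap.toContinuousLinearMap
    { toFun := fun ζ => rotZeta ζ k
      map_add' := fun ζ ζ' => by
        funext i
        refine Prod.ext rfl ?_
        simp [rotZeta, rotFrame, Finset.sum_add_distrib]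
      map_smul' := fun c ζ => by
        funext i
        refine Prod.ext rfl ?_
        simp [rotZeta, rotFrame, Finset.smul_sum, smul_comm c] }

theorem hasDerivAt_rot4 {κ : ℝ → RotGroup}
    (hκ : ∀ α β, ContDiff ℝ ∞ (fun t => (κ t : Matrix (Fin 3) (Fin 3) ℝ) α β)) (i j : Fin 4) :
    HasDerivAt (fun t => rot4 (κ t).val i j) (deriv (fun t => rot4 (κ t).val i j) 0) 0 := by
  have h : ContMDiffWithinAt 𝓘(ℝ) 𝓘(ℝ) ∞ (fun t => rot4 (κ t).val i j) Set.univ (0 : ℝ) :=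
    contMDiffWithinAt_rot4 (fun α β => (hκ α β).contMDiff.contMDiffAt.contMDiffWithinAt) i j
  rw [contMDiffWithinAt_univ, contMDiffAt_iff_contDiffAt] at h
  exact (h.differentiableAt (by simp)).hasDerivAt

section Geometry

variable {M : Type*} [TopologicalSpace M] [ChartedSpace (Euc 4) M] [IsManifold (𝓡 4) ∞ M]
  {φ φ' : OpenPartialHomeomorph M (Euc 4)} {FS : FinslerSpacetime M} {T : TimeOrientation FS}
  {ori : ManifoldOrientation M} [ChartedSpace (Euc 10) (ObserverFrame T ori)]
  [IsManifold (𝓡 10) ∞ (ObserverFrame T ori)]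

variable (hP : IsSliceAtlas (n := 10) (frameInc T ori))
include hP

theorem bijective_cartanForm (Λ : ℝ) (p : ObserverFrame T ori) :
    Function.Bijective (cartanForm hP Λ p) := by
  have hi : Function.Injective (cartanForm hP Λ p) := by
    refine (injective_iff_map_eq_zero _).2 fun v hv => ?_
    exact eq_zero_of_formMat hP (chartAt_mem_maximalAtlas p.base) Λ (mem_chart_source _ _)
      (congrArg Subtype.val hv)
  have h10 : Module.finrank ℝ (TangentSpace (𝓡 10) p) = 10 :=
    (finrank_euclideanSpace_fin : Module.finrank ℝ (Euc 10) = 10)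
  have hf : Module.Finite ℝ (TangentSpace (𝓡 10) p) := inferInstanceAs (Module.Finite ℝ (Euc 10))
  have h1 := LinearMap.finrank_le_finrank_of_injective hi
  have h2 := finrank_obsAlgebra_le Λ
  exact ⟨hi, (LinearMap.injective_iff_surjective_of_finrank_eq_finrank (by omega)).1 hi⟩

theorem hasMFDerivAt_act (p : ObserverFrame T ori) (k : RotGroup) :
    MDifferentiableAt (𝓡 10) (𝓡 10) (fun q : ObserverFrame T ori => q.act k) p := by
  have h : ContMDiffWithinAt (𝓡 10) (𝓡 10) ∞ (fun q : ObserverFrame T ori => q.act k) Set.univ p :=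
    contMDiffWithinAt_act hP contMDiff_id.contMDiffAt.contMDiffWithinAt
      fun _ _ => contMDiffWithinAt_const
  exact (contMDiffWithinAt_univ.1 h).mdifferentiableAt (by simp)

theorem frameVel_act (hφ : φ ∈ IsManifold.maximalAtlas (𝓡 4) ∞ M) {p : ObserverFrame T ori}
    (hp : p.base ∈ φ.source) (k : RotGroup) (v : TangentSpace (𝓡 10) p) :
    frameVel φ (p.act k) (mfderiv (𝓡 10) (𝓡 10) (fun q => q.act k) p v) =
      rotZeta (frameVel φ p v) k.val := by
  have h1 := HasMFDerivAt.comp p (f := fun q : ObserverFrame T ori => q.act k)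
    (hasMFDerivAt_frameCoords hP hφ (p := p.act k) hp) (hasMFDerivAt_act hP p k).hasMFDerivAt
  have h2 := hasMFDerivAt_comp_frameCoords hP hφ hp (rotZetaL k.val).hasFDerivAt
  have h3 : (frameCoords φ ∘ fun q : ObserverFrame T ori => q.act k) =
      fun q => rotZetaL k.val (frameCoords φ q) := funext fun q => frameCoords_act q k
  rw [h3] at h1
  exact congrArg (fun A : TangentSpace (𝓡 10) p →L[ℝ] (Fin 4 → Euc 4 × Euc 4) => A v)
    (hasMFDerivAt_unique h1 h2)

theorem cartanForm_equivariant (Λ : ℝ) (p : ObserverFrame T ori) (k : RotGroup)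
    (v : TangentSpace (𝓡 10) p) :
    (cartanForm hP Λ (p.act k) (mfderiv (𝓡 10) (𝓡 10) (fun q => q.act k) p v) : Mat5) =
      rotMat k⁻¹ * (cartanForm hP Λ p v : Mat5) * rotMat k := by
  have hφ := chartAt_mem_maximalAtlas (M := M) p.base
  have hp : p.base ∈ (chartAt (Euc 4) p.base).source := mem_chart_source _ _
  rw [coe_cartanForm hP hφ Λ (p := p.act k) hp, coe_cartanForm hP hφ Λ hp, formMat,
    frameVel_act hP hφ hp, frameCoords_act]
  exact obsMat_rotZeta Λ (isOrthoFrame_frameCoords hφ hp) k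

/-- Along a fibre neither the base point nor `f_0` moves. The connection term drops out, and `ω` is
the plain derivative of the rotation expressed in the frame itself. -/
theorem cartanForm_maurerCartan (Λ : ℝ) (p : ObserverFrame T ori) (κ : ℝ → RotGroup)
    (hκ : ∀ α β, ContDiff ℝ ∞ (fun t => (κ t : Matrix (Fin 3) (Fin 3) ℝ) α β)) (h0 : κ 0 = 1)
    (i j : Fin 4 ⊕ Unit) :
    (cartanForm hP Λ (p.act (κ 0))
      (mfderiv 𝓘(ℝ) (𝓡 10) (fun t => p.act (κ t)) 0 (1 : ℝ)) : Mat5) i j =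
      deriv (fun t => rotMat (κ t) i j) 0 := by
  have hφ := chartAt_mem_maximalAtlas (M := M) p.base
  have hp : p.base ∈ (chartAt (Euc 4) p.base).source := mem_chart_source _ _
  set φ := chartAt (Euc 4) p.base
  set ρ : Matrix (Fin 4) (Fin 4) ℝ := Matrix.of fun i j => deriv (fun t => rot4 (κ t).val i j) 0
  have hρ0 : ∀ l, ρ l 0 = 0 := by
    intro l
    refine Fin.cases ?_ (fun α => ?_) l <;> simp [ρ]
  have hγ : ContMDiffAt 𝓘(ℝ) (𝓡 10) ∞ (fun t => p.act (κ t)) (0 : ℝ) :=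
    contMDiffWithinAt_univ.1 (contMDiffWithinAt_act hP contMDiffWithinAt_const
      fun α β => (hκ α β).contMDiff.contMDiffAt.contMDiffWithinAt)
  set w := mfderiv 𝓘(ℝ) (𝓡 10) (fun t => p.act (κ t)) 0 (1 : ℝ) with hw
  have hv : frameVel φ (p.act (κ 0)) w = fun i => (0, ∑ l, ρ l i • (frameCoords φ p l).2) := by
    have h1 := HasMFDerivAt.comp (0 : ℝ) (f := fun t => p.act (κ t))
      (hasMFDerivAt_frameCoords hP hφ (p := p.act (κ 0)) hp)
      (hγ.mdifferentiableAt (by simp)).hasMFDerivAt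
    have h2 : HasDerivAt (fun t i => ((frameCoords φ p 0).1,
        ∑ l, rot4 (κ t).val l i • (frameCoords φ p l).2))
        (fun i => (0, ∑ l, ρ l i • (frameCoords φ p l).2)) (0 : ℝ) := by
      rw [hasDerivAt_pi]
      intro i
      refine (hasDerivAt_const (0 : ℝ) (frameCoords φ p 0).1).prodMk (HasDerivAt.fun_sum fun l _ => ?_)
      exact (hasDerivAt_rot4 hκ l i).smul_const _
    have h3 : (frameCoords φ ∘ fun t => p.act (κ t)) = fun t i => ((frameCoords φ p 0).1,
        ∑ l, rot4 (κ t).val l i • (frameCoords φ p l).2) :=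
      funext fun t => frameCoords_act p (κ t)
    rw [h3] at h1
    have h4 := congrArg (fun A : ℝ →L[ℝ] (Fin 4 → Euc 4 × Euc 4) => A 1)
      (hasMFDerivAt_unique h1 h2.hasFDerivAt.hasMFDerivAt)
    refine h4.trans ?_
    exact one_smul ℝ _
  -- The condition `κ 0 = 1` enters here: the velocity is expanded in the frame `p` itself, so the
  -- components are those of `κ'(0)`.
  have hact : frameCoords φ (p.act (κ 0)) = frameCoords φ p := by
    rw [h0, ObserverFrame.act_one]
  have hv0 : frameVel φ (p.act (κ 0)) w 0 = 0 := by
    rw [hv]; simp [hρ0]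
  have hc : ∀ i, covDer (coordSq FS.F φ) (frameCoords φ p) (frameVel φ (p.act (κ 0)) w) i =
      ∑ l, ρ l i • (frameCoords φ p l).2 := by
    intro i
    have h3 : ∀ f, cartanConn (coordSq FS.F φ) (frameCoords φ p 0) 0 f = 0 := fun f => by
      have := cartanConn_smul (coordSq FS.F φ) (frameCoords φ p 0) 0 0 f
      simpa using this
    rw [covDer, hv0, h3, hv, add_zero]
  have ho := isOrthoFrame_frameCoords (T := T) hφ hp
  have h1 : (cartanForm hP Λ (p.act (κ 0)) w : Mat5) = obsMat Λ ρ 0 := by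
    rw [coe_cartanForm hP hφ Λ (p := p.act (κ 0)) hp, formMat, hact,
      lorentzPart_eq ho fun i => (hc i).symm, solderPart_eq (e := 0) ho (by rw [hv0]; simp)]
  rw [h1]
  rcases i with i | ⟨⟩ <;> rcases j with j | ⟨⟩
  · rfl
  · simp [obsMat, rotMat]
  · simp [obsMat, rotMat]
  · simp [obsMat, rotMat]

variable [ChartedSpace (Euc 7) (ObserverSpace T)] [IsManifold (𝓡 7) ∞ (ObserverSpace T)]

omit hP in
/-- The Cartan geometry of a Finsler spacetime. -/
def finslerCartanGeometry (Λ : ℝ) (hO : IsSliceAtlas (n := 7) (obsInc T))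
    (hP : IsSliceAtlas (n := 10) (frameInc T ori)) :
    ObserverCartanGeometry Λ (ObserverFrame T ori) (ObserverSpace T) where
  proj := ObserverFrame.observer
  act := ObserverFrame.act
  form := cartanForm hP Λ
  proj_smooth := contMDiff_observer hO hP
  act_one := ObserverFrame.act_one
  act_mul := ObserverFrame.act_mul
  act_smooth m W f κ _ hf hκ := act_smooth hP m W f κ hf hκ
  proj_act := ObserverFrame.observer_act
  locally_trivial := locally_trivial hO hP
  form_smooth := cartanForm_smooth hP Λ
  bijective := bijective_cartanForm hP Λ
  equivariant := cartanForm_equivariant hP Λ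
  maurerCartan := cartanForm_maurerCartan hP Λ

theorem isFinslerCartanGeometry (Λ : ℝ) (hO : IsSliceAtlas (n := 7) (obsInc T)) :
    IsFinslerCartanGeometry (finslerCartanGeometry Λ hO hP) where
  proj_eq _ := rfl
  act_zero := ObserverFrame.toTM_act_zero
  act_succ p k α := ObserverFrame.mk_congr (rotFrame_succ p.vec k.val α)
  form_translation φ hφ p hp v a := by
    have h1 := congrArg (fun u : Euc 4 => u a)
      (sum_solderPart (ξ := frameVel φ p v) (isOrthoFrame_frameCoords (T := T) hφ hp))
    have h2 : (finslerCartanGeometry Λ hO hP).form p v = cartanForm hP Λ p v := rfl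
    simp only [h2, coe_cartanForm hP hφ Λ hp]
    rw [mfderiv_baseCoord hP hφ hp 0 v]
    refine Eq.trans ?_ h1
    simp only [WithLp.ofLp_sum, WithLp.ofLp_smul, Finset.sum_apply, Pi.smul_apply, smul_eq_mul]
    rfl
  form_lorentz φ hφ p hp v i a := by
    have h1 := congrArg (fun u : Euc 4 => u a)
      (sum_lorentzPart (ξ := frameVel φ p v) (isOrthoFrame_frameCoords (T := T) hφ hp) i)
    have h2 : (finslerCartanGeometry Λ hO hP).form p v = cartanForm hP Λ p v := rfl
    simp only [h2, coe_cartanForm hP hφ Λ hp]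
    have h3 := (TimeOrientation.isMetricDomain (T := T) hφ).cartanConn_apply (frameCoords_mem hφ hp)
      (frameVel φ p v 0) (frameCoords φ p i).2 a
    simp only [mfderiv_baseCoord hP hφ hp 0 v, mfderiv_vecCoord hP hφ hp]
    refine Eq.trans ?_ (h1.trans ?_)
    · simp only [WithLp.ofLp_sum, WithLp.ofLp_smul, Finset.sum_apply, Pi.smul_apply, smul_eq_mul]
      rfl
    · exact congrArg (fun r => (frameVel φ p v i).2 a + r) h3.symm

end Geometry

/-! ### The vertical distribution -/

section Vertical

variable {M : Type*} [TopologicalSpace M] [ChartedSpace (Euc 4) M] [IsManifold (𝓡 4) ∞ M]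
  {φ : OpenPartialHomeomorph M (Euc 4)} {FS : FinslerSpacetime M} {T : TimeOrientation FS}
  [ChartedSpace (Euc 7) (ObserverSpace T)] [IsManifold (𝓡 7) ∞ (ObserverSpace T)]

/-- The coordinates of a tangent vector to the observer space. -/
def obsVel (φ : OpenPartialHomeomorph M (Euc 4)) (o : ObserverSpace T) :
    TangentSpace (𝓡 7) o →L[ℝ] Euc 4 × Euc 4 :=
  mfderiv (𝓡 7) 𝓘(ℝ, Euc 4 × Euc 4) (fun u : ObserverSpace T => tcoord φ u.val) o

section

variable (hO : IsSliceAtlas (n := 7) (obsInc T)) (hφ : φ ∈ IsManifold.maximalAtlas (𝓡 4) ∞ M)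
  {o : ObserverSpace T}
include hO

theorem contMDiff_val : ContMDiff (𝓡 7) (𝓡 4).tangent ∞
    (Subtype.val : ObserverSpace T → TangentBundle (𝓡 4) M) := hO.contMDiff_inc ()

/-- The base point of an observer depends smoothly on the observer. -/
theorem contMDiff_base : ContMDiff (𝓡 7) (𝓡 4) ∞ (fun o : ObserverSpace T => o.val.proj) :=
  (Bundle.contMDiff_proj (TangentSpace (𝓡 4))).comp (contMDiff_val hO)

include hφ

theorem contMDiffAt_tcoord_val (ho : o.val.proj ∈ φ.source) :
    ContMDiffAt (𝓡 7) 𝓘(ℝ, Euc 4 × Euc 4) ∞ (fun u : ObserverSpace T => tcoord φ u.val) o :=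
  (contMDiffAt_tcoord hφ ho).comp o (contMDiff_val hO).contMDiffAt

theorem hasMFDerivAt_obsVel (ho : o.val.proj ∈ φ.source) :
    HasMFDerivAt (𝓡 7) 𝓘(ℝ, Euc 4 × Euc 4) (fun u : ObserverSpace T => tcoord φ u.val) o
      (obsVel φ o) :=
  ((contMDiffAt_tcoord_val hO hφ ho).mdifferentiableAt (by simp)).hasMFDerivAt

theorem obsVel_injective (ho : o.val.proj ∈ φ.source) {ξ ξ' : TangentSpace (𝓡 7) o}
    (h : obsVel φ o ξ = obsVel φ o ξ') : ξ = ξ' := by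
  have h1 : obsVel φ o (ξ - ξ') = 0 := by rw [map_sub, h, sub_self]
  exact sub_eq_zero.1 (hO.eq_zero_of_mfderiv_tcoord hφ (fun _ => ho) fun _ => h1)

/-- The coordinates of the derivative of the base point. -/
theorem mfderiv_base (ho : o.val.proj ∈ φ.source) (ξ : TangentSpace (𝓡 7) o) :
    mfderiv (𝓡 4) (𝓡 4) φ o.val.proj
      (mfderiv (𝓡 7) (𝓡 4) (fun o : ObserverSpace T => o.val.proj) o ξ) = (obsVel φ o ξ).1 := by
  have h1 := HasMFDerivAt.comp o (f := fun o : ObserverSpace T => o.val.proj) (g := φ)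
    ((mdifferentiable_of_mem_maximalAtlas hφ).mdifferentiableAt ho).hasMFDerivAt
    (((contMDiff_base hO) o).mdifferentiableAt (by simp)).hasMFDerivAt
  have h2 := HasMFDerivAt.comp o (f := fun u : ObserverSpace T => tcoord φ u.val)
    (ContinuousLinearMap.fst ℝ (Euc 4) (Euc 4)).hasFDerivAt.hasMFDerivAt
    (hasMFDerivAt_obsVel hO hφ ho)
  exact congrArg (fun A : TangentSpace (𝓡 7) o →L[ℝ] Euc 4 => A ξ) (hasMFDerivAt_unique h1 h2)

/-- Tangent vectors to the observer space are orthogonal to the observer. -/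
theorem vHess_obsVel (ho : o.val.proj ∈ φ.source) {ξ : TangentSpace (𝓡 7) o}
    (hξ : (obsVel φ o ξ).1 = 0) :
    vHess (coordSq FS.F φ) (tcoord φ o.val) (tcoord φ o.val).2 (obsVel φ o ξ).2 = 0 := by
  have hz := TimeOrientation.tcoord_mem_coordDomain hφ ho (TimeOrientation.observer_mem_cone o)
  rw [TimeOrientation.vHess_self hφ hz, ← hξ, Prod.mk.eta]
  have h1 := HasMFDerivAt.comp o (f := fun u : ObserverSpace T => tcoord φ u.val)
    ((TimeOrientation.contDiffAt_coordSq hφ hz).differentiableAt (by simp)).hasFDerivAt.hasMFDerivAt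
    (hasMFDerivAt_obsVel hO hφ ho)
  -- Observers satisfy `F² = 1`, so the differential of `F²` vanishes on vectors tangent to `O`; by
  -- Euler's identity it is twice the scalar product with the observer.
  have h2 : HasMFDerivAt (𝓡 7) 𝓘(ℝ) (fun _ : ObserverSpace T => (1 : ℝ)) o
      (0 : TangentSpace (𝓡 7) o →L[ℝ] ℝ) := hasMFDerivAt_const _ _
  have h3 := h2.congr_of_eventuallyEq
      (f₁ := coordSq FS.F φ ∘ fun u : ObserverSpace T => tcoord φ u.val) (by
    filter_upwards [((isOpen_proj_source φ).preimage continuous_subtype_val).mem_nhds ho] with u hu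
    change FS.F (tpoint φ (tcoord φ u.val)) ^ 2 = 1
    rw [tpoint_tcoord hφ hu, TimeOrientation.F_eq_one, one_pow])
  have h4 := congrArg (fun A : TangentSpace (𝓡 7) o →L[ℝ] ℝ => A ξ) (hasMFDerivAt_unique h1 h3)
  have h5 : fderiv ℝ (coordSq FS.F φ) (tcoord φ o.val) (obsVel φ o ξ) = 0 := h4
  rw [h5, mul_zero]

end

/-- The boost with given velocity. -/
def boostMat (c : Fin 3 → ℝ) : Matrix (Fin 4) (Fin 4) ℝ :=
  Matrix.of (Fin.cons (Fin.cons 0 c) (fun α => Fin.cons (c α) 0))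

theorem boostMat_mem (c : Fin 3 → ℝ) : (boostMat c)ᵀ * eta + eta * boostMat c = 0 := by
  rw [transpose_mul_eta_add_eq_zero_iff]
  intro i j
  refine Fin.cases ?_ (fun α => ?_) i <;> refine Fin.cases ?_ (fun β => ?_) j <;>
    simp [boostMat, eta_apply, Fin.succ_ne_zero]

variable {ori : ManifoldOrientation M} [ChartedSpace (Euc 10) (ObserverFrame T ori)]
  [IsManifold (𝓡 10) ∞ (ObserverFrame T ori)]

theorem form_fundamental {Λ : ℝ} {P O : Type*}
    [TopologicalSpace P] [ChartedSpace (Euc 10) P] [IsManifold (𝓡 10) ∞ P]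
    [TopologicalSpace O] [ChartedSpace (Euc 7) O] [IsManifold (𝓡 7) ∞ O]
    (C : ObserverCartanGeometry Λ P O) (a : obsAlgebra Λ) (p : P) :
    C.form p (C.fundamental a p).snd = a :=
  (LinearEquiv.ofBijective (C.form p) (C.bijective p)).apply_symm_apply a

variable (Λ : ℝ) (hO : IsSliceAtlas (n := 7) (obsInc T))
  (hP : IsSliceAtlas (n := 10) (frameInc T ori))

include hO hP in
theorem obsVel_mfderiv_observer (hφ : φ ∈ IsManifold.maximalAtlas (𝓡 4) ∞ M)
    {p : ObserverFrame T ori} (hp : p.base ∈ φ.source) (v : TangentSpace (𝓡 10) p) :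
    obsVel φ p.observer (mfderiv (𝓡 10) (𝓡 7)
      (ObserverFrame.observer : ObserverFrame T ori → ObserverSpace T) p v) = frameVel φ p v 0 := by
  have h1 := HasMFDerivAt.comp p
    (f := (ObserverFrame.observer : ObserverFrame T ori → ObserverSpace T))
    (hasMFDerivAt_obsVel hO hφ (o := p.observer) hp)
    (((contMDiff_observer hO hP) p).mdifferentiableAt (by simp)).hasMFDerivAt
  rw [← mfderiv_tcoord_toTM hP hφ hp 0 v]
  exact (congrArg (fun A : TangentSpace (𝓡 10) p →L[ℝ] Euc 4 × Euc 4 => A v) h1.mfderiv).symm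

/-- Fundamental fields are defined by inverting `A`. Their velocities are used only through the
equation `A(A̲(a)) = a`, which prescribes covariant derivatives and base velocity. -/
theorem fundamental_parts (hφ : φ ∈ IsManifold.maximalAtlas (𝓡 4) ∞ M)
    {p : ObserverFrame T ori} (hp : p.base ∈ φ.source) {A : Matrix (Fin 4) (Fin 4) ℝ}
    {e : Matrix (Fin 4) Unit ℝ} {a : obsAlgebra Λ} (ha : (a : Mat5) = obsMat Λ A e) :
    (∀ i, ∑ j, A j i • (frameCoords φ p j).2 = covDer (coordSq FS.F φ) (frameCoords φ p)
      (frameVel φ p ((finslerCartanGeometry Λ hO hP).fundamental a p).snd) i) ∧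
    ∑ j, e j () • (frameCoords φ p j).2 =
      (frameVel φ p ((finslerCartanGeometry Λ hO hP).fundamental a p).snd 0).1 := by
  have h1 := congrArg Subtype.val (form_fundamental (finslerCartanGeometry Λ hO hP) a p)
  have h2 := (coe_cartanForm hP hφ Λ hp
    ((finslerCartanGeometry Λ hO hP).fundamental a p).snd).symm.trans (h1.trans ha)
  obtain ⟨h3, h4⟩ := obsMat_inj h2
  have ho := isOrthoFrame_frameCoords (T := T) hφ hp
  rw [← h3, ← h4]
  exact ⟨fun i => sum_lorentzPart ho i, sum_solderPart ho⟩

/-- The vertical distribution consists of the vectors tangent to the fibres of `O → M`. -/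
theorem mem_vertical_iff (hφ : φ ∈ IsManifold.maximalAtlas (𝓡 4) ∞ M)
    (w : TangentBundle (𝓡 7) (ObserverSpace T)) (hw : w.proj.val.proj ∈ φ.source) :
    w ∈ (finslerCartanGeometry Λ hO hP).vertical ↔ (obsVel φ w.proj w.snd).1 = 0 := by
  constructor
  · rintro ⟨p, a, ha, rfl⟩
    have hp : p.base ∈ φ.source := hw
    obtain ⟨A, e, -, hA⟩ := a.2
    have h0 : ∀ i, e i () = 0 := fun i => by
      have := ha.1 i
      rw [hA] at this
      exact this
    have h1 := (fundamental_parts Λ hO hP hφ hp hA).2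
    have h2 := obsVel_mfderiv_observer hO hP hφ hp
      ((finslerCartanGeometry Λ hO hP).fundamental a p).snd
    refine (congrArg Prod.fst h2).trans (h1.symm.trans ?_)
    simp [h0]
  · obtain ⟨o, ξ⟩ := w
    intro hξ
    obtain ⟨p, rfl⟩ := ObserverFrame.exists_observer_eq (ori := ori) o
    have hp : p.base ∈ φ.source := hw
    have hof := isOrthoFrame_frameCoords (T := T) hφ hp
    set η : Euc 4 := (obsVel φ p.observer ξ).2 with hη
    have h0 : vHess (coordSq FS.F φ) (frameCoords φ p 0) (frameCoords φ p 0).2 η = 0 :=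
      vHess_obsVel hO hφ hw hξ
    -- The boost is built from the spatial components of the fibre velocity `η`. A component along
    -- `f_0` is absent because vectors tangent to `S_x` are orthogonal to the observer.
    set c : Fin 3 → ℝ := fun α => -eta α.succ α.succ *
      vHess (coordSq FS.F φ) (frameCoords φ p 0) (frameCoords φ p α.succ).2 η with hc
    let a : obsAlgebra Λ := ⟨obsMat Λ (boostMat c) 0, _, _, boostMat_mem c, rfl⟩
    have hsum : ∑ j, boostMat c j 0 • (frameCoords φ p j).2 = η := by
      refine Eq.trans ?_ (hof.sum_repr η)
      simp only [Fin.sum_univ_succ (n := 3), h0]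
      simp [boostMat, hc]
    refine ⟨p, a, ⟨fun i => rfl, fun α β => rfl⟩, ?_⟩
    obtain ⟨h1, h2⟩ := fundamental_parts Λ hO hP hφ hp (a := a) rfl
    set v := ((finslerCartanGeometry Λ hO hP).fundamental a p).snd with hv
    have h3 : (frameVel φ p v 0).1 = 0 := by rw [← h2]; simp
    -- For a vertical motion the covariant derivative of `f_0` is its ordinary velocity, so the
    -- column of index zero of the boost matrix is the velocity in the fibre.
    have h4 : (frameVel φ p v 0).2 = η := by
      rw [← covDer_zero_of_vertical (TimeOrientation.isMetricDomain (T := T) hφ)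
        (fun w hw => TimeOrientation.vHess_self hφ hw) (frameCoords_mem hφ hp) h3, ← h1 0, hsum]
    have h5 : ξ = mfderiv (𝓡 10) (𝓡 7)
        (ObserverFrame.observer : ObserverFrame T ori → ObserverSpace T) p v := by
      refine obsVel_injective hO hφ hw ?_
      refine Eq.trans ?_ (obsVel_mfderiv_observer hO hP hφ hp v).symm
      exact Prod.ext (hξ.trans h3.symm) h4.symm
    exact Bundle.TotalSpace.ext rfl (heq_of_eq h5)

/-- The projection to `TM` of the vector field `𝐫` is the inclusion of the observer space. -/
theorem tangentMap_base_reeb (o : ObserverSpace T) :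
    tangentMap (𝓡 7) (𝓡 4) (fun o : ObserverSpace T => o.val.proj)
      ((finslerCartanGeometry Λ hO hP).reeb o) = o.val := by
  set C := finslerCartanGeometry Λ hO hP with hC
  -- The definition of `reeb` picks a frame over `o`. Only the fact that it lies over `o` is used,
  -- so the choice does not affect the result.
  obtain ⟨p, hp, hr⟩ : ∃ p : ObserverFrame T ori, p.observer = o ∧ C.reeb o =
      tangentMap (𝓡 10) (𝓡 7) C.proj (C.fundamental (timeGenerator Λ) p) :=
    ⟨_, Function.surjInv_eq C.proj_surjective o, rfl⟩
  subst hp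
  rw [hr]
  have hφ := chartAt_mem_maximalAtlas (M := M) p.base
  set φ := chartAt (Euc 4) p.base
  have hp : p.base ∈ φ.source := mem_chart_source _ _
  have h1 := (fundamental_parts Λ hO hP hφ hp (a := timeGenerator Λ) rfl).2
  have h2 := obsVel_mfderiv_observer hO hP hφ hp (C.fundamental (timeGenerator Λ) p).snd
  have h3 := mfderiv_base hO hφ (o := p.observer) hp (mfderiv (𝓡 10) (𝓡 7)
    (ObserverFrame.observer : ObserverFrame T ori → ObserverSpace T) p
    (C.fundamental (timeGenerator Λ) p).snd)
  have h4 : ∑ j : Fin 4, (Matrix.of fun (i : Fin 4) (_ : Unit) => if i = 0 then (1 : ℝ) else 0) j () •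
      (frameCoords φ p j).2 = (frameCoords φ p 0).2 := by simp
  have h5 := (mdifferentiable_of_mem_maximalAtlas hφ).mfderiv_injective hp
    (h3.trans ((congrArg Prod.fst h2).trans (h1.symm.trans h4)))
  exact Bundle.TotalSpace.ext rfl (heq_of_eq h5)

end Vertical

/-! ### The leaves of the vertical foliation -/

section Leaves

variable {M : Type*} [TopologicalSpace M] [ChartedSpace (Euc 4) M] [IsManifold (𝓡 4) ∞ M]
  {φ : OpenPartialHomeomorph M (Euc 4)} {FS : FinslerSpacetime M} {T : TimeOrientation FS}
  [ChartedSpace (Euc 7) (ObserverSpace T)] [IsManifold (𝓡 7) ∞ (ObserverSpace T)]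

section

variable (hO : IsSliceAtlas (n := 7) (obsInc T)) (hφ : φ ∈ IsManifold.maximalAtlas (𝓡 4) ∞ M)
  (A : Euc 4 ≃L[ℝ] Euc 3 × ℝ)
include hO

theorem contMDiffAt_obsPoint (o₀ : ObserverSpace T) {q : Euc 4 × Euc 3}
    (hq : (q.1, A.symm (q.2, 0)) ∈ (T.radialChart φ hφ A).target) :
    ContMDiffAt 𝓘(ℝ, Euc 4 × Euc 3) (𝓡 7) ∞ (T.obsPoint φ hφ A o₀) q :=
  contMDiffWithinAt_univ.1 (hO.contMDiffWithinAt fun _ =>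
    ((TimeOrientation.contMDiffOn_obsPoint hφ A o₀).contMDiffAt
      ((TimeOrientation.isOpen_obsTarget hφ A).mem_nhds hq)).contMDiffWithinAt)

theorem hasMFDerivAt_obsCoord {o : ObserverSpace T} (ho : o.val ∈ (T.radialChart φ hφ A).source) :
    ∃ D : TangentSpace (𝓡 7) o →L[ℝ] Euc 4 × Euc 3,
      HasMFDerivAt (𝓡 7) 𝓘(ℝ, Euc 4 × Euc 3) (TimeOrientation.obsCoord φ A) o D ∧
      ∀ ξ, (D ξ).1 = (obsVel φ o ξ).1 := by
  have hd := (TimeOrientation.contDiffAt_obsCoord A (z := tcoord φ o.val) ho.2.2.ne').differentiableAt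
    (by simp)
  have h1 := HasMFDerivAt.comp o (f := fun u : ObserverSpace T => tcoord φ u.val)
    hd.hasFDerivAt.hasMFDerivAt (hasMFDerivAt_obsVel hO hφ ho.1)
  refine ⟨_, h1, fun ξ => ?_⟩
  have h2 := (ContinuousLinearMap.fst ℝ (Euc 4) (Euc 3)).hasFDerivAt.comp (tcoord φ o.val)
    hd.hasFDerivAt
  have h3 : HasFDerivAt (fun z : Euc 4 × Euc 4 => z.1) (ContinuousLinearMap.fst ℝ (Euc 4) (Euc 4))
    (tcoord φ o.val) := hasFDerivAt_fst
  exact congrArg (fun B : Euc 4 × Euc 4 →L[ℝ] Euc 4 => B (obsVel φ o ξ)) (h2.unique h3)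

end

variable {ori : ManifoldOrientation M} [ChartedSpace (Euc 10) (ObserverFrame T ori)]
  [IsManifold (𝓡 10) ∞ (ObserverFrame T ori)] (Λ : ℝ) (hO : IsSliceAtlas (n := 7) (obsInc T))
  (hP : IsSliceAtlas (n := 10) (frameInc T ori))

/-- The fibres of `O → M` are integral manifolds of the vertical distribution. -/
theorem isIntegralManifold_fibre (hφ : φ ∈ IsManifold.maximalAtlas (𝓡 4) ∞ M)
    (A : Euc 4 ≃L[ℝ] Euc 3 × ℝ) (o₀ : ObserverSpace T) (x : Euc 4) {W : Set (Euc 3)}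
    (hW : IsOpen W) (hWt : ∀ w ∈ W, (x, A.symm (w, 0)) ∈ (T.radialChart φ hφ A).target) :
    (finslerCartanGeometry Λ hO hP).IsIntegralManifold W (fun w => T.obsPoint φ hφ A o₀ (x, w)) := by
  have hι : ContDiff ℝ ∞ (fun w : Euc 3 => (x, w)) := contDiff_const.prodMk contDiff_id
  have hs : ∀ w ∈ W, ContMDiffAt (𝓡 3) (𝓡 7) ∞ (fun w => T.obsPoint φ hφ A o₀ (x, w)) w :=
    fun w hw => ContMDiffAt.comp w (f := fun w : Euc 3 => (x, w))
      (contMDiffAt_obsPoint hO hφ A o₀ (q := (x, w)) (hWt w hw)) hι.contMDiff.contMDiffAt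
  -- The differentials `D` of the observer coordinates and `B` of their inverse are mutually
  -- inverse. Tangency thereby reduces to linear algebra in `ℝ⁴ × ℝ³`, where the vertical vectors
  -- are those of the form `(0, v)`.
  have key : ∀ w ∈ W, ∃ (D : TangentSpace (𝓡 7) (T.obsPoint φ hφ A o₀ (x, w)) →L[ℝ] Euc 4 × Euc 3)
      (B : Euc 4 × Euc 3 →L[ℝ] TangentSpace (𝓡 7) (T.obsPoint φ hφ A o₀ (x, w))),
      (∀ ξ, (D ξ).1 = (obsVel φ _ ξ).1) ∧ (∀ q, D (B q) = q) ∧ (∀ ξ, B (D ξ) = ξ) ∧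
      ∀ v, mfderiv (𝓡 3) (𝓡 7) (fun w => T.obsPoint φ hφ A o₀ (x, w)) w v = B (0, v) := by
    intro w hw
    have hq := hWt w hw
    have hm := TimeOrientation.obsPoint_mem hφ A o₀ (q := (x, w)) hq
    obtain ⟨D, hD, hD1⟩ := hasMFDerivAt_obsCoord hO hφ A hm
    have hK := ((contMDiffAt_obsPoint hO hφ A o₀ (q := (x, w)) hq).mdifferentiableAt
      (by simp)).hasMFDerivAt
    refine ⟨D, mfderiv 𝓘(ℝ, Euc 4 × Euc 3) (𝓡 7) (T.obsPoint φ hφ A o₀) (x, w), hD1, fun q => ?_,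
      fun ξ => ?_, fun v => ?_⟩
    · have h1 := HasMFDerivAt.comp (x, w) hD hK
      have h2 : HasMFDerivAt 𝓘(ℝ, Euc 4 × Euc 3) 𝓘(ℝ, Euc 4 × Euc 3)
          (TimeOrientation.obsCoord φ A ∘ T.obsPoint φ hφ A o₀) (x, w)
          (ContinuousLinearMap.id ℝ (Euc 4 × Euc 3)) := by
        refine (hasMFDerivAt_id (x, w)).congr_of_eventuallyEq ?_
        filter_upwards [(TimeOrientation.isOpen_obsTarget hφ A).mem_nhds hq] with q' hq'
        exact TimeOrientation.obsCoord_obsPoint hφ A o₀ hq'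
      exact congrArg (fun B : Euc 4 × Euc 3 →L[ℝ] Euc 4 × Euc 3 => B q) (hasMFDerivAt_unique h1 h2)
    · have hc := TimeOrientation.obsCoord_obsPoint hφ A o₀ (q := (x, w)) hq
      have h1 := HasMFDerivAt.comp (T.obsPoint φ hφ A o₀ (x, w)) (g := T.obsPoint φ hφ A o₀)
        (g' := mfderiv 𝓘(ℝ, Euc 4 × Euc 3) (𝓡 7) (T.obsPoint φ hφ A o₀) (x, w))
        (by rw [hc]; exact hK) hD
      have h2 : HasMFDerivAt (𝓡 7) (𝓡 7)
          (T.obsPoint φ hφ A o₀ ∘ TimeOrientation.obsCoord φ A) (T.obsPoint φ hφ A o₀ (x, w))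
          (ContinuousLinearMap.id ℝ (Euc 7)) := by
        refine (hasMFDerivAt_id (T.obsPoint φ hφ A o₀ (x, w))).congr_of_eventuallyEq ?_
        filter_upwards [((T.radialChart φ hφ A).open_source.preimage
          continuous_subtype_val).mem_nhds hm] with u hu
        exact TimeOrientation.obsPoint_obsCoord hφ A o₀ u hu
      exact congrArg (fun B : Euc 7 →L[ℝ] Euc 7 => B ξ) (hasMFDerivAt_unique h1 h2)
    · have h1 : HasMFDerivAt (𝓡 3) 𝓘(ℝ, Euc 4 × Euc 3) (fun w : Euc 3 => (x, w)) w
          (ContinuousLinearMap.inr ℝ (Euc 4) (Euc 3)) := (hasFDerivAt_prodMk_right x w).hasMFDerivAt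
      have h2 := HasMFDerivAt.comp w (f := fun w : Euc 3 => (x, w)) hK h1
      exact congrArg (fun B : Euc 3 →L[ℝ] Euc 7 => B v) h2.mfderiv
  refine ⟨hW, fun w hw => (hs w hw).contMDiffWithinAt, fun w hw w' hw' h => ?_, fun w hw => ?_,
    fun w hw ξ => ?_⟩
  · have h1 := congrArg (TimeOrientation.obsCoord φ A) h
    rw [TimeOrientation.obsCoord_obsPoint hφ A o₀ (q := (x, w)) (hWt w hw),
      TimeOrientation.obsCoord_obsPoint hφ A o₀ (q := (x, w')) (hWt w' hw')] at h1
    exact congrArg Prod.snd h1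
  · obtain ⟨D, B, -, h2, -, h4⟩ := key w hw
    intro v v' h
    have h5 : B (0, v) = B (0, v') := (h4 v).symm.trans (h.trans (h4 v'))
    have h6 := (h2 (0, v)).symm.trans ((congrArg D h5).trans (h2 (0, v')))
    exact congrArg Prod.snd h6
  · have hm := TimeOrientation.obsPoint_mem hφ A o₀ (q := (x, w)) (hWt w hw)
    obtain ⟨D, B, h1, h2, h3, h4⟩ := key w hw
    rw [mem_vertical_iff Λ hO hP hφ _ hm.1]
    constructor
    · intro h
      refine ⟨(D ξ).2, (h4 _).trans ?_⟩
      have h5 : (0, (D ξ).2) = D ξ := Prod.ext ((h1 ξ).trans h).symm rfl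
      rw [h5]
      exact h3 ξ
    · rintro ⟨v, rfl⟩
      refine (h1 _).symm.trans ?_
      exact (congrArg (fun u => (D u).1) (h4 v)).trans (congrArg Prod.fst (h2 (0, v)))

theorem isIntegrable : (finslerCartanGeometry Λ hO hP).IsIntegrable := by
  intro o
  have hφ := chartAt_mem_maximalAtlas (M := M) o.val.proj
  obtain ⟨A, hA⟩ := TimeOrientation.exists_mem_radialChart hφ o (mem_chart_source _ _)
  set q := TimeOrientation.obsCoord (chartAt (Euc 4) o.val.proj) A o with hq
  refine ⟨{w | (q.1, A.symm (w, 0)) ∈ (T.radialChart _ hφ A).target}, _,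
    isIntegralManifold_fibre Λ hO hP hφ A o q.1
      ((T.radialChart _ hφ A).open_target.preimage (by fun_prop)) fun w hw => hw, q.2, ?_, ?_⟩
  · rw [Set.mem_ofPred_eq, TimeOrientation.obsCoord_eq hφ A o]
    exact (T.radialChart _ hφ A).map_source hA
  · exact TimeOrientation.obsPoint_obsCoord hφ A o o hA

variable {Λ hO hP}

/-- The base point is constant on connected integral manifolds. -/
theorem base_eq_of_isIntegralManifold {W : Set (Euc 3)} {j : Euc 3 → ObserverSpace T}
    (h : (finslerCartanGeometry Λ hO hP).IsIntegralManifold W j) (hW : IsPreconnected W)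
    {w w' : Euc 3} (hw : w ∈ W) (hw' : w' ∈ W) : (j w).val.proj = (j w').val.proj := by
  -- On a preconnected set it suffices that the base point is locally constant. On a small ball a
  -- chart of `M` applies, and the derivative vanishes because the tangent vectors are vertical.
  refine hW.induction₂ (fun w w' => (j w).val.proj = (j w').val.proj) (fun w hw => ?_)
    (fun _ _ _ _ _ _ h1 h2 => h1.trans h2) (fun _ _ _ _ h1 => h1.symm) hw hw'
  refine Filter.Eventually.filter_mono nhdsWithin_le_nhds ?_
  have hφ := chartAt_mem_maximalAtlas (M := M) (j w).val.proj
  set φ := chartAt (Euc 4) (j w).val.proj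
  have hjc : ∀ w ∈ W, ContMDiffAt (𝓡 3) (𝓡 7) ∞ j w := fun w hw =>
    h.smooth.contMDiffAt (h.isOpen.mem_nhds hw)
  have hc : ContinuousAt (fun w' => (j w').val.proj) w :=
    (contMDiff_base hO).continuous.continuousAt.comp (hjc w hw).continuousAt
  obtain ⟨ε, hε, hb⟩ := Metric.mem_nhds_iff.1 (Filter.inter_mem (h.isOpen.mem_nhds hw)
    (hc (φ.open_source.mem_nhds (mem_chart_source (Euc 4) (j w).val.proj))))
  have hd : ∀ u ∈ Metric.ball w ε, HasFDerivAt (fun w' => φ (j w').val.proj)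
      (0 : Euc 3 →L[ℝ] Euc 4) u := by
    intro u hu
    have h1 := HasMFDerivAt.comp u (f := j) (hasMFDerivAt_obsVel hO hφ (o := j u) (hb hu).2)
      ((hjc u (hb hu).1).mdifferentiableAt (by simp)).hasMFDerivAt
    have h2 := HasMFDerivAt.comp u (f := (fun u : ObserverSpace T => tcoord φ u.val) ∘ j)
      (ContinuousLinearMap.fst ℝ (Euc 4) (Euc 4)).hasFDerivAt.hasMFDerivAt h1
    have h3 := hasMFDerivAt_iff_hasFDerivAt.1 h2
    refine HasFDerivAt.congr_fderiv h3 ?_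
    ext1 v
    exact (mem_vertical_iff Λ hO hP hφ ⟨j u, mfderiv (𝓡 3) (𝓡 7) j u v⟩ (hb hu).2).1
      ((h.tangent u (hb hu).1 _).2 ⟨v, rfl⟩)
  filter_upwards [Metric.ball_mem_nhds w hε] with u hu
  have h4 := Metric.isOpen_ball.is_const_of_fderiv_eq_zero (𝕜 := ℝ)
    (convex_ball w ε).isPreconnected
    (fun u hu => (hd u hu).differentiableAt.differentiableWithinAt)
    (fun u hu => (hd u hu).fderiv) (Metric.mem_ball_self hε) hu
  exact φ.injOn (mem_chart_source (Euc 4) (j w).val.proj) (hb hu).2 h4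

/-- The leaves are the fibres of `O → M`. -/
theorem leafSetoid_iff {o o' : ObserverSpace T} :
    (finslerCartanGeometry Λ hO hP).leafSetoid o o' ↔ o.val.proj = o'.val.proj := by
  constructor
  · intro h
    induction h with
    | rel _ _ h =>
      obtain ⟨W, j, h1, h2, ⟨w, hw, rfl⟩, ⟨w', hw', rfl⟩⟩ := h
      exact base_eq_of_isIntegralManifold h1 h2 hw hw'
    | refl => rfl
    | symm _ _ _ h => exact h.symm
    | trans _ _ _ _ _ h h' => exact h.trans h'
  · obtain ⟨⟨x, y⟩, hy⟩ := o
    obtain ⟨⟨x', y'⟩, hy'⟩ := o'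
    intro hx
    obtain rfl : x = x' := hx
    set R := (finslerCartanGeometry Λ hO hP).leafSetoid
    -- Conversely, being on the same leaf is an equivalence relation, and since `S_x` is connected
    -- it suffices to relate nearby observers of the same fibre.
    have key := IsPreconnected.induction₂ (T.isPreconnected_S x)
      (fun y y' => ∀ (hy : y ∈ T.S x) (hy' : y' ∈ T.S x),
        R (⟨⟨x, y⟩, hy⟩ : ObserverSpace T) (⟨⟨x, y'⟩, hy'⟩ : ObserverSpace T)) ?_
      (fun a b c ha hb hc h1 h2 ha' hc' => R.trans (h1 ha' hb) (h2 hb hc'))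
      (fun a b ha hb h1 hb' ha' => R.symm (h1 ha' hb')) hy hy'
    · exact key hy hy'
    · intro y hy
      set o : ObserverSpace T := ⟨⟨x, y⟩, hy⟩ with ho
      have hφ := chartAt_mem_maximalAtlas (M := M) x
      set φ := chartAt (Euc 4) x
      have hx : x ∈ φ.source := mem_chart_source _ x
      obtain ⟨A, hA⟩ := TimeOrientation.exists_mem_radialChart hφ o hx
      set q := TimeOrientation.obsCoord φ A o with hq
      have hq0 : (q.1, A.symm (q.2, 0)) ∈ (T.radialChart φ hφ A).target := by
        rw [TimeOrientation.obsCoord_eq hφ A o]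
        exact (T.radialChart φ hφ A).map_source hA
      have hWo : IsOpen {w : Euc 3 | (q.1, A.symm (w, 0)) ∈ (T.radialChart φ hφ A).target} :=
        (T.radialChart φ hφ A).open_target.preimage (by fun_prop)
      obtain ⟨ε, hε, hb⟩ := Metric.mem_nhds_iff.1 (hWo.mem_nhds hq0)
      -- Restriction to a ball makes the parameter domain connected, as the definition of leaves
      -- demands.
      have hi := isIntegralManifold_fibre Λ hO hP hφ A o q.1 (Metric.isOpen_ball (x := q.2) (ε := ε))
        fun w hw => hb hw
      have hc : ContinuousAt (fun y : Euc 4 => (⟨x, y⟩ : TangentBundle (𝓡 4) M)) y :=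
        (contMDiff_fiber_inclusion x).continuous.continuousAt
      have hc' : ContinuousAt (fun v : TangentBundle (𝓡 4) M => wproj A (tcoord φ v).2) ⟨x, y⟩ := by
        have h1 := (TimeOrientation.contDiffAt_obsCoord A (z := tcoord φ o.val) hA.2.2.ne').continuousAt
        have h2 := (contMDiffAt_tcoord hφ (v := o.val) hx).continuousAt
        exact (ContinuousAt.comp (f := tcoord φ) h1 h2).snd
      have e1 : ∀ᶠ y' in 𝓝 y, (⟨x, y'⟩ : TangentBundle (𝓡 4) M) ∈ (T.radialChart φ hφ A).source :=
        hc ((T.radialChart φ hφ A).open_source.mem_nhds hA)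
      have e2 : ∀ᶠ y' in 𝓝 y, wproj A (tcoord φ (⟨x, y'⟩ : TangentBundle (𝓡 4) M)).2 ∈
          Metric.ball q.2 ε :=
        (ContinuousAt.comp (f := fun y : Euc 4 => (⟨x, y⟩ : TangentBundle (𝓡 4) M)) hc' hc)
          (Metric.ball_mem_nhds _ hε)
      refine Filter.Eventually.filter_mono nhdsWithin_le_nhds ?_
      filter_upwards [e1, e2] with y' h1 h2 hy₁ hy'
      refine Relation.EqvGen.rel _ _ ⟨_, _, hi, (convex_ball q.2 ε).isPreconnected,
        ⟨q.2, Metric.mem_ball_self hε, TimeOrientation.obsPoint_obsCoord hφ A o o hA⟩, _, h2, ?_⟩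
      exact TimeOrientation.obsPoint_obsCoord hφ A o ⟨⟨x, y'⟩, hy'⟩ h1

end Leaves

/-! ### Transport of manifold structures -/

section Transport

variable {M L : Type*} [TopologicalSpace M] [ChartedSpace (Euc 4) M] [TopologicalSpace L]

/-- The manifold structure on `L` for which a given homeomorphism to `M` is a diffeomorphism. -/
@[reducible]
def transportChartedSpace (ν : L ≃ₜ M) : ChartedSpace (Euc 4) L where
  atlas := {e' | ∃ e ∈ atlas (Euc 4) M, e' = ν.transOpenPartialHomeomorph e}
  chartAt l := ν.transOpenPartialHomeomorph (chartAt (Euc 4) (ν l))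
  mem_chart_source l := mem_chart_source (Euc 4) (ν l)
  chart_mem_atlas l := ⟨_, chart_mem_atlas (Euc 4) (ν l), rfl⟩

variable [IsManifold (𝓡 4) ∞ M]

theorem isManifold_transport (ν : L ≃ₜ M) :
    letI := transportChartedSpace ν
    IsManifold (𝓡 4) ∞ L := by
  let := transportChartedSpace ν
  refine isManifold_of_contDiffOn _ _ _ ?_
  rintro _ _ ⟨e, he, rfl⟩ ⟨e', he', rfl⟩
  have h1 : ContDiffOn ℝ ∞ (fun u => e' (e.symm u)) (e.symm.trans e').source := by
    rw [← contMDiffOn_iff_contDiffOn]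
    refine (contMDiffOn_of_mem_maximalAtlas (IsManifold.subset_maximalAtlas he')).comp
      ((contMDiffOn_symm_of_mem_maximalAtlas (IsManifold.subset_maximalAtlas he)).mono ?_) ?_
    · exact fun u hu => hu.1
    · exact fun u hu => hu.2
  have h2 : (e.symm.trans e').source = e.target ∩ e.symm ⁻¹' e'.source := rfl
  rw [h2] at h1
  simpa [Function.comp_def, ← Set.preimage_comp] using h1

/-- The diffeomorphism to which the homeomorphism is upgraded. -/
def transportDiffeomorph (ν : L ≃ₜ M) :
    letI := transportChartedSpace ν
    M ≃ₘ^∞⟮𝓡 4, 𝓡 4⟯ L :=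
  letI := transportChartedSpace ν
  haveI := isManifold_transport ν
  { toEquiv := ν.symm.toEquiv
    contMDiff_toFun := by
      intro x
      set e := chartAt (Euc 4) x
      have hx : x ∈ e.source := mem_chart_source _ x
      have hm : ν.transOpenPartialHomeomorph e ∈ IsManifold.maximalAtlas (𝓡 4) ∞ L :=
        IsManifold.subset_maximalAtlas ⟨e, chart_mem_atlas _ x, rfl⟩
      have h1 := ContMDiffAt.comp x ((contMDiffOn_symm_of_mem_maximalAtlas hm).contMDiffAt
        (e.open_target.mem_nhds (e.map_source hx)))
        ((contMDiffOn_of_mem_maximalAtlas (chartAt_mem_maximalAtlas x)).contMDiffAt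
          (e.open_source.mem_nhds hx))
      refine h1.congr_of_eventuallyEq ?_
      filter_upwards [e.open_source.mem_nhds hx] with y hy
      exact congrArg ν.symm (e.left_inv hy).symm
    contMDiff_invFun := by
      intro l
      set e := chartAt (Euc 4) (ν l)
      have hx : ν l ∈ e.source := mem_chart_source _ (ν l)
      have hm : ν.transOpenPartialHomeomorph e ∈ IsManifold.maximalAtlas (𝓡 4) ∞ L :=
        IsManifold.subset_maximalAtlas ⟨e, chart_mem_atlas _ (ν l), rfl⟩
      have h1 := ContMDiffAt.comp l ((contMDiffOn_symm_of_mem_maximalAtlas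
        (chartAt_mem_maximalAtlas (ν l))).contMDiffAt (e.open_target.mem_nhds (e.map_source hx)))
        ((contMDiffOn_of_mem_maximalAtlas hm).contMDiffAt
          ((ν.transOpenPartialHomeomorph e).open_source.mem_nhds hx))
      refine h1.congr_of_eventuallyEq ?_
      filter_upwards [(e.open_source.preimage ν.continuous).mem_nhds hx] with y hy
      exact (e.left_inv hy).symm }

end Transport

/-! ### Immersions and tangent bundles under diffeomorphisms -/

section Diffeomorphisms

variable {E H E' H' : Type*} [NormedAddCommGroup E] [NormedSpace ℝ E] [TopologicalSpace H]
  {I : ModelWithCorners ℝ E H} [NormedAddCommGroup E'] [NormedSpace ℝ E'] [TopologicalSpace H']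
  {J : ModelWithCorners ℝ E' H'} {S N N' : Type*} [TopologicalSpace S] [ChartedSpace H S]
  [TopologicalSpace N] [ChartedSpace H' N] [TopologicalSpace N'] [ChartedSpace H' N']
  [IsManifold J ∞ N] [IsManifold J ∞ N']

theorem transport_mem_maximalAtlas (g : N ≃ₘ^∞⟮J, J⟯ N') {e : OpenPartialHomeomorph N H'}
    (he : e ∈ IsManifold.maximalAtlas J ∞ N) :
    g.symm.toHomeomorph.transOpenPartialHomeomorph e ∈ IsManifold.maximalAtlas J ∞ N' := by
  refine OpenPartialHomeomorph.mem_maximalAtlas_of_contMDiffOn _ ?_ ?_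
  · exact (contMDiffOn_of_mem_maximalAtlas he).comp g.symm.contMDiff.contMDiffOn fun _ h => h
  · exact g.contMDiff.comp_contMDiffOn (contMDiffOn_symm_of_mem_maximalAtlas he)

/-- Transporting the target chart along `g` leaves the map unchanged in coordinates, so the local
normal form persists with the same complement. -/
theorem isImmersionOfComplement_diffeomorph_comp {F : Type*} [NormedAddCommGroup F]
    [NormedSpace ℝ F] {f : S → N} (hf : Manifold.IsImmersionOfComplement F I J ∞ f)
    (g : N ≃ₘ^∞⟮J, J⟯ N') : Manifold.IsImmersionOfComplement F I J ∞ (fun s => g (f s)) := by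
  intro s
  have h := hf s
  refine Manifold.IsImmersionAtOfComplement.mk_of_charts h.equiv h.domChart
    (g.symm.toHomeomorph.transOpenPartialHomeomorph h.codChart) h.mem_domChart_source ?_
    h.domChart_mem_maximalAtlas (transport_mem_maximalAtlas g h.codChart_mem_maximalAtlas) ?_ ?_
  · change g.symm (g (f s)) ∈ h.codChart.source
    rw [g.symm_apply_apply]; exact h.mem_codChart_source
  · intro t ht
    change g.symm (g (f t)) ∈ h.codChart.source
    rw [g.symm_apply_apply]; exact h.source_subset_preimage_source ht
  · intro u hu
    refine Eq.trans ?_ (h.writtenInCharts hu)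
    change J (h.codChart (g.symm (g (f _)))) = J (h.codChart (f _))
    rw [g.symm_apply_apply]

variable {M L : Type*} [TopologicalSpace M] [ChartedSpace (Euc 4) M] [IsManifold (𝓡 4) ∞ M]
  [TopologicalSpace L] [ChartedSpace (Euc 4) L] [IsManifold (𝓡 4) ∞ L]

theorem tangentMap_symm_tangentMap (μ : M ≃ₘ^∞⟮𝓡 4, 𝓡 4⟯ L) (v : TangentBundle (𝓡 4) M) :
    tangentMap (𝓡 4) (𝓡 4) μ.symm (tangentMap (𝓡 4) (𝓡 4) μ v) = v := by
  rw [← tangentMap_comp_at v ((μ.symm.contMDiff _).mdifferentiableAt (by simp))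
    ((μ.contMDiff _).mdifferentiableAt (by simp))]
  have h : μ.symm ∘ μ = id := funext fun x => μ.symm_apply_apply x
  rw [h, tangentMap_id]; rfl

/-- The diffeomorphism of tangent bundles induced by a diffeomorphism. -/
def tangentDiffeomorph (μ : M ≃ₘ^∞⟮𝓡 4, 𝓡 4⟯ L) :
    TangentBundle (𝓡 4) M ≃ₘ^∞⟮(𝓡 4).tangent, (𝓡 4).tangent⟯ TangentBundle (𝓡 4) L where
  toFun := tangentMap (𝓡 4) (𝓡 4) μ
  invFun := tangentMap (𝓡 4) (𝓡 4) μ.symm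
  left_inv := tangentMap_symm_tangentMap μ
  right_inv := tangentMap_symm_tangentMap μ.symm
  contMDiff_toFun := μ.contMDiff.contMDiff_tangentMap (by simp)
  contMDiff_invFun := μ.symm.contMDiff.contMDiff_tangentMap (by simp)

theorem tangentMap_smul (μ : M → L) (x : M) (y : TangentSpace (𝓡 4) x) (c : ℝ) :
    tangentMap (𝓡 4) (𝓡 4) μ ⟨x, c • y⟩ = ⟨(tangentMap (𝓡 4) (𝓡 4) μ ⟨x, y⟩).proj,
      c • (tangentMap (𝓡 4) (𝓡 4) μ ⟨x, y⟩).snd⟩ :=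
  Bundle.TotalSpace.ext rfl (heq_of_eq (map_smul (mfderiv (𝓡 4) (𝓡 4) μ x) c y))

end Diffeomorphisms

/-! ### The leaf space is the spacetime -/

section LeafSpace

variable {M : Type*} [TopologicalSpace M] [ChartedSpace (Euc 4) M] [IsManifold (𝓡 4) ∞ M]
  {FS : FinslerSpacetime M} {T : TimeOrientation FS}
  [ChartedSpace (Euc 7) (ObserverSpace T)] [IsManifold (𝓡 7) ∞ (ObserverSpace T)]
  {ori : ManifoldOrientation M} [ChartedSpace (Euc 10) (ObserverFrame T ori)]
  [IsManifold (𝓡 10) ∞ (ObserverFrame T ori)]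

/-- Through every observer there is a continuous local section of `O → M`, so images of
neighbourhoods are neighbourhoods. Openness identifies the quotient topology of the leaf space with
that of `M`. -/
theorem isOpenMap_base (hO : IsSliceAtlas (n := 7) (obsInc T)) :
    IsOpenMap (fun o : ObserverSpace T => o.val.proj) := by
  rw [isOpenMap_iff_nhds_le]
  intro o
  have hφ := chartAt_mem_maximalAtlas (M := M) o.val.proj
  obtain ⟨A, hA⟩ := TimeOrientation.exists_mem_radialChart hφ o (mem_chart_source _ _)
  have hx : o.val.proj ∈ (chartAt (Euc 4) o.val.proj).source := mem_chart_source _ _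
  set φ := chartAt (Euc 4) o.val.proj
  set q := TimeOrientation.obsCoord φ A o with hq
  have hqt : (q.1, A.symm (q.2, 0)) ∈ (T.radialChart φ hφ A).target := by
    rw [TimeOrientation.obsCoord_eq hφ A o]
    exact (T.radialChart φ hφ A).map_source hA
  -- The section keeps the projective direction in coordinates fixed and varies the base point.
  set s : M → ObserverSpace T := fun x => T.obsPoint φ hφ A o (φ x, q.2) with hs
  have hφc : ContinuousAt (fun x : M => (φ x, q.2)) o.val.proj :=
    (φ.continuousAt hx).prodMk continuousAt_const
  have hso : s o.val.proj = o := TimeOrientation.obsPoint_obsCoord hφ A o o hA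
  have hsc : Filter.Tendsto s (𝓝 o.val.proj) (𝓝 o) := by
    have h1 : ContinuousAt s o.val.proj :=
      ContinuousAt.comp (f := fun x : M => (φ x, q.2)) (g := T.obsPoint φ hφ A o)
        (contMDiffAt_obsPoint hO hφ A o (q := q) hqt).continuousAt hφc
    have h2 := h1.tendsto
    rwa [hso] at h2
  have hsec : ∀ᶠ x in 𝓝 o.val.proj, (s x).val.proj = x := by
    filter_upwards [φ.open_source.mem_nhds hx,
      hφc ((TimeOrientation.isOpen_obsTarget hφ A).mem_nhds hqt)] with x hx' hxt
    exact φ.injOn (TimeOrientation.obsPoint_mem hφ A o hxt).1 hx'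
      (congrArg Prod.fst (TimeOrientation.obsCoord_obsPoint hφ A o hxt))
  intro V hV
  filter_upwards [hsec, hsc hV] with x h1 h2
  exact (congrArg (· ∈ V) h1).mp h2

variable (Λ : ℝ) (hO : IsSliceAtlas (n := 7) (obsInc T))
  (hP : IsSliceAtlas (n := 10) (frameInc T ori))

/-- The base point of a leaf. -/
def leafBase : (finslerCartanGeometry Λ hO hP).LeafSpace → M :=
  Quotient.lift (fun o : ObserverSpace T => o.val.proj) fun _ _ h => leafSetoid_iff.1 h

/-- The leaf space is homeomorphic to the spacetime. -/
def leafHomeomorph : (finslerCartanGeometry Λ hO hP).LeafSpace ≃ₜ M :=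
  (Equiv.ofBijective (leafBase Λ hO hP) ⟨by
    rintro ⟨o⟩ ⟨o'⟩ h
    exact Quotient.sound (leafSetoid_iff.2 h), fun x => by
    obtain ⟨y, hy⟩ := T.S_nonempty x
    exact ⟨Quotient.mk _ ⟨⟨x, y⟩, hy⟩, rfl⟩⟩).toHomeomorphOfContinuousOpen
    ((contMDiff_base hO).continuous.quotient_lift _) (fun U hU => by
      have h := isOpenMap_base hO _ (hU.preimage continuous_quotient_mk')
      convert h using 1
      ext x
      constructor
      · rintro ⟨⟨o⟩, ho, rfl⟩
        exact ⟨o, ho, rfl⟩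
      · rintro ⟨o, ho, rfl⟩
        exact ⟨_, ho, rfl⟩)

theorem leafHomeomorph_symm_base (o : ObserverSpace T) :
    (leafHomeomorph Λ hO hP).symm o.val.proj = (finslerCartanGeometry Λ hO hP).leafProj o :=
  (leafHomeomorph Λ hO hP).symm_apply_eq.2 rfl

end LeafSpace

/-! ### Reconstruction of the spacetime -/

section Reconstruction

variable {M : Type*} [TopologicalSpace M] [ChartedSpace (Euc 4) M] [IsManifold (𝓡 4) ∞ M]
  {FS : FinslerSpacetime M} {T : TimeOrientation FS}
  [ChartedSpace (Euc 7) (ObserverSpace T)] [IsManifold (𝓡 7) ∞ (ObserverSpace T)]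
  {ori : ManifoldOrientation M} [ChartedSpace (Euc 10) (ObserverFrame T ori)]
  [IsManifold (𝓡 10) ∞ (ObserverFrame T ori)]
  {Λ : ℝ} {hO : IsSliceAtlas (n := 7) (obsInc T)} {hP : IsSliceAtlas (n := 10) (frameInc T ori)}
  [ChartedSpace (Euc 4) (finslerCartanGeometry Λ hO hP).LeafSpace]
  [IsManifold (𝓡 4) ∞ (finslerCartanGeometry Λ hO hP).LeafSpace]
  {μ : M ≃ₘ^∞⟮𝓡 4, 𝓡 4⟯ (finslerCartanGeometry Λ hO hP).LeafSpace}
  (hμ : ∀ o : ObserverSpace T, μ o.val.proj = (finslerCartanGeometry Λ hO hP).leafProj o)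
include hμ

/-- In the chart `obsChart` of `O` and the transported chart of the leaf space the projection is the
first projection of `ℝ⁴ × ℝ³`. -/
theorem isSubmersion_leafProj :
    Manifold.IsSubmersion (𝓡 7) (𝓡 4) ∞ (finslerCartanGeometry Λ hO hP).leafProj := by
  refine Manifold.IsSubmersionOfComplement.isSubmersion (F := Euc 3) fun o => ?_
  have hφ := chartAt_mem_maximalAtlas (M := M) o.val.proj
  obtain ⟨A, hA⟩ := TimeOrientation.exists_mem_radialChart hφ o (mem_chart_source _ _)
  set φ := chartAt (Euc 4) o.val.proj
  have hb : ∀ o', μ.symm ((finslerCartanGeometry Λ hO hP).leafProj o') = o'.val.proj :=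
    fun o' => by rw [← hμ, μ.symm_apply_apply]
  refine Manifold.IsSubmersionAtOfComplement.mk_of_charts euc7.symm (T.obsChart φ hφ A o)
    (μ.symm.toHomeomorph.transOpenPartialHomeomorph φ) hA ?_
    (hO.mem_maximalAtlas (TimeOrientation.isSliceChart_obsChart hφ A o))
    (transport_mem_maximalAtlas μ hφ) (fun o' ho' => ?_) ?_
  · change μ.symm _ ∈ φ.source
    rw [hb]; exact hA.1
  · change μ.symm _ ∈ φ.source
    rw [hb]; exact ho'.1
  · intro u hu
    have hu' : u ∈ (T.obsChart φ hφ A o).target := by simpa using hu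
    change φ (μ.symm ((finslerCartanGeometry Λ hO hP).leafProj
      (T.obsPoint φ hφ A o (euc7.symm u)))) = (euc7.symm u).1
    rw [hb]
    exact congrArg Prod.fst (TimeOrientation.obsCoord_obsPoint hφ A o hu')

theorem isStrictlySimple [T2Space M] : (finslerCartanGeometry Λ hO hP).IsStrictlySimple where
  hausdorff := μ.toHomeomorph.t2Space
  submersion := isSubmersion_leafProj hμ

/-- The diffeomorphism maps the observers to their reconstructions. -/
theorem tangentMap_val (o : ObserverSpace T) :
    tangentMap (𝓡 4) (𝓡 4) μ o.val = (finslerCartanGeometry Λ hO hP).sigma o := by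
  have h1 : (finslerCartanGeometry Λ hO hP).leafProj =
      μ ∘ fun o : ObserverSpace T => o.val.proj := funext fun o => (hμ o).symm
  have h2 := tangentMap_comp_at (I := 𝓡 7) (I' := 𝓡 4) (I'' := 𝓡 4)
    (f := fun o : ObserverSpace T => o.val.proj) (g := μ)
    ((finslerCartanGeometry Λ hO hP).reeb o)
    ((μ.contMDiff _).mdifferentiableAt (by simp))
    ((contMDiff_base hO _).mdifferentiableAt (by simp))
  rw [ObserverCartanGeometry.sigma, h1, h2, tangentMap_base_reeb Λ hO hP o]

theorem sigma_eq : (finslerCartanGeometry Λ hO hP).sigma =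
    fun o => tangentDiffeomorph μ o.val := funext fun o => (tangentMap_val hμ o).symm

/-- The map `σ` is the inclusion of `O` followed by the diffeomorphism of tangent bundles induced by
`μ`. -/
theorem sigmaIsEmbedding : (finslerCartanGeometry Λ hO hP).SigmaIsEmbedding := by
  have h1 := isImmersionOfComplement_diffeomorph_comp (TimeOrientation.isImmersion_val hO)
    (tangentDiffeomorph μ)
  refine ⟨?_, ?_⟩
  · rw [sigma_eq hμ]; exact h1.isImmersion
  · rw [sigma_eq hμ]
    exact (tangentDiffeomorph μ).toHomeomorph.isEmbedding.comp Topology.IsEmbedding.subtypeVal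

theorem tangentMap_smul_val (o : ObserverSpace T) (c : ℝ) :
    tangentMap (𝓡 4) (𝓡 4) μ ⟨o.val.proj, c • o.val.snd⟩ =
      ⟨((finslerCartanGeometry Λ hO hP).sigma o).proj,
        c • ((finslerCartanGeometry Λ hO hP).sigma o).snd⟩ := by
  rw [← tangentMap_val hμ]
  exact tangentMap_smul μ _ _ c

omit hμ in
theorem F_smul_observer (o : ObserverSpace T) (c : ℝ) :
    FS.F ⟨o.val.proj, c • o.val.snd⟩ = |c| := by
  rw [FS.F_smul]
  exact (congrArg (|c| * ·) (TimeOrientation.F_eq_one o)).trans (mul_one _)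

/-- After pulling back to `M`, two multiples of one vector that are both observers have `F = 1`,
hence factors of equal modulus. Opposite factors are excluded since `S_x` does not contain opposite
vectors. -/
theorem linesMeetOnce : (finslerCartanGeometry Λ hO hP).LinesMeetOnce := by
  rintro x y _ ⟨⟨o, rfl⟩, c, hc⟩ _ ⟨⟨o', rfl⟩, c', hc'⟩
  have key : ∀ (o : ObserverSpace T) (c : ℝ),
      (⟨x, c • y⟩ : TangentBundle (𝓡 4) (finslerCartanGeometry Λ hO hP).LeafSpace) =
        (finslerCartanGeometry Λ hO hP).sigma o →
      o.val = ⟨μ.symm x, c • mfderiv (𝓡 4) (𝓡 4) μ.symm x y⟩ := by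
    intro o c h
    have h1 := tangentMap_symm_tangentMap μ o.val
    rw [tangentMap_val hμ, ← h] at h1
    exact h1.symm.trans (tangentMap_smul μ.symm x y c)
  have h1 := key o c hc
  have h2 := key o' c' hc'
  set y' : TangentSpace (𝓡 4) (μ.symm x) := mfderiv (𝓡 4) (𝓡 4) μ.symm x y
  have e1 := TimeOrientation.F_eq_one o
  have e2 := TimeOrientation.F_eq_one o'
  rw [h1, FS.F_smul] at e1
  rw [h2, FS.F_smul] at e2
  have m1 := o.2
  have m2 := o'.2
  rw [h1] at m1
  rw [h2] at m2
  have hcc : c = c' := by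
    have hF : FS.F ⟨μ.symm x, y'⟩ ≠ 0 := fun h0 => by rw [h0, mul_zero] at e1; exact zero_ne_one e1
    rcases abs_eq_abs.1 (mul_right_cancel₀ hF (e1.trans e2.symm)) with h | h
    · exact h
    · refine absurd m1 ?_
      change c • y' ∉ T.S (μ.symm x)
      rw [h, neg_smul]
      exact T.neg_notMem_S m2
  rw [← hc, ← hc', hcc]

/-- The function `recFinsler` is defined through an arbitrary representation of its argument as a
multiple of some `σ(o')`. All representations give the same value, since they pull back to one
vector of `M`, whose `F` is the modulus of the factor. -/
theorem recFinsler_tangentMap (o : ObserverSpace T) (c : ℝ) :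
    (finslerCartanGeometry Λ hO hP).recFinsler
      (tangentMap (𝓡 4) (𝓡 4) μ ⟨o.val.proj, c • o.val.snd⟩) = |c| := by
  have hex : ∃ (c' : ℝ) (o' : ObserverSpace T),
      tangentMap (𝓡 4) (𝓡 4) μ ⟨o.val.proj, c • o.val.snd⟩ =
        ⟨((finslerCartanGeometry Λ hO hP).sigma o').proj,
          c' • ((finslerCartanGeometry Λ hO hP).sigma o').snd⟩ :=
    ⟨c, o, tangentMap_smul_val hμ o c⟩
  rw [ObserverCartanGeometry.recFinsler, dif_pos hex]
  -- The chosen observer `o'` need not be `o`; comparison with `F` on `M` makes this harmless.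
  obtain ⟨o', ho'⟩ := hex.choose_spec
  have h1 := (tangentDiffeomorph μ).injective (ho'.trans (tangentMap_smul_val hμ o' _).symm)
  exact (F_smul_observer o' _).symm.trans ((congrArg FS.F h1).symm.trans (F_smul_observer o c))

/-- The reconstructed Finsler function agrees with the original one near the observers. -/
theorem recFinsler_tangentMap_of_mem_cone {v : TangentBundle (𝓡 4) M} (hv : v ∈ T.cone) :
    (finslerCartanGeometry Λ hO hP).recFinsler (tangentMap (𝓡 4) (𝓡 4) μ v) = FS.F v := by
  obtain ⟨x, y⟩ := v
  have hF := FS.F_pos hv.1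
  have h1 := recFinsler_tangentMap hμ ⟨⟨x, (FS.F ⟨x, y⟩)⁻¹ • y⟩, hv.2⟩ (FS.F ⟨x, y⟩)
  have h2 : FS.F ⟨x, y⟩ • (FS.F ⟨x, y⟩)⁻¹ • y = y := by
    rw [smul_smul, mul_inv_cancel₀ hF.ne', one_smul]
  have h3 : (⟨x, FS.F ⟨x, y⟩ • (FS.F ⟨x, y⟩)⁻¹ • y⟩ : TangentBundle (𝓡 4) M) = ⟨x, y⟩ :=
    Bundle.TotalSpace.ext rfl (heq_of_eq h2)
  rw [← h3]
  exact h1.trans ((abs_of_pos hF).trans (congrArg FS.F h3).symm)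

/-- The two Finsler functions correspond on the whole cone spanned by the observers. It is open, so
smoothness carries over to a full neighbourhood of `σ(o)`. -/
theorem contMDiffAt_recFinsler (o : ObserverSpace T) :
    ContMDiffAt (𝓡 4).tangent 𝓘(ℝ) ∞ (finslerCartanGeometry Λ hO hP).recFinsler
      ((finslerCartanGeometry Λ hO hP).sigma o) := by
  set τ := tangentDiffeomorph μ
  have hσ : τ.symm ((finslerCartanGeometry Λ hO hP).sigma o) = o.val := by
    rw [sigma_eq hμ]; exact τ.symm_apply_apply _
  have hc : o.val ∈ T.cone := TimeOrientation.observer_mem_cone o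
  have h1 : ContMDiffAt (𝓡 4).tangent 𝓘(ℝ) ∞ (FS.F ∘ τ.symm)
      ((finslerCartanGeometry Λ hO hP).sigma o) := by
    refine ContMDiffAt.comp _ ?_ τ.symm.contMDiff.contMDiffAt
    rw [hσ]; exact FS.contMDiffAt_F hc.1
  refine h1.congr_of_eventuallyEq ?_
  filter_upwards [(T.isOpen_cone.preimage τ.symm.continuous).mem_nhds
    (show τ.symm _ ∈ T.cone by rw [hσ]; exact hc)] with w hw
  refine Eq.trans ?_ (recFinsler_tangentMap_of_mem_cone hμ hw)
  exact congrArg _ (τ.apply_symm_apply w).symm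

/-- The diffeomorphism preserves the Finsler metric. -/
theorem finslerMetric_tangentMap (o : ObserverSpace T) (v w : TangentSpace (𝓡 4) o.val.proj) :
    finslerMetric (finslerCartanGeometry Λ hO hP).recFinsler (tangentMap (𝓡 4) (𝓡 4) μ o.val)
      (mfderiv (𝓡 4) (𝓡 4) μ o.val.proj v) (mfderiv (𝓡 4) (𝓡 4) μ o.val.proj w) =
    finslerMetric FS.F o.val v w := by
  let B : Euc 4 ≃L[ℝ] Euc 4 := μ.mfderivToContinuousLinearEquiv (by simp) o.val.proj
  -- The differential of `μ` is linear on the fibre, so the Hessian pulls back; the pulled back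
  -- function agrees with `F²` near the observer and hence has the same Hessian there.
  have h1 := hess_comp_linear (fun y : Euc 4 =>
    (finslerCartanGeometry Λ hO hP).recFinsler ⟨μ o.val.proj, y⟩ ^ 2) B o.val.snd v w
  refine h1.symm.trans ?_
  refine congrArg (fun D : Euc 4 →L[ℝ] Euc 4 →L[ℝ] ℝ => D v w)
    (hess_congr (g := fun y : Euc 4 => FS.F ⟨o.val.proj, y⟩ ^ 2) ?_)
  have hc : ContinuousAt (fun y : Euc 4 => (⟨o.val.proj, y⟩ : TangentBundle (𝓡 4) M)) o.val.snd :=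
    (contMDiff_fiber_inclusion o.val.proj).continuous.continuousAt
  filter_upwards [hc (T.isOpen_cone.mem_nhds (TimeOrientation.observer_mem_cone o))] with y hy
  exact congrArg (· ^ 2) (recFinsler_tangentMap_of_mem_cone hμ hy)

/-- The differential of `μ` is an isometry of the Finsler metrics, so the image of a frame in `P` is
an orthonormal basis that exhibits the signature. -/
theorem hasLorentzMetric : (finslerCartanGeometry Λ hO hP).HasLorentzMetric := by
  intro o
  refine ⟨contMDiffAt_recFinsler hμ o, ?_⟩
  obtain ⟨p, rfl⟩ := ObserverFrame.exists_observer_eq (ori := ori) o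
  have hf : IsOrthoFrame (finslerMetric (finslerCartanGeometry Λ hO hP).recFinsler
      ((finslerCartanGeometry Λ hO hP).sigma p.observer))
      (fun i => mfderiv (𝓡 4) (𝓡 4) μ p.base (p.vec i)) := by
    intro i j
    rw [← tangentMap_val hμ]
    exact (finslerMetric_tangentMap hμ p.observer (p.vec i) (p.vec j)).trans (p.isOrthoFrame i j)
  exact hf.hasLorentzSignature

end Reconstruction

end FinslerCartan

end

/-! ### The main theorem -/

open FinslerCartan in
theorem mainTheorem2 {M : Type*} [TopologicalSpace M] [ChartedSpace (Euc 4) M]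
    [IsManifold (𝓡 4) ∞ M] [ConnectedSpace M] [T2Space M] [ParacompactSpace M]
    (FS : FinslerSpacetime M) (T : TimeOrientation FS) (ori : ManifoldOrientation M) (Λ : ℝ) :
    ∃ (_ : ChartedSpace (Euc 7) (ObserverSpace T)) (_ : IsManifold (𝓡 7) ∞ (ObserverSpace T))
      (_ : ChartedSpace (Euc 10) (ObserverFrame T ori))
      (_ : IsManifold (𝓡 10) ∞ (ObserverFrame T ori))
      (C : ObserverCartanGeometry Λ (ObserverFrame T ori) (ObserverSpace T)),
      Manifold.IsSmoothEmbedding (𝓡 7) (𝓡 4).tangent ∞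
        (Subtype.val : ObserverSpace T → TangentBundle (𝓡 4) M) ∧
      IsFrameSubmanifold (T := T) (ori := ori) ∧
      IsFinslerCartanGeometry C ∧
      C.IsIntegrable ∧
      ∃ (_ : ChartedSpace (Euc 4) C.LeafSpace) (_ : IsManifold (𝓡 4) ∞ C.LeafSpace),
        C.IsStrictlySimple ∧
        C.SigmaIsEmbedding ∧
        C.LinesMeetOnce ∧
        C.HasLorentzMetric ∧
        ∃ μ : M ≃ₘ^∞⟮𝓡 4, 𝓡 4⟯ C.LeafSpace,
          (∀ o : ObserverSpace T, tangentMap (𝓡 4) (𝓡 4) μ o.val = C.sigma o) ∧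
          (∀ (o : ObserverSpace T) (c : ℝ),
            C.recFinsler (tangentMap (𝓡 4) (𝓡 4) μ ⟨o.val.proj, c • o.val.snd⟩) =
              FS.F ⟨o.val.proj, c • o.val.snd⟩ ∧
            FS.F ⟨o.val.proj, c • o.val.snd⟩ = |c|) ∧
          ∀ (o : ObserverSpace T) (v w : TangentSpace (𝓡 4) o.val.proj),
            finslerMetric C.recFinsler (tangentMap (𝓡 4) (𝓡 4) μ o.val)
              (mfderiv (𝓡 4) (𝓡 4) μ o.val.proj v) (mfderiv (𝓡 4) (𝓡 4) μ o.val.proj w) =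
            finslerMetric FS.F o.val v w := by
  let : ChartedSpace (Euc 7) (ObserverSpace T) :=
    sliceChartedSpace (obsInc T) TimeOrientation.exists_isSliceChart
  have hO : IsSliceAtlas (n := 7) (obsInc T) :=
    isSliceAtlas_sliceChartedSpace (isInducing_obsInc T) TimeOrientation.exists_isSliceChart
  have hO' : IsManifold (𝓡 7) ∞ (ObserverSpace T) := hO.isManifold
  let : ChartedSpace (Euc 10) (ObserverFrame T ori) :=
    sliceChartedSpace (frameInc T ori) exists_frameChart
  have hP : IsSliceAtlas (n := 10) (frameInc T ori) :=
    isSliceAtlas_sliceChartedSpace (isInducing_frameInc) exists_frameChart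
  have hP' : IsManifold (𝓡 10) ∞ (ObserverFrame T ori) := hP.isManifold
  -- The leaf space receives its smooth structure from `M`, so that `μ` is a diffeomorphism by
  -- construction; that the leaf projection is a submersion for this structure is proved in
  -- `isSubmersion_leafProj`.
  let := transportChartedSpace (leafHomeomorph Λ hO hP)
  have hM := isManifold_transport (leafHomeomorph Λ hO hP)
  have hμ : ∀ o : ObserverSpace T, transportDiffeomorph (leafHomeomorph Λ hO hP) o.val.proj =
      (finslerCartanGeometry Λ hO hP).leafProj o := leafHomeomorph_symm_base Λ hO hP
  exact ⟨_, hO', _, hP', finslerCartanGeometry Λ hO hP,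
    ⟨(TimeOrientation.isImmersion_val hO).isImmersion, Topology.IsEmbedding.subtypeVal⟩,
    isFrameSubmanifold hP, isFinslerCartanGeometry hP Λ hO, isIntegrable Λ hO hP, _, hM,
    isStrictlySimple hμ, sigmaIsEmbedding hμ, linesMeetOnce hμ, hasLorentzMetric hμ,
    transportDiffeomorph (leafHomeomorph Λ hO hP), tangentMap_val hμ,
    fun o c => ⟨(recFinsler_tangentMap hμ o c).trans (F_smul_observer o c).symm,
      F_smul_observer o c⟩, finslerMetric_tangentMap hμ⟩
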